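/- **Divided power forms.** For $n\ge 0$ let $\mathbb Z\langle x_0,\dots,x_n\rangle\subset\mathbb Q[x_0,\dots,x_n]$ be the subring spanned over $\mathbb Z$ by the products of the divided powers $x_i^{[N]}=x_i^N/N!$; write $\vartheta=x_0$ and $K=\mathbb Z\langle\vartheta\rangle$. Let $A^\bullet(\Delta^n)$ be the exterior algebra over $\mathbb Z\langle \vartheta,x_1,\dots,x_n\rangle$ on $dx_1,\dots,dx_n$, with the $K$-linear differential $d(f\,dx_I)=\sum_i\frac{\partial f}{\partial x_i}dx_i\wedge dx_I$ (so $d\vartheta=0$). An order-preserving map $\alpha\colon[m]\to[n]$ induces $\alpha^*\colon A^\bullet(\Delta^n)\to A^\bullet(\Delta^m)$ by $\alpha^*x_i=x_{\min\{j:\alpha(j)\ge i\}}$, and $\alpha^*x_i=0$ if $\alpha(m)<i$. For a simplicial set $X$ let $A^k(X)$ be the $K$-module of simplicial maps $X\to A^k(\Delta^{-})$ and $A(X)=\bigoplus_kA^k(X)$. **Fibre integration.** For a maximal chain $\Gamma\colon[n+r]\to[n]\times[r]$, with components $\Gamma_1,\Gamma_2$, put $b(i)=\min\{j:\Gamma_1(j)=i\}$,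 $f(i)=\min\{j:\Gamma_2(j)\ge i\}$ and $u(i)=f(\min\{j\ge1: f(j)-j=f(i)-i\})-1$. For $\omega\in A^\bullet(\Delta^{n+r})$ write the part of $\omega$ containing all of $dx_{f(1)},\dots,dx_{f(r)}$ as $\sum_Jg_J\,dx_{f(1)}\wedge\dots\wedge dx_{f(r)}\wedge dx_J$, integrate the coefficients $g_J$ successively for $i=1,\dots,r$ with respect to $x_{f(i)}$ from $x_{f(i)+1}$ to $x_{u(i)}$ (with $x_{n+r+1}=0$), and apply $b^*$ to the resulting form. The integral over the fibres of $Y\times\Delta^r\to Y$ of a form $\omega$ on $Y\times\Delta^r$ has at an $n$-simplex $y$ of $Y$ the value given by the sum, over all maximal chains $\Gamma$, of the results obtained in this way from $\Gamma^*(y\times\mathrm{id})^*\omega$. **Iterated integrals.** Let $\mathsf E_\varepsilon\colon X^{\Delta^1}\to X$ be the evaluation at the vertex $\varepsilon\in\{0,1\}$. For $\omega_1,\dots,\omega_r\in A(X)$ let $\omega_1\times\dots\times\omega_r$ be the pullback of $\mathrm{pr}_1^*\omega_1\wedge\dots\wedge\mathrm{pr}_r^*\omega_r$ along $X^{\Delta^1}\times\Delta^r\to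 X^{\Delta^1}\times(\Delta^1)^r\to X^r$, where $\Delta^r\to(\Delta^1)^r$ is $i\mapsto(1,\dots,1,0,\dots,0)$ ($i$ ones) and the second map evaluates the path at each of the $r$ parameters. Its integral over the fibres of $X^{\Delta^1}\times\Delta^r\to X^{\Delta^1}$ is denoted $\int\omega_1\cdots\omega_r$. **Bar construction.** For a commutative cochain algebra $A$ over $K$ put $\overline A=A/K\cdot1$ and $\mathbf BA=\bigoplus_{r\ge0}A\otimes_K(\overline A[1])^{\otimes r}\otimes_KA$. The element $f\otimes g_1\otimes\dots\otimes g_r\otimes h$ is written $f[g_1|\dots|g_r]h$ and has degree $|f|+\sum_i(|g_i|-1)+|h|$. With $\nu_i=|g_1|+\dots+|g_i|-i$, the differential is $d=d_1+d_2$, where $$d_1(f[g_1|\dots|g_r]h)=df[g_1|\dots|g_r]h-\sum_{i=1}^r(-1)^{|f|+\nu_{i-1}}f[g_1|\dots|dg_i|\dots|g_r]h+(-1)^{|f|+\nu_r}f[g_1|\dots|g_r]dh,$$ $$d_2(f[g_1|\dots|g_r]h)=(-1)^{|f|}f\wedge g_1[g_2|\dots|g_r]h+\sum_{i=1}^{r-1}(-1)^{|f|+\nu_i}f[g_1|\dots|g_i\wedge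 g_{i+1}|\dots|g_r]h+(-1)^{|f|+\nu_{r-1}+1}f[g_1|\dots|g_{r-1}]g_r\wedge h$$ ($d_2=0$ for $r=0$), and the product is $$(f[g_1|\dots|g_p]h)\wedge(f'[g_{p+1}|\dots|g_{p+q}]h')=\sum_\sigma\pm\,\varepsilon(\sigma)\,f\wedge f'[g_{\sigma(1)}|\dots|g_{\sigma(p+q)}]h\wedge h',$$ where $\sigma$ runs over the permutations for which $g_{\sigma(1)},\dots,g_{\sigma(p+q)}$ is a shuffle of $g_1,\dots,g_p$ and $g_{p+1},\dots,g_{p+q}$, $\varepsilon(\sigma)$ is the Koszul sign for letters of degrees $|g_i|-1$, and $\pm=(-1)^{|h||f'|+(|g_1|+\dots+|g_p|-p)|f'|+|h|(|g_{p+1}|+\dots+|g_{p+q}|-q)}$. The unit is $1[\,]1$. **Proposition.** Let $X$ be a simplicial set. Then $A(X)$, $A(X^{\Delta^1})$ and $\mathbf BA(X)$ are commutative cochain algebras over $K$, and $\int\omega_1\cdots\omega_r$ is an element of $A(X^{\Delta^1})$ for all $r\ge0$ and $\omega_1,\dots,\omega_r\in A(X)$. There is a unique $K$-linear map $\mathbb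 I\colon\mathbf BA(X)\to A(X^{\Delta^1})$ which satisfies $$\mathbb I(\omega_0[\omega_1|\dots|\omega_r]\omega_{r+1})=(-1)^{\sum_{i=1}^r(r-i)(|\omega_i|-1)}\,(\mathsf E_1^*\omega_0)\wedge\Big(\int\omega_1\cdots\omega_r\Big)\wedge(\mathsf E_0^*\omega_{r+1})$$ for all $r\ge0$, all homogeneous $\omega_1,\dots,\omega_r$ and all $\omega_0,\omega_{r+1}$ in $A(X)$, and has the following properties: 1. $\mathbb I$ is a morphism of commutative cochain algebras: it preserves degrees, commutes with the differentials, and preserves units and products. 2. The composite of $A(X)\otimes_KA(X)\to\mathbf BA(X)$, $f\otimes h\mapsto f[\,]h$, with $\mathbb I$ is the map $A(X)\otimes_KA(X)\to A(X\times X)\to A(X^{\Delta^1})$ given by the cross product followed by the pullback along $(\mathsf E_1,\mathsf E_0)$. 3. The composite of $\mathbb I$ with the pullback $A(X^{\Delta^1})\to A(X)$ along the inclusion $X\to X^{\Delta^1}$ of the constant paths is the augmentation $\mathbf BA(X)\to A(X)$, $f[\,]h\mapsto f\wedge h$ and $f[g_1|\dots|g_r]h\mapsto0$ for $r\ge1$.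 -/

import Mathlib

open CategoryTheory MonoidalCategory Simplicial TensorProduct DirectSum Opposite

universe u

noncomputable section

namespace SimplicialDeRham

/-! ### Divided power polynomials -/

/-- The divided power polynomial ring `ℤ⟨x₀, …, xₙ⟩`, realised inside `ℚ[x₀, …, xₙ]`: the polynomials
that are integral linear combinations of the divided monomials `∏ xᵢ^{mᵢ} / mᵢ!`.
The variable `x₀` plays the role of `ϑ`. -/
def dpRing (n : ℕ) : Subring (MvPolynomial (Fin (n + 1)) ℚ) where
  carrier := {p | ∀ m : Fin (n + 1) →₀ ℕ, ∃ z : ℤ,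
    ((∏ i, (m i).factorial : ℕ) : ℚ) * p.coeff m = z}
  zero_mem' m := ⟨0, by simp⟩
  one_mem' m := by
    classical
    by_cases h : 0 = m
    · subst h
      exact ⟨1, by simp⟩
    · exact ⟨0, by simp [MvPolynomial.coeff_one, h]⟩
  add_mem' {p q} hp hq m := by
    obtain ⟨a, ha⟩ := hp m
    obtain ⟨b, hb⟩ := hq m
    exact ⟨a + b, by rw [MvPolynomial.coeff_add, mul_add, ha, hb]; push_cast; rfl⟩
  neg_mem' {p} hp m := by
    obtain ⟨a, ha⟩ := hp m
    exact ⟨-a, by rw [MvPolynomial.coeff_neg, mul_neg, ha]; push_cast; rfl⟩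
  mul_mem' {p q} hp hq m := by
    classical
    have key : ∀ x ∈ Finset.HasAntidiagonal.antidiagonal m, ∃ z : ℤ,
        ((∏ i, (m i).factorial : ℕ) : ℚ) * (p.coeff x.1 * q.coeff x.2) = z := by
      rintro ⟨a, b⟩ hab
      rw [Finset.HasAntidiagonal.mem_antidiagonal] at hab
      obtain ⟨s, hs⟩ := hp a
      obtain ⟨t, ht⟩ := hq b
      refine ⟨(∏ i, (m i).choose (a i) : ℕ) * s * t, ?_⟩
      have : (∏ i, (m i).factorial : ℕ)
          = (∏ i, (m i).choose (a i)) * (∏ i, (a i).factorial) * (∏ i, (b i).factorial) := by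
        rw [← Finset.prod_mul_distrib, ← Finset.prod_mul_distrib]
        refine Finset.prod_congr rfl fun i _ => ?_
        have hi : m i = a i + b i := by rw [← hab]; rfl
        rw [hi, ← Nat.choose_mul_factorial_mul_factorial (Nat.le_add_right (a i) (b i)),
          Nat.add_sub_cancel_left]
      push_cast
      rw [← hs, ← ht]
      have h2 := congrArg (Nat.cast : ℕ → ℚ) this
      push_cast at h2
      rw [h2]
      push_cast
      ring
    choose! z hz using key
    refine ⟨∑ x ∈ Finset.HasAntidiagonal.antidiagonal m, z x, ?_⟩
    rw [MvPolynomial.coeff_mul, Finset.mul_sum]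
    push_cast at hz ⊢
    exact Finset.sum_congr rfl hz

/-- The ring `ℤ⟨x₀, …, xₙ⟩` of functions on the standard `n`-simplex. -/
abbrev DP (n : ℕ) : Type := dpRing n

lemma monomial_mem_dpRing {n : ℕ} (m : Fin (n + 1) →₀ ℕ) (c : ℚ) (z : ℤ)
    (h : ((∏ i, (m i).factorial : ℕ) : ℚ) * c = z) : MvPolynomial.monomial m c ∈ dpRing n := by
  classical
  intro m'
  by_cases hm : m = m'
  · subst hm
    exact ⟨z, by simpa using h⟩
  · exact ⟨0, by simp [MvPolynomial.coeff_monomial, hm]⟩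

/-- The coordinate `x_k` on the `N`-simplex; it is `ϑ` for `k = 0` and `0` for `k > N`. -/
def xvar (N k : ℕ) : MvPolynomial (Fin (N + 1)) ℚ :=
  if h : k < N + 1 then MvPolynomial.X ⟨k, h⟩ else 0

lemma divPow_mem {N : ℕ} (k e : ℕ) :
    MvPolynomial.C (1 / (e.factorial : ℚ)) * xvar N k ^ e ∈ dpRing N := by
  classical
  unfold xvar
  split_ifs with h
  · rw [MvPolynomial.X_pow_eq_monomial, MvPolynomial.C_mul_monomial, mul_one]
    refine monomial_mem_dpRing _ _ 1 ?_
    rw [Finset.prod_eq_single (⟨k, h⟩ : Fin (N + 1))]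
    · have : (e.factorial : ℚ) ≠ 0 := by exact_mod_cast e.factorial_ne_zero
      simp [this]
    · intro b _ hb
      simp [Ne.symm hb]
    · simp
  · rcases Nat.eq_zero_or_pos e with rfl | he
    · simp
    · rw [zero_pow he.ne', mul_zero]
      exact zero_mem _

/-- Substituting a coordinate or `0` for each variable preserves divided power polynomials. -/
lemma aeval_mem_dpRing {n m : ℕ} (g : Fin (n + 1) → ℕ) {p : MvPolynomial (Fin (n + 1)) ℚ}
    (hp : p ∈ dpRing n) : MvPolynomial.aeval (fun i => xvar m (g i)) p ∈ dpRing m := by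
  classical
  rw [MvPolynomial.aeval_def, MvPolynomial.eval₂_eq']
  refine sum_mem fun a _ => ?_
  obtain ⟨z, hz⟩ := hp a
  have h0 : ((∏ i, (a i).factorial : ℕ) : ℚ) ≠ 0 := by
    exact_mod_cast Finset.prod_ne_zero_iff.2 fun i _ => Nat.factorial_ne_zero _
  have : (algebraMap ℚ (MvPolynomial (Fin (m + 1)) ℚ)) (p.coeff a) * ∏ i, xvar m (g i) ^ a i
      = (z : MvPolynomial (Fin (m + 1)) ℚ) *
        ∏ i, (MvPolynomial.C (1 / ((a i).factorial : ℚ)) * xvar m (g i) ^ a i) := by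
    rw [Finset.prod_mul_distrib, ← mul_assoc, ← map_prod]
    congr 1
    have : (z : MvPolynomial (Fin (m + 1)) ℚ) = MvPolynomial.C (z : ℚ) := by simp
    rw [this, ← map_mul, MvPolynomial.algebraMap_eq, ← hz]
    congr 1
    simp only [one_div, Finset.prod_inv_distrib]
    push_cast at h0 ⊢
    field_simp
  rw [this]
  exact mul_mem (intCast_mem _ _) (prod_mem fun i _ => divPow_mem _ _)

/-- The ring homomorphism `x_i ↦ x_{g i}` (with `x_k = 0` for `k > m`). -/
def dpSubst {n : ℕ} (m : ℕ) (g : Fin (n + 1) → ℕ) : DP n →+* DP m :=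
  ((MvPolynomial.aeval (R := ℚ) (fun i => xvar m (g i))).toRingHom.comp (dpRing n).subtype).codRestrict
    (dpRing m) fun p => aeval_mem_dpRing g p.2

/-- The coefficient ring `ℤ⟨ϑ⟩`. -/
def Theta : Type := DP 0

instance : CommRing Theta := inferInstanceAs (CommRing (DP 0))

/-- `ℤ⟨x₀, …, xₙ⟩` is an algebra over `ℤ⟨ϑ⟩` through `ϑ ↦ x₀`. -/
instance (n : ℕ) : Algebra Theta (DP n) :=
  RingHom.toAlgebra (dpSubst n (fun _ : Fin (0 + 1) => 0) : DP 0 →+* DP n)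

lemma dpSubst_theta {n m : ℕ} (g : Fin (n + 1) → ℕ) (hg : g 0 = 0) (c : Theta) :
    dpSubst m g (algebraMap Theta (DP n) c) = algebraMap Theta (DP m) c := by
  apply Subtype.ext
  change MvPolynomial.aeval (fun i => xvar m (g i))
    (MvPolynomial.aeval (fun _ : Fin (0 + 1) => xvar n 0) c.1)
      = MvPolynomial.aeval (fun _ : Fin (0 + 1) => xvar m 0) c.1
  rw [← AlgHom.comp_apply]
  congr 1
  apply MvPolynomial.algHom_ext
  intro i
  have : xvar n 0 = MvPolynomial.X 0 := by simp [xvar]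
  simp [this, hg]

/-- The partial derivative `∂/∂x_i`, `i = 1, …, n`, of divided power polynomials. -/
def dpDeriv {n : ℕ} (i : Fin n) : DP n →ₗ[Theta] DP n where
  toFun p := ⟨MvPolynomial.pderiv i.succ p.1, fun m => by
    classical
    obtain ⟨z, hz⟩ := p.2 (m + Finsupp.single i.succ 1)
    refine ⟨z, ?_⟩
    rw [MvPolynomial.coeff_pderiv, ← hz]
    have : (∏ j, ((m + Finsupp.single i.succ 1 : Fin (n + 1) →₀ ℕ) j).factorial)
        = (m i.succ + 1) * ∏ j, (m j).factorial := by
      rw [← Finset.mul_prod_erase _ _ (Finset.mem_univ i.succ),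
        ← Finset.mul_prod_erase Finset.univ (fun j => (m j).factorial) (Finset.mem_univ i.succ),
        ← mul_assoc]
      congr 1
      · simp [Nat.factorial_succ]
      · refine Finset.prod_congr rfl fun j hj => ?_
        have := Finset.ne_of_mem_erase hj
        simp [this.symm]
    rw [this]
    push_cast
    ring⟩
  map_add' p q := Subtype.ext (by simp)
  map_smul' c p := by
    apply Subtype.ext
    rw [Algebra.smul_def, RingHom.id_apply, Algebra.smul_def]
    have : MvPolynomial.pderiv i.succ (algebraMap Theta (DP n) c).1 = 0 := by
      change MvPolynomial.pderiv i.succ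
        (MvPolynomial.aeval (fun _ : Fin (0 + 1) => xvar n 0) c.1) = 0
      generalize c.1 = q
      have hx : MvPolynomial.pderiv i.succ (xvar n 0) = 0 := by
        have : xvar n 0 = MvPolynomial.X 0 := by simp [xvar]
        rw [this, MvPolynomial.pderiv_X_of_ne (Fin.succ_ne_zero i).symm]
      induction q using MvPolynomial.induction_on with
      | C a => simp
      | add p q hp hq => rw [map_add, map_add, hp, hq, add_zero]
      | mul_X p j hp =>
        rw [map_mul, Derivation.leibniz, hp, MvPolynomial.aeval_X, hx, smul_zero, smul_zero,
          add_zero]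
    simp [Derivation.leibniz, this]

/-- The antiderivative `x_i^{[N]} ↦ x_i^{[N + 1]}` in the variable `x_i`, on rational polynomials. -/
def antideriv {n : ℕ} (i : Fin (n + 1)) :
    MvPolynomial (Fin (n + 1)) ℚ →ₗ[ℚ] MvPolynomial (Fin (n + 1)) ℚ :=
  (MvPolynomial.basisMonomials (Fin (n + 1)) ℚ).constr ℚ fun m =>
    MvPolynomial.monomial (m + Finsupp.single i 1) (1 / ((m i : ℚ) + 1))

lemma antideriv_mem {n : ℕ} (i : Fin (n + 1)) {p : MvPolynomial (Fin (n + 1)) ℚ}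
    (hp : p ∈ dpRing n) : antideriv i p ∈ dpRing n := by
  classical
  rw [p.as_sum, map_sum]
  refine sum_mem fun m _ => ?_
  have : antideriv i (MvPolynomial.monomial m (p.coeff m))
      = MvPolynomial.monomial (m + Finsupp.single i 1) (p.coeff m / ((m i : ℚ) + 1)) := by
    have h1 : MvPolynomial.monomial m (p.coeff m)
        = p.coeff m • (MvPolynomial.basisMonomials (Fin (n + 1)) ℚ) m := by
      simp [MvPolynomial.smul_monomial]
    rw [h1, map_smul, antideriv, Module.Basis.constr_basis, MvPolynomial.smul_monomial]
    congr 1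
    rw [smul_eq_mul, mul_one_div]
  rw [this]
  obtain ⟨z, hz⟩ := hp m
  refine monomial_mem_dpRing _ _ z ?_
  have h2 : (∏ j, ((m + Finsupp.single i 1 : Fin (n + 1) →₀ ℕ) j).factorial)
      = (m i + 1) * ∏ j, (m j).factorial := by
    rw [← Finset.mul_prod_erase _ _ (Finset.mem_univ i),
      ← Finset.mul_prod_erase Finset.univ (fun j => (m j).factorial) (Finset.mem_univ i),
      ← mul_assoc]
    congr 1
    · simp [Nat.factorial_succ]
    · refine Finset.prod_congr rfl fun j hj => ?_
      have := Finset.ne_of_mem_erase hj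
      simp [this.symm]
  rw [h2, ← hz]
  have : ((m i : ℚ) + 1) ≠ 0 := by positivity
  push_cast
  field_simp

/-- `∫_{x_lo}^{x_up} f dx_i`: the variable `x_i` of the antiderivative of `f` is replaced by the
upper and by the lower bound (`x₀ = ϑ`, and `x_k = 0` for `k > n`), and the results are
subtracted. -/
def dpIntegral {n : ℕ} (i : Fin (n + 1)) (up lo : ℕ) : DP n →ₗ[ℤ] DP n := AddMonoidHom.toIntLinearMap {
  toFun p :=
    dpSubst n (fun j => if j = i then up else j) ⟨antideriv i p.1, antideriv_mem i p.2⟩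
      - dpSubst n (fun j => if j = i then lo else j) ⟨antideriv i p.1, antideriv_mem i p.2⟩
  map_zero' := by
    have : (⟨antideriv i (0 : DP n).1, antideriv_mem i (0 : DP n).2⟩ : DP n) = 0 :=
      Subtype.ext (by simp)
    rw [this]; simp
  map_add' p q := by
    have : (⟨antideriv i (p + q).1, antideriv_mem i (p + q).2⟩ : DP n)
        = ⟨antideriv i p.1, antideriv_mem i p.2⟩ + ⟨antideriv i q.1, antideriv_mem i q.2⟩ :=
      Subtype.ext (by simp)
    rw [this, map_add, map_add]; abel }

/-! ### Differential forms on the standard simplices -/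

/-- The least `j ∈ {0, …, N}` with property `P`, and `N + 1` if there is none. -/
def firstIdx {N : ℕ} (P : Fin (N + 1) → Prop) : ℕ :=
  sInf {j | j = N + 1 ∨ ∃ h : j < N + 1, P ⟨j, h⟩}

/-- The index with `α^* x_i = x_{pullIdx α i}`, that is `min {j | α j ≥ i}`; it is `m + 1`
(and `x_{m + 1} = 0`) if there is no such `j`. -/
def pullIdx {m n : ℕ} (α : Fin (m + 1) → Fin (n + 1)) (i : ℕ) : ℕ :=
  firstIdx fun j => i ≤ (α j : ℕ)

lemma pullIdx_zero {m n : ℕ} (α : Fin (m + 1) → Fin (n + 1)) : pullIdx α 0 = 0 :=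
  Nat.sInf_eq_zero.2 (Or.inl (Or.inr ⟨Nat.succ_pos m, Nat.zero_le _⟩))

/-- The divided power de Rham algebra of the standard `n`-simplex: the exterior algebra on
`dx₁, …, dxₙ` over `ℤ⟨ϑ, x₁, …, xₙ⟩`. The standard basis vectors of `ℤⁿ` are `dx₁, …, dxₙ`. -/
abbrev Omega (n : ℕ) : Type := DP n ⊗[ℤ] ExteriorAlgebra ℤ (Fin n → ℤ)

instance (n : ℕ) : Ring (Omega n) := inferInstance

instance (n : ℕ) : Algebra Theta (Omega n) := inferInstance

/-- The vector `dx_k`; it is zero for `k = 0` (as `x₀ = ϑ` is a constant) and for `k > n`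
(as `x_k = 0`). -/
def dxVec (n k : ℕ) : Fin n → ℤ := fun i => if (i : ℕ) + 1 = k then 1 else 0

/-- The differential `d (f dx_I) = ∑ᵢ (∂f/∂xᵢ) dxᵢ ∧ dx_I`. -/
def omegaD (n : ℕ) : Omega n →ₗ[Theta] Omega n :=
  ∑ i : Fin n, TensorProduct.AlgebraTensorModule.map (dpDeriv i)
    (LinearMap.mulLeft ℤ (ExteriorAlgebra.ι ℤ (Pi.single i (1 : ℤ))))

/-- The linear map `dx_i ↦ d (α^* x_i)`. -/
def pullDx {m n : ℕ} (α : Fin (m + 1) → Fin (n + 1)) : (Fin n → ℤ) →ₗ[ℤ] (Fin m → ℤ) :=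
  (Pi.basisFun ℤ (Fin n)).constr ℤ fun i => dxVec m (pullIdx α ((i : ℕ) + 1))

/-- The map `α^*` on functions. -/
def dpPull {m n : ℕ} (α : Fin (m + 1) → Fin (n + 1)) : DP n →ₐ[Theta] DP m :=
  { dpSubst m (fun i => pullIdx α i) with
    commutes' := fun c => dpSubst_theta _ (pullIdx_zero α) c }

/-- The map `α^*` on differential forms induced by `α : [m] → [n]`. -/
def omegaPull {m n : ℕ} (α : Fin (m + 1) → Fin (n + 1)) : Omega n →ₐ[Theta] Omega m :=
  Algebra.TensorProduct.map (dpPull α) (ExteriorAlgebra.map (pullDx α))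

lemma pderiv_xvar {m : ℕ} (j : Fin m) (k : ℕ) :
    MvPolynomial.pderiv j.succ (xvar m k) = if k = (j : ℕ) + 1 then 1 else 0 := by
  classical
  unfold xvar
  split_ifs with h1 h2 h2
  · have : (⟨k, h1⟩ : Fin (m + 1)) = j.succ := Fin.ext (by simpa using h2)
    rw [this, MvPolynomial.pderiv_X_self]
  · apply MvPolynomial.pderiv_X_of_ne
    intro h
    exact h2 (by simpa using congrArg Fin.val h)
  · omega
  · simp

lemma pderiv_aeval {m n : ℕ} (g : Fin (n + 1) → ℕ) (hg : g 0 = 0) (j : Fin m)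
    (p : MvPolynomial (Fin (n + 1)) ℚ) :
    MvPolynomial.pderiv j.succ (MvPolynomial.aeval (fun i => xvar m (g i)) p)
      = ∑ i : Fin n, if g i.succ = (j : ℕ) + 1 then
          MvPolynomial.aeval (fun i => xvar m (g i)) (MvPolynomial.pderiv i.succ p) else 0 := by
  classical
  induction p using MvPolynomial.induction_on with
  | C a => simp
  | add p q hp hq =>
    rw [map_add, map_add, hp, hq, ← Finset.sum_add_distrib]
    refine Finset.sum_congr rfl fun i _ => ?_
    split_ifs
    · rw [map_add, map_add]
    · rw [add_zero]
  | mul_X p k hp =>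
    rw [map_mul, Derivation.leibniz, hp, MvPolynomial.aeval_X, pderiv_xvar]
    have : ∀ i : Fin n, (if g i.succ = (j : ℕ) + 1 then
        MvPolynomial.aeval (fun i => xvar m (g i))
          (MvPolynomial.pderiv i.succ (p * MvPolynomial.X k)) else 0)
        = (if g i.succ = (j : ℕ) + 1 ∧ i.succ = k then
            MvPolynomial.aeval (fun i => xvar m (g i)) p else 0)
          + xvar m (g k) * (if g i.succ = (j : ℕ) + 1 then
            MvPolynomial.aeval (fun i => xvar m (g i)) (MvPolynomial.pderiv i.succ p) else 0) := by
      intro i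
      rw [Derivation.leibniz, map_add]
      by_cases h1 : g i.succ = (j : ℕ) + 1
      · by_cases h2 : i.succ = k
        · subst h2
          simp [h1]
        · rw [MvPolynomial.pderiv_X_of_ne (Ne.symm h2)]
          simp [h1, h2]
      · simp [h1]
    rw [Finset.sum_congr rfl fun i _ => this i, Finset.sum_add_distrib, ← Finset.mul_sum,
      smul_eq_mul, smul_eq_mul]
    congr 1
    by_cases hk : g k = (j : ℕ) + 1
    · obtain ⟨i, rfl⟩ := Fin.exists_succ_eq.2 (show k ≠ 0 by rintro rfl; omega)
      rw [Finset.sum_eq_single i]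
      · simp [hk]
      · intro b _ hb
        simp [hb]
      · simp
    · rw [if_neg hk, mul_zero]
      refine (Finset.sum_eq_zero fun i _ => if_neg ?_).symm
      rintro ⟨h1, rfl⟩
      exact hk h1

lemma dpDeriv_pull {m n : ℕ} (α : Fin (m + 1) → Fin (n + 1)) (j : Fin m) (p : DP n) :
    dpDeriv j (dpPull α p)
      = ∑ i : Fin n, if pullIdx α ((i : ℕ) + 1) = (j : ℕ) + 1 then dpPull α (dpDeriv i p) else 0 := by
  apply Subtype.ext
  refine (pderiv_aeval (fun i : Fin (n + 1) => pullIdx α i) (pullIdx_zero α) j p.1).trans ?_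
  rw [AddSubmonoidClass.coe_finsetSum]
  refine Finset.sum_congr rfl fun i _ => ?_
  simp only [Fin.val_succ]
  split_ifs
  · rfl
  · rfl

lemma dxVec_eq_sum (m k : ℕ) :
    dxVec m k = ∑ j : Fin m, if k = (j : ℕ) + 1 then Pi.single j (1 : ℤ) else 0 := by
  classical
  ext i
  rw [Finset.sum_apply, Finset.sum_eq_single i]
  · unfold dxVec
    by_cases h : k = (i : ℕ) + 1
    · simp [h]
    · simp [h, Ne.symm h]
  · intro b _ hb
    split_ifs
    · simp [hb.symm]
    · rfl
  · simp

lemma omegaD_pull {m n : ℕ} (α : Fin (m + 1) → Fin (n + 1)) (ω : Omega n) :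
    omegaD m (omegaPull α ω) = omegaPull α (omegaD n ω) := by
  classical
  induction ω using TensorProduct.induction_on with
  | zero => simp
  | add x y hx hy => rw [map_add, map_add, hx, hy, map_add, map_add]
  | tmul p a =>
    have hL : omegaD m (omegaPull α (p ⊗ₜ a)) = ∑ j : Fin m, dpDeriv j (dpPull α p) ⊗ₜ[ℤ]
        (ExteriorAlgebra.ι ℤ (Pi.single j (1 : ℤ)) * ExteriorAlgebra.map (pullDx α) a) := by
      simp [omegaD, omegaPull, LinearMap.sum_apply]
    have hR : omegaPull α (omegaD n (p ⊗ₜ a)) = ∑ i : Fin n, dpPull α (dpDeriv i p) ⊗ₜ[ℤ]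
        (ExteriorAlgebra.ι ℤ (dxVec m (pullIdx α ((i : ℕ) + 1)))
          * ExteriorAlgebra.map (pullDx α) a) := by
      simp only [omegaD, omegaPull, LinearMap.sum_apply, map_sum,
        TensorProduct.AlgebraTensorModule.map_tmul, Algebra.TensorProduct.map_tmul,
        LinearMap.mulLeft_apply, map_mul, ExteriorAlgebra.map_apply_ι]
      refine Finset.sum_congr rfl fun i _ => ?_
      have : pullDx α (Pi.single i 1) = dxVec m (pullIdx α ((i : ℕ) + 1)) := by
        rw [pullDx, ← Pi.basisFun_apply, Module.Basis.constr_basis]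
      rw [this]
    rw [hL, hR]
    simp only [dpDeriv_pull, TensorProduct.sum_tmul]
    rw [Finset.sum_comm]
    refine Finset.sum_congr rfl fun i _ => ?_
    rw [dxVec_eq_sum, map_sum, Finset.sum_mul, TensorProduct.tmul_sum]
    refine Finset.sum_congr rfl fun j _ => ?_
    split_ifs
    · rfl
    · simp

/-- The forms of degree `k` on the standard `n`-simplex (zero for negative `k`). -/
def omegaDeg (n : ℕ) (k : ℤ) : Submodule Theta (Omega n) :=
  Submodule.span Theta {ω | ∃ j : ℕ, (j : ℤ) = k ∧ ∃ p : DP n,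
    ∃ a ∈ ⋀[ℤ]^j (Fin n → ℤ), ω = p ⊗ₜ[ℤ] a}

lemma omegaDeg_one (n : ℕ) : (1 : Omega n) ∈ omegaDeg n 0 :=
  Submodule.subset_span ⟨0, rfl, 1, 1, SetLike.GradedOne.one_mem, rfl⟩

lemma omegaDeg_mul (n : ℕ) {i j : ℤ} {a b : Omega n} (ha : a ∈ omegaDeg n i)
    (hb : b ∈ omegaDeg n j) : a * b ∈ omegaDeg n (i + j) := by
  have h := Submodule.mul_mem_mul ha hb
  rw [omegaDeg, omegaDeg, Submodule.span_mul_span] at h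
  refine Submodule.span_mono ?_ h
  rintro _ ⟨_, ⟨k, hk, p, a, ha', rfl⟩, _, ⟨l, hl, q, b, hb', rfl⟩, rfl⟩
  subst hk hl
  exact ⟨k + l, by push_cast; rfl, p * q, a * b, SetLike.GradedMul.mul_mem ha' hb',
    Algebra.TensorProduct.tmul_mul_tmul _ _ _ _⟩

lemma omegaDeg_d (n : ℕ) {k : ℤ} {ω : Omega n} (h : ω ∈ omegaDeg n k) :
    omegaD n ω ∈ omegaDeg n (k + 1) := by
  have : omegaDeg n k ≤ (omegaDeg n (k + 1)).comap (omegaD n) := by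
    refine Submodule.span_le.2 ?_
    rintro _ ⟨j, rfl, p, a, ha, rfl⟩
    change omegaD n (p ⊗ₜ a) ∈ omegaDeg n (j + 1)
    rw [omegaD, LinearMap.sum_apply]
    refine Submodule.sum_mem _ fun i _ => Submodule.subset_span ⟨1 + j, by push_cast; ring, dpDeriv i p,
      ExteriorAlgebra.ι ℤ (Pi.single i (1 : ℤ)) * a, ?_, rfl⟩
    refine SetLike.GradedMul.mul_mem ?_ ha
    rw [pow_one]
    exact LinearMap.mem_range_self _ _
  exact this h

/-! ### Integration over the fibres -/

/-- Contraction of a form with the vector field `∂/∂x_k`. -/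
def omegaContract {N : ℕ} (k : ℕ) : Omega N →ₗ[ℤ] Omega N :=
  LinearMap.lTensor (DP N) (CliffordAlgebra.contractLeft (Q := (0 : QuadraticForm ℤ (Fin N → ℤ)))
    (∑ i : Fin N, if (i : ℕ) + 1 = k then LinearMap.proj i else 0))

/-- Integration `∫_{x_lo}^{x_up} (-) dx_k` of the coefficients of a form. -/
def omegaIntegral {N : ℕ} (k up lo : ℕ) : Omega N →ₗ[ℤ] Omega N :=
  LinearMap.rTensor (ExteriorAlgebra ℤ (Fin N → ℤ)) (dpIntegral (Fin.ofNat (N + 1) k) up lo)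

section chain

variable {n r : ℕ} (Γ : Fin (n + r + 1) → Fin (n + 1) × Fin (r + 1))

/-- `Γ^b : [n] → [n + r]`, the index of the first vertex of `Γ` above `i ∈ [n]`. -/
def baseIdx (i : Fin (n + 1)) : Fin (n + r + 1) :=
  Fin.ofNat (n + r + 1) (firstIdx fun j => (Γ j).1 = i)

/-- `Γ^f : [r] → [n + r]`: the fibre coordinates of `Γ` are `x_{fibIdx Γ 1}, …, x_{fibIdx Γ r}`. -/
def fibIdx (i : ℕ) : ℕ := firstIdx fun j => i ≤ ((Γ j).2 : ℕ)

/-- The index of the upper limit of integration for the `i`-th fibre coordinate: the index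
preceding the maximal block of consecutive fibre coordinates that contains `fibIdx Γ i`. -/
def upIdx (i : ℕ) : ℕ :=
  fibIdx Γ (sInf {j | 1 ≤ j ∧ fibIdx Γ j + i = fibIdx Γ i + j}) - 1

/-- The integral of a form on the `(n + r)`-simplex over the fibres of the projection to the
`n`-simplex given by the maximal chain `Γ`. The coefficient of `dx_{Γ^f 1} ∧ … ∧ dx_{Γ^f r}`
(written to the left of the base differentials) is extracted by contractions; it is then integrated
for `i = 1, …, r` successively with respect to `x_{Γ^f i}`, from `x_{Γ^f i + 1}` to the coordinate
that precedes the block of `Γ^f i`; finally the base coordinates are renamed by `Γ^b`. -/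
def chainIntegral (ω : Omega (n + r)) : Omega n :=
  omegaPull (baseIdx Γ)
    ((List.range' 1 r).foldl
      (fun w i => omegaIntegral (fibIdx Γ i) (upIdx Γ i) (fibIdx Γ i + 1) w)
      ((List.range' 1 r).foldl (fun w i => omegaContract (fibIdx Γ i) w) ω))

end chain

/-! ### Differential forms on simplicial sets -/

/-- The algebra of all simplicial maps from `X` to the simplicial algebra `[n] ↦ Omega n`. -/
def Forms (X : SSet.{u}) : Subalgebra Theta (∀ n : ℕ, X _⦋n⦌ → Omega n) where
  carrier := {ω | ∀ (m n : ℕ) (α : ⦋m⦌ ⟶ ⦋n⦌) (x : X _⦋n⦌),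
    ω m (X.map α.op x) = omegaPull α.toOrderHom (ω n x)}
  add_mem' {a b} ha hb m n α x := by simp only [Pi.add_apply, ha m n α x, hb m n α x, map_add]
  mul_mem' {a b} ha hb m n α x := by simp only [Pi.mul_apply, ha m n α x, hb m n α x, map_mul]
  algebraMap_mem' c m n α x := by
    exact ((omegaPull (α.toOrderHom)).commutes c).symm

/-- The differential forms of degree `k` on `X`: the simplicial maps to the forms of degree `k`. -/
def FormsDeg (X : SSet.{u}) (k : ℤ) : Submodule Theta (Forms X) where
  carrier := {ω | ∀ n x, ω.1 n x ∈ omegaDeg n k}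
  add_mem' ha hb n x := add_mem (ha n x) (hb n x)
  zero_mem' _ _ := zero_mem _
  smul_mem' c _ ha n x := Submodule.smul_mem _ c (ha n x)

instance (X : SSet.{u}) : SetLike.GradedMonoid (FormsDeg X) where
  one_mem n _ := omegaDeg_one n
  mul_mem _ _ _ _ ha hb n x := omegaDeg_mul n (ha n x) (hb n x)

/-- The module `Aᵏ(X)` of the differential forms of degree `k` on `X`. -/
def DegForms (X : SSet.{u}) (k : ℤ) : Type u := FormsDeg X k

instance (X : SSet.{u}) (k : ℤ) : AddCommGroup (DegForms X k) :=
  inferInstanceAs (AddCommGroup (FormsDeg X k))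

instance (X : SSet.{u}) (k : ℤ) : Module Theta (DegForms X k) :=
  inferInstanceAs (Module Theta (FormsDeg X k))

instance (X : SSet.{u}) : DirectSum.GRing (DegForms X) :=
  inferInstanceAs (DirectSum.GRing fun k => FormsDeg X k)

instance (X : SSet.{u}) : DirectSum.GAlgebra Theta (DegForms X) :=
  inferInstanceAs (DirectSum.GAlgebra Theta fun k => FormsDeg X k)

/-- A form of degree `k`, regarded as a form. -/
def DegForms.incl (X : SSet.{u}) (k : ℤ) : DegForms X k →ₗ[Theta] Forms X :=
  (FormsDeg X k).subtype

/-- The divided power de Rham algebra `A(X) = ⨁ₖ Aᵏ(X)` of a simplicial set `X`, with the wedge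
product of forms as multiplication. -/
abbrev DeRham (X : SSet.{u}) : Type u := ⨁ k : ℤ, DegForms X k

/-- The value of a differential form at a simplex. -/
def DeRham.value {X : SSet.{u}} (ω : DeRham X) {n : ℕ} (x : X _⦋n⦌) : Omega n :=
  (DirectSum.toModule Theta ℤ (Forms X) (DegForms.incl X) ω).1 n x

/-- The differential of `A(X)`. -/
def deRhamD (X : SSet.{u}) : DeRham X →ₗ[Theta] DeRham X :=
  DirectSum.toModule Theta ℤ _ fun k =>
    DirectSum.lof Theta ℤ (DegForms X) (k + 1) ∘ₗ
    { toFun := fun ω => ⟨⟨fun n x => omegaD n (ω.1.1 n x), fun m n α x => by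
        change omegaD m (ω.1.1 m (X.map α.op x)) = omegaPull α.toOrderHom (omegaD n (ω.1.1 n x))
        rw [ω.1.2 m n α x, omegaD_pull]⟩, fun n x => omegaDeg_d n (ω.2 n x)⟩
      map_add' := fun a b => Subtype.ext (Subtype.ext (funext fun n => funext fun x =>
        map_add (omegaD n) _ _))
      map_smul' := fun c a => Subtype.ext (Subtype.ext (funext fun n => funext fun x =>
        map_smul (omegaD n) _ _)) }

/-- The pullback of differential forms along a simplicial map. -/
def deRhamPull {X Y : SSet.{u}} (f : X ⟶ Y) : DeRham Y →ₗ[Theta] DeRham X :=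
  DirectSum.lmap fun k =>
    { toFun := fun ω => ⟨⟨fun n x => ω.1.1 n (f.app _ x), fun m n α x => by
        change ω.1.1 m (f.app _ (X.map α.op x)) = omegaPull α.toOrderHom (ω.1.1 n (f.app _ x))
        rw [← ω.1.2 m n α (f.app _ x), NatTrans.naturality_apply]⟩, fun n x => ω.2 n _⟩
      map_add' := fun a b => rfl
      map_smul' := fun c a => rfl }

open Classical in
/-- Integration of a form on `Y × Δ^r` over the fibres of the projection to `Y`, evaluated at an
`n`-simplex `y` of `Y`: the sum over all maximal chains `Γ` in `[n] × [r]` of the integrals of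
`Γ^* (y × id)^* ω`. -/
def fiberIntegral {Y : SSet.{u}} {r : ℕ} (ω : DeRham (Y ⊗ Δ[r])) {n : ℕ} (y : Y _⦋n⦌) : Omega n :=
  ∑ Γ : {Γ : Fin (n + r + 1) → Fin (n + 1) × Fin (r + 1) // StrictMono Γ},
    chainIntegral Γ.1 (ω.value (n := n + r)
      ((Y.map (SimplexCategory.mkHom
          (⟨fun j => (Γ.1 j).1, fun _ _ h => (Γ.2.monotone h).1⟩ :
            Fin (n + r + 1) →o Fin (n + 1))).op y,
        SSet.stdSimplex.objMk
          (⟨fun j => (Γ.1 j).2, fun _ _ h => (Γ.2.monotone h).2⟩ :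
            Fin (n + r + 1) →o Fin (r + 1)))))

/-! ### The path space and the iterated integrals -/

/-- The path space `X^{Δ¹}`. -/
abbrev PathSp (X : SSet.{u}) : SSet.{u} := (ihom (Δ[1] : SSet.{u})).obj X

/-- The evaluation `Δ¹ × X^{Δ¹} → X`. -/
def pathEv (X : SSet.{u}) : Δ[1] ⊗ PathSp X ⟶ X := (ihom.ev (Δ[1] : SSet.{u})).app X

/-- The evaluation `E_ε : X^{Δ¹} → X` at the vertex `ε` of `Δ¹`. -/
def evalAt (X : SSet.{u}) (ε : Fin 2) : PathSp X ⟶ X :=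
  CartesianMonoidalCategory.lift (SSet.const (SSet.stdSimplex.obj₀Equiv.symm ε)) (𝟙 (PathSp X))
    ≫ pathEv X

/-- The inclusion `X → X^{Δ¹}` of the constant paths. -/
def constPath (X : SSet.{u}) : X ⟶ PathSp X :=
  MonoidalClosed.curry (SemiCartesianMonoidalCategory.snd (Δ[1] : SSet.{u}) X)

/-- The `i`-th component `Δ^r → Δ¹` (for `i = 0, …, r - 1`) of `Δ^r → (Δ¹)^r`,
`j ↦ (1, …, 1, 0, …, 0)` with `j` ones. -/
def stepMap {r : ℕ} (i : Fin r) : (Δ[r] : SSet.{u}) ⟶ Δ[1] :=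
  SSet.stdSimplex.map (SimplexCategory.mkHom
    (⟨fun j => if (i : ℕ) < j then 1 else 0, fun a b h => by
      have : (a : ℕ) ≤ b := h
      dsimp only
      split_ifs
      · exact le_rfl
      · omega
      · exact Fin.zero_le _
      · exact le_rfl⟩ : Fin (r + 1) →o Fin 2))

/-- The `i`-th component `X^{Δ¹} × Δ^r → X` of the map `X^{Δ¹} × Δ^r → X^r`. -/
def pathComp (X : SSet.{u}) {r : ℕ} (i : Fin r) : PathSp X ⊗ Δ[r] ⟶ X :=
  CartesianMonoidalCategory.lift
    (SemiCartesianMonoidalCategory.snd (PathSp X) (Δ[r] : SSet.{u}) ≫ stepMap i)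
    (SemiCartesianMonoidalCategory.fst (PathSp X) (Δ[r] : SSet.{u})) ≫ pathEv X

/-- The form `ω₁ × … × ω_r` on `X^{Δ¹} × Δ^r`. -/
def pathProd {X : SSet.{u}} {r : ℕ} (ω : Fin r → DeRham X) : DeRham (PathSp X ⊗ Δ[r]) :=
  (List.ofFn fun i => deRhamPull (pathComp X i) (ω i)).prod

/-- The iterated integral `∫ ω₁ ⋯ ω_r`, evaluated at an `n`-simplex of `X^{Δ¹}`. -/
def iteratedIntegral {X : SSet.{u}} {r : ℕ} (ω : Fin r → DeRham X) {n : ℕ}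
    (γ : (PathSp X) _⦋n⦌) : Omega n :=
  fiberIntegral (pathProd ω) γ

/-- The map `A(X) ⊗ A(X) → A(X × X) → A(X^{Δ¹})`: the cross product followed by the pullback along
`(E₁, E₀) : X^{Δ¹} → X × X`. -/
def endpointsMap (X : SSet.{u}) : DeRham X ⊗[Theta] DeRham X →ₗ[Theta] DeRham (PathSp X) :=
  deRhamPull (CartesianMonoidalCategory.lift (evalAt X 1) (evalAt X 0)) ∘ₗ
    LinearMap.mul' Theta (DeRham (X ⊗ X)) ∘ₗ
    TensorProduct.map (deRhamPull (SemiCartesianMonoidalCategory.fst X X))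
      (deRhamPull (SemiCartesianMonoidalCategory.snd X X))
/-! ### The bar construction -/

section descend

variable {K A N ι : Type*} [CommRing K] [AddCommGroup A] [Module K A] [AddCommMonoid N] [Module K N]
  [Fintype ι] [DecidableEq ι]

lemma multilinear_congr_mod (S : Submodule K A) (φ : MultilinearMap K (fun _ : ι => A) N)
    (hφ : ∀ g i, g i ∈ S → φ g = 0) (g g' : ι → A) (h : ∀ i, g i - g' i ∈ S) : φ g = φ g' := by
  classical
  have key : ∀ s : Finset ι, φ (s.piecewise g' g) = φ g := by
    intro s
    induction s using Finset.induction_on with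
    | empty => simp
    | insert a s ha ih =>
      rw [← ih, Finset.piecewise_insert]
      have h1 : s.piecewise g' g = Function.update (s.piecewise g' g) a (g a) := by
        rw [eq_comm, Function.update_eq_self_iff, Finset.piecewise_eq_of_notMem _ _ _ ha]
      have h2 : φ (Function.update (s.piecewise g' g) a (g a - g' a)) = 0 :=
        hφ _ a (by simpa using h a)
      have h3 := φ.map_update_add (s.piecewise g' g) a (g' a) (g a - g' a)
      rw [add_sub_cancel, h2, add_zero, ← h1] at h3
      exact h3.symm
  have := key Finset.univ
  rw [Finset.piecewise_univ] at this
  exact this.symm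

/-- A multilinear map that vanishes as soon as one argument lies in `S` descends to the quotient
modulo `S`. -/
def multilinearDescend (S : Submodule K A) (φ : MultilinearMap K (fun _ : ι => A) N)
    (hφ : ∀ g i, g i ∈ S → φ g = 0) : MultilinearMap K (fun _ : ι => A ⧸ S) N :=
  have hout : ∀ x : A ⧸ S, Submodule.Quotient.mk (Quotient.out x) = x := fun x => Quotient.out_eq x
  have hcongr : ∀ (g g' : ι → A), (∀ i, (Submodule.Quotient.mk (g i) : A ⧸ S)
      = Submodule.Quotient.mk (g' i)) → φ g = φ g' := fun g g' h =>
    multilinear_congr_mod S φ hφ g g' fun i => (Submodule.Quotient.eq S).1 (h i)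
  have hupd : ∀ (inst : DecidableEq ι) (v : ι → A ⧸ S) (i : ι) (a : A),
      φ (fun j => Quotient.out (@Function.update ι (fun _ => A ⧸ S) inst v i
        (Submodule.Quotient.mk a) j))
        = φ (@Function.update ι (fun _ => A) inst (fun j => Quotient.out (v j)) i a) :=
    fun inst v i a => hcongr _ _ fun j => by
      rw [hout]
      by_cases hj : j = i
      · subst hj; simp
      · simp [hj, hout]
  { toFun := fun v => φ fun i => Quotient.out (v i)
    map_update_add' := fun {inst} v i x y => by
      obtain ⟨a, rfl⟩ := Submodule.Quotient.mk_surjective S x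
      obtain ⟨b, rfl⟩ := Submodule.Quotient.mk_surjective S y
      rw [← Submodule.Quotient.mk_add, hupd, hupd, hupd, φ.map_update_add]
    map_update_smul' := fun {inst} v i c x => by
      obtain ⟨a, rfl⟩ := Submodule.Quotient.mk_surjective S x
      rw [← Submodule.Quotient.mk_smul, hupd, hupd, φ.map_update_smul] }

lemma multilinearDescend_mk (S : Submodule K A) (φ : MultilinearMap K (fun _ : ι => A) N)
    (hφ : ∀ g i, g i ∈ S → φ g = 0) (g : ι → A) :
    multilinearDescend S φ hφ (fun i => Submodule.Quotient.mk (g i)) = φ g :=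
  multilinear_congr_mod S φ hφ _ _ fun i => (Submodule.Quotient.eq S).1 (Quotient.out_eq _)

end descend

/-- The raw data of a (not necessarily associative) cochain algebra over `K`: a module with a
family of submodules of homogeneous elements, a differential, a product and a unit. -/
structure CochainAlgData (K : Type) [CommRing K] where
  /-- the underlying module -/
  carrier : Type u
  /-- its addition -/
  [addCommMonoid : AddCommMonoid carrier]
  /-- its module structure -/
  [module : Module K carrier]
  /-- the homogeneous elements -/
  gr : ℤ → Submodule K carrier
  /-- the differential -/
  d : carrier →ₗ[K] carrier
  /-- the product -/
  mul : carrier →ₗ[K] carrier →ₗ[K] carrier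
  /-- the unit -/
  one : carrier

attribute [instance] CochainAlgData.addCommMonoid CochainAlgData.module

/-- The sign `(-1)^k` as a scalar. -/
def sgn (K : Type) [CommRing K] (k : ℤ) : K := ((k.negOnePow : ℤ) : K)

/-- `C` is a commutative cochain algebra: a graded module with an associative, unital, graded
commutative product and a differential of degree one that is a graded derivation. -/
structure IsCommCochainAlg {K : Type} [CommRing K] (C : CochainAlgData.{u} K) : Prop where
  internal : DirectSum.IsInternal C.gr
  one_mem : C.one ∈ C.gr 0
  mul_mem : ∀ i j, ∀ a ∈ C.gr i, ∀ b ∈ C.gr j, C.mul a b ∈ C.gr (i + j)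
  one_mul : ∀ a, C.mul C.one a = a
  mul_one : ∀ a, C.mul a C.one = a
  mul_assoc : ∀ a b c, C.mul (C.mul a b) c = C.mul a (C.mul b c)
  mul_comm : ∀ i j, ∀ a ∈ C.gr i, ∀ b ∈ C.gr j, C.mul a b = sgn K (i * j) • C.mul b a
  d_mem : ∀ i, ∀ a ∈ C.gr i, C.d a ∈ C.gr (i + 1)
  d_d : ∀ a, C.d (C.d a) = 0
  leibniz : ∀ i, ∀ a ∈ C.gr i, ∀ b,
    C.d (C.mul a b) = C.mul (C.d a) b + sgn K i • C.mul a (C.d b)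

/-- `φ` is a morphism of cochain algebras. -/
structure IsCochainAlgHom {K : Type} [CommRing K] (C D : CochainAlgData.{u} K)
    (φ : C.carrier →ₗ[K] D.carrier) : Prop where
  map_mem : ∀ i, ∀ a ∈ C.gr i, φ a ∈ D.gr i
  map_d : ∀ a, φ (C.d a) = D.d (φ a)
  map_one : φ C.one = D.one
  map_mul : ∀ a b, φ (C.mul a b) = D.mul (φ a) (φ b)

namespace Bar

variable {K : Type} [CommRing K] (𝒜 : ℤ → Type u) [∀ k, AddCommGroup (𝒜 k)]
  [∀ k, Module K (𝒜 k)]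

/-- The projection of `⨁ₖ 𝒜 k` to the part of parity `s`. -/
def parity (s : ZMod 2) : (⨁ k, 𝒜 k) →ₗ[K] ⨁ k, 𝒜 k :=
  DirectSum.toModule K ℤ _ fun k => if (k : ZMod 2) = s then DirectSum.lof K ℤ 𝒜 k else 0

/-- The sign operator `a ↦ (-1)^{|a|} a`. -/
def eps : (⨁ k, 𝒜 k) →ₗ[K] ⨁ k, 𝒜 k := parity 𝒜 0 - parity 𝒜 1

variable [DirectSum.GRing 𝒜] [DirectSum.GAlgebra K 𝒜]

lemma parity_zero_one : parity (K := K) 𝒜 0 1 = 1 := by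
  change parity (K := K) 𝒜 0 (DirectSum.lof K ℤ 𝒜 0 GradedMonoid.GOne.one) = _
  rw [parity, DirectSum.toModule_lof, Int.cast_zero, if_pos rfl]
  rfl

lemma parity_one_one : parity (K := K) 𝒜 1 1 = 0 := by
  change parity (K := K) 𝒜 1 (DirectSum.lof K ℤ 𝒜 0 GradedMonoid.GOne.one) = _
  rw [parity, DirectSum.toModule_lof, Int.cast_zero, if_neg (by decide)]
  rfl

lemma eps_one : eps (K := K) 𝒜 1 = 1 := by
  rw [eps, LinearMap.sub_apply, parity_zero_one, parity_one_one, sub_zero]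

variable (K)

/-- The reduced algebra `Ā = A / K·1`. -/
abbrev Red : Type u := (⨁ k, 𝒜 k) ⧸ (1 : Submodule K (⨁ k, 𝒜 k))

/-- The summand `A ⊗ Ā^{⊗ r} ⊗ A` of the bar construction. -/
abbrev Part (r : ℕ) : Type u := ((⨁ k, 𝒜 k) ⊗[K] (⨂[K]^r (Red K 𝒜))) ⊗[K] (⨁ k, 𝒜 k)

/-- The underlying module `⨁ᵣ A ⊗ Ā^{⊗ r} ⊗ A` of the two-sided bar construction. -/
abbrev Total : Type u := ⨁ r : ℕ, Part K 𝒜 r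

variable {𝒜}

/-- The element `f ⊗ g₁ ⊗ ⋯ ⊗ g_r ⊗ h` of `A ⊗ Ā^{⊗ r} ⊗ A`. -/
def pureWord {r : ℕ} (f : ⨁ k, 𝒜 k) (g : Fin r → ⨁ k, 𝒜 k) (h : ⨁ k, 𝒜 k) : Part K 𝒜 r :=
  (f ⊗ₜ PiTensorProduct.tprod K fun i => Submodule.Quotient.mk (g i)) ⊗ₜ h

/-- The element `f[g₁|⋯|g_r]h` of the bar construction. -/
def word {r : ℕ} (f : ⨁ k, 𝒜 k) (g : Fin r → ⨁ k, 𝒜 k) (h : ⨁ k, 𝒜 k) : Total K 𝒜 :=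
  DirectSum.lof K ℕ (Part K 𝒜) r (pureWord K f g h)

variable (𝒜)

lemma one_le_comap {φ : (⨁ k, 𝒜 k) →ₗ[K] ⨁ k, 𝒜 k} {c : K} (h : φ 1 = c • 1) :
    (1 : Submodule K (⨁ k, 𝒜 k)) ≤ (1 : Submodule K (⨁ k, 𝒜 k)).comap φ := by
  rw [Submodule.one_eq_span, Submodule.span_le, Set.singleton_subset_iff]
  change φ 1 ∈ Submodule.span K {1}
  rw [h]
  exact Submodule.smul_mem _ _ (Submodule.mem_span_singleton_self _)

/-- The projection of `Ā` to the part of parity `s`. -/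
def parityBar (s : ZMod 2) : Red K 𝒜 →ₗ[K] Red K 𝒜 :=
  Submodule.mapQ _ _ (parity 𝒜 s) <| by
    by_cases hs : s = 0
    · subst hs
      exact one_le_comap K 𝒜 (c := 1) (by rw [parity_zero_one, one_smul])
    · have : s = 1 := by revert s; decide
      subst this
      exact one_le_comap K 𝒜 (c := 0) (by rw [parity_one_one, zero_smul])

/-- The operator `g ↦ (-1)^{|g| - 1} g` on `Ā`. -/
def sgnBar : Red K 𝒜 →ₗ[K] Red K 𝒜 := parityBar K 𝒜 1 - parityBar K 𝒜 0

variable {K}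
variable (d : (⨁ k, 𝒜 k) →ₗ[K] ⨁ k, 𝒜 k) (hd : d 1 = 0)

/-- The differential induced on `Ā`. -/
def dBar : Red K 𝒜 →ₗ[K] Red K 𝒜 :=
  Submodule.mapQ _ _ d (one_le_comap K 𝒜 (c := 0) (by rw [hd, zero_smul]))

/-- The operator `[g₁|⋯|g_r] ↦ - ∑ᵢ (-1)^{ν_{i-1}} [g₁|⋯|dgᵢ|⋯|g_r]`. -/
def dMid (r : ℕ) : ⨂[K]^r (Red K 𝒜) →ₗ[K] ⨂[K]^r (Red K 𝒜) :=
  ∑ i : Fin r, PiTensorProduct.map fun j =>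
    if j < i then sgnBar K 𝒜 else if j = i then - dBar 𝒜 d hd else LinearMap.id

/-- The internal differential `d₁` of the bar construction,
`df[g]h - ∑ᵢ (-1)^{|f| + ν_{i-1}} f[⋯|dgᵢ|⋯]h + (-1)^{|f| + ν_r} f[g]dh`. -/
def d₁ (r : ℕ) : Part K 𝒜 r →ₗ[K] Part K 𝒜 r :=
  TensorProduct.map (TensorProduct.map d LinearMap.id) LinearMap.id
    + TensorProduct.map (TensorProduct.map (eps 𝒜) (dMid 𝒜 d hd r)) LinearMap.id
    + TensorProduct.map (TensorProduct.map (eps 𝒜)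
        (PiTensorProduct.map fun _ => sgnBar K 𝒜)) d

section face

variable {𝒜} {r : ℕ}

/-- The left factor of the `j`-th face. -/
def faceL (j : ℕ) (g : Fin (r + 1) → ⨁ k, 𝒜 k) (f : ⨁ k, 𝒜 k) : ⨁ k, 𝒜 k :=
  if j = 0 then eps (K := K) 𝒜 f * g 0 else eps (K := K) 𝒜 f

/-- The middle factors of the `j`-th face. -/
def faceM (j : ℕ) (g : Fin (r + 1) → ⨁ k, 𝒜 k) (k : Fin r) : ⨁ k, 𝒜 k :=
  if (k : ℕ) + 1 < j then - eps (K := K) 𝒜 (g k.castSucc)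
  else if (k : ℕ) + 1 = j then - eps (K := K) 𝒜 (g k.castSucc) * g k.succ
  else g k.succ

/-- The right factor of the `j`-th face. -/
def faceR (j : ℕ) (g : Fin (r + 1) → ⨁ k, 𝒜 k) (h : ⨁ k, 𝒜 k) : ⨁ k, 𝒜 k :=
  if j = r + 1 then - (g (Fin.last r) * h) else h

/-- The `j`-th summand, `0 ≤ j ≤ r + 1`, of `d₂ (f[g₁|⋯|g_{r+1}]h)`: it is
`(-1)^{|f|} f ∧ g₁[g₂|⋯|g_{r+1}]h` for `j = 0`, then
`(-1)^{|f| + ν_j} f[g₁|⋯|g_j ∧ g_{j+1}|⋯|g_{r+1}]h`, and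
`(-1)^{|f| + ν_r + 1} f[g₁|⋯|g_r]g_{r+1} ∧ h` for `j = r + 1`. -/
def face (j : ℕ) (f : ⨁ k, 𝒜 k) (g : Fin (r + 1) → ⨁ k, 𝒜 k) (h : ⨁ k, 𝒜 k) : Part K 𝒜 r :=
  pureWord K (faceL (K := K) j g f) (faceM (K := K) j g) (faceR j g h)

lemma pureWord_zero_mid (f : ⨁ k, 𝒜 k) (g : Fin r → ⨁ k, 𝒜 k) (h : ⨁ k, 𝒜 k) (i : Fin r)
    (hi : g i ∈ (1 : Submodule K (⨁ k, 𝒜 k))) : pureWord K f g h = 0 := by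
  have : PiTensorProduct.tprod K (fun i => (Submodule.Quotient.mk (g i) : Red K 𝒜)) = 0 :=
    MultilinearMap.map_coord_zero _ i ((Submodule.Quotient.mk_eq_zero _).2 hi)
  rw [pureWord, this, tmul_zero, zero_tmul]

lemma mk_update (g : Fin r → ⨁ k, 𝒜 k) (i : Fin r) (x : ⨁ k, 𝒜 k) :
    (fun j => (Submodule.Quotient.mk (Function.update g i x j) : Red K 𝒜))
      = Function.update (fun j => (Submodule.Quotient.mk (g j) : Red K 𝒜)) i
        (Submodule.Quotient.mk x) := by
  ext j
  by_cases hj : j = i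
  · subst hj; simp
  · simp [hj]

lemma pureWord_update_add (f : ⨁ k, 𝒜 k) (g : Fin r → ⨁ k, 𝒜 k) (h : ⨁ k, 𝒜 k) (i : Fin r)
    (x y : ⨁ k, 𝒜 k) : pureWord K f (Function.update g i (x + y)) h
      = pureWord K f (Function.update g i x) h + pureWord K f (Function.update g i y) h := by
  simp only [pureWord, mk_update, Submodule.Quotient.mk_add, MultilinearMap.map_update_add,
    tmul_add, add_tmul]

lemma pureWord_update_smul (f : ⨁ k, 𝒜 k) (g : Fin r → ⨁ k, 𝒜 k) (h : ⨁ k, 𝒜 k) (i : Fin r)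
    (c : K) (x : ⨁ k, 𝒜 k) : pureWord K f (Function.update g i (c • x)) h
      = c • pureWord K f (Function.update g i x) h := by
  simp only [pureWord, mk_update, Submodule.Quotient.mk_smul, MultilinearMap.map_update_smul,
    tmul_smul, smul_tmul']

lemma faceM_update (j : ℕ) (g : Fin (r + 1) → ⨁ k, 𝒜 k) (i : Fin (r + 1))
    (h0 : ¬ (j = 0 ∧ i = 0)) (hr : ¬ (j = r + 1 ∧ i = Fin.last r)) (hj : j ≤ r + 1) :
    ∃ (k : Fin r) (L : (⨁ k, 𝒜 k) →ₗ[K] ⨁ k, 𝒜 k), ∀ x,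
      faceM (K := K) j (Function.update g i x) = Function.update (faceM (K := K) j g) k (L x) := by
  have hi : (i : ℕ) ≤ r := Nat.lt_succ_iff.1 i.2
  have h0' : ¬ (j = 0 ∧ (i : ℕ) = 0) := fun h => h0 ⟨h.1, Fin.ext h.2⟩
  have hr' : ¬ (j = r + 1 ∧ (i : ℕ) = r) := fun h => hr ⟨h.1, Fin.ext h.2⟩
  have hcs : ∀ (k : Fin r) (x : ⨁ k, 𝒜 k), (k : ℕ) ≠ i →
      Function.update g i x k.castSucc = g k.castSucc := fun k x hk =>
    Function.update_of_ne (fun h => hk (by rw [← h]; rfl)) _ _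
  have hsc : ∀ (k : Fin r) (x : ⨁ k, 𝒜 k), (k : ℕ) + 1 ≠ i →
      Function.update g i x k.succ = g k.succ := fun k x hk =>
    Function.update_of_ne (fun h => hk (by rw [← h]; rfl)) _ _
  by_cases hij : (i : ℕ) < j
  · -- the argument in position `i` contributes to the slot `i`
    have hir : (i : ℕ) < r := by omega
    obtain ⟨i, hi'⟩ := i
    simp only at *
    have ecs : ∀ x : ⨁ k, 𝒜 k, Function.update g ⟨i, hi'⟩ x (Fin.castSucc ⟨i, hir⟩) = x :=
      fun x => Function.update_self _ _ _
    by_cases hlt : i + 1 < j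
    · refine ⟨⟨i, hir⟩, - eps 𝒜, fun x => funext fun k => ?_⟩
      by_cases hk : k = ⟨i, hir⟩
      · subst hk
        rw [Function.update_self, faceM, if_pos hlt, ecs]
        rfl
      · have hk' : (k : ℕ) ≠ i := fun h => hk (Fin.ext h)
        rw [Function.update_of_ne hk, faceM, faceM, hcs k x hk']
        by_cases hk2 : (k : ℕ) + 1 = i
        · rw [if_pos (by omega), if_pos (by omega)]
        · rw [hsc k x hk2]
    · have hje : i + 1 = j := by omega
      refine ⟨⟨i, hir⟩, LinearMap.mulRight K (g (Fin.succ ⟨i, hir⟩)) ∘ₗ (- eps 𝒜),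
        fun x => funext fun k => ?_⟩
      by_cases hk : k = ⟨i, hir⟩
      · subst hk
        rw [Function.update_self, faceM, if_neg hlt, if_pos hje, ecs, hsc _ _ (by simp)]
        rfl
      · have hk' : (k : ℕ) ≠ i := fun h => hk (Fin.ext h)
        rw [Function.update_of_ne hk, faceM, faceM, hcs k x hk']
        by_cases hk2 : (k : ℕ) + 1 = i
        · rw [if_pos (by omega), if_pos (by omega)]
        · rw [hsc k x hk2]
  · -- the argument in position `i` contributes to the slot `i - 1`
    obtain ⟨i, hi'⟩ := i
    simp only at *
    obtain ⟨i, rfl⟩ : ∃ i', i = i' + 1 := ⟨i - 1, by omega⟩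
    have hir : i < r := by omega
    have esc : ∀ x : ⨁ k, 𝒜 k, Function.update g ⟨i + 1, hi'⟩ x (Fin.succ ⟨i, hir⟩) = x :=
      fun x => Function.update_self _ _ _
    by_cases hje : i + 1 = j
    · refine ⟨⟨i, hir⟩, LinearMap.mulLeft K (- eps (K := K) 𝒜 (g (Fin.castSucc ⟨i, hir⟩))),
        fun x => funext fun k => ?_⟩
      by_cases hk : k = ⟨i, hir⟩
      · subst hk
        rw [Function.update_self, faceM, if_neg (by simp [hje]), if_pos hje, esc,
          hcs _ _ (by simp)]
        rfl
      · have hk' : (k : ℕ) + 1 ≠ i + 1 := fun h => hk (Fin.ext (Nat.succ_injective h))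
        rw [Function.update_of_ne hk, faceM, faceM, hsc k x hk']
        by_cases hk2 : (k : ℕ) = i + 1
        · rw [if_neg (by omega), if_neg (by omega), if_neg (by omega), if_neg (by omega)]
        · rw [hcs k x hk2]
    · refine ⟨⟨i, hir⟩, LinearMap.id, fun x => funext fun k => ?_⟩
      by_cases hk : k = ⟨i, hir⟩
      · subst hk
        have h1 : ¬ (i + 1 < j) := by omega
        rw [Function.update_self, faceM, if_neg h1, if_neg hje, esc]
        rfl
      · have hk' : (k : ℕ) + 1 ≠ i + 1 := fun h => hk (Fin.ext (Nat.succ_injective h))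
        rw [Function.update_of_ne hk, faceM, faceM, hsc k x hk']
        by_cases hk2 : (k : ℕ) = i + 1
        · rw [if_neg (by omega), if_neg (by omega), if_neg (by omega), if_neg (by omega)]
        · rw [hcs k x hk2]

lemma add_neg_one_smul {N : Type*} [AddCommMonoid N] [Module K N] (x : N) :
    x + (-1 : K) • x = 0 := by
  have : (1 : K) • x + (-1 : K) • x = 0 := by rw [← add_smul, add_neg_cancel, zero_smul]
  rwa [one_smul] at this

lemma pureWord_add_left (f f' : ⨁ k, 𝒜 k) (g : Fin r → ⨁ k, 𝒜 k) (h : ⨁ k, 𝒜 k) :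
    pureWord K (f + f') g h = pureWord K f g h + pureWord K f' g h := by
  simp only [pureWord, add_tmul]

lemma pureWord_smul_left (c : K) (f : ⨁ k, 𝒜 k) (g : Fin r → ⨁ k, 𝒜 k) (h : ⨁ k, 𝒜 k) :
    pureWord K (c • f) g h = c • pureWord K f g h := by
  simp only [pureWord, smul_tmul']

lemma pureWord_add_right (f : ⨁ k, 𝒜 k) (g : Fin r → ⨁ k, 𝒜 k) (h h' : ⨁ k, 𝒜 k) :
    pureWord K f g (h + h') = pureWord K f g h + pureWord K f g h' := by
  simp only [pureWord, tmul_add]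

lemma pureWord_smul_right (c : K) (f : ⨁ k, 𝒜 k) (g : Fin r → ⨁ k, 𝒜 k) (h : ⨁ k, 𝒜 k) :
    pureWord K f g (c • h) = c • pureWord K f g h := by
  simp only [pureWord, tmul_smul]

/-- A face depends linearly on each of the letters. -/
lemma face_update (j : ℕ) (hj : j ≤ r + 1) (f : ⨁ k, 𝒜 k) (g : Fin (r + 1) → ⨁ k, 𝒜 k)
    (h : ⨁ k, 𝒜 k) (i : Fin (r + 1)) :
    (∀ x y, face (K := K) j f (Function.update g i (x + y)) h
      = face (K := K) j f (Function.update g i x) h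
        + face (K := K) j f (Function.update g i y) h) ∧
    (∀ (c : K) x, face (K := K) j f (Function.update g i (c • x)) h
      = c • face (K := K) j f (Function.update g i x) h) := by
  have hM0 : ∀ x, faceM (K := K) 0 (Function.update g 0 x) = faceM (K := K) 0 g := by
    intro x
    funext k
    have : Function.update g 0 x k.succ = g k.succ :=
      Function.update_of_ne (Fin.succ_ne_zero k) _ _
    simp [faceM]
  have hMr : ∀ x, faceM (K := K) (r + 1) (Function.update g (Fin.last r) x)
      = faceM (K := K) (r + 1) g := by
    intro x
    funext k
    have : Function.update g (Fin.last r) x k.castSucc = g k.castSucc :=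
      Function.update_of_ne (Fin.castSucc_lt_last k).ne _ _
    simp [faceM]
  by_cases h0 : j = 0 ∧ i = 0
  · obtain ⟨rfl, rfl⟩ := h0
    have hR : ∀ x, faceR 0 (Function.update g 0 x) h = h := fun x => if_neg (by omega)
    have hL : ∀ x, faceL (K := K) 0 (Function.update g 0 x) f = eps (K := K) 𝒜 f * x := fun x => by
      simp [faceL]
    simp only [face, hM0, hR, hL, mul_add, mul_smul_comm, pureWord_add_left, pureWord_smul_left]
    exact ⟨fun _ _ => trivial, fun _ _ => trivial⟩
  by_cases hr : j = r + 1 ∧ i = Fin.last r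
  · obtain ⟨rfl, rfl⟩ := hr
    have hR : ∀ x, faceR (r + 1) (Function.update g (Fin.last r) x) h = (-1 : K) • (x * h) :=
      fun x => by simp [faceR]
    have hL : ∀ x, faceL (K := K) (r + 1) (Function.update g (Fin.last r) x) f
        = eps (K := K) 𝒜 f := fun x => if_neg (by omega)
    simp only [face, hMr, hR, hL, add_mul, smul_mul_assoc, smul_add, pureWord_add_right,
      pureWord_smul_right]
    exact ⟨fun _ _ => trivial, fun c _ => smul_comm _ _ _⟩
  · obtain ⟨k, L, hk⟩ := faceM_update (K := K) j g i h0 hr hj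
    have hL : ∀ x, faceL (K := K) j (Function.update g i x) f = faceL (K := K) j g f := by
      intro x
      unfold faceL
      split_ifs with hj0
      · rw [Function.update_of_ne]
        rintro rfl
        exact h0 ⟨hj0, rfl⟩
      · rfl
    have hR : ∀ x, faceR j (Function.update g i x) h = faceR j g h := by
      intro x
      unfold faceR
      split_ifs with hj0
      · rw [Function.update_of_ne]
        rintro rfl
        exact hr ⟨hj0, rfl⟩
      · rfl
    simp only [face, hk, hL, hR, map_add, map_smul, pureWord_update_add, pureWord_update_smul]
    exact ⟨fun _ _ => trivial, fun _ _ => trivial⟩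

/-- A face is linear in the left and in the right factor. -/
lemma face_bilinear (j : ℕ) (g : Fin (r + 1) → ⨁ k, 𝒜 k) :
    (∀ f f' h, face (K := K) j (f + f') g h = face (K := K) j f g h + face (K := K) j f' g h) ∧
    (∀ (c : K) f h, face (K := K) j (c • f) g h = c • face (K := K) j f g h) ∧
    (∀ f h h', face (K := K) j f g (h + h') = face (K := K) j f g h + face (K := K) j f g h') ∧
    (∀ (c : K) f h, face (K := K) j f g (c • h) = c • face (K := K) j f g h) := by
  refine ⟨fun f f' h => ?_, fun c f h => ?_, fun f h h' => ?_, fun c f h => ?_⟩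
  · have : faceL (K := K) j g (f + f') = faceL (K := K) j g f + faceL (K := K) j g f' := by
      unfold faceL; split_ifs <;> simp [add_mul]
    rw [face, this, pureWord_add_left]; rfl
  · have : faceL (K := K) j g (c • f) = c • faceL (K := K) j g f := by
      unfold faceL; split_ifs <;> simp
    rw [face, this, pureWord_smul_left]; rfl
  · have : faceR j g (h + h') = faceR j g h + faceR j g h' := by
      unfold faceR; split_ifs
      · rw [mul_add, neg_add]
      · rfl
    rw [face, this, pureWord_add_right]; rfl
  · have : faceR j g (c • h) = c • faceR j g h := by
      unfold faceR; split_ifs <;> simp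
    rw [face, this, pureWord_smul_right]; rfl

variable (K 𝒜 r)

/-- The map `(g₁, …, g_{r+1}) ↦ (f ↦ h ↦ d₂ (f[g₁|⋯|g_{r+1}]h))`, before the letters are reduced
modulo `K·1`. -/
def faceSum : MultilinearMap K (fun _ : Fin (r + 1) => ⨁ k, 𝒜 k)
    ((⨁ k, 𝒜 k) →ₗ[K] (⨁ k, 𝒜 k) →ₗ[K] Part K 𝒜 r) where
  toFun g := LinearMap.mk₂ K (fun f h => ∑ j : Fin (r + 2), face j f g h)
    (fun f f' h => by
      rw [← Finset.sum_add_distrib]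
      exact Finset.sum_congr rfl fun j _ => (face_bilinear (j : ℕ) g).1 f f' h)
    (fun c f h => by
      rw [Finset.smul_sum]
      exact Finset.sum_congr rfl fun j _ => (face_bilinear (j : ℕ) g).2.1 c f h)
    (fun f h h' => by
      rw [← Finset.sum_add_distrib]
      exact Finset.sum_congr rfl fun j _ => (face_bilinear (j : ℕ) g).2.2.1 f h h')
    (fun c f h => by
      rw [Finset.smul_sum]
      exact Finset.sum_congr rfl fun j _ => (face_bilinear (j : ℕ) g).2.2.2 c f h)
  map_update_add' {inst} g i x y := by
    obtain rfl : inst = instDecidableEqFin (r + 1) := Subsingleton.elim _ _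
    refine LinearMap.ext₂ fun f h => ?_
    simp only [LinearMap.mk₂_apply, LinearMap.add_apply]
    rw [← Finset.sum_add_distrib]
    exact Finset.sum_congr rfl fun j _ =>
      (face_update (j : ℕ) (Nat.lt_succ_iff.1 j.2) f g h i).1 x y
  map_update_smul' {inst} g i c x := by
    obtain rfl : inst = instDecidableEqFin (r + 1) := Subsingleton.elim _ _
    refine LinearMap.ext₂ fun f h => ?_
    simp only [LinearMap.mk₂_apply, LinearMap.smul_apply]
    rw [Finset.smul_sum]
    exact Finset.sum_congr rfl fun j _ =>
      (face_update (j : ℕ) (Nat.lt_succ_iff.1 j.2) f g h i).2 c x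

variable {K 𝒜 r}

/-- If a letter is `1`, then the two adjacent faces cancel. -/
lemma face_one_add (p : Fin (r + 1)) (f : ⨁ k, 𝒜 k) (g : Fin (r + 1) → ⨁ k, 𝒜 k) (h : ⨁ k, 𝒜 k)
    (hg : g p = 1) : face (K := K) p f g h + face (K := K) (p + 1) f g h = 0 := by
  obtain ⟨p, hp⟩ := p
  simp only
  have hL : faceL (K := K) p g f = eps (K := K) 𝒜 f := by
    unfold faceL
    split_ifs with h0
    · subst h0
      rw [show g 0 = 1 from hg, mul_one]
    · rfl
  have hL' : faceL (K := K) (p + 1) g f = eps (K := K) 𝒜 f := if_neg (by omega)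
  have hR : faceR p g h = h := if_neg (by omega)
  rw [face, face, hL, hL', hR]
  have hlow : ∀ k : Fin r, (k : ℕ) + 1 = p → g k.succ = 1 := fun k hk => by
    rw [← hg]; congr 1; exact Fin.ext hk
  rcases Nat.lt_succ_iff_lt_or_eq.1 hp with hpr | hpr
  · have hR' : faceR (p + 1) g h = h := if_neg (by omega)
    have hM : faceM (K := K) (p + 1) g = Function.update (faceM (K := K) p g) ⟨p, hpr⟩
        ((-1 : K) • faceM (K := K) p g ⟨p, hpr⟩) := by
      funext k
      by_cases hk : k = ⟨p, hpr⟩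
      · subst hk
        have : g (Fin.castSucc ⟨p, hpr⟩) = 1 := hg
        rw [Function.update_self]
        rw [faceM, faceM, if_neg (by simp), if_pos rfl, if_neg (by simp), if_neg (by simp), this,
          eps_one, neg_one_smul, neg_one_mul]
      · have hk' : (k : ℕ) ≠ p := fun h => hk (Fin.ext h)
        rw [Function.update_of_ne hk]
        unfold faceM
        by_cases h1 : (k : ℕ) + 1 = p
        · rw [if_pos (by omega), if_neg (by omega), if_pos h1, hlow k h1, mul_one]
        · by_cases h2 : (k : ℕ) + 1 < p
          · rw [if_pos (by omega), if_pos h2]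
          · rw [if_neg (by omega), if_neg (by omega), if_neg h2, if_neg h1]
    rw [hM, hR', pureWord_update_smul, Function.update_eq_self, add_neg_one_smul]
  · subst hpr
    have hR' : faceR (p + 1) g h = (-1 : K) • h := by
      have : g (Fin.last p) = 1 := hg
      simp [faceR, this]
    have hM : faceM (K := K) (p + 1) g = faceM (K := K) p g := by
      funext k
      have hk := k.2
      unfold faceM
      by_cases h1 : (k : ℕ) + 1 = p
      · rw [if_pos (by omega), if_neg (by omega), if_pos h1, hlow k h1, mul_one]
      · rw [if_pos (by omega), if_pos (by omega)]
    rw [hM, hR', pureWord_smul_right, add_neg_one_smul]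

/-- The remaining faces of a word with a letter `1` are degenerate. -/
lemma face_one_zero (p : Fin (r + 1)) (f : ⨁ k, 𝒜 k) (g : Fin (r + 1) → ⨁ k, 𝒜 k) (h : ⨁ k, 𝒜 k)
    (hg : g p = 1) (j : ℕ) (hj : j ≤ r + 1) (h1 : j ≠ p) (h2 : j ≠ p + 1) :
    face (K := K) j f g h = 0 := by
  obtain ⟨p, hp⟩ := p
  simp only at *
  by_cases hjp : p < j
  · refine pureWord_zero_mid _ _ _ ⟨p, by omega⟩ ?_
    have : g (Fin.castSucc ⟨p, by omega⟩) = 1 := hg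
    rw [faceM, if_pos (by simp only; omega), this, eps_one]
    exact neg_mem (Submodule.one_le.1 le_rfl)
  · obtain ⟨q, rfl⟩ : ∃ q, p = q + 1 := ⟨p - 1, by omega⟩
    refine pureWord_zero_mid _ _ _ ⟨q, by omega⟩ ?_
    have : g (Fin.succ ⟨q, by omega⟩) = 1 := hg
    rw [faceM, if_neg (by simp only; omega), if_neg (by simp only; omega), this]
    exact Submodule.one_le.1 le_rfl

lemma faceSum_eq_zero (g : Fin (r + 1) → ⨁ k, 𝒜 k) (p : Fin (r + 1))
    (hg : g p ∈ (1 : Submodule K (⨁ k, 𝒜 k))) : faceSum K 𝒜 r g = 0 := by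
  rw [Submodule.one_eq_span, Submodule.mem_span_singleton] at hg
  obtain ⟨c, hc⟩ := hg
  have : g = Function.update g p (c • 1) := by rw [hc, Function.update_eq_self]
  rw [this, MultilinearMap.map_update_smul]
  refine smul_eq_zero_of_right c (LinearMap.ext₂ fun f h => ?_)
  change ∑ j : Fin (r + 2), face (K := K) j f (Function.update g p 1) h = 0
  have h1 : Function.update g p 1 p = 1 := Function.update_self _ _ _
  rw [← Finset.add_sum_erase _ _ (Finset.mem_univ p.castSucc),
    ← Finset.add_sum_erase _ _ (Finset.mem_erase.2
      ⟨(Fin.castSucc_lt_succ (i := p)).ne', Finset.mem_univ p.succ⟩), ← add_assoc]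
  rw [Finset.sum_eq_zero, add_zero]
  · exact face_one_add p f _ h h1
  · intro j hj
    rw [Finset.mem_erase, Finset.mem_erase] at hj
    refine face_one_zero p f _ h h1 _ (Nat.lt_succ_iff.1 j.2) (fun h => hj.2.1 (Fin.ext h))
      (fun h => hj.1 (Fin.ext h))

end face

variable (K)

/-- The external differential `d₂` of the bar construction on words with `r + 1` letters. -/
def d₂ (r : ℕ) : Part K 𝒜 (r + 1) →ₗ[K] Part K 𝒜 r :=
  TensorProduct.lift (TensorProduct.lift (LinearMap.flip (PiTensorProduct.lift
    (multilinearDescend 1 (faceSum K 𝒜 r) faceSum_eq_zero))))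

lemma d₂_pureWord (r : ℕ) (f : ⨁ k, 𝒜 k) (g : Fin (r + 1) → ⨁ k, 𝒜 k) (h : ⨁ k, 𝒜 k) :
    d₂ K 𝒜 r (pureWord K f g h) = ∑ j : Fin (r + 2), face (j : ℕ) f g h := by
  rw [d₂, pureWord, TensorProduct.lift.tmul, TensorProduct.lift.tmul, LinearMap.flip_apply,
    PiTensorProduct.lift.tprod, multilinearDescend_mk]
  rfl

variable {K}

/-- The differential `d₁ + d₂` of the bar construction. -/
def diff : Total K 𝒜 →ₗ[K] Total K 𝒜 :=
  DirectSum.toModule K ℕ _ fun r =>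
    DirectSum.lof K ℕ (Part K 𝒜) r ∘ₗ d₁ 𝒜 d hd r +
    match r with
    | 0 => 0
    | r + 1 => DirectSum.lof K ℕ (Part K 𝒜) r ∘ₗ d₂ K 𝒜 r

section shuffle

/-- The `(p, q)`-shuffles: the permutations `σ` for which `σ⁻¹` is increasing on the first `p` and on
the last `q` elements, so that `g_{σ 1}, …, g_{σ (p + q)}` is a shuffle of `g₁, …, g_p` and
`g_{p + 1}, …, g_{p + q}`. -/
def shuffles (p q : ℕ) : Finset (Equiv.Perm (Fin (p + q))) := by
  classical
  exact Finset.univ.filter fun σ => StrictMono (fun i : Fin p => σ.symm (Fin.castAdd q i)) ∧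
    StrictMono (fun j : Fin q => σ.symm (Fin.natAdd p j))

variable (K)

/-- The sign `(-1)^s` for `s ∈ ℤ/2`. -/
def zsgn (s : ZMod 2) : K := if s = 0 then 1 else -1

/-- The Koszul sign `ε(σ, s₁, …, sₙ)` of the permutation `(x₁, …, xₙ) ↦ (x_{σ 1}, …, x_{σ n})` of
elements of degrees `s₁, …, sₙ`. -/
def koszul {n : ℕ} (σ : Equiv.Perm (Fin n)) (s : Fin n → ZMod 2) : K :=
  ∏ i, ∏ j, if i < j ∧ σ j < σ i then zsgn K (s (σ i) * s (σ j)) else 1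

/-- The projection of `(Ā[1])^{⊗ n}` to the part on which the `i`-th letter `gᵢ` has shifted degree
`|gᵢ| - 1 ≡ sᵢ` modulo `2`. -/
def letterParity {n : ℕ} (s : Fin n → ZMod 2) : ⨂[K]^n (Red K 𝒜) →ₗ[K] ⨂[K]^n (Red K 𝒜) :=
  PiTensorProduct.map fun i => parityBar K 𝒜 (s i + 1)

/-- The projection of `(Ā[1])^{⊗ n}` to the part of total degree `∑ᵢ (|gᵢ| - 1) ≡ b` modulo `2`. -/
def wordParity {n : ℕ} (b : ZMod 2) : ⨂[K]^n (Red K 𝒜) →ₗ[K] ⨂[K]^n (Red K 𝒜) :=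
  ∑ s : Fin n → ZMod 2, if ∑ i, s i = b then letterParity K 𝒜 s else 0

/-- The shuffle product of letters, `[g₁|⋯|g_p] ⊗ [g_{p+1}|⋯|g_{p+q}] ↦
∑_σ ε(σ, |g₁| - 1, …, |g_{p+q}| - 1) [g_{σ 1}|⋯|g_{σ (p+q)}]`. -/
def shuffleMid (p q : ℕ) :
    ⨂[K]^p (Red K 𝒜) →ₗ[K] ⨂[K]^q (Red K 𝒜) →ₗ[K] ⨂[K]^(p + q) (Red K 𝒜) :=
  TensorProduct.curry ((∑ σ ∈ shuffles p q, ∑ s : Fin (p + q) → ZMod 2, koszul K σ s •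
    ((PiTensorProduct.reindex K (fun _ => Red K 𝒜) σ.symm).toLinearMap ∘ₗ letterParity K 𝒜 s)) ∘ₗ
      TensorPower.mulEquiv.toLinearMap)

/-- The shuffle product `(f[g₁|⋯|g_p]h) ∧ (f'[g_{p+1}|⋯|g_{p+q}]h')`: the sum over the parities
`a = |f'|`, `b = ∑_{i ≤ p} (|gᵢ| - 1)`, `c = |h|`, `e = ∑_{i > p} (|gᵢ| - 1)` of the terms with the
sign `(-1)^{ca + ba + ce}`. -/
def mulPart (p q : ℕ) : Part K 𝒜 p →ₗ[K] Part K 𝒜 q →ₗ[K] Part K 𝒜 (p + q) :=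
  ∑ a : ZMod 2, ∑ b : ZMod 2, ∑ c : ZMod 2, ∑ e : ZMod 2, zsgn K (c * a + b * a + c * e) •
    TensorProduct.map₂
      (TensorProduct.map₂
        ((LinearMap.mul K (⨁ k, 𝒜 k)).compl₂ (parity 𝒜 a))
        ((shuffleMid K 𝒜 p q).compl₁₂ (wordParity K 𝒜 b) (wordParity K 𝒜 e)))
      (LinearMap.mul K (⨁ k, 𝒜 k) ∘ₗ parity 𝒜 c)

/-- The shuffle product on the bar construction. -/
def mul : Total K 𝒜 →ₗ[K] Total K 𝒜 →ₗ[K] Total K 𝒜 :=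
  DirectSum.toModule K ℕ _ fun p => LinearMap.flip <|
    DirectSum.toModule K ℕ _ fun q => LinearMap.flip <|
      (mulPart K 𝒜 p q).compr₂ (DirectSum.lof K ℕ (Part K 𝒜) (p + q))

end shuffle

variable (K)

/-- The elements of degree `k` of the bar construction; the degree of `f[g₁|⋯|g_r]h` is
`|f| + ∑ᵢ (|gᵢ| - 1) + |h|`. -/
def gr (k : ℤ) : Submodule K (Total K 𝒜) :=
  Submodule.span K {w | ∃ (r : ℕ) (a : ℤ) (b : Fin r → ℤ) (c : ℤ)
    (f : 𝒜 a) (g : ∀ i, 𝒜 (b i)) (h : 𝒜 c), a + ∑ i, (b i - 1) + c = k ∧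
    w = word K (DirectSum.lof K ℤ 𝒜 a f) (fun i => DirectSum.lof K ℤ 𝒜 (b i) (g i))
      (DirectSum.lof K ℤ 𝒜 c h)}

/-- The map `A ⊗ A → BA`, `f ⊗ h ↦ f[]h`. -/
def incl : (⨁ k, 𝒜 k) ⊗[K] (⨁ k, 𝒜 k) →ₗ[K] Total K 𝒜 :=
  DirectSum.lof K ℕ (Part K 𝒜) 0 ∘ₗ
    TensorProduct.map ((TensorProduct.mk K _ _).flip (PiTensorProduct.tprod K Fin.elim0))
      LinearMap.id

/-- The augmentation `BA → A`: `f[]h ↦ f ∧ h`, and `f[g₁|⋯|g_r]h ↦ 0` for `r ≥ 1`. -/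
def aug : Total K 𝒜 →ₗ[K] ⨁ k, 𝒜 k :=
  DirectSum.toModule K ℕ _ fun r =>
    match r with
    | 0 => LinearMap.mul' K (⨁ k, 𝒜 k) ∘ₗ
        TensorProduct.map ((TensorProduct.rid K _).toLinearMap ∘ₗ
          TensorProduct.map LinearMap.id (PiTensorProduct.isEmptyEquiv (Fin 0)).toLinearMap)
          LinearMap.id
    | _ + 1 => 0

end Bar

/-- The bar construction `BA` of a differential graded algebra `A = ⨁ₖ 𝒜 k`. -/
def barData {K : Type} [CommRing K] (𝒜 : ℤ → Type u) [∀ k, AddCommGroup (𝒜 k)]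
    [∀ k, Module K (𝒜 k)] [DirectSum.GRing 𝒜] [DirectSum.GAlgebra K 𝒜]
    (d : (⨁ k, 𝒜 k) →ₗ[K] ⨁ k, 𝒜 k) (hd : d 1 = 0) : CochainAlgData.{u} K where
  carrier := Bar.Total K 𝒜
  gr := Bar.gr K 𝒜
  d := Bar.diff 𝒜 d hd
  mul := Bar.mul K 𝒜
  one := Bar.word K 1 Fin.elim0 1

/-! ### The de Rham algebra and its bar construction as cochain algebras -/

lemma deRhamD_one (X : SSet.{u}) : deRhamD X 1 = 0 := by
  change deRhamD X (DirectSum.lof Theta ℤ (DegForms X) 0 GradedMonoid.GOne.one) = 0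
  rw [deRhamD, DirectSum.toModule_lof, LinearMap.comp_apply]
  refine (congrArg _ ?_).trans (map_zero _)
  refine Subtype.ext (Subtype.ext (funext fun n => funext fun x => ?_))
  change omegaD n (1 : Omega n) = 0
  rw [Algebra.TensorProduct.one_def, omegaD, LinearMap.sum_apply]
  refine Finset.sum_eq_zero fun i _ => ?_
  have : dpDeriv i (1 : DP n) = 0 := Subtype.ext (by
    change MvPolynomial.pderiv i.succ (1 : MvPolynomial (Fin (n + 1)) ℚ) = 0
    exact Derivation.map_one_eq_zero _)
  rw [TensorProduct.AlgebraTensorModule.map_tmul, this, zero_tmul]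

/-- The cochain algebra `A(X)` over `ℤ⟨ϑ⟩`. -/
def deRhamAlg (X : SSet.{u}) : CochainAlgData.{u} Theta where
  carrier := DeRham X
  gr k := LinearMap.range (DirectSum.lof Theta ℤ (DegForms X) k)
  d := deRhamD X
  mul := LinearMap.mul Theta (DeRham X)
  one := 1

/-- The bar construction `BA(X)` of the de Rham algebra of `X`. -/
def barAlg (X : SSet.{u}) : CochainAlgData.{u} Theta :=
  barData (DegForms X) (deRhamD X) (deRhamD_one X)

end SimplicialDeRham

end

open SimplicialDeRham

/-!
# Iterated integrals over simplicial path spaces and the bar construction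

Fibre integration over `Δ^r` is reduced to one operator `T` (`segHomotopy`) on the forms on a prism
`Y × Δ¹`, the integration over the segments from a point of the prism to its end `Y × {1}`. A
maximal chain of `[n] × [r + 1]` is a maximal chain of `[n] × [r]` together with the place of its
first step in the direction of the fibre; the first integration depends only on that place, and
summing over it yields `T` (`fibInt_succ`). By induction, `∫ ω₁ ⋯ ω_r` is the restriction of `T(⋯
T(T(η₁) η₂) ⋯ η_r)` to the end `X^{Δ¹} × {0}`, where `ηᵢ` is the pullback of `ωᵢ` along the
evaluation `X^{Δ¹} × Δ¹ → X` (`iteratedIntegral_eq`).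

Four properties of `T` carry the argument. It is a homotopy, `D T + T D = E - 1` with `E` the
restriction to `Y × {1}`, by Stokes' theorem for each segment (`segInt_stokes`). It is linear over
the forms on `Y`. It annihilates the forms without component along the segments, among them its own
values and the forms on `Y`. And it is a Rota–Baxter operator, `T η · T ξ = T(η T ξ) ± T(T η · ξ)`
(`segHomotopy_mul`). The last property follows from the others: the difference of the two sides and
its differential have no component along the segments, and the difference vanishes at `Y × {1}`, so
that the homotopy formula makes it zero (`eq_zero_of_vertical`).

The bar construction is treated through the module `A ⊗ T(A)` of unreduced words `f[g₁|⋯|g_r]`, of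
which its elements `x h` are images (`Bar.ofWords`). A linear map on words is determined by
recursion on the last letter, and so are the shuffle product (`Cdga.mul`) and the differential
(`Cdga.D`, which leaves out the face that multiplies the last letter with `h`). In this form
associativity, commutativity, the Leibniz rule and `D² = 0` are short inductions. The comparison
with the sums over shuffles and faces (`Bar.diff_ofWords`, `Bar.mul_ofWords`) transfers them to the
bar construction, which is therefore a commutative cochain algebra (`Bar.isCommCochainAlg_barData`).

With signs, the iterated integral of a word satisfies `int (x[a]) = T(ε(int x) · ev a)`. The
recursion for the shuffle product and the Rota–Baxter identity are the same formula, whence `int` is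
multiplicative (`PathIntegration.int_mul`); the homotopy formula shows that it is compatible with
the differentials, up to a boundary term at the end of the path that accounts for the last face
(`PathIntegration.D_int`, `formsInt_lastFace`); and words with a letter `1` have integral zero, as
`T` annihilates the forms `T x` and the forms on `Y`. On constant paths the integrands are forms on
the base, and integrals over them vanish. The map is unique because the homogeneous words span the
bar construction.

The integration is carried out in the algebra of all families of forms on the simplices, in which
`A(X)` embeds by `toForms`.
-/

noncomputable section

namespace SimplicialDeRham

/-! ### Calculus of divided power polynomials in one variable -/

lemma antideriv_monomial {n : ℕ} (i : Fin (n + 1)) (m : Fin (n + 1) →₀ ℕ) (c : ℚ) :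
    antideriv i (MvPolynomial.monomial m c)
      = MvPolynomial.monomial (m + Finsupp.single i 1) (c / ((m i : ℚ) + 1)) := by
  have h1 : MvPolynomial.monomial m c
      = c • (MvPolynomial.basisMonomials (Fin (n + 1)) ℚ) m := by
    simp [MvPolynomial.smul_monomial]
  rw [h1, map_smul, antideriv, Module.Basis.constr_basis, MvPolynomial.smul_monomial,
    smul_eq_mul, mul_one_div]

lemma pderiv_antideriv {n : ℕ} (i : Fin (n + 1)) (p : MvPolynomial (Fin (n + 1)) ℚ) :
    MvPolynomial.pderiv i (antideriv i p) = p := by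
  induction p using MvPolynomial.induction_on' with
  | add p q hp hq => rw [map_add, map_add, hp, hq]
  | monomial m c =>
    rw [antideriv_monomial, MvPolynomial.pderiv_monomial, add_tsub_cancel_right]
    have : ((m i : ℚ) + 1) ≠ 0 := by positivity
    congr 1
    simp [this]

/-- The substitution `x_i ↦ 0` on rational polynomials. -/
def killVar {n : ℕ} (i : Fin (n + 1)) :
    MvPolynomial (Fin (n + 1)) ℚ →ₐ[ℚ] MvPolynomial (Fin (n + 1)) ℚ :=
  MvPolynomial.aeval fun j => xvar n (if j = i then n + 1 else j)

lemma xvar_val {n : ℕ} (j : Fin (n + 1)) : xvar n j = MvPolynomial.X j := by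
  rw [xvar, dif_pos j.2]

lemma xvar_of_lt {n k : ℕ} (h : n < k) : xvar n k = 0 := dif_neg (by omega)

lemma killVar_X {n : ℕ} (i j : Fin (n + 1)) :
    killVar i (MvPolynomial.X j) = if j = i then 0 else MvPolynomial.X j := by
  rw [killVar, MvPolynomial.aeval_X]
  split_ifs
  · exact xvar_of_lt (Nat.lt_succ_self n)
  · exact xvar_val j

lemma killVar_monomial {n : ℕ} (i : Fin (n + 1)) (m : Fin (n + 1) →₀ ℕ) (c : ℚ) :
    killVar i (MvPolynomial.monomial m c) = if m i = 0 then MvPolynomial.monomial m c else 0 := by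
  classical
  rw [MvPolynomial.monomial_eq, Finsupp.prod_fintype _ _ (by simp), map_mul, map_prod]
  simp only [map_pow, killVar_X, MvPolynomial.algHom_C]
  split_ifs with h
  · congr 1
    refine Finset.prod_congr rfl fun j _ => ?_
    split_ifs with hj
    · subst hj; simp [h]
    · rfl
  · rw [Finset.prod_eq_zero (Finset.mem_univ i), mul_zero]
    simp [h]

lemma killVar_antideriv {n : ℕ} (i : Fin (n + 1)) (p : MvPolynomial (Fin (n + 1)) ℚ) :
    killVar i (antideriv i p) = 0 := by
  induction p using MvPolynomial.induction_on' with
  | add p q hp hq => rw [map_add, map_add, hp, hq, add_zero]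
  | monomial m c => rw [antideriv_monomial, killVar_monomial, if_neg (by simp)]

lemma antideriv_pderiv {n : ℕ} (i : Fin (n + 1)) (p : MvPolynomial (Fin (n + 1)) ℚ) :
    antideriv i (MvPolynomial.pderiv i p) = p - killVar i p := by
  induction p using MvPolynomial.induction_on' with
  | add p q hp hq => rw [map_add, map_add, hp, hq, map_add]; abel
  | monomial m c =>
    rw [MvPolynomial.pderiv_monomial, antideriv_monomial, killVar_monomial]
    split_ifs with h
    · simp [h]
    · have h1 : m - Finsupp.single i 1 + Finsupp.single i 1 = m := by
        ext j
        by_cases hj : i = j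
        · subst hj; simp; omega
        · simp [hj]
      have h2 : (((m - Finsupp.single i 1 : Fin (n + 1) →₀ ℕ) i : ℕ) : ℚ) + 1 = m i := by
        have : (m - Finsupp.single i 1 : Fin (n + 1) →₀ ℕ) i + 1 = m i := by simp; omega
        exact_mod_cast this
      have h3 : (m i : ℚ) ≠ 0 := by exact_mod_cast h
      rw [h1, h2, sub_zero, mul_div_cancel_right₀ _ h3]

/-- The antiderivative in the variable `x_i` on divided power polynomials. -/
def dpAnti {n : ℕ} (i : Fin (n + 1)) : DP n →ₗ[ℤ] DP n := AddMonoidHom.toIntLinearMap {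
  toFun p := ⟨antideriv i p.1, antideriv_mem i p.2⟩
  map_zero' := Subtype.ext (by simp)
  map_add' p q := Subtype.ext (by simp) }

/-- The substitution `x_i ↦ 0` on divided power polynomials. -/
def dpKill {n : ℕ} (i : Fin (n + 1)) : DP n →+* DP n :=
  dpSubst n fun j => if j = i then n + 1 else j

lemma dpDeriv_dpAnti {n : ℕ} (k : Fin n) (p : DP n) : dpDeriv k (dpAnti k.succ p) = p :=
  Subtype.ext (pderiv_antideriv _ _)

lemma dpAnti_dpDeriv {n : ℕ} (k : Fin n) (p : DP n) :
    dpAnti k.succ (dpDeriv k p) = p - dpKill k.succ p :=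
  Subtype.ext (antideriv_pderiv _ _)

lemma dpKill_dpAnti {n : ℕ} (i : Fin (n + 1)) (p : DP n) : dpKill i (dpAnti i p) = 0 :=
  Subtype.ext (killVar_antideriv _ _)

/-- The antiderivative of `p` is the only function with derivative `p` that vanishes for
`x_{k + 1} = 0`. -/
lemma dpAnti_eq {n : ℕ} (k : Fin n) {p q : DP n} (h : dpDeriv k q = p)
    (h0 : dpKill k.succ q = 0) : dpAnti k.succ p = q := by
  rw [← h, dpAnti_dpDeriv, h0, sub_zero]

lemma dpDeriv_mul {n : ℕ} (k : Fin n) (p q : DP n) :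
    dpDeriv k (p * q) = dpDeriv k p * q + p * dpDeriv k q :=
  Subtype.ext (by
    change MvPolynomial.pderiv k.succ (p.1 * q.1) = MvPolynomial.pderiv k.succ p.1 * q.1
      + p.1 * MvPolynomial.pderiv k.succ q.1
    rw [Derivation.leibniz, smul_eq_mul, smul_eq_mul]; ring)

lemma dpDeriv_comm {n : ℕ} (j k : Fin n) (p : DP n) :
    dpDeriv j (dpDeriv k p) = dpDeriv k (dpDeriv j p) := by
  apply Subtype.ext
  change MvPolynomial.pderiv j.succ (MvPolynomial.pderiv k.succ p.1)
    = MvPolynomial.pderiv k.succ (MvPolynomial.pderiv j.succ p.1)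
  have : ⁅(MvPolynomial.pderiv j.succ : Derivation ℚ (MvPolynomial (Fin (n + 1)) ℚ) _),
      MvPolynomial.pderiv (R := ℚ) k.succ⁆ = 0 := by
    apply MvPolynomial.derivation_ext
    intro i
    rw [Derivation.commutator_apply]
    simp [MvPolynomial.pderiv_X, Pi.single_apply, apply_ite]
  have h := congrArg (fun D => D p.1) this
  simp only [Derivation.commutator_apply, Derivation.zero_apply] at h
  exact sub_eq_zero.1 h

lemma dpDeriv_subst {m n : ℕ} (g : Fin (n + 1) → ℕ) (hg : g 0 = 0) (j : Fin m) (p : DP n) :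
    dpDeriv j (dpSubst m g p)
      = ∑ i : Fin n, if g i.succ = (j : ℕ) + 1 then dpSubst m g (dpDeriv i p) else 0 := by
  apply Subtype.ext
  refine (pderiv_aeval g hg j p.1).trans ?_
  rw [AddSubmonoidClass.coe_finsetSum]
  refine Finset.sum_congr rfl fun i _ => ?_
  split_ifs <;> rfl

/-- Two compositions of substitutions agree when they agree on the variables. -/
lemma dpSubst_dpSubst_eq {n m k m' : ℕ} (g : Fin (n + 1) → ℕ) (h : Fin (m + 1) → ℕ)
    (g' : Fin (n + 1) → ℕ) (h' : Fin (m' + 1) → ℕ)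
    (H : ∀ i, MvPolynomial.aeval (R := ℚ) (fun j => xvar k (h j)) (xvar m (g i))
      = MvPolynomial.aeval (R := ℚ) (fun j => xvar k (h' j)) (xvar m' (g' i))) (p : DP n) :
    dpSubst k h (dpSubst m g p) = dpSubst k h' (dpSubst m' g' p) := by
  apply Subtype.ext
  change MvPolynomial.aeval (R := ℚ) (fun j => xvar k (h j))
      (MvPolynomial.aeval (R := ℚ) (fun j => xvar m (g j)) p.1)
    = MvPolynomial.aeval (R := ℚ) (fun j => xvar k (h' j))
      (MvPolynomial.aeval (R := ℚ) (fun j => xvar m' (g' j)) p.1)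
  rw [← AlgHom.comp_apply, ← AlgHom.comp_apply]
  congr 1
  apply MvPolynomial.algHom_ext
  intro i
  simpa using H i

lemma dpSubst_xvar {m k : ℕ} (h : Fin (m + 1) → ℕ) (a : ℕ) :
    MvPolynomial.aeval (R := ℚ) (fun j : Fin (m + 1) => xvar k (h j)) (xvar m a)
      = if ha : a < m + 1 then xvar k (h ⟨a, ha⟩) else 0 := by
  split_ifs with ha
  · rw [xvar, dif_pos ha, MvPolynomial.aeval_X]
  · rw [xvar_of_lt (by omega), map_zero]

/-- A factor that does not involve the variable can be taken out of the antiderivative. -/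
lemma dpAnti_mul {n : ℕ} (k : Fin n) (q p : DP n) (hq : dpDeriv k q = 0) :
    dpAnti k.succ (q * p) = q * dpAnti k.succ p := by
  refine dpAnti_eq k ?_ ?_
  · rw [dpDeriv_mul, hq, zero_mul, zero_add, dpDeriv_dpAnti]
  · rw [map_mul, dpKill_dpAnti, mul_zero]

lemma dpDeriv_dpKill {n : ℕ} (j k : Fin n) (h : j ≠ k) (p : DP n) :
    dpDeriv j (dpKill k.succ p) = dpKill k.succ (dpDeriv j p) := by
  rw [dpKill, dpDeriv_subst _ (by rw [if_neg (Fin.succ_ne_zero k).symm]; rfl),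
    Finset.sum_eq_single j]
  · rw [if_pos (by rw [if_neg (by simpa using h), Fin.val_succ])]
  · intro b _ hb
    refine if_neg ?_
    split_ifs
    · have := j.2; omega
    · rw [Fin.val_succ]
      exact fun h => hb (Fin.ext (by omega))
  · simp

lemma dpDeriv_dpAnti_of_ne {n : ℕ} (j k : Fin n) (h : j ≠ k) (p : DP n) :
    dpDeriv j (dpAnti k.succ p) = dpAnti k.succ (dpDeriv j p) := by
  refine (dpAnti_eq k ?_ ?_).symm
  · rw [dpDeriv_comm, dpDeriv_dpAnti]
  · rw [← dpDeriv_dpKill j k h, dpKill_dpAnti, map_zero]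

/-- Antiderivatives commute with a substitution under which `x_{i + 1}`, and no other variable,
goes to `x_{j + 1}`. -/
lemma dpAnti_subst {m n : ℕ} (g : Fin (n + 1) → ℕ) (hg : g 0 = 0) (i : Fin n) (j : Fin m)
    (hij : ∀ a, g a = (j : ℕ) + 1 ↔ a = i.succ) (p : DP n) :
    dpAnti j.succ (dpSubst m g p) = dpSubst m g (dpAnti i.succ p) := by
  refine dpAnti_eq j ?_ ?_
  · rw [dpDeriv_subst g hg, Finset.sum_eq_single i, if_pos ((hij _).2 rfl), dpDeriv_dpAnti]
    · intro b _ hb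
      exact if_neg fun h => hb (Fin.succ_injective _ ((hij _).1 h))
    · simp
  · have H : ((killVar j.succ).comp (MvPolynomial.aeval (R := ℚ) fun a => xvar m (g a)))
        = ((killVar j.succ).comp (MvPolynomial.aeval (R := ℚ) fun a => xvar m (g a))).comp
          (killVar i.succ) := by
      apply MvPolynomial.algHom_ext
      intro a
      rw [AlgHom.comp_apply, AlgHom.comp_apply, killVar_X]
      split_ifs with ha
      · rw [AlgHom.comp_apply, map_zero, MvPolynomial.aeval_X, (hij a).2 ha, ← Fin.val_succ,
          xvar_val, killVar_X, if_pos rfl, map_zero]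
      · rfl
    have : dpKill j.succ (dpSubst m g (dpAnti i.succ p))
        = dpKill j.succ (dpSubst m g (dpKill i.succ (dpAnti i.succ p))) :=
      Subtype.ext (DFunLike.congr_fun H _)
    rw [this, dpKill_dpAnti, map_zero, map_zero]

/-! ### Exterior algebras: sign involution and contractions -/

section exterior

variable {M N : Type*} [AddCommGroup M] [AddCommGroup N]

local notation "Λ" => ExteriorAlgebra ℤ

lemma ι_mul_eq (v : M) (a : Λ M) :
    ExteriorAlgebra.ι ℤ v * a = CliffordAlgebra.involute a * ExteriorAlgebra.ι ℤ v := by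
  induction a using ExteriorAlgebra.induction with
  | algebraMap r => rw [AlgHom.commutes, Algebra.commutes]
  | ι x =>
    rw [CliffordAlgebra.involute_ι, neg_mul, eq_neg_iff_add_eq_zero]
    exact ExteriorAlgebra.ι_add_mul_swap v x
  | mul a b ha hb => rw [← mul_assoc, ha, mul_assoc, hb, ← mul_assoc, map_mul]
  | add a b ha hb => rw [mul_add, ha, hb, map_add, add_mul]

lemma contract_mul (κ : Module.Dual ℤ M) (a b : Λ M) :
    CliffordAlgebra.contractLeft κ (a * b) = CliffordAlgebra.contractLeft κ a * b
      + CliffordAlgebra.involute a * CliffordAlgebra.contractLeft κ b := by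
  induction a using ExteriorAlgebra.induction generalizing b with
  | algebraMap r =>
    rw [CliffordAlgebra.contractLeft_algebraMap_mul, CliffordAlgebra.contractLeft_algebraMap,
      zero_mul, zero_add, AlgHom.commutes]
  | ι x =>
    rw [CliffordAlgebra.contractLeft_ι_mul, CliffordAlgebra.contractLeft_ι,
      CliffordAlgebra.involute_ι, neg_mul, Algebra.smul_def, sub_eq_add_neg]
  | mul a a' ha ha' =>
    rw [mul_assoc, ha, ha', ha, map_mul]
    simp only [add_mul, mul_add, mul_assoc, add_assoc]
  | add a a' ha ha' => rw [add_mul, map_add, ha, ha', map_add, map_add]; simp only [add_mul]; abel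

lemma contract_involute (κ : Module.Dual ℤ M) (a : Λ M) :
    CliffordAlgebra.contractLeft κ (CliffordAlgebra.involute a)
      = - CliffordAlgebra.involute (CliffordAlgebra.contractLeft κ a) := by
  induction a using ExteriorAlgebra.induction with
  | algebraMap r =>
    rw [AlgHom.commutes, CliffordAlgebra.contractLeft_algebraMap, map_zero, neg_zero]
  | ι x =>
    rw [CliffordAlgebra.involute_ι, map_neg, CliffordAlgebra.contractLeft_ι, AlgHom.commutes]
  | mul a b ha hb =>
    rw [map_mul, contract_mul, contract_mul, ha, hb, map_add, map_mul, map_mul]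
    simp only [neg_mul, mul_neg, neg_add]
  | add a b ha hb => rw [map_add, map_add, ha, hb, map_add, map_add, neg_add]

lemma map_involute (φ : M →ₗ[ℤ] N) (a : Λ M) :
    ExteriorAlgebra.map φ (CliffordAlgebra.involute a)
      = CliffordAlgebra.involute (ExteriorAlgebra.map φ a) := by
  induction a using ExteriorAlgebra.induction with
  | algebraMap r => rw [AlgHom.commutes, AlgHom.commutes, AlgHom.commutes]
  | ι x =>
    rw [CliffordAlgebra.involute_ι, map_neg, ExteriorAlgebra.map_apply_ι,
      CliffordAlgebra.involute_ι]
  | mul a b ha hb => rw [map_mul, map_mul, ha, hb, map_mul, map_mul]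
  | add a b ha hb => rw [map_add, map_add, ha, hb, map_add, map_add]

lemma contract_map (φ : M →ₗ[ℤ] N) (κ : Module.Dual ℤ N) (a : Λ M) :
    CliffordAlgebra.contractLeft κ (ExteriorAlgebra.map φ a)
      = ExteriorAlgebra.map φ (CliffordAlgebra.contractLeft (κ ∘ₗ φ) a) := by
  induction a using ExteriorAlgebra.induction with
  | algebraMap r =>
    rw [AlgHom.commutes, CliffordAlgebra.contractLeft_algebraMap,
      CliffordAlgebra.contractLeft_algebraMap, map_zero]
  | ι x =>
    rw [ExteriorAlgebra.map_apply_ι, CliffordAlgebra.contractLeft_ι,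
      CliffordAlgebra.contractLeft_ι, AlgHom.commutes]
    rfl
  | mul a b ha hb =>
    rw [map_mul, contract_mul, contract_mul, ha, hb, map_add, map_mul, map_mul, map_involute]
  | add a b ha hb => rw [map_add, map_add, ha, hb, map_add, map_add]

/-- The action on the exterior algebra of the map `u ↦ u + κ(u) w`. -/
lemma map_transvection (φ : M →ₗ[ℤ] M) (κ : Module.Dual ℤ M) (w : M)
    (h : ∀ u, φ u = u + κ u • w) (a : Λ M) :
    ExteriorAlgebra.map φ a
      = a + ExteriorAlgebra.ι ℤ w * CliffordAlgebra.contractLeft κ a := by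
  induction a using CliffordAlgebra.left_induction with
  | algebraMap r =>
    rw [AlgHom.commutes, CliffordAlgebra.contractLeft_algebraMap, mul_zero, add_zero]
  | add a b ha hb => rw [map_add, ha, hb, map_add, mul_add]; abel
  | ι_mul a u ha =>
    have h1 : ExteriorAlgebra.ι ℤ w * ExteriorAlgebra.ι ℤ w = 0 := ExteriorAlgebra.ι_sq_zero w
    have h2 : ExteriorAlgebra.ι ℤ u * ExteriorAlgebra.ι ℤ w
        = - (ExteriorAlgebra.ι ℤ w * ExteriorAlgebra.ι ℤ u) :=
      eq_neg_of_add_eq_zero_left (ExteriorAlgebra.ι_add_mul_swap u w)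
    have h3 : CliffordAlgebra.contractLeft κ (ExteriorAlgebra.ι ℤ u * a)
        = κ u • a - ExteriorAlgebra.ι ℤ u * CliffordAlgebra.contractLeft κ a :=
      CliffordAlgebra.contractLeft_ι_mul κ u a
    change ExteriorAlgebra.map φ (ExteriorAlgebra.ι ℤ u * a) = ExteriorAlgebra.ι ℤ u * a
      + ExteriorAlgebra.ι ℤ w * CliffordAlgebra.contractLeft κ (ExteriorAlgebra.ι ℤ u * a)
    rw [map_mul, ha, h3, ExteriorAlgebra.map_apply_ι, h u, map_add, map_smul]
    generalize (CliffordAlgebra.contractLeft κ a : Λ M) = b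
    generalize ExteriorAlgebra.ι ℤ w = W at *
    generalize ExteriorAlgebra.ι ℤ u = U at *
    rw [add_mul, mul_add, smul_mul_assoc, mul_add, ← mul_assoc W W, h1, zero_mul, add_zero, mul_sub,
      ← mul_assoc U W, h2, mul_smul_comm, neg_mul, mul_assoc]
    abel

end exterior

/-! ### Operators on the forms on a simplex -/

/-- The sign operator `ω ↦ (-1)^{|ω|} ω`. -/
def omegaEps (n : ℕ) : Omega n →ₐ[Theta] Omega n :=
  Algebra.TensorProduct.map (AlgHom.id Theta (DP n)) CliffordAlgebra.involute

lemma omegaEps_tmul {n : ℕ} (p : DP n) (a : ExteriorAlgebra ℤ (Fin n → ℤ)) :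
    omegaEps n (p ⊗ₜ a) = p ⊗ₜ CliffordAlgebra.involute a := rfl

@[simp]
lemma omegaEps_eps {n : ℕ} (ω : Omega n) : omegaEps n (omegaEps n ω) = ω := by
  induction ω using TensorProduct.induction_on with
  | zero => simp
  | add x y hx hy => rw [map_add, map_add, hx, hy]
  | tmul p a => rw [omegaEps_tmul, omegaEps_tmul, CliffordAlgebra.involute_involute]

lemma omegaD_tmul {n : ℕ} (p : DP n) (a : ExteriorAlgebra ℤ (Fin n → ℤ)) :
    omegaD n (p ⊗ₜ a) = ∑ i : Fin n, dpDeriv i p ⊗ₜ[ℤ]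
      (ExteriorAlgebra.ι ℤ (Pi.single i (1 : ℤ)) * a) := by
  simp [omegaD, LinearMap.sum_apply]

lemma omegaPull_tmul {m n : ℕ} (α : Fin (m + 1) → Fin (n + 1)) (p : DP n)
    (a : ExteriorAlgebra ℤ (Fin n → ℤ)) :
    omegaPull α (p ⊗ₜ a) = dpPull α p ⊗ₜ ExteriorAlgebra.map (pullDx α) a := rfl

lemma omegaPull_eps {m n : ℕ} (α : Fin (m + 1) → Fin (n + 1)) (ω : Omega n) :
    omegaPull α (omegaEps n ω) = omegaEps m (omegaPull α ω) := by
  induction ω using TensorProduct.induction_on with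
  | zero => simp
  | add x y hx hy => simp only [map_add, hx, hy]
  | tmul p a => rw [omegaEps_tmul, omegaPull_tmul, omegaPull_tmul, omegaEps_tmul, map_involute]

lemma omegaD_mul {n : ℕ} (x y : Omega n) :
    omegaD n (x * y) = omegaD n x * y + omegaEps n x * omegaD n y := by
  induction x using TensorProduct.induction_on with
  | zero => simp
  | add x x' hx hx' => simp only [add_mul, map_add, hx, hx']; abel
  | tmul p a =>
    induction y using TensorProduct.induction_on with
    | zero => simp
    | add y y' hy hy' => simp only [mul_add, map_add, hy, hy']; abel
    | tmul q b =>
      rw [Algebra.TensorProduct.tmul_mul_tmul, omegaD_tmul, omegaD_tmul, omegaD_tmul, omegaEps_tmul,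
        Finset.sum_mul, Finset.mul_sum, ← Finset.sum_add_distrib]
      refine Finset.sum_congr rfl fun i _ => ?_
      rw [Algebra.TensorProduct.tmul_mul_tmul, Algebra.TensorProduct.tmul_mul_tmul, dpDeriv_mul,
        add_tmul, mul_assoc, ← mul_assoc (CliffordAlgebra.involute a), ← ι_mul_eq, mul_assoc]

lemma omegaD_eps {n : ℕ} (x : Omega n) : omegaD n (omegaEps n x) = - omegaEps n (omegaD n x) := by
  induction x using TensorProduct.induction_on with
  | zero => simp
  | add x x' hx hx' => simp only [map_add, hx, hx', neg_add]
  | tmul p a =>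
    rw [omegaEps_tmul, omegaD_tmul, omegaD_tmul, map_sum, ← Finset.sum_neg_distrib]
    refine Finset.sum_congr rfl fun i _ => ?_
    rw [omegaEps_tmul, map_mul, CliffordAlgebra.involute_ι, neg_mul, tmul_neg, neg_neg]

lemma omegaD_omegaD {n : ℕ} (x : Omega n) : omegaD n (omegaD n x) = 0 := by
  induction x using TensorProduct.induction_on with
  | zero => simp
  | add x x' hx hx' => simp only [map_add, hx, hx', add_zero]
  | tmul p a =>
    rw [omegaD_tmul, map_sum]
    simp only [omegaD_tmul]
    -- the double sum is antisymmetric, and its diagonal vanishes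
    have key : ∀ i j : Fin n, dpDeriv j (dpDeriv i p) ⊗ₜ[ℤ]
        (ExteriorAlgebra.ι ℤ (Pi.single j (1 : ℤ))
          * (ExteriorAlgebra.ι ℤ (Pi.single i (1 : ℤ)) * a))
        = - (dpDeriv i (dpDeriv j p) ⊗ₜ[ℤ] (ExteriorAlgebra.ι ℤ (Pi.single i (1 : ℤ)) *
          (ExteriorAlgebra.ι ℤ (Pi.single j (1 : ℤ)) * a))) := by
      intro i j
      have h : ExteriorAlgebra.ι ℤ (Pi.single j (1 : ℤ) : Fin n → ℤ)
          * ExteriorAlgebra.ι ℤ (Pi.single i (1 : ℤ))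
          = - (ExteriorAlgebra.ι ℤ (Pi.single i (1 : ℤ))
              * ExteriorAlgebra.ι ℤ (Pi.single j (1 : ℤ))) :=
        eq_neg_of_add_eq_zero_left (ExteriorAlgebra.ι_add_mul_swap _ _)
      rw [dpDeriv_comm, ← tmul_neg, ← mul_assoc, ← mul_assoc, ← neg_mul, h]
    rw [← Finset.sum_product']
    refine Finset.sum_involution (fun x _ => (x.2, x.1)) (fun x _ => ?_) (fun x _ h hx => h ?_)
      (fun _ _ => Finset.mem_univ _) (fun _ _ => rfl)
    · rw [key x.1 x.2, neg_add_cancel]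
    · have : x.2 = x.1 := congrArg Prod.fst hx
      rw [this, ← mul_assoc, ExteriorAlgebra.ι_sq_zero, zero_mul, tmul_zero]

/-- The coordinate functional that takes the coefficient of `dx_k`. -/
def coDx (N k : ℕ) : (Fin N → ℤ) →ₗ[ℤ] ℤ :=
  ∑ i : Fin N, if (i : ℕ) + 1 = k then LinearMap.proj i else 0

lemma coDx_single {N k : ℕ} (i : Fin N) :
    coDx N k (Pi.single i 1) = if (i : ℕ) + 1 = k then 1 else 0 := by
  rw [coDx, LinearMap.sum_apply, Finset.sum_eq_single i]
  · split_ifs <;> simp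
  · intro b _ hb
    split_ifs <;> simp [hb]
  · simp

lemma coDx_succ {N : ℕ} (l : Fin N) : coDx N (l + 1) = LinearMap.proj l := by
  refine LinearMap.pi_ext' fun i => LinearMap.ext_ring ?_
  simp only [LinearMap.comp_apply, LinearMap.coe_single, coDx_single, LinearMap.proj_apply,
    Pi.single_apply]
  simp [Fin.ext_iff, eq_comm]

lemma omegaContract_tmul {N k : ℕ} (p : DP N) (a : ExteriorAlgebra ℤ (Fin N → ℤ)) :
    omegaContract k (p ⊗ₜ a) = p ⊗ₜ CliffordAlgebra.contractLeft (coDx N k) a := rfl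

lemma omegaContract_mul {N k : ℕ} (x y : Omega N) :
    omegaContract k (x * y) = omegaContract k x * y + omegaEps N x * omegaContract k y := by
  induction x using TensorProduct.induction_on with
  | zero => simp
  | add x x' hx hx' => simp only [add_mul, map_add, hx, hx']; abel
  | tmul p a =>
    induction y using TensorProduct.induction_on with
    | zero => simp
    | add y y' hy hy' => simp only [mul_add, map_add, hy, hy']; abel
    | tmul q b =>
      rw [Algebra.TensorProduct.tmul_mul_tmul, omegaContract_tmul, omegaContract_tmul,
        omegaContract_tmul, omegaEps_tmul, Algebra.TensorProduct.tmul_mul_tmul,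
        Algebra.TensorProduct.tmul_mul_tmul, contract_mul, tmul_add]

lemma omegaContract_eps {N k : ℕ} (x : Omega N) :
    omegaContract k (omegaEps N x) = - omegaEps N (omegaContract k x) := by
  induction x using TensorProduct.induction_on with
  | zero => simp
  | add x x' hx hx' => simp only [map_add, hx, hx', neg_add]
  | tmul p a =>
    rw [omegaEps_tmul, omegaContract_tmul, omegaContract_tmul, contract_involute, tmul_neg,
      omegaEps_tmul]

lemma omegaContract_self {N k : ℕ} (x : Omega N) : omegaContract k (omegaContract k x) = 0 := by
  induction x using TensorProduct.induction_on with
  | zero => simp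
  | add x x' hx hx' => simp only [map_add, hx, hx', add_zero]
  | tmul p a =>
    rw [omegaContract_tmul, omegaContract_tmul, CliffordAlgebra.contractLeft_contractLeft,
      tmul_zero]

lemma omegaContract_comm {N k l : ℕ} (x : Omega N) :
    omegaContract k (omegaContract l x) = - omegaContract l (omegaContract k x) := by
  induction x using TensorProduct.induction_on with
  | zero => simp
  | add x x' hx hx' => simp only [map_add, hx, hx', neg_add]
  | tmul p a =>
    rw [omegaContract_tmul, omegaContract_tmul, CliffordAlgebra.contractLeft_comm, tmul_neg]
    rfl

lemma pullDx_single {m n : ℕ} (α : Fin (m + 1) → Fin (n + 1)) (i : Fin n) :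
    pullDx α (Pi.single i 1) = dxVec m (pullIdx α ((i : ℕ) + 1)) := by
  rw [pullDx, ← Pi.basisFun_apply, Module.Basis.constr_basis]

lemma coDx_dxVec {m j k : ℕ} : coDx m j (dxVec m k) = if k = j ∧ 1 ≤ k ∧ k ≤ m then 1 else 0 := by
  rw [dxVec_eq_sum, map_sum]
  by_cases h : 1 ≤ k ∧ k ≤ m
  · rw [Finset.sum_eq_single (⟨k - 1, by omega⟩ : Fin m)]
    · rw [if_pos (by simp; omega), coDx_single]
      simp only [h, and_self, and_true]
      congr 1
      simp; omega
    · intro b _ hb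
      rw [if_neg, map_zero]
      intro h'
      exact hb (Fin.ext (by simp; omega))
    · simp
  · rw [if_neg (by tauto)]
    refine Finset.sum_eq_zero fun i _ => ?_
    rw [if_neg (by have := i.2; omega), map_zero]

/-- Contraction of a pulled back form: exactly the coordinates that go to `x_j` contribute. -/
lemma omegaContract_pull {m n : ℕ} (α : Fin (m + 1) → Fin (n + 1)) (j : ℕ) (hj : 1 ≤ j)
    (hjm : j ≤ m) (x : Omega n) :
    omegaContract j (omegaPull α x) = ∑ i : Fin n, if pullIdx α ((i : ℕ) + 1) = j then
      omegaPull α (omegaContract ((i : ℕ) + 1) x) else 0 := by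
  induction x using TensorProduct.induction_on with
  | zero => simp
  | add x x' hx hx' =>
    simp only [map_add, hx, hx', ← Finset.sum_add_distrib]
    refine Finset.sum_congr rfl fun i _ => ?_
    split_ifs <;> simp
  | tmul p a =>
    rw [omegaPull_tmul, omegaContract_tmul, contract_map]
    have : coDx m j ∘ₗ pullDx α
        = ∑ i : Fin n, if pullIdx α ((i : ℕ) + 1) = j then coDx n (i + 1) else 0 := by
      refine LinearMap.pi_ext' fun l => LinearMap.ext_ring ?_
      rw [LinearMap.comp_apply, LinearMap.comp_apply, LinearMap.coe_single, pullDx_single,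
        coDx_dxVec, LinearMap.comp_apply, LinearMap.sum_apply, Finset.sum_eq_single l]
      · rw [LinearMap.coe_single]
        split_ifs with h1 h2 h2
        · rw [coDx_single, if_pos rfl]
        · exact absurd h1.1 h2
        · exact absurd ⟨h2, by omega, by omega⟩ h1
        · rfl
      · intro b _ hb
        rw [LinearMap.coe_single]
        split_ifs
        · rw [coDx_single, if_neg]
          intro h
          exact hb (Fin.ext (by omega))
        · rfl
      · simp
    rw [this, map_sum, LinearMap.sum_apply, map_sum, tmul_sum]
    refine Finset.sum_congr rfl fun i _ => ?_
    split_ifs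
    · rfl
    · rw [map_zero, LinearMap.zero_apply, map_zero, tmul_zero]

/-! ### Functoriality of the pullback of forms -/

lemma firstIdx_eq {N : ℕ} {P : Fin (N + 1) → Prop} {k : ℕ} (hk : k ≤ N + 1)
    (h1 : ∀ h : k < N + 1, P ⟨k, h⟩) (h2 : ∀ j : Fin (N + 1), (j : ℕ) < k → ¬ P j) :
    firstIdx P = k := by
  apply le_antisymm
  · apply Nat.sInf_le
    rcases hk.eq_or_lt with h | h
    · exact Or.inl h
    · exact Or.inr ⟨h, h1 h⟩
  · refine le_csInf ⟨N + 1, Or.inl rfl⟩ ?_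
    rintro j (rfl | ⟨h, hP⟩)
    · exact hk
    · by_contra hlt
      exact h2 ⟨j, h⟩ (not_le.1 hlt) hP

lemma firstIdx_le {N : ℕ} (P : Fin (N + 1) → Prop) : firstIdx P ≤ N + 1 :=
  Nat.sInf_le (Or.inl rfl)

lemma firstIdx_le_of {N : ℕ} {P : Fin (N + 1) → Prop} (j : Fin (N + 1)) (h : P j) :
    firstIdx P ≤ j :=
  Nat.sInf_le (Or.inr ⟨j.2, h⟩)

lemma firstIdx_spec {N : ℕ} {P : Fin (N + 1) → Prop} (h : firstIdx P < N + 1) :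
    P ⟨firstIdx P, h⟩ := by
  have := Nat.sInf_mem (s := {j | j = N + 1 ∨ ∃ h : j < N + 1, P ⟨j, h⟩}) ⟨N + 1, Or.inl rfl⟩
  rcases this with h' | ⟨_, h'⟩
  · exact absurd h' h.ne
  · exact h'

lemma pullIdx_eq {m n : ℕ} (α : Fin (m + 1) → Fin (n + 1)) {i k : ℕ} (hk : k ≤ m + 1)
    (h : ∀ j : Fin (m + 1), (j : ℕ) < k ↔ (α j : ℕ) < i) : pullIdx α i = k :=
  firstIdx_eq hk (fun h' => not_lt.1 fun h'' => lt_irrefl _ ((h ⟨k, h'⟩).2 h''))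
    fun j hj => not_le.2 ((h j).1 hj)

lemma lt_pullIdx {m n : ℕ} {α : Fin (m + 1) → Fin (n + 1)} (hα : Monotone α) (i : ℕ)
    (j : Fin (m + 1)) : (j : ℕ) < pullIdx α i ↔ (α j : ℕ) < i := by
  constructor
  · intro h
    by_contra h'
    exact absurd (firstIdx_le_of (P := fun j => i ≤ (α j : ℕ)) j (not_lt.1 h')) (not_le.2 h)
  · intro h
    by_contra h'
    have h1 : firstIdx (fun j => i ≤ (α j : ℕ)) < m + 1 := lt_of_le_of_lt (not_lt.1 h') j.2
    have h2 := firstIdx_spec h1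
    have h3 : α ⟨_, h1⟩ ≤ α j := hα (not_lt.1 h')
    have h4 : (α ⟨_, h1⟩ : ℕ) ≤ α j := h3
    omega

lemma pullIdx_le {m n : ℕ} (α : Fin (m + 1) → Fin (n + 1)) (i : ℕ) : pullIdx α i ≤ m + 1 :=
  firstIdx_le _

lemma pullIdx_of_lt {m n : ℕ} (α : Fin (m + 1) → Fin (n + 1)) {i : ℕ} (h : n < i) :
    pullIdx α i = m + 1 :=
  pullIdx_eq α le_rfl fun j => by have := (α j).2; have := j.2; omega

lemma pullIdx_comp {l m n : ℕ} {α : Fin (m + 1) → Fin (n + 1)} {β : Fin (l + 1) → Fin (m + 1)}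
    (hα : Monotone α) (hβ : Monotone β) (i : ℕ) :
    pullIdx (α ∘ β) i = pullIdx β (pullIdx α i) :=
  pullIdx_eq _ (pullIdx_le _ _) fun j => by
    rw [lt_pullIdx hβ, lt_pullIdx hα]; rfl

lemma pullDx_dxVec {m n : ℕ} (α : Fin (m + 1) → Fin (n + 1)) (k : ℕ) :
    pullDx α (dxVec n k) = dxVec m (pullIdx α k) := by
  by_cases h : 1 ≤ k ∧ k ≤ n
  · obtain ⟨h1, h2⟩ := h
    have : dxVec n k = Pi.single (⟨k - 1, by omega⟩ : Fin n) 1 := by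
      ext i
      rw [dxVec, Pi.single_apply]
      congr 1
      simp only [Fin.ext_iff, eq_iff_iff]
      omega
    rw [this, pullDx_single]
    congr 2
    simp only
    omega
  · have h0 : dxVec n k = 0 := by
      ext i
      have := i.2
      exact if_neg (by omega)
    rw [h0, map_zero]
    ext i
    have hi := i.2
    refine (if_neg ?_).symm
    rcases Nat.eq_zero_or_pos k with rfl | hk
    · rw [pullIdx_zero]; omega
    · rw [pullIdx_of_lt α (by omega)]; omega

lemma dpPull_xvar {m n : ℕ} (α : Fin (m + 1) → Fin (n + 1)) (k : ℕ) :
    MvPolynomial.aeval (R := ℚ) (fun j : Fin (n + 1) => xvar m (pullIdx α j)) (xvar n k)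
      = xvar m (pullIdx α k) := by
  rw [dpSubst_xvar]
  split_ifs with h
  · rfl
  · rw [pullIdx_of_lt α (by omega), xvar_of_lt (by omega)]

lemma dpPull_dpPull {l m n : ℕ} {α : Fin (m + 1) → Fin (n + 1)} {β : Fin (l + 1) → Fin (m + 1)}
    (hα : Monotone α) (hβ : Monotone β) (p : DP n) :
    dpPull β (dpPull α p) = dpPull (α ∘ β) p := by
  apply Subtype.ext
  change MvPolynomial.aeval (R := ℚ) (fun j : Fin (m + 1) => xvar l (pullIdx β j))
      (MvPolynomial.aeval (R := ℚ) (fun j : Fin (n + 1) => xvar m (pullIdx α j)) p.1)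
    = MvPolynomial.aeval (R := ℚ) (fun j : Fin (n + 1) => xvar l (pullIdx (α ∘ β) j)) p.1
  rw [← AlgHom.comp_apply]
  congr 1
  apply MvPolynomial.algHom_ext
  intro i
  rw [AlgHom.comp_apply, MvPolynomial.aeval_X, MvPolynomial.aeval_X, dpPull_xvar,
    pullIdx_comp hα hβ]

lemma pullDx_comp {l m n : ℕ} {α : Fin (m + 1) → Fin (n + 1)} {β : Fin (l + 1) → Fin (m + 1)}
    (hα : Monotone α) (hβ : Monotone β) : pullDx β ∘ₗ pullDx α = pullDx (α ∘ β) := by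
  refine LinearMap.pi_ext' fun i => LinearMap.ext_ring ?_
  rw [LinearMap.comp_apply, LinearMap.comp_apply, LinearMap.comp_apply, LinearMap.coe_single,
    pullDx_single, pullDx_single, pullDx_dxVec, pullIdx_comp hα hβ]

lemma omegaPull_omegaPull {l m n : ℕ} {α : Fin (m + 1) → Fin (n + 1)}
    {β : Fin (l + 1) → Fin (m + 1)} (hα : Monotone α) (hβ : Monotone β) (x : Omega n) :
    omegaPull β (omegaPull α x) = omegaPull (α ∘ β) x := by
  induction x using TensorProduct.induction_on with
  | zero => simp
  | add x y hx hy => simp only [map_add, hx, hy]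
  | tmul p a =>
    rw [omegaPull_tmul, omegaPull_tmul, omegaPull_tmul, dpPull_dpPull hα hβ, ← pullDx_comp hα hβ,
      ← ExteriorAlgebra.map_comp_map]
    rfl

lemma pullIdx_id {n : ℕ} {i : ℕ} (hi : i ≤ n + 1) :
    pullIdx (id : Fin (n + 1) → Fin (n + 1)) i = i :=
  pullIdx_eq _ hi fun _ => Iff.rfl

lemma omegaPull_id {n : ℕ} (x : Omega n) : omegaPull (id : Fin (n + 1) → Fin (n + 1)) x = x := by
  induction x using TensorProduct.induction_on with
  | zero => simp
  | add x y hx hy => simp only [map_add, hx, hy]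
  | tmul p a =>
    have h1 : pullDx (id : Fin (n + 1) → Fin (n + 1)) = LinearMap.id := by
      refine LinearMap.pi_ext' fun i => LinearMap.ext_ring ?_
      rw [LinearMap.comp_apply, LinearMap.coe_single, pullDx_single, pullIdx_id (by omega)]
      ext j
      simp [dxVec, Pi.single_apply, Fin.ext_iff]
    have h2 : dpPull (id : Fin (n + 1) → Fin (n + 1)) p = p := by
      apply Subtype.ext
      change MvPolynomial.aeval (R := ℚ) (fun j : Fin (n + 1) => xvar n (pullIdx id j)) p.1 = p.1
      have : (fun j : Fin (n + 1) => xvar n (pullIdx (id : Fin (n + 1) → Fin (n + 1)) j))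
          = MvPolynomial.X := by
        funext j
        rw [pullIdx_id (by omega), xvar_val]
      rw [this, MvPolynomial.aeval_X_left_apply]
    rw [omegaPull_tmul, h1, h2, ExteriorAlgebra.map_id]
    rfl

/-! ### Integration over the segments of a prism -/

lemma predAbove_val {n : ℕ} (l : Fin (n + 1)) (i : Fin (n + 2)) :
    (l.predAbove i : ℕ) = if (i : ℕ) ≤ l then (i : ℕ) else i - 1 := by
  rw [Fin.predAbove]
  split_ifs with h1 h2 h2
  · rw [Fin.lt_def, Fin.val_castSucc] at h1; omega
  · rfl
  · rfl
  · rw [Fin.lt_def, Fin.val_castSucc] at h1; omega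

lemma succAbove_val {n : ℕ} (k : Fin (n + 2)) (i : Fin (n + 1)) :
    (k.succAbove i : ℕ) = if (i : ℕ) < k then (i : ℕ) else i + 1 := by
  rw [Fin.succAbove]
  split_ifs with h1 h2 h2
  · rfl
  · rw [Fin.lt_def, Fin.val_castSucc] at h1; omega
  · rw [Fin.lt_def, Fin.val_castSucc] at h1; omega
  · rfl

lemma predAbove_castSucc_succAbove {n : ℕ} (l j : Fin (n + 1)) :
    l.predAbove (l.castSucc.succAbove j) = j := by
  apply Fin.ext
  rw [predAbove_val, succAbove_val, Fin.val_castSucc]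
  split_ifs <;> omega

lemma predAbove_succ_succAbove {n : ℕ} (l j : Fin (n + 1)) :
    l.predAbove (l.succ.succAbove j) = j := by
  apply Fin.ext
  rw [predAbove_val, succAbove_val, Fin.val_succ]
  split_ifs <;> omega

lemma pullIdx_predAbove {n : ℕ} (l : Fin (n + 1)) {i : ℕ} (hi : i ≤ n + 1) :
    pullIdx l.predAbove i = if i ≤ l then i else i + 1 := by
  refine pullIdx_eq _ (by split_ifs <;> omega) fun j => ?_
  rw [predAbove_val]
  split_ifs <;> omega

lemma pullIdx_succAbove {n : ℕ} (k : Fin (n + 2)) {i : ℕ} (hi : i ≤ n + 2) :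
    pullIdx k.succAbove i = if i ≤ k then i else i - 1 := by
  refine pullIdx_eq _ (by split_ifs <;> omega) fun j => ?_
  rw [succAbove_val]
  split_ifs <;> omega

lemma predAbove_mono {n : ℕ} (l : Fin (n + 1)) : Monotone l.predAbove :=
  Fin.predAbove_right_monotone l

lemma succAbove_mono {n : ℕ} (k : Fin (n + 2)) : Monotone k.succAbove :=
  (Fin.strictMono_succAbove k).monotone

/-- The antiderivative of the coefficients of a form in the variable `x_{k + 1}`. -/
def omegaAnti {N : ℕ} (k : Fin N) : Omega N →ₗ[ℤ] Omega N :=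
  LinearMap.rTensor _ (dpAnti k.succ)

lemma omegaAnti_tmul {N : ℕ} (k : Fin N) (p : DP N) (a : ExteriorAlgebra ℤ (Fin N → ℤ)) :
    omegaAnti k (p ⊗ₜ a) = dpAnti k.succ p ⊗ₜ a := rfl

lemma omegaContract_anti {N j : ℕ} (k : Fin N) (x : Omega N) :
    omegaContract j (omegaAnti k x) = omegaAnti k (omegaContract j x) := by
  induction x using TensorProduct.induction_on with
  | zero => simp
  | add x y hx hy => simp only [map_add, hx, hy]
  | tmul p a => rfl

lemma omegaAnti_eps {N : ℕ} (k : Fin N) (x : Omega N) :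
    omegaAnti k (omegaEps N x) = omegaEps N (omegaAnti k x) := by
  induction x using TensorProduct.induction_on with
  | zero => simp
  | add x y hx hy => simp only [map_add, hx, hy]
  | tmul p a => rfl

/-- The linear map `u ↦ u - u_k e_k`. -/
def dropDx {N : ℕ} (k : Fin N) : (Fin N → ℤ) →ₗ[ℤ] (Fin N → ℤ) :=
  LinearMap.id - (LinearMap.proj k).smulRight (Pi.single k 1)

/-- The substitution `x_{k + 1} ↦ 0`, `dx_{k + 1} ↦ 0` on forms. -/
def omegaKill {N : ℕ} (k : Fin N) : Omega N →ₗ[ℤ] Omega N :=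
  TensorProduct.map (dpKill k.succ).toAddMonoidHom.toIntLinearMap
    (ExteriorAlgebra.map (dropDx k)).toLinearMap

/-- The Poincaré lemma in the variable `x_{k + 1}`. -/
lemma omegaD_anti_contract {N : ℕ} (k : Fin N) (x : Omega N) :
    omegaD N (omegaAnti k (omegaContract (k + 1) x))
        + omegaAnti k (omegaContract (k + 1) (omegaD N x))
      = x - omegaKill k x := by
  induction x using TensorProduct.induction_on with
  | zero => simp
  | add x y hx hy =>
    simp only [map_add]
    rw [add_add_add_comm, hx, hy]; abel
  | tmul p a =>
    rw [omegaContract_tmul, omegaAnti_tmul, omegaD_tmul, omegaD_tmul, map_sum, map_sum,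
      ← Finset.sum_add_distrib]
    simp only [omegaContract_tmul, omegaAnti_tmul]
    have hc : ∀ i : Fin N, CliffordAlgebra.contractLeft (coDx N (k + 1))
        (ExteriorAlgebra.ι ℤ (Pi.single i (1 : ℤ)) * a) = (if i = k then a else 0)
          - ExteriorAlgebra.ι ℤ (Pi.single i (1 : ℤ))
            * CliffordAlgebra.contractLeft (coDx N (k + 1)) a := by
      intro i
      refine (CliffordAlgebra.contractLeft_ι_mul _ _ _).trans ?_
      rw [coDx_single]
      simp only [add_left_inj, ← Fin.ext_iff, ite_smul, one_smul, zero_smul]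
    simp only [hc]
    rw [Finset.sum_eq_single k]
    · rw [if_pos rfl, dpDeriv_dpAnti, dpAnti_dpDeriv]
      have h : omegaKill k (p ⊗ₜ[ℤ] a) = dpKill k.succ p ⊗ₜ[ℤ]
          (a - ExteriorAlgebra.ι ℤ (Pi.single k (1 : ℤ))
            * CliffordAlgebra.contractLeft (coDx N (k + 1)) a) := by
        change dpKill k.succ p ⊗ₜ[ℤ] ExteriorAlgebra.map (dropDx k) a = _
        rw [map_transvection (dropDx k) (coDx N (k + 1)) (- Pi.single k 1), map_neg, neg_mul,
          ← sub_eq_add_neg]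
        intro u
        rw [coDx_succ, smul_neg, ← sub_eq_add_neg]
        rfl
      rw [h]
      simp only [tmul_sub, sub_tmul]
      abel
    · intro i _ hi
      rw [if_neg hi, zero_sub, tmul_neg, dpDeriv_dpAnti_of_ne i k hi, add_neg_cancel]
    · simp

/-- The integral of a form on the `(n + 1)`-simplex over the segments between the two sections
`d_{l+1}` and `d_l` of the degeneracy `σ_l` : `x_{l+1}` runs from `x_{l+2}` to `x_l`. -/
def segInt {n : ℕ} (l : Fin (n + 1)) : Omega (n + 1) →ₗ[ℤ] Omega n :=
  ((omegaPull l.castSucc.succAbove).toLinearMap.restrictScalars ℤ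
    - (omegaPull l.succ.succAbove).toLinearMap.restrictScalars ℤ) ∘ₗ
    omegaAnti l ∘ₗ omegaContract (l + 1)

lemma segInt_apply {n : ℕ} (l : Fin (n + 1)) (x : Omega (n + 1)) :
    segInt l x = omegaPull l.castSucc.succAbove (omegaAnti l (omegaContract (l + 1) x))
      - omegaPull l.succ.succAbove (omegaAnti l (omegaContract (l + 1) x)) := rfl

/-- If `x` has no component along the segments, its integral over the segments is zero. -/
lemma segInt_of_contract {n : ℕ} (l : Fin (n + 1)) {x : Omega (n + 1)}
    (h : omegaContract (l + 1) x = 0) : segInt l x = 0 := by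
  rw [segInt_apply, h]; simp

lemma pullIdx_succAbove_eq {n : ℕ} (l : Fin (n + 1)) {i : ℕ} (hi : i ≤ n + 2) (hl : i ≠ l + 1) :
    pullIdx l.castSucc.succAbove i = pullIdx l.succ.succAbove i := by
  rw [pullIdx_succAbove _ hi, pullIdx_succAbove _ hi]
  simp only [Fin.val_castSucc, Fin.val_succ]
  split_ifs <;> omega

lemma dpPull_dpKill {n : ℕ} (l : Fin (n + 1)) (p : DP (n + 1)) :
    dpPull l.castSucc.succAbove (dpKill l.succ p) = dpPull l.succ.succAbove (dpKill l.succ p) := by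
  have H : (MvPolynomial.aeval (R := ℚ)
        fun j : Fin (n + 2) => xvar n (pullIdx l.castSucc.succAbove j)).comp (killVar l.succ)
      = (MvPolynomial.aeval (R := ℚ)
        fun j : Fin (n + 2) => xvar n (pullIdx l.succ.succAbove j)).comp (killVar l.succ) := by
    apply MvPolynomial.algHom_ext
    intro i
    rw [AlgHom.comp_apply, AlgHom.comp_apply, killVar_X]
    split_ifs with h
    · rw [map_zero, map_zero]
    · rw [MvPolynomial.aeval_X, MvPolynomial.aeval_X, pullIdx_succAbove_eq l (by omega)]
      intro h'
      exact h (Fin.ext (by simpa using h'))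
  exact Subtype.ext (DFunLike.congr_fun H p.1)

lemma pullDx_dropDx {n : ℕ} (l : Fin (n + 1)) :
    pullDx l.castSucc.succAbove ∘ₗ dropDx l = pullDx l.succ.succAbove ∘ₗ dropDx l := by
  refine LinearMap.pi_ext' fun i => LinearMap.ext_ring ?_
  rw [LinearMap.comp_apply, LinearMap.comp_apply, LinearMap.coe_single, LinearMap.comp_apply,
    LinearMap.comp_apply, LinearMap.coe_single]
  by_cases hi : i = l
  · subst hi
    have : dropDx i (Pi.single i 1) = 0 := by
      simp [dropDx]
    rw [this, map_zero, map_zero]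
  · have : dropDx l (Pi.single i 1) = Pi.single i 1 := by
      simp [dropDx, Ne.symm hi]
    rw [this, pullDx_single, pullDx_single, pullIdx_succAbove_eq l (by omega)]
    intro h
    exact hi (Fin.ext (by omega))

lemma omegaKill_tmul {N : ℕ} (k : Fin N) (p : DP N) (a : ExteriorAlgebra ℤ (Fin N → ℤ)) :
    omegaKill k (p ⊗ₜ a) = dpKill k.succ p ⊗ₜ ExteriorAlgebra.map (dropDx k) a := rfl

lemma pull_omegaKill {n : ℕ} (l : Fin (n + 1)) (x : Omega (n + 1)) :
    omegaPull l.castSucc.succAbove (omegaKill l x)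
      = omegaPull l.succ.succAbove (omegaKill l x) := by
  induction x using TensorProduct.induction_on with
  | zero => simp
  | add x y hx hy => simp only [map_add, hx, hy]
  | tmul p a =>
    rw [omegaKill_tmul, omegaPull_tmul, omegaPull_tmul, dpPull_dpKill]
    have h := congrArg (fun φ => ExteriorAlgebra.map φ a) (pullDx_dropDx l)
    simp only [← ExteriorAlgebra.map_comp_map, AlgHom.comp_apply] at h
    rw [h]

/-- Stokes' theorem for the integration over segments. -/
lemma segInt_stokes {n : ℕ} (l : Fin (n + 1)) (x : Omega (n + 1)) :
    omegaD n (segInt l x) + segInt l (omegaD (n + 1) x)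
      = omegaPull l.castSucc.succAbove x - omegaPull l.succ.succAbove x := by
  have h := omegaD_anti_contract l x
  rw [segInt_apply, segInt_apply, map_sub, omegaD_pull, omegaD_pull]
  generalize omegaD (n + 1) (omegaAnti l (omegaContract (l + 1) x)) = u at *
  generalize omegaAnti l (omegaContract (l + 1) (omegaD (n + 1) x)) = v at *
  have h1 := congrArg (omegaPull l.castSucc.succAbove) h
  have h2 := congrArg (omegaPull l.succ.succAbove) h
  rw [map_add, map_sub] at h1 h2
  rw [sub_add_sub_comm, h1, h2, pull_omegaKill]
  abel

lemma contract_pull_predAbove {n : ℕ} (l : Fin (n + 1)) (c : Omega n) :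
    omegaContract (l + 1) (omegaPull l.predAbove c) = 0 := by
  rw [omegaContract_pull _ _ (by omega) (by omega)]
  refine Finset.sum_eq_zero fun i _ => if_neg ?_
  rw [pullIdx_predAbove _ (by omega)]
  split_ifs <;> omega

lemma omegaAnti_mul_pull {n : ℕ} (l : Fin (n + 1)) (x : Omega (n + 1)) (c : Omega n) :
    omegaAnti l (x * omegaPull l.predAbove c) = omegaAnti l x * omegaPull l.predAbove c ∧
    omegaAnti l (omegaPull l.predAbove c * x) = omegaPull l.predAbove c * omegaAnti l x := by
  have h0 : ∀ q : DP n, dpDeriv l (dpPull l.predAbove q) = 0 := by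
    intro q
    rw [dpDeriv_pull]
    refine Finset.sum_eq_zero fun i _ => if_neg ?_
    rw [pullIdx_predAbove _ (by omega)]
    split_ifs <;> omega
  induction c using TensorProduct.induction_on with
  | zero => simp
  | add c c' hc hc' =>
    simp only [map_add, mul_add, add_mul, hc.1, hc.2, hc'.1, hc'.2, and_self]
  | tmul q b =>
    induction x using TensorProduct.induction_on with
    | zero => simp
    | add x x' hx hx' =>
      simp only [map_add, mul_add, add_mul, hx.1, hx.2, hx'.1, hx'.2, and_self]
    | tmul p a =>
      simp only [omegaPull_tmul, Algebra.TensorProduct.tmul_mul_tmul, omegaAnti_tmul]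
      rw [dpAnti_mul l _ _ (h0 q), mul_comm p, dpAnti_mul l _ _ (h0 q), mul_comm (dpAnti l.succ p)]
      exact ⟨rfl, rfl⟩

lemma pull_castSucc_predAbove {n : ℕ} (l : Fin (n + 1)) (c : Omega n) :
    omegaPull l.castSucc.succAbove (omegaPull l.predAbove c) = c := by
  rw [omegaPull_omegaPull (predAbove_mono _) (succAbove_mono _)]
  have : l.predAbove ∘ l.castSucc.succAbove = id := by
    funext j
    exact predAbove_castSucc_succAbove _ _
  rw [this, omegaPull_id]

lemma pull_succ_predAbove {n : ℕ} (l : Fin (n + 1)) (c : Omega n) :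
    omegaPull l.succ.succAbove (omegaPull l.predAbove c) = c := by
  rw [omegaPull_omegaPull (predAbove_mono _) (succAbove_mono _)]
  have : l.predAbove ∘ l.succ.succAbove = id := by
    funext j
    exact predAbove_succ_succAbove _ _
  rw [this, omegaPull_id]

lemma segInt_mul_pull {n : ℕ} (l : Fin (n + 1)) (x : Omega (n + 1)) (c : Omega n) :
    segInt l (x * omegaPull l.predAbove c) = segInt l x * c := by
  rw [segInt_apply, omegaContract_mul, contract_pull_predAbove, mul_zero, add_zero,
    (omegaAnti_mul_pull l _ c).1, map_mul, map_mul, pull_castSucc_predAbove, pull_succ_predAbove,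
    ← sub_mul]
  rfl

lemma segInt_pull_mul {n : ℕ} (l : Fin (n + 1)) (x : Omega (n + 1)) (c : Omega n) :
    segInt l (omegaPull l.predAbove c * x) = omegaEps n c * segInt l x := by
  rw [segInt_apply, omegaContract_mul, contract_pull_predAbove, zero_mul, zero_add,
    ← omegaPull_eps, (omegaAnti_mul_pull l _ _).2, map_mul, map_mul, pull_castSucc_predAbove,
    pull_succ_predAbove, ← mul_sub]
  rfl

lemma segInt_eps {n : ℕ} (l : Fin (n + 1)) (x : Omega (n + 1)) :
    segInt l (omegaEps (n + 1) x) = - omegaEps n (segInt l x) := by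
  rw [segInt_apply, omegaContract_eps, map_neg, omegaAnti_eps, map_neg, map_neg, omegaPull_eps,
    omegaPull_eps, segInt_apply, map_sub]
  abel

/-- The map `[m] → [n + 1]` given by `α` below `k` and by `α + 1` from `k` on. -/
def liftAt {m n : ℕ} (α : Fin (m + 1) → Fin (n + 1)) (k : ℕ) (i : Fin (m + 1)) : Fin (n + 2) :=
  if (i : ℕ) < k then (α i).castSucc else (α i).succ

/-- The map `[m + 1] → [n + 1]` of prisms over `α`: it goes from the `j`-th maximal simplex of
`[m] × [1]` to the `α j`-th maximal simplex of `[n] × [1]`. -/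
def prismMap {m n : ℕ} (α : Fin (m + 1) → Fin (n + 1)) (j : Fin (m + 1)) (i : Fin (m + 2)) :
    Fin (n + 2) :=
  if (i : ℕ) ≤ j then (α (j.predAbove i)).castSucc else (α (j.predAbove i)).succ

lemma prismMap_val {m n : ℕ} (α : Fin (m + 1) → Fin (n + 1)) (j : Fin (m + 1)) (i : Fin (m + 2)) :
    (prismMap α j i : ℕ)
      = if (i : ℕ) ≤ j then (α (j.predAbove i) : ℕ) else α (j.predAbove i) + 1 := by
  unfold prismMap
  split_ifs <;> simp

lemma prismMap_mono {m n : ℕ} {α : Fin (m + 1) → Fin (n + 1)} (hα : Monotone α) (j : Fin (m + 1)) :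
    Monotone (prismMap α j) := by
  intro a b hab
  have h1 : (α (j.predAbove a) : ℕ) ≤ α (j.predAbove b) := hα (predAbove_mono j hab)
  have h2 : (a : ℕ) ≤ b := hab
  rw [Fin.le_def, prismMap_val, prismMap_val]
  split_ifs <;> omega

lemma prismMap_succAbove_castSucc {m n : ℕ} (α : Fin (m + 1) → Fin (n + 1)) (j : Fin (m + 1)) :
    prismMap α j ∘ j.castSucc.succAbove = liftAt α j := by
  funext i
  have h : j.predAbove (j.castSucc.succAbove i) = i := predAbove_castSucc_succAbove _ _
  rw [Function.comp_apply, prismMap, h, liftAt]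
  congr 1
  rw [succAbove_val, eq_iff_iff, Fin.val_castSucc]
  split_ifs <;> omega

lemma prismMap_succAbove_succ {m n : ℕ} (α : Fin (m + 1) → Fin (n + 1)) (j : Fin (m + 1)) :
    prismMap α j ∘ j.succ.succAbove = liftAt α (j + 1) := by
  funext i
  have h : j.predAbove (j.succ.succAbove i) = i := predAbove_succ_succAbove _ _
  rw [Function.comp_apply, prismMap, h, liftAt]
  congr 1
  rw [succAbove_val, eq_iff_iff, Fin.val_succ]
  split_ifs <;> omega

lemma pullIdx_prismMap {m n : ℕ} {α : Fin (m + 1) → Fin (n + 1)} (hα : Monotone α)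
    (j : Fin (m + 1)) (a : ℕ) : pullIdx (prismMap α j) a = (j : ℕ) + 1 ↔ a = (α j : ℕ) + 1 := by
  have hj1 : (prismMap α j j.castSucc : ℕ) = α j := by
    rw [prismMap_val, if_pos (by simp), Fin.predAbove_castSucc_self]
  have hj2 : (prismMap α j j.succ : ℕ) = α j + 1 := by
    rw [prismMap_val, if_neg (by simp), Fin.predAbove_succ_self]
  have h1 := lt_pullIdx (prismMap_mono hα j) a j.castSucc
  have h2 := lt_pullIdx (prismMap_mono hα j) a j.succ
  rw [hj1] at h1
  rw [hj2] at h2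
  simp only [Fin.val_castSucc, Fin.val_succ] at h1 h2
  omega

/-- Telescoping over the fibre of `α` over `l`. -/
lemma sum_fiber_telescope {G : Type*} [AddCommGroup G] {m n : ℕ} {α : Fin (m + 1) → Fin (n + 1)}
    (hα : Monotone α) (l : Fin (n + 1)) (F : ℕ → G) :
    (∑ j : Fin (m + 1), if α j = l then F j - F (j + 1) else 0)
      = F (pullIdx α l) - F (pullIdx α (l + 1)) := by
  set a := pullIdx α l with ha
  set b := pullIdx α (l + 1) with hb
  have hab : a ≤ b := by
    by_contra h
    have hlt : b < m + 1 := by have := pullIdx_le α l; omega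
    have h1 := lt_pullIdx hα l ⟨b, hlt⟩
    have h2 := lt_pullIdx hα (l + 1) ⟨b, hlt⟩
    simp only at h1 h2
    omega
  have hbm : b ≤ m + 1 := pullIdx_le _ _
  have key : ∀ j : Fin (m + 1), (if α j = l then F j - F (j + 1) else 0)
      = F (max a (min j b)) - F (max a (min (j + 1 : ℕ) b)) := by
    intro j
    have h1 := lt_pullIdx hα l j
    have h2 := lt_pullIdx hα (l + 1) j
    rw [← ha] at h1
    rw [← hb] at h2
    split_ifs with h
    · have : (α j : ℕ) = l := congrArg Fin.val h
      congr 2 <;> omega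
    · have : (α j : ℕ) ≠ l := fun h' => h (Fin.ext h')
      rw [eq_comm, sub_eq_zero]
      congr 1
      omega
  rw [Finset.sum_congr rfl fun j _ => key j,
    Fin.sum_univ_eq_sum_range (fun j => F (max a (min j b)) - F (max a (min (j + 1) b))),
    Finset.sum_range_sub' (fun j => F (max a (min j b)))]
  congr 2 <;> omega

lemma omegaAnti_pull {m n : ℕ} {α : Fin (m + 1) → Fin (n + 1)} (i : Fin n) (j : Fin m)
    (hij : ∀ a, pullIdx α a = (j : ℕ) + 1 ↔ a = (i : ℕ) + 1) (x : Omega n) :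
    omegaAnti j (omegaPull α x) = omegaPull α (omegaAnti i x) := by
  induction x using TensorProduct.induction_on with
  | zero => simp
  | add x y hx hy => simp only [map_add, hx, hy]
  | tmul p a =>
    rw [omegaPull_tmul, omegaAnti_tmul, omegaAnti_tmul, omegaPull_tmul]
    congr 1
    refine dpAnti_subst _ (pullIdx_zero α) i j (fun a => ?_) p
    rw [hij, Fin.ext_iff, Fin.val_succ]

lemma omegaContract_pull_single {m n : ℕ} {α : Fin (m + 1) → Fin (n + 1)} (i : Fin n) (j : Fin m)
    (hij : ∀ a, pullIdx α a = (j : ℕ) + 1 ↔ a = (i : ℕ) + 1) (x : Omega n) :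
    omegaContract (j + 1) (omegaPull α x) = omegaPull α (omegaContract (i + 1) x) := by
  rw [omegaContract_pull _ _ (by omega) (by omega), Finset.sum_eq_single i]
  · rw [if_pos ((hij _).2 rfl)]
  · intro b _ hb
    refine if_neg fun h => hb (Fin.ext ?_)
    have := (hij _).1 h
    omega
  · simp

/-- Naturality of the integration over segments. -/
lemma pull_segInt {m n : ℕ} {α : Fin (m + 1) → Fin (n + 1)} (hα : Monotone α) (l : Fin (n + 1))
    (x : Omega (n + 1)) :
    omegaPull α (segInt l x)
      = ∑ j : Fin (m + 1), if α j = l then segInt j (omegaPull (prismMap α j) x) else 0 := by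
  set y := omegaAnti l (omegaContract (l + 1) x) with hy
  have h1 : ∀ j : Fin (m + 1), (if α j = l then segInt j (omegaPull (prismMap α j) x) else 0)
      = if α j = l then omegaPull (liftAt α j) y - omegaPull (liftAt α (j + 1)) y else 0 := by
    intro j
    split_ifs with h
    · subst h
      rw [segInt_apply, omegaContract_pull_single (α j) j (pullIdx_prismMap hα j),
        omegaAnti_pull (α j) j (pullIdx_prismMap hα j),
        omegaPull_omegaPull (prismMap_mono hα j) (succAbove_mono _),
        omegaPull_omegaPull (prismMap_mono hα j) (succAbove_mono _), prismMap_succAbove_castSucc,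
        prismMap_succAbove_succ]
    · rfl
  rw [Finset.sum_congr rfl fun j _ => h1 j,
    sum_fiber_telescope hα l fun k => omegaPull (liftAt α k) y, segInt_apply, ← hy, map_sub,
    omegaPull_omegaPull (succAbove_mono _) hα, omegaPull_omegaPull (succAbove_mono _) hα]
  congr 3
  · funext i
    have := lt_pullIdx hα l i
    apply Fin.ext
    rw [Function.comp_apply, succAbove_val, liftAt, apply_ite Fin.val]
    simp only [Fin.val_castSucc, Fin.val_succ]
    split_ifs <;> omega
  · funext i
    have := lt_pullIdx hα (l + 1) i
    apply Fin.ext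
    rw [Function.comp_apply, succAbove_val, liftAt, apply_ite Fin.val]
    simp only [Fin.val_castSucc, Fin.val_succ]
    split_ifs <;> omega

/-- An integral over segments with a variable end point has no component in the direction of
that end point. -/
lemma contract_segInt_pull {n : ℕ} (l : Fin (n + 1)) (x : Omega (n + 1)) :
    omegaContract (l + 1) (segInt l.castSucc (omegaPull l.succ.predAbove x)) = 0 := by
  have h2 : omegaContract ((l : ℕ) + 1 + 1) (omegaAnti l.castSucc
      (omegaContract ((l.castSucc : ℕ) + 1) (omegaPull l.succ.predAbove x))) = 0 := by
    have := contract_pull_predAbove l.succ x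
    rw [Fin.val_succ] at this
    rw [omegaContract_anti, omegaContract_comm, this]
    simp
  have h1 : omegaContract ((l : ℕ) + 1) (omegaAnti l.castSucc
      (omegaContract ((l.castSucc : ℕ) + 1) (omegaPull l.succ.predAbove x))) = 0 := by
    rw [omegaContract_anti, Fin.val_castSucc, omegaContract_self, map_zero]
  rw [segInt_apply, map_sub]
  generalize omegaAnti l.castSucc
      (omegaContract ((l.castSucc : ℕ) + 1) (omegaPull l.succ.predAbove x)) = y at h1 h2
  have h3 : ∀ k : Fin (n + 3), (k : ℕ) = l ∨ (k : ℕ) = l + 1 →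
      omegaContract ((l : ℕ) + 1) (omegaPull k.succAbove y) = 0 := by
    intro k hk
    rw [omegaContract_pull _ _ (by omega) (by omega)]
    refine Finset.sum_eq_zero fun i _ => ?_
    split_ifs with h
    · rw [pullIdx_succAbove _ (by omega)] at h
      have : (i : ℕ) = l ∨ (i : ℕ) = l + 1 := by split_ifs at h <;> omega
      rcases this with h' | h'
      · rw [h', h1, map_zero]
      · rw [h', h2, map_zero]
    · rfl
  rw [h3 _ (Or.inl (by simp)), h3 _ (Or.inr (by simp)), sub_zero]

/-! ### Operations on the forms on a simplicial set -/

/-- The action of an order-preserving map on the simplices of a simplicial set. -/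
def act {X : SSet.{u}} {m n : ℕ} (α : Fin (m + 1) →o Fin (n + 1)) (x : X _⦋n⦌) : X _⦋m⦌ :=
  X.map (SimplexCategory.mkHom α).op x

lemma act_act {X : SSet.{u}} {l m n : ℕ} (α : Fin (m + 1) →o Fin (n + 1))
    (β : Fin (l + 1) →o Fin (m + 1)) (x : X _⦋n⦌) : act β (act α x) = act (α.comp β) x := by
  unfold act
  rw [← Functor.map_comp_apply]
  rfl

lemma act_id {X : SSet.{u}} {n : ℕ} (x : X _⦋n⦌) : act OrderHom.id x = x := by
  unfold act
  have : (SimplexCategory.mkHom (OrderHom.id : Fin (n + 1) →o Fin (n + 1))) = 𝟙 ⦋n⦌ := rfl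
  rw [this]
  simp

lemma app_act {X Y : SSet.{u}} (f : X ⟶ Y) {m n : ℕ} (α : Fin (m + 1) →o Fin (n + 1))
    (x : X _⦋n⦌) : f.app _ (act α x) = act α (f.app _ x) :=
  NatTrans.naturality_apply _ _ _

lemma Forms.value_act {X : SSet.{u}} (ω : Forms X) {m n : ℕ} (α : Fin (m + 1) →o Fin (n + 1))
    (x : X _⦋n⦌) : ω.1 m (act α x) = omegaPull α (ω.1 n x) :=
  ω.2 m n (SimplexCategory.mkHom α) x

lemma Forms.ext {X : SSet.{u}} {ω ω' : Forms X} (h : ∀ n x, ω.1 n x = ω'.1 n x) : ω = ω' :=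
  Subtype.ext (funext fun n => funext fun x => h n x)

/-- The pullback of forms along a simplicial map. -/
def formsPull {X Y : SSet.{u}} (f : X ⟶ Y) : Forms Y →ₐ[Theta] Forms X where
  toFun ω := ⟨fun n x => ω.1 n (f.app _ x), fun m n α x => by
    change ω.1 m (f.app _ (X.map α.op x)) = omegaPull α.toOrderHom (ω.1 n (f.app _ x))
    rw [← ω.2 m n α (f.app _ x), NatTrans.naturality_apply]⟩
  map_one' := rfl
  map_mul' _ _ := rfl
  map_zero' := rfl
  map_add' _ _ := rfl
  commutes' _ := rfl

lemma formsPull_apply {X Y : SSet.{u}} (f : X ⟶ Y) (ω : Forms Y) (n : ℕ) (x : X _⦋n⦌) :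
    (formsPull f ω).1 n x = ω.1 n (f.app _ x) := rfl

lemma formsPull_comp {X Y Z : SSet.{u}} (f : X ⟶ Y) (g : Y ⟶ Z) (ω : Forms Z) :
    formsPull (f ≫ g) ω = formsPull f (formsPull g ω) := rfl

lemma formsPull_id {X : SSet.{u}} (ω : Forms X) : formsPull (𝟙 X) ω = ω := rfl

/-- The sign operator on forms. -/
def formsEps (X : SSet.{u}) : Forms X →ₐ[Theta] Forms X where
  toFun ω := ⟨fun n x => omegaEps n (ω.1 n x), fun m n α x => by
    change omegaEps m (ω.1 m (X.map α.op x)) = omegaPull α.toOrderHom (omegaEps n (ω.1 n x))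
    rw [ω.2 m n α x, omegaPull_eps]⟩
  map_one' := Forms.ext fun n _ => map_one (omegaEps n)
  map_mul' _ _ := Forms.ext fun n _ => map_mul (omegaEps n) _ _
  map_zero' := Forms.ext fun n _ => map_zero (omegaEps n)
  map_add' _ _ := Forms.ext fun n _ => map_add (omegaEps n) _ _
  commutes' c := Forms.ext fun n _ => (omegaEps n).commutes c

/-- The differential of forms. -/
def formsD (X : SSet.{u}) : Forms X →ₗ[Theta] Forms X where
  toFun ω := ⟨fun n x => omegaD n (ω.1 n x), fun m n α x => by
    change omegaD m (ω.1 m (X.map α.op x)) = omegaPull α.toOrderHom (omegaD n (ω.1 n x))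
    rw [ω.2 m n α x, omegaD_pull]⟩
  map_add' _ _ := Forms.ext fun n _ => map_add (omegaD n) _ _
  map_smul' c _ := Forms.ext fun n _ => map_smul (omegaD n) c _

lemma formsEps_apply {X : SSet.{u}} (ω : Forms X) (n : ℕ) (x : X _⦋n⦌) :
    (formsEps X ω).1 n x = omegaEps n (ω.1 n x) := rfl

lemma formsD_apply {X : SSet.{u}} (ω : Forms X) (n : ℕ) (x : X _⦋n⦌) :
    (formsD X ω).1 n x = omegaD n (ω.1 n x) := rfl

@[simp]
lemma formsEps_eps {X : SSet.{u}} (ω : Forms X) : formsEps X (formsEps X ω) = ω :=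
  Forms.ext fun _ _ => omegaEps_eps _

lemma formsD_eps {X : SSet.{u}} (ω : Forms X) :
    formsD X (formsEps X ω) = - formsEps X (formsD X ω) :=
  Forms.ext fun _ _ => omegaD_eps _

lemma formsD_mul {X : SSet.{u}} (ω η : Forms X) :
    formsD X (ω * η) = formsD X ω * η + formsEps X ω * formsD X η :=
  Forms.ext fun _ _ => omegaD_mul _ _

lemma formsD_formsD {X : SSet.{u}} (ω : Forms X) : formsD X (formsD X ω) = 0 :=
  Forms.ext fun _ _ => omegaD_omegaD _

lemma formsEps_pull {X Y : SSet.{u}} (f : X ⟶ Y) (ω : Forms Y) :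
    formsEps X (formsPull f ω) = formsPull f (formsEps Y ω) := rfl

lemma formsD_pull {X Y : SSet.{u}} (f : X ⟶ Y) (ω : Forms Y) :
    formsD X (formsPull f ω) = formsPull f (formsD Y ω) := rfl

/-! ### The homotopy operator on `Y × Δ¹` -/

/-- The degeneracy `[n + 1] → [n]` that takes the value `l` twice. -/
def degHom {n : ℕ} (l : Fin (n + 1)) : Fin (n + 2) →o Fin (n + 1) :=
  ⟨l.predAbove, predAbove_mono l⟩

/-- The map `[n] → [1]` that is `0` exactly below `k`. -/
def stepHom (n k : ℕ) : Fin (n + 1) →o Fin 2 :=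
  ⟨fun j => if (j : ℕ) < k then 0 else 1, fun a b h => by
    have : (a : ℕ) ≤ b := h
    dsimp only
    split_ifs
    · exact le_rfl
    · exact Fin.zero_le _
    · omega
    · exact le_rfl⟩

lemma stepHom_apply (n k : ℕ) (j : Fin (n + 1)) :
    stepHom n k j = if (j : ℕ) < k then 0 else 1 := rfl

lemma stepHom_eq_zero {n k : ℕ} {j : Fin (n + 1)} : stepHom n k j = 0 ↔ (j : ℕ) < k := by
  rw [stepHom_apply]
  split_ifs with h <;> simp [h]

/-- The simplex of `Δ¹` that is `0` exactly below `k`. -/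
def stepSimplex (n k : ℕ) : (Δ[1] : SSet.{u}) _⦋n⦌ := SSet.stdSimplex.objMk (stepHom n k)

lemma stepSimplex_apply (n k : ℕ) (j : Fin (n + 1)) :
    (stepSimplex n k : (Δ[1] : SSet.{u}) _⦋n⦌) j = stepHom n k j := rfl

lemma act_apply {m n k : ℕ} (α : Fin (m + 1) →o Fin (n + 1)) (δ : (Δ[k] : SSet.{u}) _⦋n⦌)
    (j : Fin (m + 1)) : act α δ j = δ (α j) := rfl

lemma exists_eq_stepSimplex {n : ℕ} (δ : (Δ[1] : SSet.{u}) _⦋n⦌) :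
    ∃ k ≤ n + 1, δ = stepSimplex n k := by
  refine ⟨pullIdx (n := 1) (fun j => δ j) 1, pullIdx_le _ _, ?_⟩
  refine SSet.stdSimplex.ext _ _ fun j => ?_
  have h := lt_pullIdx (n := 1) (α := fun j => δ j) (SSet.stdSimplex.monotone_apply δ) 1 j
  rw [stepSimplex_apply, stepHom_apply]
  split_ifs with h'
  · exact Fin.ext (by have := h.1 h'; simp at *; omega)
  · have h2 : ¬ ((δ j : Fin 2) : ℕ) < 1 := fun h'' => h' (h.2 h'')
    exact Fin.ext (by have := (δ j : Fin 2).2; simp; omega)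

lemma act_stepSimplex {m n k k' : ℕ} (α : Fin (m + 1) →o Fin (n + 1))
    (h : ∀ j, (α j : ℕ) < k ↔ (j : ℕ) < k') :
    act α (stepSimplex n k : (Δ[1] : SSet.{u}) _⦋n⦌) = stepSimplex m k' := by
  refine SSet.stdSimplex.ext _ _ fun j => ?_
  rw [act_apply, stepSimplex_apply, stepSimplex_apply, stepHom_apply, stepHom_apply]
  simp only [h]

/-- The simplex of `Y × Δ¹` with first component `y` and with the second component `0` exactly
below `k`. -/
def cylSimplex {Y : SSet.{u}} {n : ℕ} (y : Y _⦋n⦌) (k : ℕ) : (Y ⊗ Δ[1]) _⦋n⦌ := (y, stepSimplex n k)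

lemma exists_eq_cylSimplex {Y : SSet.{u}} {n : ℕ} (z : (Y ⊗ Δ[1]) _⦋n⦌) :
    ∃ k ≤ n + 1, z = cylSimplex z.1 k := by
  obtain ⟨k, hk, h⟩ := exists_eq_stepSimplex z.2
  exact ⟨k, hk, Prod.ext rfl h⟩

lemma act_cylSimplex {Y : SSet.{u}} {m n k k' : ℕ} (α : Fin (m + 1) →o Fin (n + 1)) (y : Y _⦋n⦌)
    (h : ∀ j, (α j : ℕ) < k ↔ (j : ℕ) < k') :
    act α (cylSimplex y k) = cylSimplex (act α y) k' :=
  Prod.ext rfl (act_stepSimplex α h)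

/-- The `l`-th maximal simplex of the prism `y × Δ¹`. -/
def prismSimplex {Y : SSet.{u}} {n : ℕ} (y : Y _⦋n⦌) (l : Fin (n + 1)) : (Y ⊗ Δ[1]) _⦋n + 1⦌ :=
  cylSimplex (act (degHom l) y) (l + 1)

lemma act_prismMap {Y : SSet.{u}} {m n : ℕ} (α : Fin (m + 1) →o Fin (n + 1)) (y : Y _⦋n⦌)
    (j : Fin (m + 1)) :
    act ⟨prismMap α j, prismMap_mono α.monotone j⟩ (prismSimplex y (α j))
      = prismSimplex (act α y) j := by
  rw [prismSimplex, prismSimplex, act_cylSimplex (k' := j + 1), act_act, act_act]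
  · congr 2
    ext i
    change (((α j).predAbove (prismMap α j i)) : ℕ) = α (j.predAbove i)
    have h1 := α.monotone (Fin.le_total j.castSucc i |>.elim (fun _ => le_refl j)
          fun _ => le_refl j)
    rw [predAbove_val, prismMap_val]
    have h2 : (i : ℕ) ≤ j → (j.predAbove i : Fin (m + 1)) ≤ j := fun h => by
      rw [Fin.le_def, predAbove_val, if_pos h]; exact h
    have h3 : ¬ (i : ℕ) ≤ j → j ≤ (j.predAbove i : Fin (m + 1)) := fun h => by
      rw [Fin.le_def, predAbove_val, if_neg h]; omega
    by_cases h : (i : ℕ) ≤ j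
    · have h4 : (α (j.predAbove i) : ℕ) ≤ α j := α.monotone (h2 h)
      simp only [h, if_true, h4]
    · have h4 : (α j : ℕ) ≤ α (j.predAbove i) := α.monotone (h3 h)
      simp only [h, if_false]
      split_ifs <;> omega
  · intro i
    change (prismMap α j i : ℕ) < _ ↔ _
    rw [prismMap_val]
    have h2 : (i : ℕ) ≤ j → (j.predAbove i : Fin (m + 1)) ≤ j := fun h => by
      rw [Fin.le_def, predAbove_val, if_pos h]; exact h
    have h3 : ¬ (i : ℕ) ≤ j → j ≤ (j.predAbove i : Fin (m + 1)) := fun h => by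
      rw [Fin.le_def, predAbove_val, if_neg h]; omega
    by_cases h : (i : ℕ) ≤ j
    · have h4 : (α (j.predAbove i) : ℕ) ≤ α j := α.monotone (h2 h)
      simp only [h, if_true]
      omega
    · have h4 : (α j : ℕ) ≤ α (j.predAbove i) := α.monotone (h3 h)
      simp only [h, if_false]
      omega

lemma segInt_smul {n : ℕ} (l : Fin (n + 1)) (c : Theta) (x : Omega (n + 1)) :
    segInt l (c • x) = c • segInt l x := by
  rw [Algebra.smul_def, ← (omegaPull l.predAbove).commutes, segInt_pull_mul, AlgHom.commutes,
    ← Algebra.smul_def]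

/-- The integration of forms over the segments from a point of `Y × Δ¹` to the end `Y × {1}`. -/
def segHomotopy (Y : SSet.{u}) : Forms (Y ⊗ Δ[1]) →ₗ[Theta] Forms (Y ⊗ Δ[1]) where
  toFun η := ⟨fun n z => ∑ l : Fin (n + 1), if z.2 l = 0 then
      segInt l (η.1 (n + 1) (prismSimplex z.1 l)) else 0, fun m n α z => by
    rw [map_sum]
    have h1 : ∀ l : Fin (n + 1), omegaPull α.toOrderHom (if z.2 l = 0 then
        segInt l (η.1 (n + 1) (prismSimplex z.1 l)) else 0)
        = ∑ j : Fin (m + 1), if z.2 l = 0 then (if α.toOrderHom j = l then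
          segInt j (η.1 (m + 1) (prismSimplex (act α.toOrderHom z.1) j)) else 0) else 0 := by
      intro l
      split_ifs
      · rw [pull_segInt α.toOrderHom.monotone]
        refine Finset.sum_congr rfl fun j _ => ?_
        split_ifs with h
        · rw [← act_prismMap, Forms.value_act, h]
          rfl
        · rfl
      · simp
    rw [Finset.sum_congr rfl fun l _ => h1 l, Finset.sum_comm]
    refine Finset.sum_congr rfl fun j _ => ?_
    rw [Finset.sum_eq_single (α.toOrderHom j)]
    · rw [if_pos rfl]; rfl
    · intro l _ hl
      rw [if_neg (Ne.symm hl), ite_self]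
    · simp⟩
  map_add' η ξ := Forms.ext fun n z => by
    change (∑ l : Fin (n + 1), if z.2 l = 0 then segInt l (η.1 (n + 1) (prismSimplex z.1 l)
      + ξ.1 (n + 1) (prismSimplex z.1 l)) else 0) = (∑ l : Fin (n + 1), if z.2 l = 0 then
        segInt l (η.1 (n + 1) (prismSimplex z.1 l)) else 0) + ∑ l : Fin (n + 1), if z.2 l = 0 then
          segInt l (ξ.1 (n + 1) (prismSimplex z.1 l)) else 0
    rw [← Finset.sum_add_distrib]
    refine Finset.sum_congr rfl fun l _ => ?_
    split_ifs <;> simp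
  map_smul' c η := Forms.ext fun n z => by
    change (∑ l : Fin (n + 1), if z.2 l = 0 then segInt l (c • η.1 (n + 1) (prismSimplex z.1 l))
      else 0) = c • ∑ l : Fin (n + 1), if z.2 l = 0 then
        segInt l (η.1 (n + 1) (prismSimplex z.1 l)) else 0
    rw [Finset.smul_sum]
    refine Finset.sum_congr rfl fun l _ => ?_
    split_ifs
    · rw [segInt_smul]
    · rw [smul_zero]

lemma segHomotopy_apply {Y : SSet.{u}} (η : Forms (Y ⊗ Δ[1])) (n : ℕ) (z : (Y ⊗ Δ[1]) _⦋n⦌) :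
    (segHomotopy Y η).1 n z = ∑ l : Fin (n + 1), if z.2 l = 0 then
      segInt l (η.1 (n + 1) (prismSimplex z.1 l)) else 0 := rfl

lemma segHomotopy_cylSimplex {Y : SSet.{u}} (η : Forms (Y ⊗ Δ[1])) {n : ℕ} (y : Y _⦋n⦌) (k : ℕ) :
    (segHomotopy Y η).1 n (cylSimplex y k) = ∑ l : Fin (n + 1), if (l : ℕ) < k then
      segInt l (η.1 (n + 1) (prismSimplex y l)) else 0 :=
  (segHomotopy_apply η n _).trans
    (Finset.sum_congr rfl fun l _ => if_congr (stepHom_eq_zero (j := l)) rfl rfl)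

/-- The projection `Y × Δ¹ → Y`. -/
def cylFst (Y : SSet.{u}) : Y ⊗ Δ[1] ⟶ Y := SemiCartesianMonoidalCategory.fst Y (Δ[1] : SSet.{u})

/-- The inclusion `Y → Y × Δ¹` of the end `Y × {ε}`. -/
def cylEnd (Y : SSet.{u}) (ε : Fin 2) : Y ⟶ Y ⊗ Δ[1] :=
  CartesianMonoidalCategory.lift (𝟙 Y) (SSet.const (SSet.stdSimplex.obj₀Equiv.symm ε))

lemma cylEnd_one_app {Y : SSet.{u}} {n : ℕ} (y : Y _⦋n⦌) :
    (cylEnd Y 1).app _ y = cylSimplex y 0 := by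
  refine Prod.ext rfl (SSet.stdSimplex.ext _ _ fun j => ?_)
  rfl

lemma cylEnd_zero_app {Y : SSet.{u}} {n : ℕ} (y : Y _⦋n⦌) :
    (cylEnd Y 0).app _ y = cylSimplex y (n + 1) := by
  refine Prod.ext rfl (SSet.stdSimplex.ext _ _ fun j => ?_)
  exact (if_pos j.2 : stepHom n (n + 1) j = 0).symm

/-- The value at the end `1` of the segments, as a form on `Y × Δ¹`. -/
def endOne (Y : SSet.{u}) : Forms (Y ⊗ Δ[1]) →ₐ[Theta] Forms (Y ⊗ Δ[1]) :=
  (formsPull (cylFst Y)).comp (formsPull (cylEnd Y 1))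

lemma endOne_apply {Y : SSet.{u}} (η : Forms (Y ⊗ Δ[1])) (n : ℕ) (z : (Y ⊗ Δ[1]) _⦋n⦌) :
    (endOne Y η).1 n z = η.1 n (cylSimplex z.1 0) := by
  rw [← cylEnd_one_app]; rfl

/-- The operator `segHomotopy` is a homotopy between the identity and the restriction to the end
`Y × {1}`. -/
lemma segHomotopy_homotopy {Y : SSet.{u}} (η : Forms (Y ⊗ Δ[1])) :
    formsD _ (segHomotopy Y η) + segHomotopy Y (formsD _ η) = endOne Y η - η := by
  refine Forms.ext fun n z => ?_
  obtain ⟨k, hk, hz⟩ := exists_eq_cylSimplex z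
  change omegaD n ((segHomotopy Y η).1 n z) + (segHomotopy Y (formsD _ η)).1 n z
    = (endOne Y η).1 n z - η.1 n z
  rw [endOne_apply]
  generalize z.1 = y at hz ⊢
  subst hz
  rw [segHomotopy_cylSimplex, segHomotopy_cylSimplex, map_sum, ← Finset.sum_add_distrib]
  set F : ℕ → Omega n := fun j => η.1 n (cylSimplex y j) with hF
  have key : ∀ l : Fin (n + 1),
      (omegaD n (if (l : ℕ) < k then segInt l (η.1 (n + 1) (prismSimplex y l)) else 0)
      + if (l : ℕ) < k then segInt l ((formsD _ η).1 (n + 1) (prismSimplex y l)) else 0)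
      = F (min l k) - F (min (l + 1 : ℕ) k) := by
    intro l
    split_ifs with h
    · rw [formsD_apply, segInt_stokes]
      have h1 := Forms.value_act η ⟨l.castSucc.succAbove, succAbove_mono _⟩ (prismSimplex y l)
      have h2 := Forms.value_act η ⟨l.succ.succAbove, succAbove_mono _⟩ (prismSimplex y l)
      rw [OrderHom.coe_mk] at h1 h2
      have e1 : (degHom l).comp ⟨l.castSucc.succAbove, succAbove_mono _⟩ = OrderHom.id :=
        OrderHom.ext _ _ (funext fun j => predAbove_castSucc_succAbove l j)
      have e2 : (degHom l).comp ⟨l.succ.succAbove, succAbove_mono _⟩ = OrderHom.id :=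
        OrderHom.ext _ _ (funext fun j => predAbove_succ_succAbove l j)
      rw [← h1, ← h2, prismSimplex, act_cylSimplex (k' := l), act_cylSimplex (k' := l + 1), act_act,
        act_act, e1, e2, act_id, hF, min_eq_left h.le, min_eq_left (Nat.succ_le_of_lt h)]
      · intro j
        rw [OrderHom.coe_mk, succAbove_val, Fin.val_succ]
        split_ifs <;> omega
      · intro j
        rw [OrderHom.coe_mk, succAbove_val, Fin.val_castSucc]
        split_ifs <;> omega
    · rw [map_zero, add_zero, eq_comm, sub_eq_zero]
      congr 1
      omega
  rw [Finset.sum_congr rfl fun l _ => key l,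
    Fin.sum_univ_eq_sum_range (fun l => F (min l k) - F (min (l + 1) k)),
    Finset.sum_range_sub' (fun l => F (min l k)), Nat.zero_min, min_eq_right hk]

/-- A form without component along the segments. -/
def Vertical {Y : SSet.{u}} (η : Forms (Y ⊗ Δ[1])) : Prop :=
  ∀ (n : ℕ) (y : Y _⦋n⦌) (l : Fin (n + 1)),
    omegaContract (l + 1) (η.1 (n + 1) (prismSimplex y l)) = 0

lemma Vertical.add {Y : SSet.{u}} {η ξ : Forms (Y ⊗ Δ[1])} (h : Vertical η) (h' : Vertical ξ) :
    Vertical (η + ξ) := fun n y l => by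
  change omegaContract (l + 1) (η.1 (n + 1) (prismSimplex y l) + ξ.1 (n + 1) (prismSimplex y l)) = 0
  rw [map_add, h, h', add_zero]

lemma Vertical.neg {Y : SSet.{u}} {η : Forms (Y ⊗ Δ[1])} (h : Vertical η) :
    Vertical (- η) := fun n y l => by
  change omegaContract (l + 1) (- η.1 (n + 1) (prismSimplex y l)) = 0
  rw [map_neg, h, neg_zero]

lemma Vertical.sub {Y : SSet.{u}} {η ξ : Forms (Y ⊗ Δ[1])} (h : Vertical η) (h' : Vertical ξ) :
    Vertical (η - ξ) := by
  rw [sub_eq_add_neg]; exact h.add h'.neg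

lemma Vertical.mul {Y : SSet.{u}} {η ξ : Forms (Y ⊗ Δ[1])} (h : Vertical η) (h' : Vertical ξ) :
    Vertical (η * ξ) := fun n y l => by
  change omegaContract (l + 1) (η.1 (n + 1) (prismSimplex y l) * ξ.1 (n + 1) (prismSimplex y l)) = 0
  rw [omegaContract_mul, h, h', mul_zero, zero_mul, add_zero]

lemma Vertical.segHomotopy_eq_zero {Y : SSet.{u}} {η : Forms (Y ⊗ Δ[1])} (h : Vertical η) :
    segHomotopy Y η = 0 := Forms.ext fun n z => by
  rw [segHomotopy_apply]
  refine Finset.sum_eq_zero fun l _ => ?_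
  rw [segInt_of_contract l (h n z.1 l), ite_self]

lemma vertical_pull {Y : SSet.{u}} (c : Forms Y) : Vertical (formsPull (cylFst Y) c) :=
  fun n y l => by
  have : (formsPull (cylFst Y) c).1 (n + 1) (prismSimplex y l)
      = omegaPull l.predAbove (c.1 n y) := Forms.value_act c (degHom l) y
  rw [this]
  exact contract_pull_predAbove l _

/-- The integral over the segments that start at a variable point does not contain the differential
of the parameter of that point. -/
lemma vertical_segHomotopy {Y : SSet.{u}} (η : Forms (Y ⊗ Δ[1])) : Vertical (segHomotopy Y η) := by
  intro n y l
  have h1 : (segHomotopy Y η).1 (n + 1) (prismSimplex y l)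
      = (segHomotopy Y η).1 (n + 1) (act (degHom l) (cylSimplex y l))
        + segInt l.castSucc (omegaPull l.succ.predAbove (η.1 (n + 1) (prismSimplex y l))) := by
    rw [act_cylSimplex (degHom l) y (k' := l), prismSimplex, segHomotopy_cylSimplex,
      segHomotopy_cylSimplex]
    · rw [← sub_eq_iff_eq_add', ← Finset.sum_sub_distrib, Finset.sum_eq_single l.castSucc]
      · rw [if_pos (by simp), if_neg (by simp), sub_zero]
        have h := Forms.value_act η (degHom l.succ) (prismSimplex y l)
        change _ = omegaPull l.succ.predAbove _ at h
        rw [prismSimplex] at h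
        rw [← h, prismSimplex, act_cylSimplex (k' := l + 1), act_act, act_act]
        · congr 2
          refine congrArg (fun β => η.1 _ (cylSimplex (act β y) _))
            (OrderHom.ext _ _ (funext fun j => Fin.ext ?_))
          change (l.predAbove (l.castSucc.predAbove j) : ℕ) = l.predAbove (l.succ.predAbove j)
          simp only [predAbove_val, Fin.val_castSucc, Fin.val_succ]
          split_ifs <;> omega
        · intro j
          change ((l.succ.predAbove j : Fin (n + 2)) : ℕ) < _ ↔ _
          rw [predAbove_val, Fin.val_succ]
          split_ifs <;> omega
      · intro j _ hj
        have : (j : ℕ) ≠ l := fun h => hj (Fin.ext h)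
        by_cases h : (j : ℕ) < l
        · rw [if_pos h, if_pos (by omega), sub_self]
        · rw [if_neg h, if_neg (by omega), sub_zero]
      · simp
    · intro j
      change (l.predAbove j : ℕ) < _ ↔ _
      rw [predAbove_val]
      split_ifs <;> omega
  rw [h1, Forms.value_act, map_add, contract_segInt_pull, add_zero]
  exact contract_pull_predAbove l _

lemma endOne_segHomotopy {Y : SSet.{u}} (η : Forms (Y ⊗ Δ[1])) : endOne Y (segHomotopy Y η) = 0 :=
  Forms.ext fun n z => by
    rw [endOne_apply, segHomotopy_cylSimplex]
    exact Finset.sum_eq_zero fun l _ => if_neg (Nat.not_lt_zero _)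

/-- A form is zero if it vanishes at the end `1` and neither the form nor its differential has a
component along the segments. -/
lemma eq_zero_of_vertical {Y : SSet.{u}} {η : Forms (Y ⊗ Δ[1])} (h : Vertical η)
    (h' : Vertical (formsD _ η)) (h0 : endOne Y η = 0) : η = 0 := by
  have := segHomotopy_homotopy η
  rw [h.segHomotopy_eq_zero, h'.segHomotopy_eq_zero, h0, map_zero, zero_add, zero_sub] at this
  exact neg_eq_zero.1 this.symm

/-- The integration over segments is linear, up to the sign of an operator of degree `-1`, over the
forms on the base. -/
lemma segHomotopy_pull_mul {Y : SSet.{u}} (c : Forms Y) (η : Forms (Y ⊗ Δ[1])) :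
    segHomotopy Y (formsPull (cylFst Y) c * η)
      = formsEps _ (formsPull (cylFst Y) c) * segHomotopy Y η := Forms.ext fun n z => by
  change _ = omegaEps n (c.1 n z.1) * (segHomotopy Y η).1 n z
  rw [segHomotopy_apply, segHomotopy_apply, Finset.mul_sum]
  refine Finset.sum_congr rfl fun l _ => ?_
  split_ifs
  · rw [← segInt_pull_mul]
    have := Forms.value_act c (degHom l) z.1
    change _ = omegaPull l.predAbove _ at this
    rw [← this]
    rfl
  · rw [mul_zero]

lemma segHomotopy_mul_pull {Y : SSet.{u}} (c : Forms Y) (η : Forms (Y ⊗ Δ[1])) :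
    segHomotopy Y (η * formsPull (cylFst Y) c)
      = segHomotopy Y η * formsPull (cylFst Y) c := Forms.ext fun n z => by
  change _ = (segHomotopy Y η).1 n z * c.1 n z.1
  rw [segHomotopy_apply, segHomotopy_apply, Finset.sum_mul]
  refine Finset.sum_congr rfl fun l _ => ?_
  split_ifs
  · rw [← segInt_mul_pull]
    have := Forms.value_act c (degHom l) z.1
    change _ = omegaPull l.predAbove _ at this
    rw [← this]
    rfl
  · rw [zero_mul]

lemma segHomotopy_eps {Y : SSet.{u}} (η : Forms (Y ⊗ Δ[1])) :
    segHomotopy Y (formsEps _ η) = - formsEps _ (segHomotopy Y η) := Forms.ext fun n z => by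
  change _ = - omegaEps n ((segHomotopy Y η).1 n z)
  rw [segHomotopy_apply, segHomotopy_apply, map_sum, ← Finset.sum_neg_distrib]
  refine Finset.sum_congr rfl fun l _ => ?_
  split_ifs
  · rw [formsEps_apply, segInt_eps]
  · simp

lemma segHomotopy_natural {Y Z : SSet.{u}} (g : Z ⟶ Y) (η : Forms (Y ⊗ Δ[1])) :
    segHomotopy Z (formsPull (g ▷ Δ[1]) η) = formsPull (g ▷ Δ[1]) (segHomotopy Y η) :=
  Forms.ext fun n z => by
  rw [formsPull_apply, segHomotopy_apply, segHomotopy_apply]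
  refine Finset.sum_congr rfl fun l _ => ?_
  have : (g ▷ (Δ[1] : SSet.{u})).app _ (prismSimplex z.1 l) = prismSimplex (g.app _ z.1) l := by
    refine Prod.ext ?_ rfl
    exact app_act g _ _
  rw [formsPull_apply, this]
  rfl

/-- The formal computation of the differential of the defect of integration by parts, for a homotopy
operator `T` between the identity and an idempotent `E`. -/
lemma deriv_defect {R : Type*} [Ring R] (T D : R →+ R) (ε E : R →+* R)
    (hD : ∀ a b, D (a * b) = D a * b + ε a * D b) (hT : ∀ a, D (T a) = E a - a - T (D a))
    (hET : ∀ a, E (T a) = 0) (hl : ∀ a b, T (E a * b) = ε (E a) * T b)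
    (hr : ∀ a b, T (a * E b) = T a * E b) (hTε : ∀ a, T (ε a) = - ε (T a))
    (hDε : ∀ a, D (ε a) = - ε (D a)) (hε : ∀ a, ε (ε a) = a) (hEε : ∀ a, E (ε a) = ε (E a))
    (a b : R) :
    D (T a * T b - T (a * T b) - T (ε (T a) * b))
      = (T (ε a) * T (D b) - T (ε a * T (D b)) - T (ε (T (ε a)) * D b))
        - (T (D a) * T b - T (D a * T b) - T (ε (T (D a)) * b)) := by
  simp only [map_sub, map_add, map_neg, map_mul, hD, hT, hET, hDε, hTε, hε, hEε, hr, mul_sub,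
    sub_mul, neg_mul, mul_zero, map_zero, zero_mul]
  have h1 := hl (ε a) b
  rw [hEε, hε] at h1
  rw [h1]
  abel

section rotaBaxter

variable {Y : SSet.{u}} (η ξ : Forms (Y ⊗ Δ[1]))

/-- The defect in the formula of integration by parts. -/
def partsDefect : Forms (Y ⊗ Δ[1]) :=
  segHomotopy Y η * segHomotopy Y ξ - segHomotopy Y (η * segHomotopy Y ξ)
    - segHomotopy Y (formsEps _ (segHomotopy Y η) * ξ)

lemma vertical_partsDefect : Vertical (partsDefect η ξ) :=
  (((vertical_segHomotopy _).mul (vertical_segHomotopy _)).sub (vertical_segHomotopy _)).sub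
    (vertical_segHomotopy _)

lemma formsD_segHomotopy :
    formsD _ (segHomotopy Y η) = endOne Y η - η - segHomotopy Y (formsD _ η) :=
  eq_sub_of_add_eq (segHomotopy_homotopy η)

lemma segHomotopy_endOne_mul :
    segHomotopy Y (endOne Y η * ξ) = formsEps _ (endOne Y η) * segHomotopy Y ξ :=
  segHomotopy_pull_mul _ _

lemma segHomotopy_mul_endOne :
    segHomotopy Y (η * endOne Y ξ) = segHomotopy Y η * endOne Y ξ :=
  segHomotopy_mul_pull _ _

lemma formsEps_segHomotopy : formsEps _ (segHomotopy Y η) = - segHomotopy Y (formsEps _ η) := by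
  rw [segHomotopy_eps, neg_neg]

lemma endOne_eps : endOne Y (formsEps _ η) = formsEps _ (endOne Y η) := rfl

/-- The differential of the defect is itself a combination of defects, so that it has no component
along the segments. -/
lemma formsD_partsDefect :
    formsD _ (partsDefect η ξ) = partsDefect (formsEps _ η) (formsD _ ξ)
        - partsDefect (formsD _ η) ξ :=
  deriv_defect (segHomotopy Y).toAddMonoidHom (formsD _).toAddMonoidHom (formsEps _).toRingHom
    (endOne Y).toRingHom formsD_mul formsD_segHomotopy endOne_segHomotopy segHomotopy_endOne_mul
    segHomotopy_mul_endOne segHomotopy_eps formsD_eps formsEps_eps endOne_eps η ξ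

/-- Integration by parts: the homotopy operator is a Rota–Baxter operator. -/
lemma segHomotopy_mul : segHomotopy Y η * segHomotopy Y ξ
    = segHomotopy Y (η * segHomotopy Y ξ) + segHomotopy Y (formsEps _ (segHomotopy Y η) * ξ) := by
  have h : partsDefect η ξ = 0 := by
    refine eq_zero_of_vertical (vertical_partsDefect _ _) ?_ ?_
    · rw [formsD_partsDefect]
      exact (vertical_partsDefect _ _).sub (vertical_partsDefect _ _)
    · have e : endOne Y (segHomotopy Y η * segHomotopy Y ξ) = 0 := by
        rw [map_mul (endOne Y), endOne_segHomotopy, zero_mul]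
      refine (map_sub (endOne Y) _ _).trans ?_
      rw [endOne_segHomotopy, sub_zero]
      refine (map_sub (endOne Y) _ _).trans ?_
      rw [endOne_segHomotopy, sub_zero, e]
  rw [partsDefect, sub_sub, sub_eq_zero] at h
  exact h

end rotaBaxter

/-! ### Degrees -/

section exterior

variable {M : Type*} [AddCommGroup M]

lemma exteriorPower_induction {p : ℕ → ExteriorAlgebra ℤ M → Prop}
    (one : ∀ r : ℤ, p 0 (algebraMap ℤ _ r)) (add : ∀ j x y, p j x → p j y → p j (x + y))
    (mul : ∀ j v x, x ∈ ⋀[ℤ]^j M → p j x → p (j + 1) (ExteriorAlgebra.ι ℤ v * x))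
    {j : ℕ} {a : ExteriorAlgebra ℤ M} (ha : a ∈ ⋀[ℤ]^j M) : p j a := by
  refine Submodule.pow_induction_on_left' (LinearMap.range (ExteriorAlgebra.ι ℤ (M := M)))
    (C := fun n x _ => p n x) one (fun x y i _ _ => add i x y) ?_ ha
  rintro _ ⟨v, rfl⟩ i x hx h
  exact mul i v x hx h

lemma contract_mem (κ : Module.Dual ℤ M) {j : ℕ} {a : ExteriorAlgebra ℤ M}
    (ha : a ∈ ⋀[ℤ]^(j + 1) M) :
    CliffordAlgebra.contractLeft (Q := (0 : QuadraticForm ℤ M)) κ a ∈ ⋀[ℤ]^j M := by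
  have key : (match j + 1 with
      | 0 => CliffordAlgebra.contractLeft (Q := (0 : QuadraticForm ℤ M)) κ a = 0
      | i + 1 => CliffordAlgebra.contractLeft (Q := (0 : QuadraticForm ℤ M)) κ a ∈ ⋀[ℤ]^i M) := by
    refine exteriorPower_induction (p := fun n x => match n with
      | 0 => CliffordAlgebra.contractLeft (Q := (0 : QuadraticForm ℤ M)) κ x = 0
      | i + 1 => CliffordAlgebra.contractLeft (Q := (0 : QuadraticForm ℤ M)) κ x ∈ ⋀[ℤ]^i M)
      (fun r => CliffordAlgebra.contractLeft_algebraMap _ _ _) ?_ ?_ ha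
    · rintro (_ | i) x y hx hy
      · simp only [map_add] at *
        rw [hx, hy, add_zero]
      · simp only [map_add] at *
        exact add_mem hx hy
    · intro i v x hx h
      change CliffordAlgebra.contractLeft κ (CliffordAlgebra.ι _ v * x) ∈ _
      rw [CliffordAlgebra.contractLeft_ι_mul]
      refine sub_mem (Submodule.smul_mem _ _ hx) ?_
      rcases i with _ | i
      · simp only at h
        rw [h, mul_zero]
        exact zero_mem _
      · simp only at h
        have := SetLike.GradedMul.mul_mem (A := fun i : ℕ => ⋀[ℤ]^i M) (i := 1) (j := i)
          (gi := ExteriorAlgebra.ι ℤ v) (by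
            change _ ∈ LinearMap.range (ExteriorAlgebra.ι ℤ (M := M)) ^ 1
            rw [pow_one]; exact LinearMap.mem_range_self _ _) h
        rwa [add_comm 1 i] at this
  exact key

lemma contract_of_mem_zero (κ : Module.Dual ℤ M) {a : ExteriorAlgebra ℤ M}
    (ha : a ∈ ⋀[ℤ]^0 M) :
    CliffordAlgebra.contractLeft (Q := (0 : QuadraticForm ℤ M)) κ a = 0 := by
  change a ∈ LinearMap.range (ExteriorAlgebra.ι ℤ (M := M)) ^ 0 at ha
  rw [pow_zero] at ha
  obtain ⟨r, rfl⟩ := Submodule.mem_one.1 ha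
  exact CliffordAlgebra.contractLeft_algebraMap _ _ _

lemma involute_of_mem {j : ℕ} {a : ExteriorAlgebra ℤ M} (ha : a ∈ ⋀[ℤ]^j M) :
    CliffordAlgebra.involute (Q := (0 : QuadraticForm ℤ M)) a = (-1 : ℤ) ^ j • a := by
  refine exteriorPower_induction (p := fun n x =>
    CliffordAlgebra.involute (Q := (0 : QuadraticForm ℤ M)) x = (-1 : ℤ) ^ n • x)
    (fun r => ?_) ?_ ?_ ha
  · rw [AlgHom.commutes, pow_zero, one_smul]
  · intro j x y hx hy
    rw [map_add, hx, hy, smul_add]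
  · intro j v x _ hx
    rw [map_mul, hx]
    change CliffordAlgebra.involute (CliffordAlgebra.ι _ v) * _ = _ • (CliffordAlgebra.ι _ v * _)
    rw [CliffordAlgebra.involute_ι, pow_succ, mul_neg_one, neg_smul, mul_smul_comm, neg_mul,
      smul_neg]

/-- Graded commutativity of the exterior algebra. -/
lemma exterior_mul_comm {i j : ℕ} {a b : ExteriorAlgebra ℤ M} (ha : a ∈ ⋀[ℤ]^i M)
    (hb : b ∈ ⋀[ℤ]^j M) : a * b = (-1 : ℤ) ^ (i * j) • (b * a) := by
  refine exteriorPower_induction (p := fun n x => x * b = (-1 : ℤ) ^ (n * j) • (b * x))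
    (fun r => ?_) ?_ ?_ ha
  · rw [zero_mul, pow_zero, one_smul, Algebra.commutes]
  · intro n x y hx hy
    rw [add_mul, hx, hy, mul_add, smul_add]
  · intro n v x _ hx
    have h1 : ExteriorAlgebra.ι ℤ v * b = (-1 : ℤ) ^ j • (b * ExteriorAlgebra.ι ℤ v) := by
      rw [ι_mul_eq, involute_of_mem hb, smul_mul_assoc]
    rw [mul_assoc, hx, mul_smul_comm, ← mul_assoc, h1, smul_mul_assoc, smul_smul, mul_assoc,
      ← pow_add, add_mul, one_mul]

end exterior

@[elab_as_elim]
lemma omegaDeg_induction {n : ℕ} {k : ℤ} {p : Omega n → Prop} (zero : p 0)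
    (add : ∀ x y, p x → p y → p (x + y))
    (tmul : ∀ (j : ℕ) (f : DP n) (a : ExteriorAlgebra ℤ (Fin n → ℤ)), (j : ℤ) = k →
      a ∈ ⋀[ℤ]^j (Fin n → ℤ) → p (f ⊗ₜ a))
    {x : Omega n} (hx : x ∈ omegaDeg n k) : p x := by
  refine Submodule.closure_induction (p := fun x _ => p x) zero (fun x y _ _ => add x y) ?_ hx
  rintro c _ ⟨j, hj, f, a, ha, rfl⟩
  rw [TensorProduct.smul_tmul']
  exact tmul j _ a hj ha

lemma tmul_mem_omegaDeg {n j : ℕ} {k : ℤ} (f : DP n) {a : ExteriorAlgebra ℤ (Fin n → ℤ)}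
    (hj : (j : ℤ) = k) (ha : a ∈ ⋀[ℤ]^j (Fin n → ℤ)) : f ⊗ₜ[ℤ] a ∈ omegaDeg n k :=
  Submodule.subset_span ⟨j, hj, f, a, ha, rfl⟩

lemma omegaDeg_pull {m n : ℕ} (α : Fin (m + 1) → Fin (n + 1)) {k : ℤ} {x : Omega n}
    (hx : x ∈ omegaDeg n k) : omegaPull α x ∈ omegaDeg m k := by
  refine omegaDeg_induction (by rw [map_zero]; exact zero_mem _)
    (fun x y hx hy => by rw [map_add]; exact add_mem hx hy) (fun j f a hj ha => ?_) hx
  rw [omegaPull_tmul]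
  refine tmul_mem_omegaDeg _ hj ?_
  refine exteriorPower_induction (p := fun j a =>
    ExteriorAlgebra.map (pullDx α) a ∈ ⋀[ℤ]^j (Fin m → ℤ)) (fun r => ?_) ?_ ?_ ha
  · rw [AlgHom.commutes]
    exact SetLike.algebraMap_mem_graded (fun i : ℕ => ⋀[ℤ]^i (Fin m → ℤ)) r
  · intro j x y hx hy
    rw [map_add]; exact add_mem hx hy
  · intro j v x _ hx
    rw [map_mul, ExteriorAlgebra.map_apply_ι]
    change _ ∈ LinearMap.range (ExteriorAlgebra.ι ℤ) ^ (j + 1)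
    rw [pow_succ']
    exact Submodule.mul_mem_mul (LinearMap.mem_range_self _ _) hx

lemma omegaDeg_contract {n l : ℕ} {k : ℤ} {x : Omega n} (hx : x ∈ omegaDeg n k) :
    omegaContract l x ∈ omegaDeg n (k - 1) := by
  refine omegaDeg_induction (by rw [map_zero]; exact zero_mem _)
    (fun x y hx hy => by rw [map_add]; exact add_mem hx hy) (fun j f a hj ha => ?_) hx
  rw [omegaContract_tmul]
  rcases j with _ | j
  · rw [contract_of_mem_zero _ ha, tmul_zero]
    exact zero_mem _
  · exact tmul_mem_omegaDeg (j := j) _ (by push_cast at hj; omega) (contract_mem _ ha)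

lemma omegaDeg_anti {n : ℕ} (l : Fin n) {k : ℤ} {x : Omega n} (hx : x ∈ omegaDeg n k) :
    omegaAnti l x ∈ omegaDeg n k := by
  refine omegaDeg_induction (by rw [map_zero]; exact zero_mem _)
    (fun x y hx hy => by rw [map_add]; exact add_mem hx hy) (fun j f a hj ha => ?_) hx
  rw [omegaAnti_tmul]
  exact tmul_mem_omegaDeg _ hj ha

lemma omegaDeg_segInt {n : ℕ} (l : Fin (n + 1)) {k : ℤ} {x : Omega (n + 1)}
    (hx : x ∈ omegaDeg (n + 1) k) : segInt l x ∈ omegaDeg n (k - 1) :=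
  sub_mem (omegaDeg_pull _ (omegaDeg_anti _ (omegaDeg_contract hx)))
    (omegaDeg_pull _ (omegaDeg_anti _ (omegaDeg_contract hx)))

lemma omegaEps_of_mem {n : ℕ} {k : ℤ} {x : Omega n} (hx : x ∈ omegaDeg n k) :
    omegaEps n x = (k.negOnePow : ℤ) • x := by
  refine omegaDeg_induction (by rw [map_zero, smul_zero])
    (fun x y hx hy => by rw [map_add, hx, hy, smul_add]) (fun j f a hj ha => ?_) hx
  subst hj
  rw [omegaEps_tmul, involute_of_mem ha, tmul_smul, Int.coe_negOnePow_natCast]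

lemma omega_mul_comm {n : ℕ} {k l : ℤ} {x y : Omega n} (hx : x ∈ omegaDeg n k)
    (hy : y ∈ omegaDeg n l) : x * y = ((k * l).negOnePow : ℤ) • (y * x) := by
  refine omegaDeg_induction (p := fun x => x * y = ((k * l).negOnePow : ℤ) • (y * x))
    (by simp) (fun x x' hx hx' => by rw [add_mul, hx, hx', mul_add, smul_add])
    (fun i f a hi ha => ?_) hx
  refine omegaDeg_induction (p := fun y => f ⊗ₜ[ℤ] a * y
      = ((k * l).negOnePow : ℤ) • (y * f ⊗ₜ[ℤ] a))
    (by simp) (fun x x' hx hx' => by rw [mul_add, hx, hx', add_mul, smul_add])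
    (fun j g b hj hb => ?_) hy
  subst hi hj
  rw [Algebra.TensorProduct.tmul_mul_tmul, Algebra.TensorProduct.tmul_mul_tmul, mul_comm f g,
    exterior_mul_comm ha hb, tmul_smul, ← Nat.cast_mul, Int.coe_negOnePow_natCast]

/-- The projection of the forms on the simplex to the forms of degree `k`. -/
def omegaProj (n k : ℕ) : Omega n →ₗ[ℤ] Omega n :=
  LinearMap.lTensor (DP n) (GradedAlgebra.proj (fun i : ℕ => ⋀[ℤ]^i (Fin n → ℤ)) k)

lemma omegaProj_of_mem {n k : ℕ} {l : ℤ} {x : Omega n} (hx : x ∈ omegaDeg n l) :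
    omegaProj n k x = if (k : ℤ) = l then x else 0 := by
  refine omegaDeg_induction (by simp)
    (fun x y hx hy => by rw [map_add, hx, hy]; split_ifs <;> simp) (fun j f a hj ha => ?_) hx
  subst hj
  have : omegaProj n k (f ⊗ₜ a)
      = f ⊗ₜ GradedAlgebra.proj (fun i : ℕ => ⋀[ℤ]^i (Fin n → ℤ)) k a := rfl
  rw [this, GradedAlgebra.proj_apply]
  split_ifs with h
  · obtain rfl : k = j := by exact_mod_cast h
    rw [DirectSum.decompose_of_mem_same (fun i : ℕ => ⋀[ℤ]^i (Fin n → ℤ)) ha]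
  · rw [DirectSum.decompose_of_mem_ne (fun i : ℕ => ⋀[ℤ]^i (Fin n → ℤ)) ha
      (fun h' => h (by rw [h'])), tmul_zero]

lemma omegaDeg_neg {n : ℕ} {k : ℤ} (hk : k < 0) {x : Omega n} (hx : x ∈ omegaDeg n k) : x = 0 := by
  refine omegaDeg_induction rfl (fun x y hx hy => by rw [hx, hy, add_zero])
    (fun j f a hj ha => by omega) hx

/-! ### The de Rham algebra as an algebra of forms -/

lemma formsDeg_D {X : SSet.{u}} {k : ℤ} {ω : Forms X} (h : ω ∈ FormsDeg X k) :
    formsD X ω ∈ FormsDeg X (k + 1) := fun n x => omegaDeg_d n (h n x)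

lemma formsDeg_pull {X Y : SSet.{u}} (f : X ⟶ Y) {k : ℤ} {ω : Forms Y} (h : ω ∈ FormsDeg Y k) :
    formsPull f ω ∈ FormsDeg X k := fun n x => h n (f.app _ x)

lemma formsDeg_segHomotopy {Y : SSet.{u}} {k : ℤ} {η : Forms (Y ⊗ Δ[1])}
    (h : η ∈ FormsDeg (Y ⊗ Δ[1]) k) : segHomotopy Y η ∈ FormsDeg (Y ⊗ Δ[1]) (k - 1) := fun n z => by
  rw [segHomotopy_apply]
  refine sum_mem fun l _ => ?_
  split_ifs
  · exact omegaDeg_segInt l (h _ _)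
  · exact zero_mem _

lemma sgn_smul_eq {M : Type*} [AddCommGroup M] [Module Theta M] (k : ℤ) (x : M) :
    sgn Theta k • x = (k.negOnePow : ℤ) • x := Int.cast_smul_eq_zsmul _ _ _

lemma formsEps_of_mem {X : SSet.{u}} {k : ℤ} {ω : Forms X} (h : ω ∈ FormsDeg X k) :
    formsEps X ω = sgn Theta k • ω := by
  rw [sgn_smul_eq]
  exact Forms.ext fun n x => omegaEps_of_mem (h n x)

lemma forms_mul_comm {X : SSet.{u}} {k l : ℤ} {ω η : Forms X} (h : ω ∈ FormsDeg X k)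
    (h' : η ∈ FormsDeg X l) : ω * η = sgn Theta (k * l) • (η * ω) := by
  rw [sgn_smul_eq]
  exact Forms.ext fun n x => omega_mul_comm (h n x) (h' n x)

/-- The inclusion of `A(X)` into the algebra of all forms. -/
def toForms (X : SSet.{u}) : DeRham X →ₐ[Theta] Forms X := DirectSum.coeAlgHom (FormsDeg X)

lemma toForms_lof {X : SSet.{u}} (k : ℤ) (ω : DegForms X k) :
    toForms X (DirectSum.lof Theta ℤ (DegForms X) k ω) = DegForms.incl X k ω :=
  DirectSum.coeAlgHom_of (FormsDeg X) k ω

lemma toForms_lof_mem {X : SSet.{u}} (k : ℤ) (ω : DegForms X k) :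
    toForms X (DirectSum.lof Theta ℤ (DegForms X) k ω) ∈ FormsDeg X k := by
  rw [toForms_lof]
  exact ω.2

lemma toForms_eq (X : SSet.{u}) :
    (toForms X).toLinearMap = DirectSum.toModule Theta ℤ (Forms X) (DegForms.incl X) :=
  DirectSum.linearMap_ext _ fun k => LinearMap.ext fun ω => by
    rw [LinearMap.comp_apply, LinearMap.comp_apply, DirectSum.toModule_lof]
    exact toForms_lof k ω

lemma value_eq {X : SSet.{u}} (ω : DeRham X) {n : ℕ} (x : X _⦋n⦌) :
    ω.value x = (toForms X ω).1 n x := by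
  rw [DeRham.value, ← toForms_eq]
  rfl

@[elab_as_elim]
lemma deRham_induction {X : SSet.{u}} {p : DeRham X → Prop} (zero : p 0)
    (add : ∀ x y, p x → p y → p (x + y))
    (lof : ∀ k (ω : DegForms X k), p (DirectSum.lof Theta ℤ (DegForms X) k ω)) (x : DeRham X) :
    p x := DirectSum.induction_on x zero lof add

/-- The values of a family of forms determine its homogeneous components. -/
lemma toForms_injective (X : SSet.{u}) : Function.Injective (toForms X) := by
  refine (injective_iff_map_eq_zero (toForms X)).2 fun ω h => ?_
  refine DFinsupp.ext fun k => Subtype.ext (Forms.ext fun n x => ?_)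
  rcases lt_or_ge k 0 with hk | hk
  · exact omegaDeg_neg hk ((ω k).2 n x)
  obtain ⟨k, rfl⟩ := Int.eq_ofNat_of_zero_le hk
  have key : ∀ ω : DeRham X, omegaProj n k ((toForms X ω).1 n x) = (ω k).1.1 n x := by
    intro ω
    refine deRham_induction ?_ ?_ ?_ ω
    · rw [map_zero]; exact map_zero (omegaProj n k)
    · intro a b ha hb
      rw [map_add]
      change omegaProj n k ((toForms X a).1 n x + (toForms X b).1 n x)
        = (a k).1.1 n x + (b k).1.1 n x
      rw [map_add, ha, hb]
    · intro l ω
      rw [omegaProj_of_mem (toForms_lof_mem l ω n x), toForms_lof]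
      split_ifs with h
      · subst h
        rw [DirectSum.lof_apply]
        rfl
      · rw [DirectSum.lof_eq_of, DirectSum.of_eq_of_ne _ _ _ h]
        rfl
  rw [← key, h]
  exact map_zero (omegaProj n k)

lemma toForms_d {X : SSet.{u}} (ω : DeRham X) :
    toForms X (deRhamD X ω) = formsD X (toForms X ω) := by
  refine deRham_induction ?_ ?_ ?_ ω
  · simp only [map_zero]
  · intro a b ha hb
    simp only [map_add, ha, hb]
  · intro k ω
    rw [deRhamD, DirectSum.toModule_lof, LinearMap.comp_apply, toForms_lof, toForms_lof]
    rfl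

lemma toForms_pull {X Y : SSet.{u}} (f : X ⟶ Y) (ω : DeRham Y) :
    toForms X (deRhamPull f ω) = formsPull f (toForms Y ω) := by
  refine deRham_induction ?_ ?_ ?_ ω
  · simp only [map_zero]
  · intro a b ha hb
    simp only [map_add, ha, hb]
  · intro k ω
    rw [deRhamPull, DirectSum.lmap_lof, toForms_lof, toForms_lof]
    rfl

lemma isInternal_range_lof {K : Type*} [CommRing K] (𝒜 : ℤ → Type*) [∀ k, AddCommGroup (𝒜 k)]
    [∀ k, Module K (𝒜 k)] :
    DirectSum.IsInternal fun k => LinearMap.range (DirectSum.lof K ℤ 𝒜 k) := by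
  let g : (⨁ k, 𝒜 k) →ₗ[K] ⨁ k, LinearMap.range (DirectSum.lof K ℤ 𝒜 k) :=
    DirectSum.lmap fun k => (DirectSum.lof K ℤ 𝒜 k).rangeRestrict
  have hg : Function.Surjective g := fun y => by
    induction y using DirectSum.induction_on with
    | zero => exact ⟨0, map_zero g⟩
    | add x y hx hy =>
      obtain ⟨x, rfl⟩ := hx
      obtain ⟨y, rfl⟩ := hy
      exact ⟨x + y, map_add g x y⟩
    | of k y =>
      obtain ⟨_, x, rfl⟩ := y
      exact ⟨DirectSum.lof K ℤ 𝒜 k x, DirectSum.lmap_lof _ _ _⟩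
  have hfg : ∀ x, DirectSum.coeLinearMap (fun k => LinearMap.range (DirectSum.lof K ℤ 𝒜 k)) (g x)
      = x := fun x => by
    induction x using DirectSum.induction_on with
    | zero => rw [map_zero, map_zero]
    | add x y hx hy => rw [map_add, map_add, hx, hy]
    | of k x =>
      refine (congrArg _ (DirectSum.lmap_lof _ k x)).trans ?_
      exact DirectSum.coeLinearMap_lof _ _ _
  refine ⟨fun x y h => ?_, fun x => ⟨g x, hfg x⟩⟩
  obtain ⟨x, rfl⟩ := hg x
  obtain ⟨y, rfl⟩ := hg y
  have h' := (hfg x).symm.trans (Eq.trans h (hfg y))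
  rw [h']

lemma toForms_mem {X : SSet.{u}} {k : ℤ} {ω : DeRham X} (h : ω ∈ (deRhamAlg X).gr k) :
    toForms X ω ∈ FormsDeg X k := by
  obtain ⟨ω, rfl⟩ := h
  exact toForms_lof_mem k ω

lemma mem_of_toForms_mem {X : SSet.{u}} {k : ℤ} {ω : DeRham X} (h : toForms X ω ∈ FormsDeg X k) :
    ω ∈ (deRhamAlg X).gr k :=
  ⟨⟨_, h⟩, toForms_injective X (toForms_lof k _)⟩

/-- The de Rham algebra is a commutative cochain algebra. -/
theorem isCommCochainAlg_deRhamAlg (X : SSet.{u}) : IsCommCochainAlg (deRhamAlg X) where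
  internal := isInternal_range_lof _
  one_mem := ⟨_, rfl⟩
  mul_mem i j (a : DeRham X) ha (b : DeRham X) hb := mem_of_toForms_mem (by
    change toForms X (a * b) ∈ _
    rw [map_mul]
    exact SetLike.GradedMul.mul_mem (toForms_mem ha) (toForms_mem hb))
  one_mul := one_mul (M := DeRham X)
  mul_one := mul_one (M := DeRham X)
  mul_assoc := mul_assoc (G := DeRham X)
  mul_comm i j (a : DeRham X) ha (b : DeRham X) hb := toForms_injective X (by
    change toForms X (a * b) = toForms X (sgn Theta (i * j) • (b * a))
    rw [map_smul, map_mul, map_mul, forms_mul_comm (toForms_mem ha) (toForms_mem hb)])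
  d_mem i (a : DeRham X) ha := mem_of_toForms_mem (by
    change toForms X (deRhamD X a) ∈ _
    rw [toForms_d]
    exact formsDeg_D (toForms_mem ha))
  d_d (a : DeRham X) := toForms_injective X (by
    change toForms X (deRhamD X (deRhamD X a)) = toForms X 0
    rw [toForms_d, toForms_d, formsD_formsD, map_zero])
  leibniz i (a : DeRham X) ha (b : DeRham X) := toForms_injective X (by
    change toForms X (deRhamD X (a * b))
      = toForms X (deRhamD X a * b + sgn Theta i • (a * deRhamD X b))
    rw [toForms_d, map_mul, formsD_mul, formsEps_of_mem (toForms_mem ha), map_add, map_smul,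
      map_mul, map_mul, toForms_d, toForms_d, smul_mul_assoc])

/-! ### Maximal chains -/

section chain

variable {n r : ℕ} {Γ : Fin (n + r + 1) → Fin (n + 1) × Fin (r + 1)}

/-- A maximal chain climbs by one at each step. -/
lemma chain_rank (hΓ : StrictMono Γ) (j : Fin (n + r + 1)) : ((Γ j).1 : ℕ) + (Γ j).2 = j := by
  let s : Fin (n + r + 1) → Fin (n + r + 1) := fun j => ⟨(Γ j).1 + (Γ j).2, by omega⟩
  have hs : StrictMono s := fun a b h => by
    have h1 := hΓ h
    rw [Prod.lt_iff] at h1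
    change ((Γ a).1 : ℕ) + (Γ a).2 < (Γ b).1 + (Γ b).2
    rcases h1 with ⟨h1, h2⟩ | ⟨h1, h2⟩
    · have h1' : ((Γ a).1 : ℕ) < (Γ b).1 := h1
      have h2' : ((Γ a).2 : ℕ) ≤ (Γ b).2 := h2
      omega
    · have h1' : ((Γ a).1 : ℕ) ≤ (Γ b).1 := h1
      have h2' : ((Γ a).2 : ℕ) < (Γ b).2 := h2
      omega
  have : s = id := (StrictMono.range_inj hs strictMono_id).1 (by
    rw [Set.range_id, Set.range_eq_univ]
    exact Finite.injective_iff_surjective.1 hs.injective)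
  exact congrArg Fin.val (congrFun this j)

lemma strictMono_of_rank (h1 : Monotone fun j => (Γ j).1) (h2 : Monotone fun j => (Γ j).2)
    (h : ∀ j, ((Γ j).1 : ℕ) + (Γ j).2 = j) : StrictMono Γ := fun a b hab => by
  refine lt_of_le_of_ne ⟨h1 hab.le, h2 hab.le⟩ fun he => ?_
  have ha := h a
  rw [he, h b] at ha
  exact hab.ne' (Fin.ext ha)

lemma chain_mono_fst (hΓ : StrictMono Γ) : Monotone fun j => (Γ j).1 :=
  fun _ _ h => (hΓ.monotone h).1

lemma chain_mono_snd (hΓ : StrictMono Γ) : Monotone fun j => (Γ j).2 :=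
  fun _ _ h => (hΓ.monotone h).2

/-- The coordinates of a maximal chain climb by at most one at each step, so that they take every
value. -/
lemma chain_pullIdx (hΓ : StrictMono Γ) :
    (∀ i ≤ n, ∃ h : pullIdx (fun j => (Γ j).1) i < n + r + 1, ((Γ ⟨_, h⟩).1 : ℕ) = i) ∧
    (∀ i ≤ r, ∃ h : pullIdx (fun j => (Γ j).2) i < n + r + 1, ((Γ ⟨_, h⟩).2 : ℕ) = i) := by
  have hlast := chain_rank hΓ (Fin.last (n + r))
  rw [Fin.val_last] at hlast
  have hf := (Γ (Fin.last (n + r))).1.2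
  have hs := (Γ (Fin.last (n + r))).2.2
  have h0 := chain_rank hΓ 0
  rw [Fin.val_zero] at h0
  constructor
  · intro i hi
    have hm := lt_pullIdx (chain_mono_fst hΓ) i
    have h : pullIdx (fun j => (Γ j).1) i < n + r + 1 := by
      by_contra hc
      have := (hm (Fin.last _)).1 (by rw [Fin.val_last]; omega)
      omega
    refine ⟨h, ?_⟩
    have hge := (hm ⟨_, h⟩).not.1 (lt_irrefl _)
    by_contra hne
    have e1 := chain_rank hΓ ⟨_, h⟩
    have hpos : 0 < pullIdx (fun j => (Γ j).1) i := (hm 0).2 (by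
      rcases Nat.eq_zero_or_pos i with rfl | hi0
      · have e0 := pullIdx_zero fun j => (Γ j).1
        simp only at e1
        omega
      · omega)
    have hlt := (hm ⟨pullIdx (fun j => (Γ j).1) i - 1, by omega⟩).1 (by simp only; omega)
    have e2 := chain_rank hΓ ⟨pullIdx (fun j => (Γ j).1) i - 1, by omega⟩
    have e3 : ((Γ ⟨pullIdx (fun j => (Γ j).1) i - 1, by omega⟩).2 : ℕ) ≤ (Γ ⟨_, h⟩).2 :=
      chain_mono_snd hΓ (Nat.sub_le _ _)
    simp only at *
    omega
  · intro i hi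
    have hm := lt_pullIdx (chain_mono_snd hΓ) i
    have h : pullIdx (fun j => (Γ j).2) i < n + r + 1 := by
      by_contra hc
      have := (hm (Fin.last _)).1 (by rw [Fin.val_last]; omega)
      omega
    refine ⟨h, ?_⟩
    have hge := (hm ⟨_, h⟩).not.1 (lt_irrefl _)
    by_contra hne
    have e1 := chain_rank hΓ ⟨_, h⟩
    have hpos : 0 < pullIdx (fun j => (Γ j).2) i := (hm 0).2 (by
      rcases Nat.eq_zero_or_pos i with rfl | hi0
      · have e0 := pullIdx_zero fun j => (Γ j).2
        simp only at e1
        omega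
      · omega)
    have hlt := (hm ⟨pullIdx (fun j => (Γ j).2) i - 1, by omega⟩).1 (by simp only; omega)
    have e2 := chain_rank hΓ ⟨pullIdx (fun j => (Γ j).2) i - 1, by omega⟩
    have e3 : ((Γ ⟨pullIdx (fun j => (Γ j).2) i - 1, by omega⟩).1 : ℕ) ≤ (Γ ⟨_, h⟩).1 :=
      chain_mono_fst hΓ (Nat.sub_le _ _)
    simp only at *
    omega

lemma baseIdx_val (hΓ : StrictMono Γ) (i : Fin (n + 1)) :
    (baseIdx Γ i : ℕ) = pullIdx (fun j => (Γ j).1) i := by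
  obtain ⟨h, he⟩ := (chain_pullIdx hΓ).1 i (Nat.lt_succ_iff.1 i.2)
  have : firstIdx (fun j => (Γ j).1 = i) = pullIdx (fun j => (Γ j).1) i :=
    firstIdx_eq h.le (fun _ => Fin.ext he) fun j hj he' => by
      have := (lt_pullIdx (chain_mono_fst hΓ) i j).1 hj
      rw [he'] at this
      exact lt_irrefl _ this
  rw [baseIdx, this, Fin.val_ofNat, Nat.mod_eq_of_lt h]

lemma pullIdx_mono {m n : ℕ} {α : Fin (m + 1) → Fin (n + 1)} (hα : Monotone α) {i j : ℕ}
    (h : i ≤ j) : pullIdx α i ≤ pullIdx α j := by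
  by_contra hc
  have hm := pullIdx_le α i
  have h1 := (lt_pullIdx hα i ⟨pullIdx α j, by omega⟩).1 (by simp only; omega)
  have h2 := (lt_pullIdx hα j ⟨pullIdx α j, by omega⟩).2 (by omega)
  exact lt_irrefl _ h2

lemma baseIdx_mono (hΓ : StrictMono Γ) : Monotone (baseIdx Γ) := fun i j h => by
  rw [Fin.le_def, baseIdx_val hΓ, baseIdx_val hΓ]
  exact pullIdx_mono (chain_mono_fst hΓ) h

lemma fibIdx_eq (i : ℕ) : fibIdx Γ i = pullIdx (fun j => (Γ j).2) i := rfl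

lemma fibIdx_le (hΓ : StrictMono Γ) {i : ℕ} (hi : i ≤ r) : fibIdx Γ i ≤ n + r :=
  Nat.lt_succ_iff.1 ((chain_pullIdx hΓ).2 i hi).1

lemma fibIdx_lt (hΓ : StrictMono Γ) {i : ℕ} (hi : i + 1 ≤ r) : fibIdx Γ i < fibIdx Γ (i + 1) := by
  obtain ⟨h, he⟩ := (chain_pullIdx hΓ).2 i (by omega)
  exact (lt_pullIdx (chain_mono_snd hΓ) (i + 1) ⟨_, h⟩).2 (by omega)

lemma fibIdx_add_le (hΓ : StrictMono Γ) {i j : ℕ} (hi : i + j ≤ r) :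
    fibIdx Γ i + j ≤ fibIdx Γ (i + j) := by
  induction j with
  | zero => exact le_rfl
  | succ j ih =>
    have h1 := ih (by omega)
    have h2 := fibIdx_lt hΓ (i := i + j) (by omega)
    rw [← add_assoc i j 1]
    omega

/-- The first index of the block of consecutive fibre coordinates that contains the `i`-th one. -/
lemma upIdx_spec (Γ : Fin (n + r + 1) → Fin (n + 1) × Fin (r + 1)) {i : ℕ} (hi : 1 ≤ i) :
    ∃ s, 1 ≤ s ∧ s ≤ i ∧ fibIdx Γ s + i = fibIdx Γ i + s ∧ upIdx Γ i = fibIdx Γ s - 1 ∧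
      ∀ j, 1 ≤ j → fibIdx Γ j + i = fibIdx Γ i + j → s ≤ j := by
  have hne : {j | 1 ≤ j ∧ fibIdx Γ j + i = fibIdx Γ i + j}.Nonempty := ⟨i, hi, rfl⟩
  exact ⟨_, (Nat.sInf_mem hne).1, Nat.sInf_le ⟨hi, rfl⟩, (Nat.sInf_mem hne).2, rfl,
    fun j h1 h2 => Nat.sInf_le ⟨h1, h2⟩⟩

lemma upIdx_eq {i s : ℕ} (h1 : 1 ≤ s) (h2 : fibIdx Γ s + i = fibIdx Γ i + s)
    (h3 : ∀ j, 1 ≤ j → fibIdx Γ j + i = fibIdx Γ i + j → s ≤ j) :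
    upIdx Γ i = fibIdx Γ s - 1 := by
  have : sInf {j | 1 ≤ j ∧ fibIdx Γ j + i = fibIdx Γ i + j} = s :=
    le_antisymm (Nat.sInf_le ⟨h1, h2⟩) (le_csInf ⟨s, h1, h2⟩ fun j hj => h3 j hj.1 hj.2)
  rw [upIdx, this]

end chain

/-! ### Integration over the first fibre coordinate -/

lemma contract_integral {N j k up lo : ℕ} (x : Omega N) :
    omegaContract j (omegaIntegral k up lo x) = omegaIntegral k up lo (omegaContract j x) := by
  induction x using TensorProduct.induction_on with
  | zero => simp
  | add x y hx hy => simp only [map_add, hx, hy]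
  | tmul p a => rfl

/-- A map that changes only the coordinate `x_{k + 1}` acts only on the coefficients of a form that
does not contain `dx_{k + 1}`. -/
lemma omegaPull_contract {N : ℕ} (α : Fin (N + 1) → Fin (N + 1)) (k : Fin N) (c : ℕ)
    (h : ∀ i ≤ N, pullIdx α i = if i = k + 1 then c else i) (p : DP N)
    (a : ExteriorAlgebra ℤ (Fin N → ℤ)) :
    omegaPull α (p ⊗ₜ CliffordAlgebra.contractLeft (Q := (0 : QuadraticForm ℤ (Fin N → ℤ)))
        (coDx N (k + 1)) a)
      = dpSubst N (fun j => if j = k.succ then c else j) p ⊗ₜ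
        CliffordAlgebra.contractLeft (Q := (0 : QuadraticForm ℤ (Fin N → ℤ)))
          (coDx N (k + 1)) a := by
  have h1 : dpPull α p = dpSubst N (fun j => if j = k.succ then c else j) p := by
    change dpSubst N (fun j => pullIdx α j) p = _
    congr 2
    funext j
    rw [h j (Nat.lt_succ_iff.1 j.2)]
    simp only [Fin.ext_iff, Fin.val_succ]
  have h2 : ∀ u, pullDx α u = u + coDx N (k + 1) u • (dxVec N c - dxVec N (k + 1)) := by
    intro u
    have : pullDx α = LinearMap.id + (coDx N (k + 1)).smulRight (dxVec N c - dxVec N (k + 1)) := by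
      refine (Pi.basisFun ℤ (Fin N)).ext fun i => ?_
      rw [Pi.basisFun_apply, pullDx_single, h _ i.2, LinearMap.add_apply, LinearMap.smulRight_apply,
        coDx_single, LinearMap.id_apply]
      have hs : (Pi.single i 1 : Fin N → ℤ) = dxVec N (i + 1) := by
        funext j
        rw [dxVec, Pi.single_apply]
        simp only [Fin.ext_iff, add_left_inj]
      rw [hs]
      split_ifs with hik
      · rw [show (i : ℕ) + 1 = k + 1 from hik, one_smul, add_sub_cancel]
      · rw [zero_smul, add_zero]
    rw [this]
    rfl
  rw [omegaPull_tmul, h1, map_transvection _ _ _ h2, CliffordAlgebra.contractLeft_contractLeft,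
    mul_zero, add_zero]

lemma ofNat_succ {n : ℕ} (l : Fin (n + 1)) : Fin.ofNat (n + 1 + 1) (l + 1) = l.succ :=
  Fin.ext (by rw [Fin.val_ofNat, Nat.mod_eq_of_lt (by omega), Fin.val_succ])

lemma integral_contract {n : ℕ} (l : Fin (n + 1)) (w : Omega (n + 1)) :
    omegaIntegral (l + 1) l (l + 2) (omegaContract (l + 1) w)
      = omegaPull l.predAbove (segInt l w) := by
  induction w using TensorProduct.induction_on with
  | zero => simp
  | add x y hx hy => simp only [map_add, hx, hy]
  | tmul p a =>
    have hl := l.2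
    rw [segInt_apply, map_sub, omegaPull_omegaPull (succAbove_mono _) (predAbove_mono _),
      omegaPull_omegaPull (succAbove_mono _) (predAbove_mono _), omegaContract_tmul, omegaAnti_tmul,
      omegaPull_contract _ l l, omegaPull_contract _ l (l + 2), ← sub_tmul]
    · change dpIntegral (Fin.ofNat (n + 1 + 1) (l + 1)) l (l + 2) p ⊗ₜ _ = _
      rw [ofNat_succ]
      rfl
    · intro i hi
      rw [pullIdx_comp (succAbove_mono _) (predAbove_mono _), pullIdx_succAbove _ (by omega),
        Fin.val_succ]
      split_ifs <;> rw [pullIdx_predAbove _ (by omega)] <;> split_ifs <;> omega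
    · intro i hi
      rw [pullIdx_comp (succAbove_mono _) (predAbove_mono _), pullIdx_succAbove _ (by omega),
        Fin.val_castSucc]
      split_ifs <;> rw [pullIdx_predAbove _ (by omega)] <;> split_ifs <;> omega

lemma integral_pull {n : ℕ} (l : Fin (n + 1)) (k : Fin n) (hk : (l : ℕ) ≤ k) {up lo : ℕ}
    (x : Omega n) :
    omegaIntegral (k + 2) (pullIdx l.predAbove up) (pullIdx l.predAbove lo)
        (omegaPull l.predAbove x)
      = omegaPull l.predAbove (omegaIntegral (k + 1) up lo x) := by
  induction x using TensorProduct.induction_on with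
  | zero => simp
  | add x y hx hy => simp only [map_add, hx, hy]
  | tmul p a =>
    have hl := k.2
    obtain ⟨n, rfl⟩ : ∃ n', n = n' + 1 := ⟨n - 1, by omega⟩
    have hanti : dpAnti k.succ.succ (dpPull l.predAbove p) =
        dpPull l.predAbove (dpAnti k.succ p) := by
      refine dpAnti_subst _ (pullIdx_zero _) k k.succ (fun b => ?_) p
      rw [pullIdx_predAbove _ (by omega), Fin.ext_iff, Fin.val_succ]
      split_ifs <;> omega
    have hs : ∀ (c : ℕ) (q : DP (n + 1)),
        dpSubst (n + 1 + 1) (fun j => if j = k.succ.succ then pullIdx l.predAbove c else j)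
          (dpPull l.predAbove q)
        = dpPull l.predAbove (dpSubst (n + 1) (fun j => if j = k.succ then c else j) q) := by
      intro c q
      refine dpSubst_dpSubst_eq _ _ _ _ (fun i => ?_) q
      rw [dpPull_xvar, dpSubst_xvar, dif_pos]
      · simp only [Fin.ext_iff, Fin.val_succ]
        rw [pullIdx_predAbove (i := (i : ℕ)) _ (by omega)]
        by_cases h : (i : ℕ) = k + 1
        · rw [if_pos h, if_pos]
          split_ifs <;> omega
        · rw [if_neg h, if_neg, pullIdx_predAbove (i := (i : ℕ)) _ (by omega)]
          split_ifs <;> omega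
      · rw [pullIdx_predAbove _ (by omega)]
        split_ifs <;> omega
    have h1 : Fin.ofNat (n + 1 + 1 + 1) (k + 2) = k.succ.succ := ofNat_succ k.succ
    have h2 : Fin.ofNat (n + 1 + 1) (k + 1) = k.succ := ofNat_succ k
    change dpIntegral (Fin.ofNat (n + 1 + 1 + 1) (k + 2)) _ _ (dpPull l.predAbove p) ⊗ₜ _
      = dpPull l.predAbove (dpIntegral (Fin.ofNat (n + 1 + 1) (k + 1)) up lo p) ⊗ₜ _
    rw [h1, h2]
    congr 1
    change dpSubst _ _ (dpAnti k.succ.succ (dpPull l.predAbove p))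
        - dpSubst _ _ (dpAnti k.succ.succ (dpPull l.predAbove p))
      = dpPull l.predAbove (dpSubst _ _ (dpAnti k.succ p) - dpSubst _ _ (dpAnti k.succ p))
    rw [hanti, hs, hs, map_sub]

lemma contract_pull_degeneracy {n : ℕ} (l : Fin (n + 1)) (k : Fin n) (hk : (l : ℕ) ≤ k)
    (x : Omega n) :
    omegaContract (k + 2) (omegaPull l.predAbove x)
      = omegaPull l.predAbove (omegaContract (k + 1) x) := by
  rw [omegaContract_pull _ _ (by omega) (by omega), Finset.sum_eq_single k]
  · rw [if_pos]
    rw [pullIdx_predAbove _ (by omega), if_neg (by omega)]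
  · intro i _ hi
    refine if_neg fun h => hi (Fin.ext ?_)
    rw [pullIdx_predAbove _ (by omega)] at h
    split_ifs at h <;> omega
  · simp

lemma foldl_intertwine {α β ι : Type*} (φ : α → β) (F : α → ι → α) (G : β → ι → β) (L : List ι)
    (h : ∀ i ∈ L, ∀ x, G (φ x) i = φ (F x i)) (x : α) :
    L.foldl G (φ x) = φ (L.foldl F x) := by
  induction L generalizing x with
  | nil => rfl
  | cons i L ih =>
    rw [List.foldl_cons, List.foldl_cons, h i (by simp),
      ih fun j hj => h j (List.mem_cons_of_mem _ hj)]

section step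

variable {n r : ℕ} {Γ : Fin (n + (r + 1) + 1) → Fin (n + 1) × Fin (r + 1 + 1)}
  {Γ' : Fin (n + r + 1) → Fin (n + 1) × Fin (r + 1)} {l : Fin (n + r + 1)}

lemma lt_fibIdx (hΓ' : StrictMono Γ') (hl : (Γ' l).2 = 0) {i : ℕ} (hi : 1 ≤ i) :
    (l : ℕ) < fibIdx Γ' i :=
  (lt_pullIdx (chain_mono_snd hΓ') i l).2 (by
    have hl' : ((Γ' l).2 : ℕ) = 0 := congrArg Fin.val hl
    omega)

lemma fibIdx_one (h2 : ∀ j : Fin (n + r + 1 + 1), ((Γ j).2 : ℕ)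
      = if (j : ℕ) ≤ l then 0 else ((Γ' (l.predAbove j)).2 : ℕ) + 1) : fibIdx Γ 1 = l + 1 :=
  pullIdx_eq _ (by omega) fun j => by
    rw [h2]
    split_ifs <;> omega

lemma fibIdx_succ (hΓ' : StrictMono Γ') (hl : (Γ' l).2 = 0)
    (h2 : ∀ j : Fin (n + r + 1 + 1), ((Γ j).2 : ℕ)
      = if (j : ℕ) ≤ l then 0 else ((Γ' (l.predAbove j)).2 : ℕ) + 1) {i : ℕ} (hi : 1 ≤ i)
    (hir : i ≤ r) : fibIdx Γ (i + 1) = fibIdx Γ' i + 1 := by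
  have hl' : ((Γ' l).2 : ℕ) = 0 := congrArg Fin.val hl
  have h := lt_fibIdx hΓ' hl hi
  have h' := fibIdx_le hΓ' hir
  have : fibIdx Γ' i + 1 = pullIdx l.predAbove (fibIdx Γ' i) := by
    rw [pullIdx_predAbove _ (by omega), if_neg (by omega)]
  rw [this]
  refine pullIdx_eq _ (pullIdx_le _ _) fun j => ?_
  rw [lt_pullIdx (predAbove_mono l), fibIdx_eq, lt_pullIdx (chain_mono_snd hΓ'), h2]
  split_ifs with hj
  · have : (l.predAbove j : Fin (n + r + 1)) ≤ l := by
      rw [Fin.le_def, predAbove_val, if_pos hj]; exact hj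
    have : ((Γ' (l.predAbove j)).2 : ℕ) ≤ (Γ' l).2 := chain_mono_snd hΓ' this
    omega
  · omega

/-- The upper limits of integration of a chain and of the chain obtained by collapsing its first
step in the direction of the fibre correspond to each other. -/
lemma upIdx_succ (hΓ' : StrictMono Γ') (hl : (Γ' l).2 = 0)
    (h2 : ∀ j : Fin (n + r + 1 + 1), ((Γ j).2 : ℕ)
      = if (j : ℕ) ≤ l then 0 else ((Γ' (l.predAbove j)).2 : ℕ) + 1) {i : ℕ} (hi : 1 ≤ i)
    (hir : i ≤ r) : upIdx Γ (i + 1) = pullIdx l.predAbove (upIdx Γ' i) := by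
  have hlow : ∀ i, 1 ≤ i → (l : ℕ) < fibIdx Γ' i := fun i hi => lt_fibIdx hΓ' hl hi
  have f1 := fibIdx_one h2
  have f2 : ∀ i, 1 ≤ i → i ≤ r → fibIdx Γ (i + 1) = fibIdx Γ' i + 1 :=
    fun i => fibIdx_succ hΓ' hl h2
  obtain ⟨s, hs1, hsi, hs, hsu, hmin⟩ := upIdx_spec Γ' hi
  have hle := fibIdx_le hΓ' (hsi.trans hir)
  have hls := hlow s hs1
  have hadd := fibIdx_add_le hΓ' (i := 1) (j := s - 1) (by omega)
  rw [Nat.add_sub_cancel' hs1] at hadd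
  have hl1 := hlow 1 le_rfl
  have hi2 := f2 i hi hir
  rw [hsu]
  by_cases hc : fibIdx Γ' 1 = l + 1 ∧ s = 1
  · obtain ⟨hc, rfl⟩ := hc
    rw [upIdx_eq (s := 1) le_rfl (by omega) (fun j hj _ => hj), f1, hc,
      pullIdx_predAbove _ (by omega), if_pos (by omega)]
  · have hs2 := f2 s hs1 (hsi.trans hir)
    have hnot : ¬ fibIdx Γ' s = l + s := by
      intro he
      have hone := hmin 1 le_rfl (by omega)
      exact hc ⟨by omega, by omega⟩
    rw [upIdx_eq (s := s + 1) (by omega) (by omega), hs2, pullIdx_predAbove _ (by omega),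
      if_neg (by omega)]
    · omega
    · intro j hj he
      rcases Nat.eq_or_lt_of_le hj with rfl | hj1
      · rw [f1] at he
        omega
      · obtain ⟨j, rfl⟩ : ∃ j', j = j' + 1 := ⟨j - 1, by omega⟩
        by_contra hjs
        rw [f2 j (by omega) (by omega)] at he
        have := hmin j (by omega) (by omega)
        omega

lemma predAbove_baseIdx (hΓ : StrictMono Γ) (hΓ' : StrictMono Γ')
    (h1 : ∀ j : Fin (n + r + 1 + 1), (Γ j).1 = (Γ' (l.predAbove j)).1) :
    l.predAbove ∘ baseIdx (n := n) (r := r + 1) Γ = baseIdx Γ' := by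
  funext i
  obtain ⟨hi, -⟩ := (chain_pullIdx hΓ').1 i (Nat.lt_succ_iff.1 i.2)
  have e : pullIdx (fun j => (Γ j).1) i = pullIdx l.predAbove (pullIdx (fun j => (Γ' j).1) i) := by
    rw [← pullIdx_comp (chain_mono_fst hΓ') (predAbove_mono l)]
    congr 1
    funext j
    exact h1 j
  have hb1 := baseIdx_val hΓ i
  have hb2 := baseIdx_val hΓ' i
  rw [e, pullIdx_predAbove _ (by omega)] at hb1
  rw [Function.comp_apply, Fin.ext_iff, predAbove_val, hb1, hb2]
  split_ifs <;> omega

lemma omegaPull_baseIdx (hΓ : StrictMono Γ) (hΓ' : StrictMono Γ')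
    (h1 : ∀ j : Fin (n + r + 1 + 1), (Γ j).1 = (Γ' (l.predAbove j)).1) (x : Omega (n + r)) :
    omegaPull (baseIdx (n := n) (r := r + 1) Γ) (omegaPull l.predAbove x)
      = omegaPull (baseIdx Γ') x := by
  have key : ∀ (b : Fin (n + 1) → Fin (n + r + 1 + 1)) (_ : Monotone b)
      (b' : Fin (n + 1) → Fin (n + r + 1)) (_ : l.predAbove ∘ b = b'),
      omegaPull b (omegaPull l.predAbove x) = omegaPull b' x := by
    rintro b hb _ rfl
    exact omegaPull_omegaPull (predAbove_mono l) hb x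
  exact key _ (baseIdx_mono hΓ) _ (predAbove_baseIdx hΓ hΓ' h1)

/-- Integration over the fibre coordinate that a chain reaches first: the remaining integrations are
those of the chain obtained by collapsing the first step in the direction of the fibre. -/
lemma chainIntegral_step (hΓ : StrictMono Γ) (hΓ' : StrictMono Γ') (hl : (Γ' l).2 = 0)
    (h1 : ∀ j : Fin (n + r + 1 + 1), (Γ j).1 = (Γ' (l.predAbove j)).1)
    (h2 : ∀ j : Fin (n + r + 1 + 1), ((Γ j).2 : ℕ)
      = if (j : ℕ) ≤ l then 0 else ((Γ' (l.predAbove j)).2 : ℕ) + 1)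
    (ξ : Omega (n + r + 1)) (ρ : Omega (n + r)) :
    chainIntegral (n := n) (r := r + 1) Γ (ξ * omegaPull l.predAbove ρ)
      = chainIntegral Γ' (segInt l ξ * ρ) := by
  have hlow : ∀ i, 1 ≤ i → (l : ℕ) < fibIdx Γ' i := fun i hi => lt_fibIdx hΓ' hl hi
  have f1 := fibIdx_one h2
  have f2 : ∀ i, 1 ≤ i → i ≤ r → fibIdx Γ (i + 1) = fibIdx Γ' i + 1 :=
    fun i => fibIdx_succ hΓ' hl h2
  have hup : ∀ i, 1 ≤ i → i ≤ r → upIdx Γ (i + 1) = pullIdx l.predAbove (upIdx Γ' i) :=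
    fun i => upIdx_succ hΓ' hl h2
  have hu1 : upIdx Γ 1 = l := by
    rw [upIdx_eq (s := 1) le_rfl rfl (fun j hj _ => hj), f1]
    omega
  have hrange : List.range' 1 (r + 1) = 1 :: (List.range' 1 r).map (· + 1) := by
    have : (fun x => x + 1) = fun x => 1 + x := funext fun x => add_comm x 1
    rw [List.range'_succ, this, List.map_add_range']
  have hmem : ∀ i ∈ List.range' 1 r, 1 ≤ i ∧ i ≤ r := fun i hi => by
    rw [List.mem_range'_1] at hi; omega
  rw [chainIntegral, chainIntegral, hrange, List.foldl_cons, List.foldl_cons, List.foldl_map,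
    List.foldl_map, f1, hu1, omegaContract_mul, contract_pull_predAbove, mul_zero, add_zero]
  rw [← foldl_intertwine (omegaIntegral (l + 1) l (l + 1 + 1))
    (fun w i => omegaContract (fibIdx Γ (i + 1)) w)
    (fun w i => omegaContract (fibIdx Γ (i + 1)) w) _
    fun i _ x => contract_integral x]
  have e1 : omegaIntegral (l + 1) l (l + 1 + 1) (omegaContract (l + 1) ξ * omegaPull l.predAbove ρ)
      = omegaPull l.predAbove (segInt l ξ * ρ) := by
    rw [← segInt_mul_pull, ← integral_contract, omegaContract_mul, contract_pull_predAbove,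
      mul_zero, add_zero]
  rw [e1, foldl_intertwine (omegaPull l.predAbove) (fun w i => omegaContract (fibIdx Γ' i) w),
    foldl_intertwine (omegaPull l.predAbove)
      (fun w i => omegaIntegral (fibIdx Γ' i) (upIdx Γ' i) (fibIdx Γ' i + 1) w)]
  · exact omegaPull_baseIdx hΓ hΓ' h1 _
  · intro i hi x
    obtain ⟨hi1, hir⟩ := hmem i hi
    have ha := hlow i hi1
    have hb' := fibIdx_le hΓ' hir
    obtain ⟨k, hk⟩ : ∃ k : Fin (n + r), fibIdx Γ' i = k + 1 := ⟨⟨fibIdx Γ' i - 1, by omega⟩, by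
      simp only; omega⟩
    rw [f2 i hi1 hir, hup i hi1 hir, hk, ← integral_pull l k (by omega),
      pullIdx_predAbove l (i := k + 1 + 1) (by omega), if_neg (by omega)]
  · intro i hi x
    obtain ⟨hi1, hir⟩ := hmem i hi
    have ha := hlow i hi1
    have hb' := fibIdx_le hΓ' hir
    obtain ⟨k, hk⟩ : ∃ k : Fin (n + r), fibIdx Γ' i = k + 1 := ⟨⟨fibIdx Γ' i - 1, by omega⟩, by
      simp only; omega⟩
    rw [f2 i hi1 hir, hk]
    exact contract_pull_degeneracy l k (by omega) x

end step

/-! ### Fibre integrals as iterated integrals over segments -/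

section extend

variable {n r : ℕ}

/-- The maximal chain with an additional step in the direction of the fibre after the index `l`. -/
def extendChain (Γ' : Fin (n + r + 1) → Fin (n + 1) × Fin (r + 1)) (l : Fin (n + r + 1))
    (j : Fin (n + (r + 1) + 1)) : Fin (n + 1) × Fin (r + 1 + 1) :=
  ((Γ' (l.predAbove j)).1, if (j : ℕ) ≤ l then 0 else (Γ' (l.predAbove j)).2.succ)

/-- The chain obtained by omitting the vertex after the index `l` and collapsing the first step in
the direction of the fibre. -/
def collapseChain (Γ : Fin (n + (r + 1) + 1) → Fin (n + 1) × Fin (r + 1 + 1)) (l : Fin (n + r + 1))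
    (j : Fin (n + r + 1)) : Fin (n + 1) × Fin (r + 1) :=
  ((Γ (l.succ.succAbove j)).1, (0 : Fin (r + 1)).predAbove (Γ (l.succ.succAbove j)).2)

variable {Γ' : Fin (n + r + 1) → Fin (n + 1) × Fin (r + 1)} {l : Fin (n + r + 1)}

lemma extendChain_snd (j : Fin (n + (r + 1) + 1)) : ((extendChain Γ' l j).2 : ℕ)
    = if (j : ℕ) ≤ l then 0 else ((Γ' (l.predAbove j)).2 : ℕ) + 1 := by
  rw [extendChain]
  split_ifs <;> simp

lemma snd_eq_zero_of_le (hΓ' : StrictMono Γ') (hl : (Γ' l).2 = 0) {j : Fin (n + r + 1)}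
    (h : j ≤ l) : (Γ' j).2 = 0 :=
  le_antisymm ((chain_mono_snd hΓ' h).trans hl.le) (Fin.zero_le _)

lemma predAbove_le {j : Fin (n + r + 1 + 1)} (h : (j : ℕ) ≤ l) : l.predAbove j ≤ l := by
  rw [Fin.le_def, predAbove_val, if_pos h]; exact h

lemma strictMono_extendChain (hΓ' : StrictMono Γ') (hl : (Γ' l).2 = 0) :
    StrictMono (extendChain Γ' l) := by
  refine strictMono_of_rank ?_ ?_ ?_
  · exact (chain_mono_fst hΓ').comp (predAbove_mono l)
  · intro a b hab
    rw [Fin.le_def, extendChain_snd, extendChain_snd]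
    have hab' : (a : ℕ) ≤ b := hab
    have h : ((Γ' (l.predAbove a)).2 : ℕ) ≤ (Γ' (l.predAbove b)).2 :=
      chain_mono_snd hΓ' (predAbove_mono l hab)
    split_ifs <;> omega
  · intro j
    rw [extendChain_snd]
    have h := chain_rank hΓ' (l.predAbove j)
    rw [predAbove_val] at h
    change ((Γ' (l.predAbove j)).1 : ℕ) + _ = _
    split_ifs with hj
    · rw [snd_eq_zero_of_le hΓ' hl (predAbove_le hj), if_pos hj, Fin.val_zero] at h
      exact h
    · rw [if_neg hj] at h
      omega

lemma collapseChain_extendChain (hΓ' : StrictMono Γ') (hl : (Γ' l).2 = 0) :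
    collapseChain (extendChain Γ' l) l = Γ' := by
  funext j
  have e : l.predAbove (l.succ.succAbove j) = j := predAbove_succ_succAbove l j
  refine Prod.ext ?_ (Fin.ext ?_)
  · change (Γ' (l.predAbove (l.succ.succAbove j))).1 = _
    rw [e]
  · change (((0 : Fin (r + 1)).predAbove (extendChain Γ' l (l.succ.succAbove j)).2
    : Fin (r + 1)) : ℕ)
      = _
    rw [predAbove_val, extendChain_snd, e, succAbove_val]
    have h := snd_eq_zero_of_le hΓ' hl (j := j)
    simp only [Fin.val_succ, Fin.val_zero]
    by_cases hj : (j : ℕ) ≤ l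
    · rw [h hj]
      simp only [Fin.val_zero]
      split_ifs <;> omega
    · split_ifs <;> omega

lemma fibIdx_extendChain : fibIdx (n := n) (r := r + 1) (extendChain Γ' l) 1 = l + 1 :=
  fibIdx_one (Γ' := Γ') (l := l) fun j => extendChain_snd (n := n) (r := r) j

/-- Every maximal chain of `[n] × [r + 1]` arises from a maximal chain of `[n] × [r]` by an
additional step in the direction of the fibre, taken after an index at which the fibre coordinate is
`0`. -/
lemma exists_extendChain {Γ : Fin (n + (r + 1) + 1) → Fin (n + 1) × Fin (r + 1 + 1)}
    (hΓ : StrictMono Γ) :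
    ∃ (l : Fin (n + r + 1)) (Γ' : Fin (n + r + 1) → Fin (n + 1) × Fin (r + 1)),
      StrictMono Γ' ∧ (Γ' l).2 = 0 ∧ extendChain Γ' l = Γ := by
  obtain ⟨hf, hf1⟩ := (chain_pullIdx (n := n) (r := r + 1) hΓ).2 1 (by omega)
  have hlt := lt_pullIdx (chain_mono_snd (n := n) (r := r + 1) hΓ) 1
  have h0 := chain_rank (n := n) (r := r + 1) hΓ 0
  rw [Fin.val_zero] at h0
  have hpos := (hlt 0).2 (by omega)
  rw [Fin.val_zero] at hpos
  obtain ⟨l, hl⟩ : ∃ l : Fin (n + r + 1), pullIdx (fun j => (Γ j).2) 1 = l + 1 :=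
    ⟨⟨pullIdx (fun j => (Γ j).2) 1 - 1, by omega⟩, by simp only; omega⟩
  have hlast : ((Γ l.succ).2 : ℕ) = 1 := by
    have : l.succ = ⟨pullIdx (fun j => (Γ j).2) 1, hf⟩ := Fin.ext hl.symm
    rw [this]; exact hf1
  have hzero : ∀ j : Fin (n + (r + 1) + 1), (j : ℕ) ≤ l → ((Γ j).2 : ℕ) = 0 := fun j hj => by
    have := (hlt j).1 (by omega)
    omega
  have hone : ∀ j : Fin (n + (r + 1) + 1), ¬ (j : ℕ) ≤ l → 1 ≤ ((Γ j).2 : ℕ) := fun j hj => by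
    have := (hlt j).not.1 (by omega)
    omega
  have hsnd : ∀ j : Fin (n + r + 1), ((collapseChain Γ l j).2 : ℕ)
      = (Γ (l.succ.succAbove j)).2 - 1 := fun j => by
    change (((0 : Fin (r + 1)).predAbove (Γ (l.succ.succAbove j)).2 : Fin (r + 1)) : ℕ) = _
    rw [predAbove_val, Fin.val_zero]
    split_ifs <;> omega
  have hval : ∀ j : Fin (n + r + 1), ((l.succ.succAbove j : Fin (n + r + 1 + 1)) : ℕ)
      = if (j : ℕ) ≤ l then (j : ℕ) else j + 1 := fun j => by
    rw [succAbove_val, Fin.val_succ]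
    split_ifs <;> omega
  have hmono : StrictMono (collapseChain Γ l) := by
    refine strictMono_of_rank ?_ ?_ ?_
    · exact (chain_mono_fst (n := n) (r := r + 1) hΓ).comp (succAbove_mono _)
    · intro a b hab
      rw [Fin.le_def, hsnd, hsnd]
      have : ((Γ (l.succ.succAbove a)).2 : ℕ) ≤ (Γ (l.succ.succAbove b)).2 :=
        chain_mono_snd (n := n) (r := r + 1) hΓ (succAbove_mono _ hab)
      omega
    · intro j
      rw [hsnd]
      change ((Γ (l.succ.succAbove j)).1 : ℕ) + _ = _
      have h := chain_rank (n := n) (r := r + 1) hΓ (l.succ.succAbove j)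
      have hv := hval j
      by_cases hj : (j : ℕ) ≤ l
      · rw [if_pos hj] at hv
        have := hzero (l.succ.succAbove j) (by omega)
        omega
      · rw [if_neg hj] at hv
        have := hone (l.succ.succAbove j) (by omega)
        omega
  have hvl : ((l.succ.succAbove l : Fin (n + r + 1 + 1)) : ℕ) = l := by rw [hval, if_pos le_rfl]
  have hcl : (collapseChain Γ l l).2 = 0 := Fin.ext (by
    rw [hsnd, hzero _ hvl.le]
    rfl)
  refine ⟨l, collapseChain Γ l, hmono, hcl, funext fun j => ?_⟩
  -- both chains are determined by their second components
  have hs : ((extendChain (collapseChain Γ l) l j).2 : ℕ) = (Γ j).2 := by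
    rw [extendChain_snd]
    split_ifs with hj
    · exact (hzero j hj).symm
    · have h1 := hone j hj
      rw [hsnd]
      by_cases hjl : (j : ℕ) = l + 1
      · have e1 : l.succ.succAbove (l.predAbove j) = l.castSucc := Fin.ext (by
          rw [hval, predAbove_val, if_neg hj, if_pos (by omega), Fin.val_castSucc]; omega)
        have e2 : j = l.succ := Fin.ext hjl
        rw [e1, hzero l.castSucc le_rfl, e2, hlast]
      · have e1 : l.succ.succAbove (l.predAbove j) = j := Fin.ext (by
          rw [hval, predAbove_val, if_neg hj, if_neg (by omega)]; omega)
        rw [e1]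
        omega
  have h1 := chain_rank (n := n) (r := r + 1) (strictMono_extendChain hmono hcl) j
  have h2 := chain_rank (n := n) (r := r + 1) hΓ j
  exact Prod.ext (Fin.ext (by omega)) (Fin.ext hs)

end extend

/-- The simplex of `Y × Δ^r` given by a simplex of `Y` and a maximal chain. -/
def chainSimplex {Y : SSet.{u}} {n r : ℕ} (y : Y _⦋n⦌)
    {Γ : Fin (n + r + 1) → Fin (n + 1) × Fin (r + 1)} (hΓ : StrictMono Γ) :
    (Y ⊗ Δ[r]) _⦋n + r⦌ :=
  (act ⟨fun j => (Γ j).1, chain_mono_fst hΓ⟩ y,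
    SSet.stdSimplex.objMk ⟨fun j => (Γ j).2, chain_mono_snd hΓ⟩)

open Classical in
/-- Integration of forms over the fibres of the projection `Y × Δ^r → Y`. -/
def fibInt {Y : SSet.{u}} {r : ℕ} (ξ : Forms (Y ⊗ Δ[r])) {n : ℕ} (y : Y _⦋n⦌) : Omega n :=
  ∑ Γ : {Γ : Fin (n + r + 1) → Fin (n + 1) × Fin (r + 1) // StrictMono Γ},
    chainIntegral Γ.1 (ξ.1 (n + r) (chainSimplex y Γ.2))

lemma fiberIntegral_eq {Y : SSet.{u}} {r : ℕ} (ω : DeRham (Y ⊗ Δ[r])) {n : ℕ} (y : Y _⦋n⦌) :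
    fiberIntegral ω y = fibInt (toForms _ ω) y := by
  rw [fiberIntegral]
  rfl

lemma exists_linear_foldl {M ι : Type*} [AddCommGroup M] (F : ι → M →ₗ[ℤ] M) (L : List ι) :
    ∃ G : M →ₗ[ℤ] M, ∀ w, L.foldl (fun w i => F i w) w = G w := by
  induction L with
  | nil => exact ⟨LinearMap.id, fun _ => rfl⟩
  | cons i L ih =>
    obtain ⟨G, hG⟩ := ih
    exact ⟨G ∘ₗ F i, fun w => hG _⟩

lemma exists_linear_chainIntegral {n r : ℕ} (Γ : Fin (n + r + 1) → Fin (n + 1) × Fin (r + 1)) :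
    ∃ G : Omega (n + r) →ₗ[ℤ] Omega n, ∀ w, chainIntegral Γ w = G w := by
  obtain ⟨G, hG⟩ := exists_linear_foldl (fun i => omegaContract (N := n + r) (fibIdx Γ i))
    (List.range' 1 r)
  obtain ⟨H, hH⟩ := exists_linear_foldl
    (fun i => omegaIntegral (N := n + r) (fibIdx Γ i) (upIdx Γ i) (fibIdx Γ i + 1))
    (List.range' 1 r)
  exact ⟨(omegaPull (baseIdx Γ)).toLinearMap.restrictScalars ℤ ∘ₗ H ∘ₗ G, fun w => by
    rw [chainIntegral, hG, hH]; rfl⟩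

/-- The map `Δ^r → Δ¹` that is `0` on the first vertex and `1` on the others. -/
def firstStep (r : ℕ) : (Δ[r] : SSet.{u}) ⟶ Δ[1] :=
  SSet.stdSimplex.map (SimplexCategory.mkHom (stepHom r 1))

/-- The degeneracy `Δ^{r+1} → Δ^r` that identifies the first two vertices. -/
def dropFirst (r : ℕ) : (Δ[r + 1] : SSet.{u}) ⟶ Δ[r] :=
  SSet.stdSimplex.map (SimplexCategory.mkHom (degHom 0))

lemma stepMap_zero (r : ℕ) : (stepMap (0 : Fin (r + 1)) : (Δ[r + 1] : SSet.{u}) ⟶ Δ[1])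
    = firstStep (r + 1) := by
  unfold stepMap firstStep
  congr 2
  refine OrderHom.ext _ _ (funext fun j => ?_)
  change (if ((0 : Fin (r + 1)) : ℕ) < j then (1 : Fin 2) else 0) = if (j : ℕ) < 1 then 0 else 1
  rw [Fin.val_zero]
  split_ifs <;> first | rfl | omega

lemma stepMap_succ {r : ℕ} (i : Fin r) : (stepMap i.succ : (Δ[r + 1] : SSet.{u}) ⟶ Δ[1])
    = dropFirst r ≫ stepMap i := by
  refine Eq.trans ?_ (Functor.map_comp (SSet.stdSimplex : SimplexCategory ⥤ SSet.{u}) _ _)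
  refine congrArg (SSet.stdSimplex : SimplexCategory ⥤ SSet.{u}).map ?_
  refine SimplexCategory.Hom.ext _ _ (OrderHom.ext _ _ (funext fun j => ?_))
  change (if ((i.succ : Fin (r + 1)) : ℕ) < j then (1 : Fin 2) else 0)
    = if (i : ℕ) < ((0 : Fin (r + 1)).predAbove j : Fin (r + 1)) then 1 else 0
  rw [Fin.val_succ, predAbove_val, Fin.val_zero]
  split_ifs <;> first | rfl | omega

section step

variable {Y : SSet.{u}} {n r : ℕ} (y : Y _⦋n⦌)

lemma firstStep_chainSimplex {Γ : Fin (n + r + 1) → Fin (n + 1) × Fin (r + 1)} (hΓ : StrictMono Γ) :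
    (Y ◁ firstStep r).app _ (chainSimplex y hΓ)
      = cylSimplex (act ⟨fun j => (Γ j).1, chain_mono_fst hΓ⟩ y) (fibIdx Γ 1) := by
  refine Prod.ext rfl (SSet.stdSimplex.ext _ _ fun j => ?_)
  change stepHom r 1 (Γ j).2 = stepHom (n + r) (fibIdx Γ 1) j
  rw [stepHom_apply, stepHom_apply]
  exact if_congr (lt_pullIdx (chain_mono_snd hΓ) 1 j).symm rfl rfl

variable {Γ' : Fin (n + r + 1) → Fin (n + 1) × Fin (r + 1)} (hΓ' : StrictMono Γ')
  {l : Fin (n + r + 1)} (hl : (Γ' l).2 = 0)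

lemma firstStep_extendChain :
    (Y ◁ firstStep (r + 1)).app _ (chainSimplex y (strictMono_extendChain hΓ' hl))
      = prismSimplex (act ⟨fun j => (Γ' j).1, chain_mono_fst hΓ'⟩ y) l := by
  rw [firstStep_chainSimplex, fibIdx_extendChain, prismSimplex, act_act]
  rfl

lemma dropFirst_extendChain :
    (Y ◁ dropFirst r).app _ (chainSimplex y (strictMono_extendChain hΓ' hl))
      = act (degHom l) (chainSimplex y hΓ') := by
  refine Prod.ext ?_ (SSet.stdSimplex.ext _ _ fun j => ?_)
  · change act _ y = act (degHom l) (act _ y)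
    rw [act_act]
    rfl
  · change (0 : Fin (r + 1)).predAbove (extendChain Γ' l j).2 = (Γ' (l.predAbove j)).2
    refine Fin.ext ?_
    rw [predAbove_val, extendChain_snd, Fin.val_zero]
    by_cases hj : (j : ℕ) ≤ l
    · rw [snd_eq_zero_of_le hΓ' hl (predAbove_le hj)]
      simp [hj]
    · rw [if_neg hj]
      split_ifs <;> omega

/-- The contribution of an extended chain is that of the original chain, with the first factor
replaced by its integral over the segments at the inserted step. -/
lemma chainIntegral_extendChain (η : Forms (Y ⊗ Δ[1])) (ρ : Forms (Y ⊗ Δ[r])) :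
    chainIntegral (n := n) (r := r + 1) (extendChain Γ' l)
        ((formsPull (Y ◁ firstStep (r + 1)) η * formsPull (Y ◁ dropFirst r) ρ).1 (n + (r + 1))
          (chainSimplex y (strictMono_extendChain hΓ' hl)))
      = chainIntegral Γ' (segInt l (η.1 (n + r + 1)
          (prismSimplex (act ⟨fun j => (Γ' j).1, chain_mono_fst hΓ'⟩ y) l))
            * ρ.1 (n + r) (chainSimplex y hΓ')) := by
  rw [← chainIntegral_step (strictMono_extendChain hΓ' hl) hΓ' hl (fun _ => rfl)
      (fun j => extendChain_snd (n := n) (r := r) j),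
    ← firstStep_extendChain y hΓ' hl]
  have h := Forms.value_act ρ (degHom l) (chainSimplex y hΓ')
  rw [← dropFirst_extendChain y hΓ' hl] at h
  change _ = omegaPull l.predAbove _ at h
  rw [← h]
  rfl

end step

/-- Integration over the fibres of `Y × Δ^{r+1} → Y` is integration over the segments from a point
to the end of the first parameter, followed by integration over the fibres of `Y × Δ^r → Y`. -/
lemma fibInt_succ {Y : SSet.{u}} {r : ℕ} (η : Forms (Y ⊗ Δ[1])) (ρ : Forms (Y ⊗ Δ[r])) {n : ℕ}
    (y : Y _⦋n⦌) :
    fibInt (formsPull (Y ◁ firstStep (r + 1)) η * formsPull (Y ◁ dropFirst r) ρ) y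
      = fibInt (formsPull (Y ◁ firstStep r) (segHomotopy Y η) * ρ) y := by
  classical
  have hR : ∀ Γ' : {Γ : Fin (n + r + 1) → Fin (n + 1) × Fin (r + 1) // StrictMono Γ},
      chainIntegral Γ'.1 ((formsPull (Y ◁ firstStep r) (segHomotopy Y η) * ρ).1 (n + r)
        (chainSimplex y Γ'.2))
      = ∑ l : Fin (n + r + 1), if (Γ'.1 l).2 = 0 then chainIntegral Γ'.1 (segInt l (η.1 (n + r + 1)
          (prismSimplex (act ⟨fun j => (Γ'.1 j).1, chain_mono_fst Γ'.2⟩ y) l))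
            * ρ.1 (n + r) (chainSimplex y Γ'.2)) else 0 := by
    intro Γ'
    obtain ⟨G, hG⟩ := exists_linear_chainIntegral Γ'.1
    have h : (formsPull (Y ◁ firstStep r) (segHomotopy Y η) * ρ).1 (n + r) (chainSimplex y Γ'.2)
        = (segHomotopy Y η).1 (n + r) ((Y ◁ firstStep r).app _ (chainSimplex y Γ'.2))
          * ρ.1 (n + r) (chainSimplex y Γ'.2) := rfl
    rw [h, firstStep_chainSimplex, segHomotopy_cylSimplex, Finset.sum_mul, hG, map_sum]
    refine Finset.sum_congr rfl fun l _ => ?_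
    have hc : (l : ℕ) < fibIdx Γ'.1 1 ↔ (Γ'.1 l).2 = 0 := by
      rw [fibIdx_eq, lt_pullIdx (chain_mono_snd Γ'.2), Nat.lt_one_iff, Fin.ext_iff, Fin.val_zero]
    simp only [hc, hG]
    split_ifs
    · rfl
    · rw [zero_mul, map_zero]
  rw [fibInt, fibInt, Finset.sum_congr rfl fun Γ' _ => hR Γ', ← Finset.sum_product',
    ← Finset.sum_filter, eq_comm]
  refine Finset.sum_bij (fun p hp => ⟨extendChain p.1.1 p.2,
    strictMono_extendChain p.1.2 (Finset.mem_filter.1 hp).2⟩) ?_ ?_ ?_ ?_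
  · intros; exact Finset.mem_univ _
  · rintro ⟨⟨Γ, hΓ⟩, l⟩ h ⟨⟨Γ₁, hΓ₁⟩, l₁⟩ h₁ he
    have he' : extendChain Γ l = extendChain Γ₁ l₁ := congrArg Subtype.val he
    have hl : l = l₁ := by
      have h1 := fibIdx_extendChain (Γ' := Γ) (l := l)
      rw [he', fibIdx_extendChain] at h1
      exact Fin.ext (by omega)
    subst hl
    have h2 : collapseChain (extendChain Γ l) l = collapseChain (extendChain Γ₁ l) l :=
      congrArg (collapseChain · l) he'
    rw [collapseChain_extendChain hΓ (Finset.mem_filter.1 h).2,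
      collapseChain_extendChain hΓ₁ (Finset.mem_filter.1 h₁).2] at h2
    subst h2
    rfl
  · rintro ⟨Γ, hΓ⟩ -
    obtain ⟨l, Γ', h1, h2, h3⟩ := exists_extendChain hΓ
    exact ⟨⟨⟨Γ', h1⟩, l⟩, by simpa using h2, Subtype.ext h3⟩
  · rintro ⟨⟨Γ, hΓ⟩, l⟩ h
    exact (chainIntegral_extendChain y hΓ (Finset.mem_filter.1 h).2 η ρ).symm

lemma fibInt_zero {Y : SSet.{u}} (U : Forms (Y ⊗ Δ[1])) {n : ℕ} (y : Y _⦋n⦌) :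
    fibInt (formsPull (Y ◁ firstStep 0) U) y = U.1 n (cylSimplex y (n + 1)) := by
  classical
  let Γ₀ : Fin (n + 0 + 1) → Fin (n + 1) × Fin (0 + 1) := fun j => (j, 0)
  have hΓ₀ : StrictMono Γ₀ :=
    strictMono_of_rank (n := n) (r := 0) (fun _ _ h => h) (fun _ _ _ => le_rfl) fun j => rfl
  rw [fibInt, Finset.sum_eq_single ⟨Γ₀, hΓ₀⟩]
  · have hb : baseIdx (n := n) (r := 0) Γ₀ = id := funext fun i => Fin.ext (by
      rw [baseIdx_val (n := n) (r := 0) hΓ₀, id]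
      exact pullIdx_eq _ (by omega) fun j => Iff.rfl)
    have h : (formsPull (Y ◁ firstStep 0) U).1 (n + 0) (chainSimplex y hΓ₀)
        = U.1 (n + 0) ((Y ◁ firstStep 0).app _ (chainSimplex y hΓ₀)) := rfl
    rw [chainIntegral, h, firstStep_chainSimplex, hb]
    refine (omegaPull_id _).trans ?_
    have h1 : fibIdx (n := n) (r := 0) Γ₀ 1 = n + 1 := pullIdx_of_lt _ Nat.zero_lt_one
    have h2 : act (⟨fun j => j, fun _ _ h => h⟩ : Fin (n + 1) →o Fin (n + 1)) y = y := act_id y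
    rw [h1]
    exact congrArg (fun z => U.1 n (cylSimplex z (n + 1))) h2
  · rintro ⟨Γ, hΓ⟩ - hne
    refine absurd (Subtype.ext (funext fun j => ?_)) hne
    have h := chain_rank (n := n) (r := 0) hΓ j
    have h2 : ((Γ j).2 : ℕ) = 0 := by omega
    exact Prod.ext (Fin.ext (by rw [h2] at h; exact h)) (Fin.ext h2)
  · intro h; exact absurd (Finset.mem_univ _) h

/-- The iteration of the operators `U ↦ T (U η)`. -/
def iterForm {Y : SSet.{u}} (U : Forms (Y ⊗ Δ[1])) (L : List (Forms (Y ⊗ Δ[1]))) :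
    Forms (Y ⊗ Δ[1]) := L.foldl (fun U η => segHomotopy Y (U * η)) U

/-- The integral over the fibres of `Y × Δ^r → Y` of a product of forms that depend on one parameter
each is an iterated integral over segments. -/
lemma fibInt_prod {Y : SSet.{u}} {n : ℕ} (y : Y _⦋n⦌) {r : ℕ} (η : Fin r → Forms (Y ⊗ Δ[1]))
    (U : Forms (Y ⊗ Δ[1])) :
    fibInt (formsPull (Y ◁ firstStep r) U
        * (List.ofFn fun i => formsPull (Y ◁ stepMap i) (η i)).prod) y
      = (iterForm U (List.ofFn η)).1 n (cylSimplex y (n + 1)) := by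
  induction r generalizing U with
  | zero => rw [List.ofFn_zero, List.prod_nil, mul_one, fibInt_zero]; rfl
  | succ r ih =>
    have h : (List.ofFn fun i : Fin r => formsPull (Y ◁ stepMap i.succ) (η i.succ)).prod
        = formsPull (Y ◁ dropFirst r)
          (List.ofFn fun i : Fin r => formsPull (Y ◁ stepMap i) (η i.succ)).prod := by
      rw [map_list_prod, List.map_ofFn]
      congr 2
      funext i
      rw [stepMap_succ]
      rfl
    rw [List.ofFn_succ, List.prod_cons, stepMap_zero, ← mul_assoc, ← map_mul, h, fibInt_succ, ih,
      List.ofFn_succ]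
    rfl

/-- The evaluation `X^{Δ¹} × Δ¹ → X`. -/
def cylEv (X : SSet.{u}) : PathSp X ⊗ Δ[1] ⟶ X :=
  CartesianMonoidalCategory.lift
    (SemiCartesianMonoidalCategory.snd (PathSp X) (Δ[1] : SSet.{u}))
    (SemiCartesianMonoidalCategory.fst (PathSp X) (Δ[1] : SSet.{u})) ≫ pathEv X

/-- The pullback of a form on `X` along the evaluation `X^{Δ¹} × Δ¹ → X`. -/
def evForm {X : SSet.{u}} (ω : DeRham X) : Forms (PathSp X ⊗ Δ[1]) :=
  formsPull (cylEv X) (toForms X ω)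

/-- The iterated integral `∫ ω₁ ⋯ ω_r` is `T(⋯ T(T(η₁) η₂) ⋯ η_r)` at the end `X^{Δ¹} × {0}`, where
`ηᵢ` is the pullback of `ωᵢ` along the evaluation and `T` is the integration over segments. -/
lemma iteratedIntegral_eq {X : SSet.{u}} {r : ℕ} (ω : Fin r → DeRham X) {n : ℕ}
    (γ : (PathSp X) _⦋n⦌) :
    iteratedIntegral ω γ
      = (iterForm 1 (List.ofFn fun i => evForm (ω i))).1 n (cylSimplex γ (n + 1)) := by
  rw [← fibInt_prod, iteratedIntegral, fiberIntegral_eq, map_one, one_mul, pathProd, map_list_prod,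
    List.map_ofFn]
  congr 3
  funext i
  exact toForms_pull _ _

/-! ### Unreduced words -/

section words

variable (K : Type) (A : Type u) [CommRing K] [Ring A] [Algebra K A]

/-- The module `A ⊗ T(A)` of the unreduced words `f[g₁|⋯|g_r]`. -/
def Words : Type u := A ⊗[K] TensorAlgebra K A

instance : AddCommGroup (Words K A) := inferInstanceAs (AddCommGroup (A ⊗[K] TensorAlgebra K A))

instance : Module K (Words K A) := inferInstanceAs (Module K (A ⊗[K] TensorAlgebra K A))

namespace Words

variable {A}

/-- The word `f[]`. -/
def inc : A →ₗ[K] Words K A := (TensorProduct.mk K A (TensorAlgebra K A)).flip 1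

/-- Appending the letter `a` to a word. -/
def app : A →ₗ[K] Words K A →ₗ[K] Words K A :=
  LinearMap.lTensorHom A ∘ₗ (LinearMap.mul K (TensorAlgebra K A)).flip ∘ₗ TensorAlgebra.ι K

variable {K}

/-- Every property that is closed under sums holds for all words if it holds for the words without
letters and is preserved when a letter is appended. -/
@[elab_as_elim]
lemma induction {p : Words K A → Prop} (inc : ∀ f, p (inc K f))
    (app : ∀ a x, p x → p (app K a x)) (add : ∀ x y, p x → p y → p (x + y)) (x : Words K A) :
    p x := by
  have key : ∀ (u t : TensorAlgebra K A) (f : A), (∀ f : A, p (f ⊗ₜ[K] t : A ⊗[K] _)) →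
      p (f ⊗ₜ[K] (t * u) : A ⊗[K] TensorAlgebra K A) := by
    intro u
    induction u using TensorAlgebra.induction with
    | algebraMap r =>
      intro t f h
      have e : (f ⊗ₜ[K] (t * algebraMap K _ r) : A ⊗[K] TensorAlgebra K A) = (r • f) ⊗ₜ[K] t := by
        rw [← Algebra.commutes, ← Algebra.smul_def, tmul_smul, smul_tmul']
      rw [e]
      exact h _
    | ι a =>
      intro t f h
      exact app a _ (h f)
    | mul u v hu hv =>
      intro t f h
      rw [← mul_assoc]
      exact hv _ f fun f => hu t f h
    | add u v hu hv =>
      intro t f h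
      rw [mul_add, tmul_add]
      exact add _ _ (hu t f h) (hv t f h)
  have h0 : p 0 := by simpa using inc 0
  refine TensorProduct.induction_on (R := K) (M := A) (N := TensorAlgebra K A)
    (motive := p) x h0 (fun f t => ?_) add
  rw [← one_mul t]
  exact key t 1 f fun f => inc f

lemma tmul_induction {p : Words K A → Prop} (zero : p 0)
    (tmul : ∀ (f : A) (t : TensorAlgebra K A), p (f ⊗ₜ[K] t : A ⊗[K] TensorAlgebra K A))
    (add : ∀ x y : Words K A, p x → p y → p (x + y)) (x : Words K A) : p x :=
  TensorProduct.induction_on (R := K) (M := A) (N := TensorAlgebra K A) (motive := p) x zero tmul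
    add

variable {N : Type*} [AddCommGroup N] [Module K N]

/-- The linear map on words defined by recursion on the last letter. -/
def recLast (i : A →ₗ[K] N) (s : A →ₗ[K] N →ₗ[K] N) : Words K A →ₗ[K] N :=
  TensorProduct.lift (LinearMap.flip (LinearMap.lcomp K N i ∘ₗ
    (MulOpposite.opLinearEquiv K (M := Module.End K N)).symm.toLinearMap ∘ₗ
    (TensorAlgebra.lift K ((MulOpposite.opLinearEquiv K (M := Module.End K N)).toLinearMap
      ∘ₗ s)).toLinearMap))

variable (i : A →ₗ[K] N) (s : A →ₗ[K] N →ₗ[K] N)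

@[simp] lemma recLast_inc (f : A) : recLast i s (inc K f) = i f := by
  change (MulOpposite.unop (TensorAlgebra.lift K _ (1 : TensorAlgebra K A)) : Module.End K N) (i f)
    = i f
  rw [map_one]
  rfl

@[simp] lemma recLast_app (a : A) (x : Words K A) :
    recLast i s (app K a x) = s a (recLast i s x) := by
  refine tmul_induction (p := fun x => recLast i s (app K a x) = s a (recLast i s x)) (by simp)
    (fun f t => ?_) (fun x y hx hy => ?_) x
  · change (MulOpposite.unop (TensorAlgebra.lift K ((MulOpposite.opLinearEquiv K
      (M := Module.End K N)).toLinearMap ∘ₗ s) (t * TensorAlgebra.ι K a)) : Module.End K N) (i f)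
        = s a ((MulOpposite.unop (TensorAlgebra.lift K ((MulOpposite.opLinearEquiv K
      (M := Module.End K N)).toLinearMap ∘ₗ s) t) : Module.End K N) (i f))
    rw [map_mul, TensorAlgebra.lift_ι_apply]
    rfl
  · rw [map_add, map_add, map_add, map_add, hx, hy]

/-- The linear map on words defined by recursion on the last letter, where the step may depend on
the word itself. -/
def paraLast (s' : A →ₗ[K] Words K A →ₗ[K] N) : Words K A →ₗ[K] N :=
  LinearMap.snd K (Words K A) N ∘ₗ recLast (LinearMap.prod (inc K) i)
    (LinearMap.mk₂ K (fun a p => (app K a p.1, s' a p.1 + s a p.2))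
      (fun a b p => by ext <;> simp; abel) (fun c a p => by ext <;> simp)
      (fun a p q => by ext <;> simp; abel) (fun c a p => by ext <;> simp))

lemma paraLast_aux (s' : A →ₗ[K] Words K A →ₗ[K] N) (x : Words K A) :
    recLast (LinearMap.prod (inc K) i)
      (LinearMap.mk₂ K (fun a p => (app K a p.1, s' a p.1 + s a p.2))
      (fun a b p => by ext <;> simp; abel) (fun c a p => by ext <;> simp)
      (fun a p q => by ext <;> simp; abel) (fun c a p => by ext <;> simp)) x
      = (x, paraLast i s s' x) := by
  refine Prod.ext ?_ rfl
  induction x using induction with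
  | inc f => simp
  | app a x h => simp [h]
  | add x y hx hy => rw [map_add, Prod.fst_add, hx, hy]

@[simp] lemma paraLast_inc (s' : A →ₗ[K] Words K A →ₗ[K] N) (f : A) :
    paraLast i s s' (inc K f) = i f := by
  simp [paraLast]

@[simp] lemma paraLast_app (s' : A →ₗ[K] Words K A →ₗ[K] N) (a : A) (x : Words K A) :
    paraLast i s s' (app K a x) = s' a x + s a (paraLast i s s' x) := by
  rw [paraLast, LinearMap.comp_apply, recLast_app, paraLast_aux]
  rfl

/-- The product of a word with an element of `A` from the left. -/
def lmul : A →ₗ[K] Words K A →ₗ[K] Words K A :=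
  LinearMap.rTensorHom (TensorAlgebra K A) ∘ₗ LinearMap.mul K A

@[simp] lemma lmul_inc (f g : A) : lmul f (inc K g) = inc K (f * g) := rfl

@[simp] lemma lmul_app (f a : A) (x : Words K A) : lmul f (app K a x) = app K a (lmul f x) := by
  refine tmul_induction (p := fun x => lmul f (app K a x) = app K a (lmul f x)) (by simp)
    (fun g t => rfl) (fun x y hx hy => ?_) x
  rw [map_add, map_add, map_add, map_add, hx, hy]

/-- The map that is defined by `h` on words without letters, and with
`interleave h (y[b]) = h (y[b]) + (interleave h y)[b]`. -/
def interleave : (Words K A →ₗ[K] Words K A) →ₗ[K] Words K A →ₗ[K] Words K A :=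
  LinearMap.flip (paraLast (N := (Words K A →ₗ[K] Words K A) →ₗ[K] Words K A)
    (LinearMap.applyₗ ∘ₗ inc K)
    (LinearMap.mk₂ K (fun b n => app K b ∘ₗ n) (fun _ _ _ => by ext; simp)
      (fun _ _ _ => by ext; simp) (fun _ _ _ => by ext; simp) (fun _ _ _ => by ext; simp))
    ((app K).compr₂ LinearMap.applyₗ))

@[simp] lemma interleave_inc (h : Words K A →ₗ[K] Words K A) (f : A) :
    interleave h (inc K f) = h (inc K f) := by
  simp [interleave]

@[simp] lemma interleave_app (h : Words K A →ₗ[K] Words K A) (b : A) (y : Words K A) :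
    interleave h (app K b y) = h (app K b y) + app K b (interleave h y) := by
  simp [interleave]

end Words

end words

section sgn

variable (K : Type) [CommRing K]

@[simp] lemma sgn_zero : sgn K 0 = 1 := by simp [sgn]

@[simp] lemma sgn_one : sgn K 1 = -1 := by simp [sgn]

lemma sgn_add (k l : ℤ) : sgn K (k + l) = sgn K k * sgn K l := by
  simp [sgn, Int.negOnePow_add]

@[simp] lemma sgn_neg (k : ℤ) : sgn K (-k) = sgn K k := by simp [sgn]

lemma sgn_sub (k l : ℤ) : sgn K (k - l) = sgn K k * sgn K l := by
  rw [sub_eq_add_neg, sgn_add, sgn_neg]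

@[simp] lemma sgn_mul_self (k : ℤ) : sgn K k * sgn K k = 1 := by
  rcases Int.even_or_odd k with h | h
  · simp [sgn, Int.negOnePow_even k h]
  · simp [sgn, Int.negOnePow_odd k h]

lemma sgn_even {k : ℤ} (h : Even k) : sgn K k = 1 := by simp [sgn, Int.negOnePow_even k h]

lemma sgn_odd {k : ℤ} (h : Odd k) : sgn K k = -1 := by simp [sgn, Int.negOnePow_odd k h]

lemma sgn_congr {k l : ℤ} (h : Even (k - l)) : sgn K k = sgn K l := by
  rw [← sub_add_cancel k l, sgn_add, sgn_even K h, one_mul]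

end sgn

/-- The structure of a graded commutative differential graded algebra on `A`, given by the
homogeneous elements, the projections to the elements of even and odd degree, and the
differential. -/
structure Cdga (K : Type) (A : Type u) [CommRing K] [Ring A] [Algebra K A] where
  /-- the homogeneous elements -/
  gr : ℤ → Submodule K A
  /-- the projections to the elements of given parity -/
  par : ZMod 2 → A →ₗ[K] A
  /-- the differential -/
  d : A →ₗ[K] A
  iSup_gr : ⨆ k, gr k = ⊤
  par_of_mem : ∀ s k, ∀ a ∈ gr k, par s a = if (k : ZMod 2) = s then a else 0
  one_mem : 1 ∈ gr 0
  mul_mem : ∀ i j, ∀ a ∈ gr i, ∀ b ∈ gr j, a * b ∈ gr (i + j)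
  comm : ∀ i j, ∀ a ∈ gr i, ∀ b ∈ gr j, a * b = sgn K (i * j) • (b * a)
  d_mem : ∀ i, ∀ a ∈ gr i, d a ∈ gr (i + 1)
  d_d : ∀ a, d (d a) = 0
  leibniz : ∀ i, ∀ a ∈ gr i, ∀ b, d (a * b) = d a * b + sgn K i • (a * d b)

namespace Cdga

open Words

variable {K : Type} {A : Type u} [CommRing K] [Ring A] [Algebra K A] (R : Cdga K A)

/-- The sign operator on `A`. -/
def eps : A →ₗ[K] A := R.par 0 - R.par 1

variable {R} in
lemma eps_of_mem {k : ℤ} {a : A} (ha : a ∈ R.gr k) : R.eps a = sgn K k • a := by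
  rw [eps, LinearMap.sub_apply, R.par_of_mem _ k a ha, R.par_of_mem _ k a ha]
  rcases Int.even_or_odd k with h | h
  · have : (k : ZMod 2) = 0 := (ZMod.intCast_zmod_eq_zero_iff_dvd k 2).2 h.two_dvd
    rw [this, if_pos rfl, if_neg (by decide), sgn_even K h, one_smul, sub_zero]
  · have : (k : ZMod 2) = 1 := by
      obtain ⟨m, rfl⟩ := h
      push_cast
      rw [show (2 : ZMod 2) = 0 from rfl, zero_mul, zero_add]
    rw [this, if_pos rfl, if_neg (by decide), sgn_odd K h, neg_one_smul, zero_sub]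

@[elab_as_elim]
lemma gr_induction {p : A → Prop} (mem : ∀ k, ∀ a ∈ R.gr k, p a)
    (add : ∀ a b, p a → p b → p (a + b)) (a : A) : p a :=
  Submodule.iSup_induction R.gr (motive := p) (R.iSup_gr ▸ Submodule.mem_top : a ∈ ⨆ k, R.gr k) mem
    (mem 0 0 (zero_mem _)) add

variable {R} in
lemma eps_mem {k : ℤ} {a : A} (ha : a ∈ R.gr k) : R.eps a ∈ R.gr k := by
  rw [eps_of_mem ha]; exact Submodule.smul_mem _ _ ha

@[simp] lemma eps_eps (a : A) : R.eps (R.eps a) = a := by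
  induction a using R.gr_induction with
  | mem k a ha => rw [eps_of_mem ha, map_smul, eps_of_mem ha, smul_smul, sgn_mul_self, one_smul]
  | add a b ha hb => rw [map_add, map_add, ha, hb]

lemma eps_mul (a b : A) : R.eps (a * b) = R.eps a * R.eps b := by
  induction a using R.gr_induction with
  | mem k a ha =>
    induction b using R.gr_induction with
    | mem l b hb =>
      rw [eps_of_mem (R.mul_mem _ _ a ha b hb), eps_of_mem ha, eps_of_mem hb, sgn_add,
        smul_mul_smul_comm]
    | add b b' hb hb' => rw [mul_add, map_add, map_add, mul_add, hb, hb']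
  | add a a' ha ha' => rw [add_mul, map_add, map_add, add_mul, ha, ha']

lemma eps_d (a : A) : R.eps (R.d a) = - R.d (R.eps a) := by
  induction a using R.gr_induction with
  | mem k a ha =>
    rw [eps_of_mem (R.d_mem k a ha), eps_of_mem ha, map_smul, sgn_add, sgn_one, mul_neg_one,
      neg_smul]
  | add a b ha hb => rw [map_add, map_add, map_add, map_add, ha, hb, neg_add]

lemma d_mul (a b : A) : R.d (a * b) = R.d a * b + R.eps a * R.d b := by
  induction a using R.gr_induction with
  | mem k a ha => rw [R.leibniz k a ha, eps_of_mem ha, smul_mul_assoc]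
  | add a a' ha ha' => rw [add_mul, map_add, ha, ha', map_add, map_add, add_mul, add_mul]; abel

/-- The homogeneous words: their letters are homogeneous; a letter of degree `l` contributes
`l - 1` to the degree. -/
inductive IsHom : ℤ → Words K A → Prop where
  /-- a word without letters -/
  | inc (k : ℤ) (f : A) (hf : f ∈ R.gr k) : IsHom k (inc K f)
  /-- a word with an appended letter -/
  | app (k l : ℤ) (a : A) (x : Words K A) (ha : a ∈ R.gr l) (hx : IsHom k x) :
    IsHom (k + (l - 1)) (app K a x)

@[elab_as_elim]
lemma app_induction {p : Words K A → Prop} (inc : ∀ k, ∀ f ∈ R.gr k, p (inc K f))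
    (app : ∀ k, ∀ a ∈ R.gr k, ∀ x, p x → p (app K a x)) (add : ∀ x y, p x → p y → p (x + y))
    (x : Words K A) : p x := by
  induction x using Words.induction with
  | inc f =>
    induction f using R.gr_induction with
    | mem k f hf => exact inc k f hf
    | add f g hf hg => rw [map_add]; exact add _ _ hf hg
  | app a x hx =>
    induction a using R.gr_induction with
    | mem k a ha => exact app k a ha x hx
    | add a b ha hb => rw [map_add]; exact add _ _ ha hb
  | add x y hx hy => exact add x y hx hy

/-- The sign operator on words, for the degrees `|f| + ∑ᵢ (|gᵢ| - 1)`. -/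
def sg : Words K A →ₗ[K] Words K A := recLast (inc K ∘ₗ R.eps) (- (app K ∘ₗ R.eps))

@[simp] lemma sg_inc (f : A) : R.sg (inc K f) = inc K (R.eps f) := by simp [sg]

lemma sg_app (a : A) (x : Words K A) : R.sg (app K a x) = - app K (R.eps a) (R.sg x) := by
  simp [sg]

@[simp] lemma sg_sg (x : Words K A) : R.sg (R.sg x) = x := by
  induction x using Words.induction with
  | inc f => simp
  | app a x h => simp [sg_app, h]
  | add x y hx hy => rw [map_add, map_add, hx, hy]

variable {R} in
lemma IsHom.sg {k : ℤ} {x : Words K A} (hx : R.IsHom k x) : R.sg x = sgn K k • x := by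
  induction hx with
  | inc k f hf => rw [sg_inc, eps_of_mem hf, map_smul]
  | app k l a x ha _ ih =>
    rw [sg_app, ih, eps_of_mem ha, map_smul, map_smul, LinearMap.smul_apply, sgn_add, sgn_sub,
      sgn_one, mul_neg_one, mul_neg, neg_smul, smul_smul]

/-- The powers of the sign operator. -/
def tw (k : ℤ) : Words K A →ₗ[K] Words K A := if Even k then LinearMap.id else R.sg

lemma tw_even {k : ℤ} (h : Even k) (x : Words K A) : R.tw k x = x := by rw [tw, if_pos h]; rfl

lemma tw_odd {k : ℤ} (h : Odd k) (x : Words K A) : R.tw k x = R.sg x := by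
  rw [tw, if_neg (Int.not_even_iff_odd.2 h)]

lemma tw_tw (k l : ℤ) (x : Words K A) : R.tw k (R.tw l x) = R.tw (k + l) x := by
  rcases Int.even_or_odd k with hk | hk <;> rcases Int.even_or_odd l with hl | hl
  · rw [tw_even _ hk, tw_even _ hl, tw_even _ (hk.add hl)]
  · rw [tw_even _ hk, tw_odd _ hl, tw_odd _ (hk.add_odd hl)]
  · rw [tw_odd _ hk, tw_even _ hl, tw_odd _ (hk.add_even hl)]
  · rw [tw_odd _ hk, tw_odd _ hl, tw_even _ (hk.add_odd hl), sg_sg]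

lemma sg_eq_tw (x : Words K A) : R.sg x = R.tw 1 x := (R.tw_odd odd_one x).symm

lemma tw_sg (k : ℤ) (x : Words K A) : R.tw k (R.sg x) = R.sg (R.tw k x) := by
  rw [sg_eq_tw, sg_eq_tw, tw_tw, tw_tw, add_comm]

variable {R} in
lemma tw_app (k : ℤ) {l : ℤ} {a : A} (ha : a ∈ R.gr l) (x : Words K A) :
    R.tw k (app K a x) = sgn K (k * (l - 1)) • app K a (R.tw k x) := by
  rcases Int.even_or_odd k with hk | hk
  · rw [tw_even _ hk, tw_even _ hk, sgn_even K (hk.mul_right _), one_smul]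
  · rw [tw_odd _ hk, tw_odd _ hk, sg_app, eps_of_mem ha, map_smul, LinearMap.smul_apply, ← neg_smul]
    congr 1
    rw [sgn_congr K (k := k * (l - 1)) (l := l - 1), sgn_sub, sgn_one, mul_neg_one]
    obtain ⟨m, rfl⟩ := hk
    exact ⟨m * (l - 1), by ring⟩

variable {R} in
lemma tw_inc (k : ℤ) {l : ℤ} {f : A} (hf : f ∈ R.gr l) :
    R.tw k (inc K f) = sgn K (k * l) • inc K f := by
  rcases Int.even_or_odd k with hk | hk
  · rw [tw_even _ hk, sgn_even K (hk.mul_right _), one_smul]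
  · rw [tw_odd _ hk, sg_inc, eps_of_mem hf, map_smul]
    congr 1
    refine sgn_congr K ?_
    obtain ⟨m, rfl⟩ := hk
    exact ⟨- (m * l), by ring⟩

variable {R} in
lemma IsHom.tw {l : ℤ} {x : Words K A} (hx : R.IsHom l x) (k : ℤ) :
    R.tw k x = sgn K (k * l) • x := by
  rcases Int.even_or_odd k with hk | hk
  · rw [tw_even _ hk, sgn_even K (hk.mul_right _), one_smul]
  · rw [tw_odd _ hk, hx.sg]
    congr 1
    refine sgn_congr K ?_
    obtain ⟨m, rfl⟩ := hk
    exact ⟨- (m * l), by ring⟩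

/-! ### The shuffle product of words -/

/-- The shuffle product of words: the last letter of a product is the last letter of one of the
factors. -/
def mul : Words K A →ₗ[K] Words K A →ₗ[K] Words K A :=
  recLast lmul (LinearMap.mk₂ K
    (fun a m => interleave (app K (R.par 0 a) ∘ₗ m ∘ₗ R.sg + app K (R.par 1 a) ∘ₗ m))
    (fun a b m => by simp only [map_add, LinearMap.add_comp]; abel)
    (fun c a m => by simp only [map_smul, map_add, LinearMap.smul_comp, smul_add])
    (fun a m m' => by simp only [map_add, LinearMap.add_comp, LinearMap.comp_add]; abel)
    (fun c a m => by
      simp only [map_smul, map_add, LinearMap.smul_comp, LinearMap.comp_smul, smul_add]))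

@[simp] lemma inc_mul (f : A) (y : Words K A) : R.mul (inc K f) y = lmul f y := by simp [mul]

variable {R} in
lemma app_mul {k : ℤ} {a : A} (ha : a ∈ R.gr k) (x : Words K A) :
    R.mul (app K a x) = interleave (app K a ∘ₗ R.mul x ∘ₗ R.tw (k - 1)) := by
  rw [mul, recLast_app, LinearMap.mk₂_apply, R.par_of_mem _ k a ha, R.par_of_mem _ k a ha]
  congr 1
  rcases Int.even_or_odd k with h | h
  · have : (k : ZMod 2) = 0 := (ZMod.intCast_zmod_eq_zero_iff_dvd k 2).2 h.two_dvd
    rw [this, if_pos rfl, if_neg (by decide), map_zero, LinearMap.zero_comp, add_zero, tw,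
      if_neg (by rw [Int.not_even_iff_odd]; exact h.sub_odd odd_one)]
  · have : (k : ZMod 2) = 1 := by
      obtain ⟨m, rfl⟩ := h
      push_cast
      rw [show (2 : ZMod 2) = 0 from rfl, zero_mul, zero_add]
    rw [this, if_pos rfl, if_neg (by decide), map_zero, LinearMap.zero_comp, zero_add, tw,
      if_pos (h.sub_odd odd_one), LinearMap.comp_id]

variable {R} in
lemma app_mul_inc {k : ℤ} {a : A} (ha : a ∈ R.gr k) (x : Words K A) (f : A) :
    R.mul (app K a x) (inc K f) = app K a (R.mul x (R.tw (k - 1) (inc K f))) := by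
  rw [app_mul ha, interleave_inc]; rfl

variable {R} in
/-- The recursion for the shuffle product: the last letter of a shuffle comes from either factor,
and moving `a` past the second factor costs the sign of its degree `k - 1`. -/
lemma app_mul_app {k : ℤ} {a : A} (ha : a ∈ R.gr k) (x : Words K A) (b : A) (y : Words K A) :
    R.mul (app K a x) (app K b y) = app K a (R.mul x (R.tw (k - 1) (app K b y)))
      + app K b (R.mul (app K a x) y) := by
  rw [app_mul ha, interleave_app]; rfl

lemma one_mul (y : Words K A) : R.mul (inc K 1) y = y := by
  rw [inc_mul]
  induction y using Words.induction with
  | inc f => rw [lmul_inc, _root_.one_mul]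
  | app a x h => rw [lmul_app, h]
  | add x y hx hy => rw [map_add, hx, hy]

lemma mul_one (x : Words K A) : R.mul x (inc K 1) = x := by
  induction x using R.app_induction with
  | inc k f hf => rw [inc_mul, lmul_inc, _root_.mul_one]
  | app k a ha x h =>
    rw [app_mul_inc ha, tw_inc _ R.one_mem, mul_zero, sgn_zero, one_smul, h]
  | add x y hx hy => rw [map_add, LinearMap.add_apply, hx, hy]

lemma sg_lmul (f : A) (x : Words K A) : R.sg (lmul f x) = lmul (R.eps f) (R.sg x) := by
  induction x using Words.induction with
  | inc g => simp [eps_mul]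
  | app a x h => simp [sg_app, h]
  | add x y hx hy => simp only [map_add, hx, hy]

lemma sg_mul (x y : Words K A) : R.sg (R.mul x y) = R.mul (R.sg x) (R.sg y) := by
  induction x using R.app_induction generalizing y with
  | inc k f hf => rw [inc_mul, sg_inc, inc_mul, sg_lmul]
  | app k a ha x hx =>
    induction y using R.app_induction with
    | inc l f hf =>
      rw [app_mul_inc ha, sg_app, sg_app, map_neg, LinearMap.neg_apply, sg_inc,
        app_mul_inc (eps_mem ha), hx, ← tw_sg, sg_inc]
    | app l b hb y hy =>
      rw [app_mul_app ha, map_add, sg_app, sg_app, sg_app, hx, hy, sg_app, ← tw_sg, sg_app]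
      simp only [map_neg, LinearMap.neg_apply, neg_neg]
      rw [app_mul_app (eps_mem ha)]
    | add y z hy hz => simp only [map_add, hy, hz]
  | add x z hx hz => simp only [map_add, LinearMap.add_apply, hx, hz]

lemma tw_mul (k : ℤ) (x y : Words K A) : R.tw k (R.mul x y) = R.mul (R.tw k x) (R.tw k y) := by
  rcases Int.even_or_odd k with hk | hk
  · simp only [tw_even _ hk]
  · simp only [tw_odd _ hk, sg_mul]

lemma lmul_mul (f : A) (x y : Words K A) : R.mul (lmul f x) y = lmul f (R.mul x y) := by
  induction x using R.app_induction generalizing y with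
  | inc k g hg =>
    rw [lmul_inc, inc_mul, inc_mul]
    induction y using Words.induction with
    | inc h => simp [_root_.mul_assoc]
    | app a x h => simp [h]
    | add x y hx hy => simp only [map_add, hx, hy]
  | app k a ha x hx =>
    induction y using Words.induction with
    | inc h => rw [lmul_app, app_mul_inc ha, app_mul_inc ha, hx, lmul_app]
    | app b y hy =>
      rw [lmul_app, app_mul_app ha, app_mul_app ha, hx, map_add, lmul_app, lmul_app, ← hy, lmul_app]
    | add x y hx hy => simp only [map_add, hx, hy]
  | add x z hx hz => simp only [map_add, LinearMap.add_apply, hx, hz]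

lemma mul_assoc (x y z : Words K A) : R.mul (R.mul x y) z = R.mul x (R.mul y z) := by
  induction x using R.app_induction generalizing y z with
  | inc k f hf => rw [inc_mul, inc_mul, lmul_mul]
  | app k a ha x hx =>
    induction y using R.app_induction generalizing z with
    | inc l g hg =>
      rw [app_mul_inc ha, inc_mul]
      induction z using R.app_induction with
      | inc m h hh => rw [app_mul_inc ha, lmul_inc, app_mul_inc ha, hx, ← tw_mul, inc_mul, lmul_inc]
      | app m c hc z hz =>
        rw [app_mul_app ha, lmul_app, app_mul_app ha, hx, ← tw_mul, inc_mul, lmul_app, hz]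
      | add z z' hz hz' => simp only [map_add, hz, hz']
    | app l b hb y hy =>
      induction z using R.app_induction with
      | inc m h hh =>
        rw [app_mul_app ha, map_add, LinearMap.add_apply, app_mul_inc ha, app_mul_inc hb, hy, hx,
          ← tw_mul, app_mul_inc hb, app_mul_app ha]
      | app m c hc z hz =>
        have h1 := hz
        rw [app_mul_app ha, map_add, LinearMap.add_apply] at h1
        rw [app_mul_app ha, map_add, LinearMap.add_apply, app_mul_app ha, app_mul_app hb, hy, hx,
          ← tw_mul, app_mul_app hb, map_add, map_add, map_add, map_add, app_mul_app ha,
          app_mul_app ha, ← h1, map_add]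
        abel
      | add z z' hz hz' => simp only [map_add, hz, hz']
    | add y y' hy hy' => simp only [map_add, LinearMap.add_apply, hy, hy']
  | add x z hx hz => simp only [map_add, LinearMap.add_apply, hx, hz]

end Cdga

namespace Cdga

open Words

variable {K : Type} {A : Type u} [CommRing K] [Ring A] [Algebra K A] (R : Cdga K A)

@[elab_as_elim]
lemma hom_induction {p : Words K A → Prop} (hom : ∀ k x, R.IsHom k x → p x)
    (add : ∀ x y, p x → p y → p (x + y)) (x : Words K A) : p x := by
  have h : x ∈ Submodule.span K {x | ∃ k, R.IsHom k x} := by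
    induction x using R.app_induction with
    | inc k f hf => exact Submodule.subset_span ⟨k, .inc k f hf⟩
    | app k a ha x hx =>
      have : Submodule.span K {x | ∃ k, R.IsHom k x}
          ≤ (Submodule.span K {x | ∃ k, R.IsHom k x}).comap (app K a) := by
        refine Submodule.span_le.2 ?_
        rintro x ⟨l, hl⟩
        exact Submodule.subset_span ⟨_, .app _ _ _ _ ha hl⟩
      exact this hx
    | add x y hx hy => exact add_mem hx hy
  have hsmul : ∀ (c : K) k x, R.IsHom k x → R.IsHom k (c • x) := fun c k x hx => by
    induction hx with
    | inc k f hf => rw [← map_smul]; exact .inc _ _ (Submodule.smul_mem _ _ hf)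
    | app k l a x ha _ ih => rw [← map_smul]; exact .app _ _ _ _ ha ih
  have h0 : p 0 := hom 0 0 (by simpa using IsHom.inc (R := R) 0 0 (zero_mem _))
  obtain ⟨n, c, g, rfl⟩ := Submodule.mem_span_set'.1 h
  refine Finset.sum_induction _ p add h0 fun i _ => ?_
  obtain ⟨k, hk⟩ := (g i).2
  exact hom k _ (hsmul _ _ _ hk)

variable {R} in
/-- The shuffle product is graded commutative. -/
lemma IsHom.mul_comm {k l : ℤ} {x y : Words K A} (hx : R.IsHom k x) (hy : R.IsHom l y) :
    R.mul x y = sgn K (k * l) • R.mul y x := by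
  induction hx generalizing y l with
  | inc k f hf =>
    induction hy with
    | inc l g hg =>
      rw [inc_mul, inc_mul, lmul_inc, lmul_inc, ← map_smul, ← R.comm k l f hf g hg]
    | app l m b y hb hy ih =>
      rw [inc_mul, lmul_app, app_mul_inc hb, tw_inc _ hf, map_smul, map_smul, smul_smul,
        ← inc_mul R, ih, map_smul]
      congr 1
      rw [← sgn_add]
      exact sgn_congr K ⟨- ((m - 1) * k), by ring⟩
  | app k m a x ha hx ih =>
    induction hy with
    | inc l g hg =>
      rw [inc_mul, lmul_app, app_mul_inc ha, tw_inc _ hg, map_smul, ih (.inc l g hg), inc_mul,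
        smul_smul, map_smul, ← sgn_add]
      congr 2
      ring
    | app l m' b y hb hy ih' =>
      have hB := IsHom.app _ _ _ _ hb hy
      have hA := IsHom.app _ _ _ _ ha hx
      rw [app_mul_app ha, app_mul_app hb, hB.tw, hA.tw, map_smul, map_smul, map_smul, map_smul,
        ih hB, ih', map_smul, map_smul, smul_add, smul_smul, smul_smul, add_comm, ← sgn_add,
        ← sgn_add]
      congr 2
      · exact sgn_congr K ⟨- ((m' - 1) * (k + (m - 1))), by ring⟩
      · congr 2
        ring

/-- The span of the homogeneous words of degree `k`. -/
def homSpan (k : ℤ) : Submodule K (Words K A) := Submodule.span K {x | R.IsHom k x}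

variable {R} in
lemma IsHom.mem {k : ℤ} {x : Words K A} (hx : R.IsHom k x) : x ∈ R.homSpan k :=
  Submodule.subset_span hx

variable {R} in
lemma map_mem_of_isHom {N : Type*} [AddCommGroup N] [Module K N] (φ : Words K A →ₗ[K] N)
    {S : Submodule K N} {k : ℤ} (h : ∀ x, R.IsHom k x → φ x ∈ S) {x : Words K A}
    (hx : x ∈ R.homSpan k) : φ x ∈ S :=
  (Submodule.span_le.2 h : R.homSpan k ≤ S.comap φ) hx

variable {R} in
lemma app_mem {k l m : ℤ} {a : A} {x : Words K A} (ha : a ∈ R.gr l) (hx : x ∈ R.homSpan k)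
    (h : k + (l - 1) = m) : app K a x ∈ R.homSpan m := by
  subst h
  exact map_mem_of_isHom (app K a) (fun x hx => (IsHom.app _ _ _ _ ha hx).mem) hx

variable {R} in
lemma sg_of_mem {k : ℤ} {x : Words K A} (hx : x ∈ R.homSpan k) : R.sg x = sgn K k • x := by
  have h : R.homSpan k ≤ LinearMap.eqLocus R.sg (sgn K k • LinearMap.id) :=
    Submodule.span_le.2 fun x hx => hx.sg
  exact h hx

variable {R} in
lemma sg_mem {k : ℤ} {x : Words K A} (hx : x ∈ R.homSpan k) : R.sg x ∈ R.homSpan k := by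
  rw [sg_of_mem hx]; exact Submodule.smul_mem _ _ hx

variable {R} in
lemma tw_mem (l : ℤ) {k : ℤ} {x : Words K A} (hx : x ∈ R.homSpan k) : R.tw l x ∈ R.homSpan k := by
  rcases Int.even_or_odd l with h | h
  · rwa [tw_even _ h]
  · rw [tw_odd _ h]; exact sg_mem hx

variable {R} in
lemma mul_mem_homSpan {k l : ℤ} {x y : Words K A} (hx : x ∈ R.homSpan k) (hy : y ∈ R.homSpan l) :
    R.mul x y ∈ R.homSpan (k + l) := by
  refine map_mem_of_isHom (R.mul.flip y) (fun x hx => ?_) hx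
  refine map_mem_of_isHom (R.mul x) (fun y hy => ?_) hy
  clear * - hx hy
  induction hx generalizing y l with
  | inc k f hf =>
    rw [inc_mul]
    induction hy with
    | inc l g hg => exact (IsHom.inc _ _ (R.mul_mem _ _ f hf g hg)).mem
    | app l m b y hb hy ih => rw [lmul_app]; exact app_mem hb ih (by ring)
  | app k m a x ha hx ih =>
    induction hy with
    | inc l g hg =>
      rw [app_mul_inc ha, tw_inc _ hg, map_smul, map_smul]
      exact Submodule.smul_mem _ _ (app_mem ha (ih _ (.inc _ g hg)) (by ring))
    | app l m' b y hb hy ih' =>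
      have hB := IsHom.app _ _ _ _ hb hy
      rw [app_mul_app ha, hB.tw, map_smul, map_smul]
      exact add_mem (Submodule.smul_mem _ _ (app_mem ha (ih _ hB) (by ring)))
        (app_mem hb ih' (by ring))

/-! ### The differential on words -/

/-- The map `(x, a) ↦ f[g₁|⋯|g_r a]` for `x = f[g₁|⋯|g_r]`, with the sign of the external
differential: the last letter of `x` is multiplied by `a`. -/
def merge : Words K A →ₗ[K] A →ₗ[K] Words K A :=
  paraLast (N := A →ₗ[K] Words K A) ((LinearMap.mul K A).compr₂ (inc K) ∘ₗ R.eps) 0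
    (LinearMap.mk₂ K (fun b x => - ((app K).flip (R.sg x) ∘ₗ LinearMap.mul K A (R.eps b)))
      (fun _ _ _ => by ext; simp; abel) (fun _ _ _ => by ext; simp)
      (fun _ _ _ => by ext; simp; abel) (fun _ _ _ => by ext; simp))

@[simp] lemma merge_inc (f a : A) : R.merge (inc K f) a = inc K (R.eps f * a) := by
  simp [merge]

@[simp] lemma merge_app (b : A) (x : Words K A) (a : A) :
    R.merge (app K b x) a = - app K (R.eps b * a) (R.sg x) := by
  simp [merge]

/-- The internal differential on words. -/
def D₁ : Words K A →ₗ[K] Words K A :=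
  paraLast (inc K ∘ₗ R.d) (app K) (- (app K).compl₁₂ R.d R.sg)

/-- The external differential on words, without the face that multiplies the last letter with the
right factor. -/
def D₂ : Words K A →ₗ[K] Words K A := paraLast 0 (app K) R.merge.flip

@[simp] lemma D₁_inc (f : A) : R.D₁ (inc K f) = inc K (R.d f) := by simp [D₁]

lemma D₁_app (a : A) (x : Words K A) :
    R.D₁ (app K a x) = app K a (R.D₁ x) - app K (R.d a) (R.sg x) := by
  simp [D₁]; abel

@[simp] lemma D₂_inc (f : A) : R.D₂ (inc K f) = 0 := by simp [D₂]

lemma D₂_app (a : A) (x : Words K A) : R.D₂ (app K a x) = app K a (R.D₂ x) + R.merge x a := by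
  simp [D₂]; abel

/-- The differential on words. -/
def D : Words K A →ₗ[K] Words K A := R.D₁ + R.D₂

@[simp] lemma D_inc (f : A) : R.D (inc K f) = inc K (R.d f) := by simp [D]

lemma D_app (a : A) (x : Words K A) :
    R.D (app K a x) = app K a (R.D x) - app K (R.d a) (R.sg x) + R.merge x a := by
  rw [D, LinearMap.add_apply, D₁_app, D₂_app, LinearMap.add_apply, map_add]; abel

lemma sg_merge (x : Words K A) (a : A) : R.sg (R.merge x a) = R.merge (R.sg x) (R.eps a) := by
  induction x using Words.induction with
  | inc f => simp [eps_mul]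
  | app b x h => simp [sg_app, eps_mul]
  | add x y hx hy => simp only [map_add, LinearMap.add_apply, hx, hy]

lemma D_sg (x : Words K A) : R.D (R.sg x) = - R.sg (R.D x) := by
  induction x using Words.induction with
  | inc f => simp [eps_d]
  | app b x h => simp [sg_app, D_app, h, sg_merge, eps_d]
  | add x y hx hy => simp only [map_add, hx, hy, neg_add]

lemma D_tw (k : ℤ) (x : Words K A) : R.D (R.tw k x) = sgn K k • R.tw k (R.D x) := by
  rcases Int.even_or_odd k with hk | hk
  · rw [tw_even _ hk, tw_even _ hk, sgn_even K hk, one_smul]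
  · rw [tw_odd _ hk, tw_odd _ hk, sgn_odd K hk, D_sg, neg_one_smul]

lemma merge_merge (x : Words K A) (a b : A) :
    R.merge (R.merge x b) a = R.merge (R.sg x) (R.eps b * a) := by
  induction x using Words.induction with
  | inc f => simp [eps_mul, _root_.mul_assoc]
  | app c x h => simp [sg_app, eps_mul, _root_.mul_assoc]
  | add x y hx hy => simp only [map_add, LinearMap.add_apply, hx, hy]

/-- The operator `merge · a` anticommutes with the differential up to the differential of `a`. -/
lemma merge_D (x : Words K A) (a : A) :
    R.merge (R.D x) a + R.D (R.merge x a) = R.merge (R.sg x) (R.d a) := by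
  induction x using Words.induction with
  | inc f => simp [d_mul, eps_d]
  | app b x h =>
    simp [sg_app, D_app, merge_merge, D_sg, d_mul, eps_d]
    abel
  | add x y hx hy =>
    simp only [map_add, LinearMap.add_apply, ← hx, ← hy]
    abel

lemma D_D (x : Words K A) : R.D (R.D x) = 0 := by
  induction x using Words.induction with
  | inc f => simp [R.d_d]
  | app a x h =>
    have h1 := R.merge_D x a
    simp only [D_app, map_add, map_sub, h, map_zero, R.d_d, LinearMap.zero_apply, D_sg, map_neg,
      sg_sg, ← h1]
    abel
  | add x y hx hy => rw [map_add, map_add, hx, hy, add_zero]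

lemma merge_lmul (f : A) (x : Words K A) (a : A) :
    R.merge (lmul f x) a = lmul (R.eps f) (R.merge x a) := by
  induction x using Words.induction with
  | inc g => simp [eps_mul, _root_.mul_assoc]
  | app b x h => simp [sg_lmul]
  | add x y hx hy => simp only [map_add, LinearMap.add_apply, hx, hy]

lemma D_lmul (f : A) (x : Words K A) :
    R.D (lmul f x) = lmul (R.d f) x + lmul (R.eps f) (R.D x) := by
  induction x using Words.induction with
  | inc g => simp [d_mul]
  | app b x h => simp [D_app, h, merge_lmul, sg_lmul]; abel
  | add x y hx hy => simp only [map_add, hx, hy]; abel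

variable {R}

lemma sg_tw_tw (k l : ℤ) (x : Words K A) :
    R.sg (R.tw (l - 1) (R.tw (k - 1) x)) = R.tw (l + k - 1) x := by
  rw [sg_eq_tw, tw_tw, tw_tw]
  congr 2
  ring

lemma merge_mul_inc {k : ℤ} {a : A} (ha : a ∈ R.gr k) (x : Words K A) {m : ℤ} {g : A}
    (hg : g ∈ R.gr m) :
    R.merge (R.mul x (R.tw (k - 1) (inc K g))) a = R.mul (R.merge x a) (inc K g) := by
  induction x using R.app_induction with
  | inc l f hf =>
    rw [tw_inc _ hg, map_smul, map_smul, LinearMap.smul_apply, inc_mul, lmul_inc, merge_inc,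
      merge_inc, inc_mul, lmul_inc, ← map_smul, eps_mul, eps_of_mem hg, _root_.mul_assoc,
      _root_.mul_assoc, R.comm k m a ha g hg, mul_smul_comm, smul_mul_assoc, mul_smul_comm,
      smul_smul, ← sgn_add]
    congr 3
    ring
  | app l c hc x hx =>
    have hm := R.mul_mem _ _ _ (eps_mem hc) _ ha
    rw [tw_inc _ hg, map_smul, app_mul_inc hc, ← map_smul, ← map_smul, ← map_smul, ← tw_inc _ hg,
      merge_app, merge_app, map_neg, LinearMap.neg_apply, app_mul_inc hm, sg_mul, sg_tw_tw]
  | add x y hx hy => simp only [map_add, LinearMap.add_apply, hx, hy]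

/-- Multiplying the last letter of a shuffle of `x` and `y[b]` by `a`. The last term, in which that
letter is `b`, cancels against the corresponding one of `merge_app_mul`, as letters of different
factors are adjacent in both orders. -/
lemma merge_mul_app {k l : ℤ} {a b : A} (ha : a ∈ R.gr k) (hb : b ∈ R.gr l) (x y : Words K A) :
    R.merge (R.mul x (R.tw (k - 1) (app K b y))) a
      = R.mul (R.merge x a) (app K b y) - app K b (R.mul (R.merge x a) y)
        - sgn K ((k - 1) * (l - 1)) • app K (R.eps b * a) (R.sg (R.mul x (R.tw (k - 1) y))) := by
  have hB := tw_app (k - 1) hb y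
  induction x using R.app_induction with
  | inc m f hf =>
    rw [hB, map_smul, map_smul, LinearMap.smul_apply, inc_mul, lmul_app, merge_app, merge_inc,
      inc_mul, lmul_app, inc_mul, sub_self, zero_sub, smul_neg, inc_mul]
  | app m c hc x hx =>
    have hm := R.mul_mem _ _ _ (eps_mem hc) _ ha
    have key : R.mul (app K c x) (R.tw (k - 1) (app K b y))
        = app K c (R.mul x (R.tw (m - 1) (R.tw (k - 1) (app K b y))))
          + sgn K ((k - 1) * (l - 1)) • app K b (R.mul (app K c x) (R.tw (k - 1) y)) := by
      rw [hB, map_smul, app_mul_app hc, smul_add, map_smul, map_smul, map_smul]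
    rw [key, map_add, map_smul, LinearMap.add_apply, LinearMap.smul_apply, merge_app, merge_app,
      merge_app, map_neg, LinearMap.neg_apply, LinearMap.neg_apply, map_neg, app_mul_app hm,
      sg_mul _ x, sg_tw_tw, smul_neg]
    abel
  | add x y hx hy => simp only [map_add, LinearMap.add_apply, hx, hy, smul_add]; abel

lemma sg_app_of_mem {k : ℤ} {a : A} (ha : a ∈ R.gr k) (x : Words K A) :
    R.sg (app K a x) = sgn K (k - 1) • app K a (R.sg x) := by
  rw [sg_app, eps_of_mem ha, map_smul, LinearMap.smul_apply, sgn_sub, sgn_one, mul_neg_one,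
    neg_smul]

lemma merge_app_mul {k : ℤ} {a : A} (ha : a ∈ R.gr k) (x y : Words K A) (b : A) :
    R.merge (R.mul (app K a x) y) b
      = R.mul (R.sg (app K a x)) (R.merge y b)
        - sgn K (k - 1) • app K a (R.mul (R.sg x) (R.tw (k - 1) (R.merge y b)))
        - app K (R.eps a * b) (R.sg (R.mul x (R.tw (k - 1) y))) := by
  induction y using Words.induction with
  | inc g =>
    rw [app_mul_inc ha, merge_app, merge_inc, sg_app_of_mem ha, map_smul, LinearMap.smul_apply,
      app_mul_inc ha, sub_self, zero_sub]
  | app c y hy =>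
    rw [app_mul_app ha, map_add, LinearMap.add_apply, merge_app, merge_app, merge_app, sg_mul _ _ y,
      sg_app_of_mem ha]
    simp only [map_smul, map_neg, LinearMap.smul_apply, smul_neg, app_mul_app ha, smul_add]
    abel
  | add y z hy hz => simp only [map_add, LinearMap.add_apply, hy, hz, smul_add]; abel

variable (R)

/-- The differential on words is a graded derivation with respect to the shuffle product. -/
lemma D_mul (x y : Words K A) : R.D (R.mul x y) = R.mul (R.D x) y + R.mul (R.sg x) (R.D y) := by
  induction x using R.app_induction generalizing y with
  | inc k f hf => rw [inc_mul, D_lmul, D_inc, sg_inc, inc_mul, inc_mul]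
  | app k a ha x hx =>
    have hda := R.d_mem k a ha
    have hk : R.sg ∘ₗ R.tw (k - 1) = R.tw (k + 1 - 1) := by
      ext x
      rw [LinearMap.comp_apply, sg_eq_tw, tw_tw]
      congr 2
      ring
    have hk' : ∀ x, R.sg (R.tw (k - 1) x) = R.tw (k + 1 - 1) x := fun x => LinearMap.congr_fun hk x
    induction y using R.app_induction with
    | inc l g hg =>
      rw [app_mul_inc ha, D_app, hx, merge_mul_inc ha x hg, D_app, sg_mul, hk', sg_app_of_mem ha,
        D_tw, D_inc]
      simp only [map_add, map_sub, map_smul, LinearMap.add_apply, LinearMap.sub_apply,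
        LinearMap.smul_apply, app_mul_inc ha, app_mul_inc hda]
      abel
    | app l b hb y hy =>
      have h1 : sgn K ((k - 1) * (l - 1)) • app K (R.eps b * a) (R.sg (R.mul x (R.tw (k - 1) y)))
          = - app K (R.eps a * b) (R.sg (R.mul x (R.tw (k - 1) y))) := by
        rw [← LinearMap.smul_apply, ← map_smul, ← LinearMap.neg_apply, ← map_neg, eps_of_mem hb,
          eps_of_mem ha, smul_mul_assoc, smul_mul_assoc, R.comm l k b hb a ha, smul_smul, smul_smul,
          ← sgn_add, ← sgn_add, ← neg_one_smul K, smul_smul, ← sgn_one, ← sgn_add]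
        congr 3
        exact sgn_congr K ⟨l * k - k, by ring⟩
      rw [app_mul_app ha, map_add, D_app, D_app _ b, hx, merge_mul_app ha hb, D_tw, D_app _ b, hy,
        D_app _ a, h1, merge_app_mul ha, sg_mul _ x, sg_mul _ x, sg_mul, hk', sg_app_of_mem ha]
      simp only [map_add, map_sub, map_smul, LinearMap.add_apply, LinearMap.sub_apply,
        LinearMap.smul_apply, app_mul_app ha, app_mul_app hda, smul_add, smul_sub]
      abel
    | add y z hy hz => simp only [map_add, hy, hz]; abel
  | add x z hx hz => simp only [map_add, LinearMap.add_apply, hx, hz]; abel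

variable {R} in
lemma merge_mem {k l : ℤ} {a : A} {x : Words K A} (ha : a ∈ R.gr l) (hx : R.IsHom k x) :
    R.merge x a ∈ R.homSpan (k + l) := by
  cases hx with
  | inc k f hf =>
    rw [merge_inc]
    exact (IsHom.inc _ _ (R.mul_mem _ _ _ (eps_mem hf) _ ha)).mem
  | app k m b x hb hx =>
    rw [merge_app]
    exact neg_mem (app_mem (R.mul_mem _ _ _ (eps_mem hb) _ ha) (sg_mem hx.mem) (by ring))

variable {R} in
lemma D_mem {k : ℤ} {x : Words K A} (hx : x ∈ R.homSpan k) : R.D x ∈ R.homSpan (k + 1) := by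
  refine map_mem_of_isHom R.D (fun x hx => ?_) hx
  clear * - hx
  induction hx with
  | inc k f hf => rw [D_inc]; exact (IsHom.inc _ _ (R.d_mem _ _ hf)).mem
  | app k l a x ha hx ih =>
    rw [D_app]
    have h := merge_mem ha hx
    rw [show k + (l - 1) + 1 = k + l by ring]
    exact add_mem (sub_mem (app_mem ha ih (by ring))
      (app_mem (R.d_mem _ _ ha) (sg_mem hx.mem) (by ring))) h

end Cdga

/-! ### Shuffles -/

section perm

variable {N : ℕ}

/-- The permutation of `Fin (N + 1)` that maps the last element to `x`, and the others, in the
order given by `τ`, to the elements different from `x`. -/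
def snocPerm (x : Fin (N + 1)) (τ : Equiv.Perm (Fin N)) : Equiv.Perm (Fin (N + 1)) :=
  ((finSuccEquiv' (Fin.last N)).trans (Equiv.optionCongr τ)).trans (finSuccEquiv' x).symm

@[simp] lemma snocPerm_last (x : Fin (N + 1)) (τ : Equiv.Perm (Fin N)) :
    snocPerm x τ (Fin.last N) = x := by
  simp [snocPerm]

@[simp] lemma snocPerm_castSucc (x : Fin (N + 1)) (τ : Equiv.Perm (Fin N)) (i : Fin N) :
    snocPerm x τ i.castSucc = x.succAbove (τ i) := by
  have : finSuccEquiv' (Fin.last N) i.castSucc = some i := by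
    rw [← Fin.succAbove_last, finSuccEquiv'_succAbove]
  simp [snocPerm, this]

lemma snocPerm_symm_self (x : Fin (N + 1)) (τ : Equiv.Perm (Fin N)) :
    (snocPerm x τ).symm x = Fin.last N := by
  rw [Equiv.symm_apply_eq, snocPerm_last]

lemma snocPerm_symm_succAbove (x : Fin (N + 1)) (τ : Equiv.Perm (Fin N)) (i : Fin N) :
    (snocPerm x τ).symm (x.succAbove i) = (τ.symm i).castSucc := by
  rw [Equiv.symm_apply_eq, snocPerm_castSucc, Equiv.apply_symm_apply]

lemma snocPerm_bijective :
    Function.Bijective fun p : Fin (N + 1) × Equiv.Perm (Fin N) => snocPerm p.1 p.2 := by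
  refine (Fintype.bijective_iff_injective_and_card _).2 ⟨?_, ?_⟩
  · rintro ⟨x, τ⟩ ⟨y, ρ⟩ h
    have h' : snocPerm x τ = snocPerm y ρ := h
    have hx : x = y := by rw [← snocPerm_last x τ, h', snocPerm_last]
    subst hx
    refine Prod.ext rfl (Equiv.ext fun i => ?_)
    refine Fin.succAbove_right_injective (p := x) ?_
    rw [← snocPerm_castSucc, h', snocPerm_castSucc]
  · rw [Fintype.card_prod, Fintype.card_perm, Fintype.card_perm, Fintype.card_fin, Fintype.card_fin,
      Nat.factorial_succ]

/-- The permutations `σ` for which `σ⁻¹` is increasing on the first `p` elements and on the other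
elements. -/
def IsShuffle (p : ℕ) (σ : Equiv.Perm (Fin N)) : Prop :=
  ∀ i j : Fin N, i < j → ((j : ℕ) < p ∨ p ≤ (i : ℕ)) → σ.symm i < σ.symm j

lemma isShuffle_one (p : ℕ) : IsShuffle p (1 : Equiv.Perm (Fin N)) := fun _ _ h _ => h

lemma eq_one_of_strictMono {σ : Equiv.Perm (Fin N)} (h : StrictMono σ.symm) : σ = 1 := by
  have h1 : (h.orderIsoOfSurjective _ σ.symm.surjective) = OrderIso.refl _ := Subsingleton.elim _ _
  refine Equiv.ext fun i => ?_
  have h2 : σ.symm (σ i) = σ i := congrArg (fun e : Fin N ≃o Fin N => e (σ i)) h1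
  rw [Equiv.symm_apply_apply] at h2
  exact h2.symm

lemma isShuffle_zero_iff {σ : Equiv.Perm (Fin N)} : IsShuffle 0 σ ↔ σ = 1 :=
  ⟨fun h => eq_one_of_strictMono fun i j hij => h i j hij (Or.inr (Nat.zero_le _)),
    fun h => h ▸ isShuffle_one _⟩

lemma isShuffle_self_iff {σ : Equiv.Perm (Fin N)} : IsShuffle N σ ↔ σ = 1 :=
  ⟨fun h => eq_one_of_strictMono fun i j hij => h i j hij (Or.inl j.2),
    fun h => h ▸ isShuffle_one _⟩

/-- The last letter of a shuffle is the last letter of one of the factors. -/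
lemma isShuffle_snocPerm_iff {p : ℕ} (x : Fin (N + 1)) (τ : Equiv.Perm (Fin N)) :
    IsShuffle (p + 1) (snocPerm x τ) ↔
      (x = Fin.last N ∧ IsShuffle (p + 1) τ) ∨ ((x : ℕ) = p ∧ IsShuffle p τ) := by
  have hval : ∀ i : Fin N, ((x.succAbove i : Fin (N + 1)) : ℕ)
      = if (i : ℕ) < x then (i : ℕ) else i + 1 := fun i => by
    by_cases h : (i : ℕ) < x
    · rw [if_pos h, Fin.succAbove_of_castSucc_lt _ _ h, Fin.val_castSucc]
    · rw [if_neg h, Fin.succAbove_of_le_castSucc _ _ (not_lt.1 h), Fin.val_succ]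
  constructor
  · intro h
    have hx : x = Fin.last N ∨ (x : ℕ) = p := by
      by_contra hx
      rw [not_or] at hx
      have hxN : (x : ℕ) < N := lt_of_le_of_ne (Nat.lt_succ_iff.1 x.2) fun h => hx.1 (Fin.ext h)
      have h1 := h x ⟨x + 1, by omega⟩ (Fin.lt_def.2 (Nat.lt_succ_self _))
        (by simp only; omega)
      rw [snocPerm_symm_self] at h1
      exact absurd h1 (not_lt.2 (Fin.le_last _))
    have key : ∀ i j : Fin N, i < j → (((x.succAbove j : Fin (N + 1)) : ℕ) < p + 1
        ∨ p + 1 ≤ ((x.succAbove i : Fin (N + 1)) : ℕ)) → τ.symm i < τ.symm j := fun i j hij h1 => by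
      have := h _ _ ((Fin.strictMono_succAbove x) hij) h1
      rwa [snocPerm_symm_succAbove, snocPerm_symm_succAbove] at this
    rcases hx with hx | hx
    · refine Or.inl ⟨hx, fun i j hij h1 => key i j hij ?_⟩
      have hi := i.2
      have hj := j.2
      rw [hval, hval, hx, Fin.val_last, if_pos hi, if_pos hj]
      exact h1
    · refine Or.inr ⟨hx, fun i j hij h1 => key i j hij ?_⟩
      rw [hval, hval, hx]
      split_ifs <;> omega
  · intro h i j hij h1
    have hxj : i ≠ x := by
      rintro rfl
      have hij' : (i : ℕ) < j := hij
      have hj := j.2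
      rcases h with ⟨h, -⟩ | ⟨h, -⟩
      · rw [h, Fin.val_last] at hij'; omega
      · omega
    obtain ⟨i, rfl⟩ := Fin.exists_succAbove_eq hxj
    by_cases hjx : j = x
    · rw [hjx, snocPerm_symm_self, snocPerm_symm_succAbove]
      exact Fin.castSucc_lt_last _
    · obtain ⟨j, rfl⟩ := Fin.exists_succAbove_eq hjx
      rw [snocPerm_symm_succAbove, snocPerm_symm_succAbove, Fin.castSucc_lt_castSucc_iff]
      have hij' : i < j := (Fin.strictMono_succAbove x).lt_iff_lt.1 hij
      have hi := i.2
      have hj := j.2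
      rw [hval, hval] at h1
      rcases h with ⟨h, h2⟩ | ⟨h, h2⟩
      · refine h2 i j hij' ?_
        rw [h, Fin.val_last, if_pos hi, if_pos hj] at h1
        exact h1
      · refine h2 i j hij' ?_
        rw [h] at h1
        split_ifs at h1 <;> omega

open Classical in
/-- The sum over the shuffles of two nonempty words splits according to the factor that contains the
last letter. -/
lemma sum_isShuffle {M : Type*} [AddCommMonoid M] {p : ℕ} (hp : p < N)
    (F : Equiv.Perm (Fin (N + 1)) → M) :
    ∑ σ with IsShuffle (p + 1) σ, F σ
      = ∑ τ with IsShuffle p τ, F (snocPerm ⟨p, by omega⟩ τ)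
        + ∑ τ with IsShuffle (p + 1) τ, F (snocPerm (Fin.last N) τ) := by
  rw [Finset.sum_filter, ← snocPerm_bijective.sum_comp, Fintype.sum_prod_type,
    Fin.sum_univ_castSucc]
  congr 1
  · rw [Finset.sum_eq_single (⟨p, hp⟩ : Fin N), Finset.sum_filter]
    · refine Finset.sum_congr rfl fun τ _ => if_congr ?_ rfl rfl
      rw [isShuffle_snocPerm_iff]
      have : (⟨p, hp⟩ : Fin N).castSucc ≠ Fin.last N := (Fin.castSucc_lt_last _).ne
      exact ⟨fun h => h.elim (fun h => absurd h.1 this) fun h => h.2, fun h => Or.inr ⟨rfl, h⟩⟩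
    · intro x _ hx
      refine Finset.sum_eq_zero fun τ _ => if_neg ?_
      rw [isShuffle_snocPerm_iff]
      rintro (⟨h, -⟩ | ⟨h, -⟩)
      · exact (Fin.castSucc_lt_last _).ne h
      · exact hx (Fin.ext h)
    · intro h; exact absurd (Finset.mem_univ _) h
  · rw [Finset.sum_filter]
    refine Finset.sum_congr rfl fun τ _ => if_congr ?_ rfl rfl
    rw [isShuffle_snocPerm_iff]
    have : ¬ ((Fin.last N : Fin (N + 1)) : ℕ) = p := by rw [Fin.val_last]; omega
    exact ⟨fun h => h.elim (fun h => h.2) fun h => absurd h.1 this, fun h => Or.inl ⟨rfl, h⟩⟩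

variable (K : Type) [CommRing K]

/-- The Koszul sign of a permutation, by recursion on its last letter: that letter moves past the
ones after it. -/
lemma koszul_snocPerm (x : Fin (N + 1)) (τ : Equiv.Perm (Fin N)) (s : Fin (N + 1) → ZMod 2) :
    Bar.koszul K (snocPerm x τ) s = Bar.koszul K τ (fun i => s (x.succAbove i))
      * ∏ i, if x < x.succAbove i then Bar.zsgn K (s (x.succAbove i) * s x) else 1 := by
  unfold Bar.koszul
  rw [Fin.prod_univ_castSucc]
  have h1 : (∏ j, if Fin.last N < j ∧ snocPerm x τ j < snocPerm x τ (Fin.last N) then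
      Bar.zsgn K (s (snocPerm x τ (Fin.last N)) * s (snocPerm x τ j)) else 1) = 1 :=
    Finset.prod_eq_one fun j _ => if_neg fun h => absurd h.1 (not_lt.2 (Fin.le_last _))
  rw [h1, mul_one, ← Equiv.prod_comp τ (fun i => if x < x.succAbove i then
    Bar.zsgn K (s (x.succAbove i) * s x) else 1), ← Finset.prod_mul_distrib]
  refine Finset.prod_congr rfl fun i _ => ?_
  rw [Fin.prod_univ_castSucc]
  congr 1
  · refine Finset.prod_congr rfl fun j _ => ?_
    simp only [snocPerm_castSucc, Fin.castSucc_lt_castSucc_iff,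
      (Fin.strictMono_succAbove x).lt_iff_lt]
  · simp [Fin.castSucc_lt_last]

lemma koszul_one (s : Fin N → ZMod 2) : Bar.koszul K 1 s = 1 :=
  Finset.prod_eq_one fun _ _ => Finset.prod_eq_one fun _ _ =>
    if_neg fun h => absurd h.1 (lt_asymm h.2)

lemma zsgn_intCast (k : ℤ) : Bar.zsgn K (k : ZMod 2) = sgn K k := by
  rcases Int.even_or_odd k with h | h
  · rw [(ZMod.intCast_zmod_eq_zero_iff_dvd k 2).2 h.two_dvd, sgn_even K h]
    exact if_pos rfl
  · have : (k : ZMod 2) = 1 := by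
      obtain ⟨m, rfl⟩ := h
      push_cast
      rw [show (2 : ZMod 2) = 0 from rfl, zero_mul, zero_add]
    rw [this, sgn_odd K h]
    exact if_neg (by decide)

lemma sgn_sum {ι : Type*} (t : Finset ι) (k : ι → ℤ) :
    sgn K (∑ i ∈ t, k i) = ∏ i ∈ t, sgn K (k i) := by
  classical
  induction t using Finset.induction_on with
  | empty => simp
  | insert a t ha ih => rw [Finset.sum_insert ha, Finset.prod_insert ha, sgn_add, ih]

end perm

section cword

variable {K : Type} {A : Type u} [CommRing K] [Ring A] [Algebra K A]

namespace Words

variable (K) in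
/-- The word `f[g₁|⋯|g_r]`. -/
def cword {r : ℕ} (f : A) (g : Fin r → A) : Words K A :=
  (f ⊗ₜ[K] TensorAlgebra.tprod K A r g : A ⊗[K] TensorAlgebra K A)

lemma cword_zero (f : A) (g : Fin 0 → A) : cword K f g = inc K f := by
  rw [cword, TensorAlgebra.tprod_apply, List.ofFn_zero, List.prod_nil]
  rfl

lemma cword_succ {r : ℕ} (f : A) (g : Fin (r + 1) → A) :
    cword K f g = app K (g (Fin.last r)) (cword K f fun i => g i.castSucc) := by
  rw [cword, TensorAlgebra.tprod_apply, List.ofFn_succ', List.concat_eq_append, List.prod_append,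
    List.prod_singleton]
  rw [cword, TensorAlgebra.tprod_apply]
  rfl

lemma app_cword {r : ℕ} (a f : A) (g : Fin r → A) :
    app K a (cword K f g) = cword K f (Fin.snoc (α := fun _ => A) g a) := by
  rw [cword_succ, Fin.snoc_last]
  simp only [Fin.snoc_castSucc]

lemma lmul_cword {r : ℕ} (e f : A) (g : Fin r → A) : lmul e (cword K f g) = cword K (e * f) g := rfl

@[elab_as_elim]
lemma cword_induction {p : Words K A → Prop} (cword : ∀ (r : ℕ) (f : A) (g : Fin r → A),
    p (cword K f g)) (add : ∀ x y, p x → p y → p (x + y)) (x : Words K A) : p x := by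
  have h : x ∈ AddSubmonoid.closure (M := Words K A) {x | ∃ (r : ℕ) (f : A) (g : Fin r → A),
      x = Words.cword K f g} := by
    induction x using Words.induction with
    | inc f => exact AddSubmonoid.subset_closure ⟨0, f, Fin.elim0, (cword_zero _ _).symm⟩
    | app a x hx =>
      induction hx using AddSubmonoid.closure_induction with
      | mem x hx =>
        obtain ⟨r, f, g, rfl⟩ := hx
        exact AddSubmonoid.subset_closure ⟨r + 1, f, _, app_cword _ _ _⟩
      | zero => rw [map_zero]; exact zero_mem _
      | add x y _ _ hx hy => rw [map_add]; exact add_mem hx hy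
    | add x y hx hy => exact add_mem hx hy
  induction h using AddSubmonoid.closure_induction with
  | mem x hx =>
    obtain ⟨r, f, g, rfl⟩ := hx
    exact cword r f g
  | zero => have := cword 0 0 Fin.elim0; rwa [cword_zero, map_zero] at this
  | add x y _ _ hx hy => exact add x y hx hy

end Words

namespace Cdga

open Words

variable {R : Cdga K A}

lemma isHom_cword {r : ℕ} {a : ℤ} {b : Fin r → ℤ} {f : A} {g : Fin r → A} (hf : f ∈ R.gr a)
    (hg : ∀ i, g i ∈ R.gr (b i)) : R.IsHom (a + ∑ i, (b i - 1)) (cword K f g) := by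
  induction r with
  | zero => rw [cword_zero, Fin.sum_univ_zero, add_zero]; exact .inc _ _ hf
  | succ r ih =>
    rw [cword_succ, Fin.sum_univ_castSucc, ← add_assoc]
    exact .app _ _ _ _ (hg _) (ih fun i => hg _)

lemma IsHom.exists_cword {k : ℤ} {x : Words K A} (hx : R.IsHom k x) :
    ∃ (r : ℕ) (a : ℤ) (b : Fin r → ℤ) (f : A) (g : Fin r → A), f ∈ R.gr a ∧
      (∀ i, g i ∈ R.gr (b i)) ∧ k = a + ∑ i, (b i - 1) ∧ x = cword K f g := by
  induction hx with
  | inc k f hf => exact ⟨0, k, Fin.elim0, f, Fin.elim0, hf, fun i => i.elim0, by simp,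
      (cword_zero _ _).symm⟩
  | app k l c x hc _ ih =>
    obtain ⟨r, a, b, f, g, hf, hg, rfl, rfl⟩ := ih
    refine ⟨r + 1, a, Fin.snoc (α := fun _ => ℤ) b l, f, Fin.snoc (α := fun _ => A) g c, hf,
      fun i => ?_, ?_, app_cword _ _ _⟩
    · refine Fin.lastCases ?_ (fun i => ?_) i
      · rw [Fin.snoc_last, Fin.snoc_last]; exact hc
      · rw [Fin.snoc_castSucc, Fin.snoc_castSucc]; exact hg i
    · rw [Fin.sum_univ_castSucc, Fin.snoc_last, ← add_assoc]
      simp only [Fin.snoc_castSucc]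

lemma cword_mul_inc {r : ℕ} {a : ℤ} {b : Fin r → ℤ} {f e : A} {g : Fin r → A}
    (hg : ∀ i, g i ∈ R.gr (b i)) (he : e ∈ R.gr a) :
    R.mul (cword K f g) (inc K e) = sgn K ((∑ i, (b i - 1)) * a) • cword K (f * e) g := by
  induction r with
  | zero => rw [cword_zero, cword_zero, inc_mul, lmul_inc, Fin.sum_univ_zero, zero_mul, sgn_zero,
      one_smul]
  | succ r ih =>
    rw [cword_succ, app_mul_inc (hg _), tw_inc _ he, map_smul, ih fun i => hg _, map_smul, map_smul,
      cword_succ, Fin.sum_univ_castSucc, smul_smul, add_mul, sgn_add, mul_comm]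

open Classical in
/-- The shuffle product, written as a sum over all shuffles. -/
lemma cword_mul_cword {N p q : ℕ} (hN : N = p + q) (f : A) (w : Fin N → A) (s : Fin N → ℤ)
    (hw : ∀ i, w i ∈ R.gr (s i)) (g : Fin p → A) (g' : Fin q → A)
    (hg : ∀ (i : Fin p) (j : Fin N), (j : ℕ) = i → g i = w j)
    (hg' : ∀ (i : Fin q) (j : Fin N), (j : ℕ) = p + i → g' i = w j) :
    R.mul (cword K f g) (cword K 1 g')
      = ∑ σ with IsShuffle p σ, Bar.koszul K σ (fun i => ((s i - 1 : ℤ) : ZMod 2)) •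
          cword K f (fun i => w (σ i)) := by
  induction N generalizing p q with
  | zero =>
    obtain ⟨rfl, rfl⟩ : p = 0 ∧ q = 0 := by omega
    simp only [isShuffle_zero_iff, Finset.filter_eq', Finset.mem_univ, if_true,
      Finset.sum_singleton, koszul_one, one_smul]
    rw [cword_zero, cword_zero, cword_zero, inc_mul, lmul_inc, _root_.mul_one]
  | succ N ih =>
    rcases p with _ | p
    · simp only [isShuffle_zero_iff, Finset.filter_eq', Finset.mem_univ, if_true,
        Finset.sum_singleton, koszul_one, one_smul]
      obtain rfl : q = N + 1 := by omega
      rw [cword_zero, inc_mul, lmul_cword, _root_.mul_one]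
      congr 1
      funext i
      exact hg' i i (by omega)
    rcases q with _ | q
    · obtain rfl : p = N := by omega
      simp only [isShuffle_self_iff, Finset.filter_eq', Finset.mem_univ, if_true,
        Finset.sum_singleton, koszul_one, one_smul]
      rw [cword_zero 1 g', Cdga.mul_one]
      congr 1
      funext i
      exact hg i i rfl
    obtain rfl : N = p + (q + 1) := by omega
    have hpN : p < p + (q + 1) := by omega
    set x : Fin (p + (q + 1) + 1) := ⟨p, by omega⟩
    have hval : ∀ i : Fin (p + (q + 1)), ((x.succAbove i : Fin (p + (q + 1) + 1)) : ℕ)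
        = if (i : ℕ) < p then (i : ℕ) else i + 1 := fun i => by
      by_cases h : (i : ℕ) < p
      · rw [if_pos h, Fin.succAbove_of_castSucc_lt _ _ h, Fin.val_castSucc]
      · rw [if_neg h, Fin.succAbove_of_le_castSucc _ _ (not_lt.1 h), Fin.val_succ]
    -- the degrees of the letters of the right factor
    set t : Fin (q + 1) → ℤ := fun j => s (x.succAbove (Fin.natAdd p j)) with ht
    have hgt : ∀ j, g' j ∈ R.gr (t j) := fun j => by
      rw [hg' j (x.succAbove (Fin.natAdd p j))]
      · exact hw _
      · rw [hval, Fin.val_natAdd, if_neg (by omega)]; omega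
    have ha : g (Fin.last p) = w x := hg _ _ rfl
    have hb : g' (Fin.last q) = w (Fin.last _) := hg' _ _ (by simp only [Fin.val_last]; omega)
    have hB := (isHom_cword R.one_mem hgt).tw (s x - 1)
    have hA := cword_succ (K := K) f g
    rw [sum_isShuffle hpN]
    have h1 := ih (p := p) (q := q + 1) rfl (fun i => w (x.succAbove i))
      (fun i => s (x.succAbove i))
      (fun i => hw _) (fun i => g i.castSucc) g'
      (fun i j hij => hg _ _ (by rw [hval, if_pos (by omega), hij, Fin.val_castSucc]))
      (fun i j hij => hg' _ _ (by rw [hval, if_neg (by omega), hij]; omega))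
    have h2 := ih (p := p + 1) (q := q) (by omega) (fun i => w i.castSucc) (fun i => s i.castSucc)
      (fun i => hw _) g (fun i => g' i.castSucc)
      (fun i j hij => hg _ _ hij) (fun i j hij => hg' _ _ hij)
    have h3 : R.mul (cword K f g) (cword K 1 g')
        = app K (w x) (R.mul (cword K f fun i => g i.castSucc) (R.tw (s x - 1) (cword K 1 g')))
          + app K (w (Fin.last _)) (R.mul (cword K f g) (cword K 1 fun i => g' i.castSucc)) := by
      rw [hA, cword_succ 1 g', ha, hb, app_mul_app (hw x)]
    rw [h3, hB, map_smul, h1, h2, map_smul, map_sum, map_sum, Finset.smul_sum]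
    congr 1
    · refine Finset.sum_congr rfl fun τ _ => ?_
      rw [koszul_snocPerm, map_smul, smul_smul, cword_succ f fun i => w (snocPerm _ τ i),
        snocPerm_last, mul_comm]
      simp only [snocPerm_castSucc]
      congr 2
      rw [Fin.prod_univ_add, Finset.prod_eq_one, _root_.one_mul, zero_add, Finset.mul_sum, sgn_sum]
      · refine Finset.prod_congr rfl fun j _ => ?_
        rw [if_pos, ← Int.cast_mul, zsgn_intCast, mul_comm]
        rw [Fin.lt_def, hval, Fin.val_natAdd, if_neg (by omega)]
        simp only
        omega
      · intro i _
        refine if_neg ?_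
        have := i.2
        rw [Fin.lt_def, hval, Fin.val_castAdd, if_pos this]
        simp only
        omega
    · refine Finset.sum_congr rfl fun τ _ => ?_
      rw [koszul_snocPerm, map_smul, cword_succ f fun i => w (snocPerm _ τ i), snocPerm_last,
        Finset.prod_eq_one, _root_.mul_one]
      · simp only [snocPerm_castSucc, Fin.succAbove_last]
      · intro i _
        exact if_neg (not_lt.2 (Fin.le_last _))

end Cdga

end cword

/-! ### The bar construction in terms of words -/

namespace Bar

open Words

variable {K : Type} [CommRing K] {𝒜 : ℤ → Type u} [∀ k, AddCommGroup (𝒜 k)] [∀ k, Module K (𝒜 k)]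
  [DirectSum.GRing 𝒜] [DirectSum.GAlgebra K 𝒜]

section

variable {K : Type} [CommRing K] {𝒜 : ℤ → Type u} [∀ k, AddCommGroup (𝒜 k)] [∀ k, Module K (𝒜 k)]
  [DirectSum.GRing 𝒜]

lemma total_induction_word {p : Total K 𝒜 → Prop}
    (word : ∀ (r : ℕ) (f : ⨁ k, 𝒜 k) (g : Fin r → ⨁ k, 𝒜 k) (h : ⨁ k, 𝒜 k), p (word K f g h))
    (add : ∀ x y, p x → p y → p (x + y)) (x : Total K 𝒜) : p x := by
  have h0 : p 0 := by
    have := word 0 0 Fin.elim0 0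
    rwa [Bar.word, pureWord, tmul_zero, map_zero] at this
  have hadd : ∀ r (y z : Part K 𝒜 r), p (DirectSum.lof K ℕ (Part K 𝒜) r y) →
      p (DirectSum.lof K ℕ (Part K 𝒜) r z) → p (DirectSum.lof K ℕ (Part K 𝒜) r (y + z)) :=
    fun r y z hy hz => by rw [map_add]; exact add _ _ hy hz
  refine DirectSum.induction_on x h0 (fun r y => ?_) add
  change p (DirectSum.lof K ℕ (Part K 𝒜) r y)
  refine TensorProduct.induction_on (motive := fun y => p (DirectSum.lof K ℕ (Part K 𝒜) r y)) y
    (by rwa [map_zero]) (fun w h => ?_) (hadd r)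
  refine TensorProduct.induction_on (motive := fun w => p (DirectSum.lof K ℕ (Part K 𝒜) r (w ⊗ₜ h)))
    w (by rwa [zero_tmul, map_zero]) (fun f t => ?_)
    (fun w w' h1 h2 => by rw [add_tmul]; exact hadd r _ _ h1 h2)
  refine PiTensorProduct.induction_on
    (motive := fun t => p (DirectSum.lof K ℕ (Part K 𝒜) r ((f ⊗ₜ t) ⊗ₜ h))) t (fun c g => ?_)
    (fun t t' h1 h2 => by rw [tmul_add, add_tmul]; exact hadd r _ _ h1 h2)
  obtain ⟨g, rfl⟩ : ∃ g' : Fin r → ⨁ k, 𝒜 k, (fun i => Submodule.Quotient.mk (g' i)) = g :=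
    ⟨fun i => (g i).out, funext fun i => Quotient.out_eq _⟩
  rw [tmul_smul, smul_tmul']
  exact word r (c • f) g h

end

/-- The summand `A ⊗ A^{⊗ r} → A ⊗ Ā^{⊗ r}` of the reduction of words, with the right factor. -/
def toTotalPart (r : ℕ) : ⨂[K]^r (⨁ k, 𝒜 k) →ₗ[K]
    (⨁ k, 𝒜 k) →ₗ[K] (⨁ k, 𝒜 k) →ₗ[K] Total K 𝒜 :=
  (LinearMap.llcomp K (⨁ k, 𝒜 k) ((⨁ k, 𝒜 k) ⊗[K] (⨂[K]^r (Red K 𝒜)))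
      ((⨁ k, 𝒜 k) →ₗ[K] Total K 𝒜)
      ((TensorProduct.mk K ((⨁ k, 𝒜 k) ⊗[K] (⨂[K]^r (Red K 𝒜))) (⨁ k, 𝒜 k)).compr₂
        (DirectSum.lof K ℕ (Part K 𝒜) r))) ∘ₗ
    (TensorProduct.mk K (⨁ k, 𝒜 k) (⨂[K]^r (Red K 𝒜))).flip ∘ₗ
    PiTensorProduct.map fun _ => Submodule.mkQ _

/-- The element `x h` of the bar construction, for an unreduced word `x = f[g₁|⋯|g_r]`. -/
def ofWords : Words K (⨁ k, 𝒜 k) →ₗ[K] (⨁ k, 𝒜 k) →ₗ[K] Total K 𝒜 :=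
  TensorProduct.lift (LinearMap.flip (DirectSum.toModule K ℕ _ toTotalPart ∘ₗ
    (TensorAlgebra.toDirectSum (R := K) (M := ⨁ k, 𝒜 k)).toLinearMap))

@[simp] lemma ofWords_cword {r : ℕ} (f : ⨁ k, 𝒜 k) (g : Fin r → ⨁ k, 𝒜 k) (h : ⨁ k, 𝒜 k) :
    ofWords (cword K f g) h = word K f g h := by
  change DirectSum.toModule K ℕ _ toTotalPart
    (TensorAlgebra.toDirectSum (TensorAlgebra.tprod K _ r g)) f h = _
  rw [TensorAlgebra.toDirectSum_tensorPower_tprod, ← DirectSum.lof_eq_of K, DirectSum.toModule_lof]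
  change DirectSum.lof K ℕ (Part K 𝒜) r ((f ⊗ₜ[K] (PiTensorProduct.map
    (fun _ => Submodule.mkQ _) (PiTensorProduct.tprod K g))) ⊗ₜ[K] h) = _
  rw [PiTensorProduct.map_tprod]
  rfl

variable (d : (⨁ k, 𝒜 k) →ₗ[K] ⨁ k, 𝒜 k) (hd : d 1 = 0)

/-- The differential graded algebra `⨁ₖ 𝒜 k`, as raw data. -/
abbrev algData : CochainAlgData.{u} K where
  carrier := ⨁ k, 𝒜 k
  gr k := LinearMap.range (DirectSum.lof K ℤ 𝒜 k)
  d := d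
  mul := LinearMap.mul K (⨁ k, 𝒜 k)
  one := 1

variable {d} (H : IsCommCochainAlg (algData d))

/-- The differential graded algebra `⨁ₖ 𝒜 k`. -/
def cdga : Cdga K (⨁ k, 𝒜 k) where
  gr k := LinearMap.range (DirectSum.lof K ℤ 𝒜 k)
  par := parity 𝒜
  d := d
  iSup_gr := H.internal.submodule_iSup_eq_top
  par_of_mem := by
    rintro s k _ ⟨a, rfl⟩
    rw [parity, DirectSum.toModule_lof]
    split_ifs <;> rfl
  one_mem := H.one_mem
  mul_mem := H.mul_mem
  comm := H.mul_comm
  d_mem := H.d_mem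
  d_d := H.d_d
  leibniz := H.leibniz

variable {H}

lemma lof_mem (k : ℤ) (a : 𝒜 k) : DirectSum.lof K ℤ 𝒜 k a ∈ (cdga H).gr k := ⟨a, rfl⟩

variable (H)

@[elab_as_elim]
lemma total_induction {p : Total K 𝒜 → Prop}
    (word : ∀ k x, (cdga H).IsHom k x → ∀ l, ∀ h ∈ (cdga H).gr l, p (ofWords x h))
    (add : ∀ x y, p x → p y → p (x + y)) (x : Total K 𝒜) : p x := by
  have hw : ∀ x h, p (ofWords x h) := fun x h => by
    induction x using (cdga H).hom_induction with
    | hom k x hx =>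
      induction h using (cdga H).gr_induction with
      | mem l h hh => exact word k x hx l h hh
      | add h h' h1 h2 => rw [map_add]; exact add _ _ h1 h2
    | add x y hx hy => rw [map_add, LinearMap.add_apply]; exact add _ _ hx hy
  refine total_induction_word (fun r f g h => ?_) add x
  rw [← ofWords_cword]
  exact hw _ _

section desc

variable (K 𝒜) in
/-- The degenerate words, which have a letter `1`. -/
def degenerate : Submodule K (Words K (⨁ k, 𝒜 k)) :=
  Submodule.span K {x | ∃ (r : ℕ) (f : ⨁ k, 𝒜 k) (g : Fin r → ⨁ k, 𝒜 k) (i : Fin r),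
    g i = 1 ∧ x = cword K f g}

lemma app_one_mem_degenerate (x : Words K (⨁ k, 𝒜 k)) : app K 1 x ∈ degenerate K 𝒜 := by
  induction x using cword_induction with
  | cword r f g =>
    refine Submodule.subset_span ⟨r + 1, f, _, Fin.last r, ?_, app_cword _ _ _⟩
    rw [Fin.snoc_last]
  | add x y hx hy => rw [map_add]; exact add_mem hx hy

lemma app_mem_degenerate (a : ⨁ k, 𝒜 k) {x : Words K (⨁ k, 𝒜 k)} (hx : x ∈ degenerate K 𝒜) :
    app K a x ∈ degenerate K 𝒜 := by
  have : degenerate K 𝒜 ≤ (degenerate K 𝒜).comap (app K a) := by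
    refine Submodule.span_le.2 ?_
    rintro _ ⟨r, f, g, i, hi, rfl⟩
    refine Submodule.subset_span ⟨r + 1, f, _, i.castSucc, ?_, app_cword _ _ _⟩
    rw [Fin.snoc_castSucc, hi]
  exact this hx

lemma degenerate_le {J : Submodule K (Words K (⨁ k, 𝒜 k))} (h1 : ∀ x, app K 1 x ∈ J)
    (h : ∀ a, ∀ x ∈ J, app K a x ∈ J) : degenerate K 𝒜 ≤ J := by
  refine Submodule.span_le.2 ?_
  rintro _ ⟨r, f, g, i, hi, rfl⟩
  change cword K f g ∈ J
  induction r with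
  | zero => exact i.elim0
  | succ r ih =>
    rw [cword_succ]
    refine Fin.lastCases (fun hi => ?_) (fun i hi => ?_) i hi
    · rw [hi]; exact h1 _
    · exact h _ _ (ih _ i hi)

lemma ofWords_of_mem_degenerate {x : Words K (⨁ k, 𝒜 k)} (hx : x ∈ degenerate K 𝒜) :
    ofWords x = 0 := by
  have : degenerate K 𝒜 ≤ LinearMap.ker ofWords := by
    refine Submodule.span_le.2 ?_
    rintro _ ⟨r, f, g, i, hi, rfl⟩
    refine LinearMap.ext fun h => ?_
    rw [ofWords_cword, word, pureWord_zero_mid _ _ _ i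
      (by rw [hi]; exact Submodule.one_le.1 le_rfl), map_zero]
    rfl
  exact this hx

variable {N : Type*} [AddCommGroup N] [Module K N]

/-- A map on words that vanishes on degenerate words, regarded as a map on the bar construction. -/
def desc (φ : Words K (⨁ k, 𝒜 k) →ₗ[K] (⨁ k, 𝒜 k) →ₗ[K] N)
    (hφ : ∀ x ∈ degenerate K 𝒜, φ x = 0) : Total K 𝒜 →ₗ[K] N :=
  DirectSum.toModule K ℕ _ fun r => TensorProduct.lift (TensorProduct.lift (LinearMap.flip
    (PiTensorProduct.lift (multilinearDescend 1
      (((LinearMap.llcomp K (⨁ k, 𝒜 k) (Words K (⨁ k, 𝒜 k)) ((⨁ k, 𝒜 k) →ₗ[K] N) φ) ∘ₗ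
        (TensorProduct.mk K (⨁ k, 𝒜 k) (TensorAlgebra K (⨁ k, 𝒜 k))).flip).compMultilinearMap
          (TensorAlgebra.tprod K (⨁ k, 𝒜 k) r))
      (fun g i hi => by
        rw [Submodule.one_eq_span, Submodule.mem_span_singleton] at hi
        obtain ⟨c, hc⟩ := hi
        have : g = Function.update g i (c • 1) := by rw [hc, Function.update_eq_self]
        rw [this, MultilinearMap.map_update_smul]
        refine smul_eq_zero_of_right c (LinearMap.ext fun f => ?_)
        exact hφ _ (Submodule.subset_span ⟨r, f, _, i, Function.update_self _ _ _, rfl⟩))))))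

@[simp] lemma desc_word (φ : Words K (⨁ k, 𝒜 k) →ₗ[K] (⨁ k, 𝒜 k) →ₗ[K] N)
    (hφ : ∀ x ∈ degenerate K 𝒜, φ x = 0) {r : ℕ} (f : ⨁ k, 𝒜 k) (g : Fin r → ⨁ k, 𝒜 k)
    (h : ⨁ k, 𝒜 k) : desc φ hφ (word K f g h) = φ (cword K f g) h := by
  rw [desc, word, DirectSum.toModule_lof, pureWord, TensorProduct.lift.tmul,
    TensorProduct.lift.tmul, LinearMap.flip_apply, PiTensorProduct.lift.tprod,
    multilinearDescend_mk]
  rfl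

lemma desc_ofWords (φ : Words K (⨁ k, 𝒜 k) →ₗ[K] (⨁ k, 𝒜 k) →ₗ[K] N)
    (hφ : ∀ x ∈ degenerate K 𝒜, φ x = 0) (x : Words K (⨁ k, 𝒜 k)) (h : ⨁ k, 𝒜 k) :
    desc φ hφ (ofWords x h) = φ x h := by
  induction x using cword_induction with
  | cword r f g => rw [ofWords_cword, desc_word]
  | add x y hx hy => simp only [map_add, LinearMap.add_apply, hx, hy]

end desc

end Bar

namespace Cdga

open Words

variable {K : Type} {A : Type u} [CommRing K] [Ring A] [Algebra K A] (R : Cdga K A)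

lemma sg_cword {r : ℕ} (f : A) (g : Fin r → A) :
    R.sg (cword K f g) = cword K (R.eps f) fun i => - R.eps (g i) := by
  induction r with
  | zero => rw [cword_zero, cword_zero, sg_inc]
  | succ r ih => rw [cword_succ, sg_app, ih, cword_succ, map_neg, LinearMap.neg_apply]

lemma D₁_cword {r : ℕ} (f : A) (g : Fin r → A) :
    R.D₁ (cword K f g) = cword K (R.d f) g + ∑ i, cword K (R.eps f) fun j =>
      if j < i then - R.eps (g j) else if j = i then - R.d (g j) else g j := by
  induction r with
  | zero => rw [cword_zero, cword_zero, D₁_inc, Fin.sum_univ_zero, add_zero]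
  | succ r ih =>
    rw [cword_succ, D₁_app, ih, map_add, map_sum, Fin.sum_univ_castSucc, sub_eq_add_neg,
      ← add_assoc, cword_succ (R.d f), sg_cword]
    congr 1
    · congr 1
      refine Finset.sum_congr rfl fun i _ => ?_
      rw [cword_succ (R.eps f), if_neg (not_lt.2 (Fin.le_last _)),
        if_neg (Fin.castSucc_lt_last i).ne']
      simp only [Fin.castSucc_lt_castSucc_iff, Fin.castSucc_inj]
    · rw [cword_succ (R.eps f) fun j => _, if_neg (lt_irrefl _), if_pos rfl, map_neg,
        LinearMap.neg_apply]
      simp only [Fin.castSucc_lt_last, if_true]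

end Cdga

namespace Bar

open Words

variable {K : Type} [CommRing K] {𝒜 : ℤ → Type u} [∀ k, AddCommGroup (𝒜 k)] [∀ k, Module K (𝒜 k)]
  [DirectSum.GRing 𝒜] [DirectSum.GAlgebra K 𝒜]
  {d : (⨁ k, 𝒜 k) →ₗ[K] ⨁ k, 𝒜 k} (hd : d 1 = 0) (H : IsCommCochainAlg (algData d))

/-- The additive group of the bar construction. Its addition is the one of the direct sum. -/
instance : AddCommGroup (Total K 𝒜) := Module.addCommMonoidToAddCommGroup K

/-! ### The differential of the bar construction -/

lemma sgnBar_mk (a : ⨁ k, 𝒜 k) :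
    sgnBar K 𝒜 (Submodule.Quotient.mk a) = Submodule.Quotient.mk (- eps (K := K) 𝒜 a) := by
  change (Submodule.Quotient.mk (parity (K := K) 𝒜 1 a) : Red K 𝒜)
    - Submodule.Quotient.mk (parity (K := K) 𝒜 0 a) = _
  rw [← Submodule.Quotient.mk_sub, eps, LinearMap.sub_apply, neg_sub]

lemma d₁_pureWord {r : ℕ} (f : ⨁ k, 𝒜 k) (g : Fin r → ⨁ k, 𝒜 k) (h : ⨁ k, 𝒜 k) :
    d₁ 𝒜 d hd r (pureWord K f g h) = pureWord K (d f) g h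
      + (∑ i, pureWord K (eps (K := K) 𝒜 f) (fun j =>
          if j < i then - eps (K := K) 𝒜 (g j) else if j = i then - d (g j) else g j) h)
      + pureWord K (eps (K := K) 𝒜 f) (fun i => - eps (K := K) 𝒜 (g i)) (d h) := by
  rw [d₁, LinearMap.add_apply, LinearMap.add_apply, pureWord, TensorProduct.map_tmul,
    TensorProduct.map_tmul, TensorProduct.map_tmul, TensorProduct.map_tmul, TensorProduct.map_tmul,
    TensorProduct.map_tmul, dMid, LinearMap.sum_apply, tmul_sum, sum_tmul,
    PiTensorProduct.map_tprod]
  simp only [sgnBar_mk, PiTensorProduct.map_tprod]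
  refine congrArg₂ (· + ·) (congrArg₂ (· + ·) rfl (Finset.sum_congr rfl fun i _ => ?_)) rfl
  rw [pureWord]
  congr 3
  funext j
  split_ifs
  · exact sgnBar_mk _
  · rfl
  · rfl

lemma faceSum_words {r : ℕ} (f : ⨁ k, 𝒜 k) (g : Fin (r + 1) → ⨁ k, 𝒜 k) :
    (cdga H).D₂ (cword K f g)
      = ∑ j : Fin (r + 1), cword K (faceL (K := K) (j : ℕ) g f) (faceM (K := K) (j : ℕ) g) := by
  induction r with
  | zero =>
    rw [cword_succ, cword_zero, Cdga.D₂_app, Cdga.D₂_inc, map_zero, zero_add, Fin.sum_univ_one,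
      cword_zero, Cdga.merge_inc, faceL, Fin.val_zero, if_pos rfl]
    rfl
  | succ r ih =>
    rw [cword_succ, Cdga.D₂_app, ih, map_sum, Fin.sum_univ_castSucc (n := r + 1)]
    congr 1
    · refine Finset.sum_congr rfl fun j _ => ?_
      have hj := j.2
      rw [cword_succ]
      congr 1
      · congr 1
        rw [faceM, Fin.val_last, Fin.val_castSucc, if_neg (by omega), if_neg (by omega)]
        rfl
    · rw [cword_succ, Cdga.merge_app, Cdga.sg_cword, cword_succ, Fin.val_last, faceL,
        if_neg (by omega), faceM, Fin.val_last, if_neg (lt_irrefl _), if_pos rfl,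
        ← LinearMap.neg_apply, ← map_neg, neg_mul]
      congr 2
      funext k
      have hk := k.2
      rw [faceM, Fin.val_castSucc, if_pos (by omega)]
      rfl

/-- The face of the bar differential that multiplies the last letter of a word with the right
factor. -/
def lastFace : Words K (⨁ k, 𝒜 k) →ₗ[K] (⨁ k, 𝒜 k) →ₗ[K] Total K 𝒜 :=
  paraLast (N := (⨁ k, 𝒜 k) →ₗ[K] Total K 𝒜) 0 0
    (LinearMap.mk₂ K (fun a x => - (ofWords ((cdga H).sg x) ∘ₗ LinearMap.mul K (⨁ k, 𝒜 k) a))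
      (fun a b x => by rw [map_add, LinearMap.comp_add, neg_add])
      (fun c a x => by rw [map_smul, LinearMap.comp_smul, smul_neg])
      (fun a x y => by rw [map_add, map_add, LinearMap.add_comp, neg_add])
      (fun c a x => by rw [map_smul, map_smul, LinearMap.smul_comp, smul_neg]))

@[simp] lemma lastFace_inc (f h : ⨁ k, 𝒜 k) : lastFace H (inc K f) h = 0 := by
  rw [lastFace, paraLast_inc]; rfl

@[simp] lemma lastFace_app (a : ⨁ k, 𝒜 k) (x : Words K (⨁ k, 𝒜 k)) (h : ⨁ k, 𝒜 k) :
    lastFace H (app K a x) h = - ofWords ((cdga H).sg x) (a * h) := by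
  rw [lastFace, paraLast_app, LinearMap.zero_apply, LinearMap.zero_apply, add_zero]; rfl

lemma lof_d₁ {r : ℕ} (f : ⨁ k, 𝒜 k) (g : Fin r → ⨁ k, 𝒜 k) (h : ⨁ k, 𝒜 k) :
    DirectSum.lof K ℕ (Part K 𝒜) r (d₁ 𝒜 d hd r (pureWord K f g h))
      = ofWords ((cdga H).D₁ (cword K f g)) h + ofWords ((cdga H).sg (cword K f g)) (d h) := by
  rw [d₁_pureWord, map_add, map_add, map_sum, Cdga.D₁_cword, Cdga.sg_cword, map_add, map_sum,
    LinearMap.add_apply, LinearMap.sum_apply, ofWords_cword, ofWords_cword]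
  refine congrArg₂ (· + ·) (congrArg₂ (· + ·) rfl (Finset.sum_congr rfl fun i _ => ?_)) rfl
  rw [ofWords_cword]
  rfl

lemma lof_d₂ {r : ℕ} (f : ⨁ k, 𝒜 k) (g : Fin (r + 1) → ⨁ k, 𝒜 k) (h : ⨁ k, 𝒜 k) :
    DirectSum.lof K ℕ (Part K 𝒜) r (d₂ K 𝒜 r (pureWord K f g h))
      = ofWords ((cdga H).D₂ (cword K f g)) h + lastFace H (cword K f g) h := by
  rw [d₂_pureWord, Fin.sum_univ_castSucc, faceSum_words, map_add, map_sum, map_sum,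
    LinearMap.sum_apply]
  refine congrArg₂ (· + ·) (Finset.sum_congr rfl fun j _ => ?_) ?_
  · have hj := j.2
    rw [ofWords_cword, face, faceR, Fin.val_castSucc, if_neg (by omega)]
    rfl
  · rw [cword_succ, lastFace_app, Cdga.sg_cword, ofWords_cword, face, faceR, Fin.val_last,
      if_pos rfl, faceL, if_neg (by omega), ← neg_one_smul K (_ * h), pureWord_smul_right, map_smul,
      neg_one_smul]
    congr 1
    have : faceM (K := K) (r + 1) g = fun i : Fin r => - (cdga H).eps (g i.castSucc) :=
      funext fun k => by
        have hk := k.2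
        rw [faceM, if_pos (by omega)]
        rfl
    rw [this]
    rfl

/-- The differential of the bar construction, on an unreduced word with right factor `h`. -/
lemma diff_ofWords (x : Words K (⨁ k, 𝒜 k)) (h : ⨁ k, 𝒜 k) :
    diff 𝒜 d hd (ofWords x h)
      = ofWords ((cdga H).D x) h + ofWords ((cdga H).sg x) (d h) + lastFace H x h := by
  induction x using cword_induction with
  | cword r f g =>
    rw [ofWords_cword, diff, word, DirectSum.toModule_lof]
    rcases r with _ | r
    · rw [LinearMap.add_apply, LinearMap.comp_apply, lof_d₁ hd H]
      change _ + (0 : Total K 𝒜) = _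
      rw [cword_zero, lastFace_inc, Cdga.D, LinearMap.add_apply, Cdga.D₂_inc, add_zero, add_zero,
        add_zero]
    · rw [LinearMap.add_apply, LinearMap.comp_apply, LinearMap.comp_apply, lof_d₁ hd H, lof_d₂ H,
        Cdga.D, LinearMap.add_apply, map_add, LinearMap.add_apply]
      abel
  | add x y hx hy => simp only [map_add, LinearMap.add_apply, hx, hy]; abel

end Bar

namespace Bar

open Words

variable {K : Type} [CommRing K] {𝒜 : ℤ → Type u} [∀ k, AddCommGroup (𝒜 k)] [∀ k, Module K (𝒜 k)]
  [DirectSum.GRing 𝒜] [DirectSum.GAlgebra K 𝒜]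
  {d : (⨁ k, 𝒜 k) →ₗ[K] ⨁ k, 𝒜 k} (hd : d 1 = 0) (H : IsCommCochainAlg (algData d))

/-- The last two letters and the right factor can be multiplied in either order. -/
lemma lastFace_merge (y : Words K (⨁ k, 𝒜 k)) (a h : ⨁ k, 𝒜 k) :
    lastFace H ((cdga H).merge y a) h = lastFace H ((cdga H).sg y) (a * h) := by
  induction y using Words.induction with
  | inc f => rw [Cdga.merge_inc, Cdga.sg_inc, lastFace_inc, lastFace_inc]
  | app b z _ =>
    rw [Cdga.merge_app, Cdga.sg_app, map_neg, map_neg, LinearMap.neg_apply, LinearMap.neg_apply,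
      lastFace_app, lastFace_app, _root_.mul_assoc]
  | add x y hx hy => simp only [map_add, LinearMap.add_apply, hx, hy]

lemma diff_lastFace (x : Words K (⨁ k, 𝒜 k)) (h : ⨁ k, 𝒜 k) :
    diff 𝒜 d hd (lastFace H x h)
      = - lastFace H ((cdga H).D x) h - lastFace H ((cdga H).sg x) (d h) := by
  induction x using Words.induction with
  | inc f => rw [Cdga.D_inc, Cdga.sg_inc, lastFace_inc, lastFace_inc, lastFace_inc, map_zero,
      neg_zero, sub_zero]
  | app a y _ =>
    have h1 : d (a * h) = d a * h + (cdga H).eps a * d h := (cdga H).d_mul a h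
    rw [lastFace_app, map_neg, diff_ofWords hd H, Cdga.D_app, Cdga.sg_app, h1, ← lastFace_merge,
      Cdga.D_sg]
    simp only [map_add, map_sub, map_neg, LinearMap.add_apply, LinearMap.sub_apply,
      LinearMap.neg_apply, lastFace_app, Cdga.sg_sg]
    change _ = - (_ - - ofWords y (d a * h) + _) - _
    abel
  | add x y hx hy => simp only [map_add, LinearMap.add_apply, hx, hy]; abel

include H in
lemma diff_diff (w : Total K 𝒜) : diff 𝒜 d hd (diff 𝒜 d hd w) = 0 := by
  induction w using total_induction H with
  | word k x hx l h hh =>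
    have h1 : d (d h) = 0 := (cdga H).d_d h
    rw [diff_ofWords hd H, map_add, map_add, diff_ofWords hd H, diff_ofWords hd H,
      diff_lastFace hd H, Cdga.D_D, Cdga.D_sg, Cdga.sg_sg, h1]
    simp only [map_zero, map_neg, LinearMap.neg_apply, LinearMap.zero_apply]
    abel
  | add x y hx hy => rw [map_add, map_add, hx, hy, add_zero]

/-! ### The product of the bar construction -/

section parity

variable {H}

lemma parityBar_mk {k : ℤ} {a : ⨁ k, 𝒜 k} (ha : a ∈ (cdga H).gr k) (s : ZMod 2) :
    parityBar K 𝒜 s (Submodule.Quotient.mk a)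
      = if (k : ZMod 2) = s then (Submodule.Quotient.mk a : Red K 𝒜) else 0 := by
  change (Submodule.Quotient.mk ((cdga H).par s a) : Red K 𝒜) = _
  rw [(cdga H).par_of_mem s k a ha]
  split_ifs <;> rfl

lemma letterParity_tprod {n : ℕ} {b : Fin n → ℤ} {g : Fin n → ⨁ k, 𝒜 k}
    (hg : ∀ i, g i ∈ (cdga H).gr (b i)) (s : Fin n → ZMod 2) :
    letterParity K 𝒜 s (PiTensorProduct.tprod K fun i => Submodule.Quotient.mk (g i))
      = if (fun i => ((b i - 1 : ℤ) : ZMod 2)) = s then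
          PiTensorProduct.tprod K fun i => (Submodule.Quotient.mk (g i) : Red K 𝒜) else 0 := by
  rw [letterParity, PiTensorProduct.map_tprod]
  have h2 : ∀ i, (b i : ZMod 2) = s i + 1 ↔ ((b i - 1 : ℤ) : ZMod 2) = s i := fun i => by
    rw [Int.cast_sub, Int.cast_one, sub_eq_iff_eq_add]
  split_ifs with h
  · congr 1
    funext i
    rw [parityBar_mk (hg i), if_pos ((h2 i).2 (congrFun h i))]
  · obtain ⟨i, hi⟩ := Function.ne_iff.1 h
    refine (PiTensorProduct.tprod K).map_coord_zero i ?_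
    rw [parityBar_mk (hg i), if_neg (mt (h2 i).1 hi)]

lemma wordParity_tprod {n : ℕ} {b : Fin n → ℤ} {g : Fin n → ⨁ k, 𝒜 k}
    (hg : ∀ i, g i ∈ (cdga H).gr (b i)) (s : ZMod 2) :
    wordParity K 𝒜 s (PiTensorProduct.tprod K fun i => Submodule.Quotient.mk (g i))
      = if ((∑ i, (b i - 1) : ℤ) : ZMod 2) = s then
          PiTensorProduct.tprod K fun i => (Submodule.Quotient.mk (g i) : Red K 𝒜) else 0 := by
  rw [wordParity, LinearMap.sum_apply,
    Fintype.sum_eq_single (fun i => ((b i - 1 : ℤ) : ZMod 2)), Int.cast_sum]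
  · split_ifs
    · rw [letterParity_tprod hg, if_pos rfl]
    · rfl
  · intro t ht
    split_ifs
    · rw [letterParity_tprod hg, if_neg ht.symm]
    · rfl

lemma mem_shuffles {p q : ℕ} (σ : Equiv.Perm (Fin (p + q))) : σ ∈ shuffles p q ↔ IsShuffle p σ := by
  simp only [shuffles, Finset.mem_filter, Finset.mem_univ, true_and]
  constructor
  · rintro ⟨h1, h2⟩ i j hij (h | h)
    · exact h1 (a := ⟨i, lt_trans hij h⟩) (b := ⟨j, h⟩) hij
    · have hi : i = Fin.natAdd p ⟨i - p, by omega⟩ := Fin.ext (by simp only [Fin.natAdd_mk]; omega)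
      have hj : j = Fin.natAdd p ⟨j - p, by omega⟩ := Fin.ext (by simp only [Fin.natAdd_mk]; omega)
      rw [hi, hj]
      exact h2 (show (i : ℕ) - p < j - p by omega)
  · intro h
    refine ⟨fun i j hij => h _ _ hij (.inl (by simp)), fun i j hij => h _ _ ?_ (.inr (by simp))⟩
    exact Fin.lt_def.2 (by simp only [Fin.val_natAdd]; have := Fin.lt_def.1 hij; omega)

open Classical in
lemma shuffleMid_tprod {p q : ℕ} {b : Fin (p + q) → ℤ} {w : Fin (p + q) → ⨁ k, 𝒜 k}
    (hw : ∀ i, w i ∈ (cdga H).gr (b i)) :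
    shuffleMid K 𝒜 p q
        (PiTensorProduct.tprod K fun i => Submodule.Quotient.mk (w (Fin.castAdd q i)))
        (PiTensorProduct.tprod K fun i => Submodule.Quotient.mk (w (Fin.natAdd p i)))
      = ∑ σ with IsShuffle p σ, koszul K σ (fun i => ((b i - 1 : ℤ) : ZMod 2)) •
          PiTensorProduct.tprod K fun i => (Submodule.Quotient.mk (w (σ i)) : Red K 𝒜) := by
  have h1 : TensorPower.mulEquiv (R := K)
      ((PiTensorProduct.tprod K fun i : Fin p =>
          (Submodule.Quotient.mk (w (Fin.castAdd q i)) : Red K 𝒜)) ⊗ₜ[K]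
        (PiTensorProduct.tprod K fun i : Fin q =>
          (Submodule.Quotient.mk (w (Fin.natAdd p i)) : Red K 𝒜)))
      = PiTensorProduct.tprod K fun i => (Submodule.Quotient.mk (w i) : Red K 𝒜) := by
    refine (TensorPower.tprod_mul_tprod K _ _).trans ?_
    congr 1
    funext i
    refine Fin.addCases (fun i => ?_) (fun i => ?_) i
    · rw [Fin.append_left]
    · rw [Fin.append_right]
  have h2 : shuffles p q = Finset.univ.filter (IsShuffle p) := by
    ext σ
    rw [mem_shuffles, Finset.mem_filter, and_iff_right (Finset.mem_univ σ)]
  rw [shuffleMid, TensorProduct.curry_apply, LinearMap.comp_apply, LinearEquiv.coe_coe, h1, h2,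
    LinearMap.sum_apply]
  refine Finset.sum_congr rfl fun σ _ => ?_
  rw [LinearMap.sum_apply, Fintype.sum_eq_single (fun i => ((b i - 1 : ℤ) : ZMod 2)),
    LinearMap.smul_apply, LinearMap.comp_apply, letterParity_tprod hw, if_pos rfl,
    LinearEquiv.coe_coe]
  · congr 1
    refine (PiTensorProduct.reindex_tprod (R := K) σ.symm _).trans ?_
    rfl
  · intro t ht
    rw [LinearMap.smul_apply, LinearMap.comp_apply, letterParity_tprod hw, if_neg ht.symm, map_zero,
      smul_zero]

lemma mulPart_pureWord {p q : ℕ} {a l : ℤ} {b : Fin p → ℤ} {b' : Fin q → ℤ} {f f' h h' : ⨁ k, 𝒜 k}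
    {g : Fin p → ⨁ k, 𝒜 k} {g' : Fin q → ⨁ k, 𝒜 k} (hf' : f' ∈ (cdga H).gr a)
    (hg : ∀ i, g i ∈ (cdga H).gr (b i)) (hg' : ∀ i, g' i ∈ (cdga H).gr (b' i))
    (hh : h ∈ (cdga H).gr l) :
    mulPart K 𝒜 p q (pureWord K f g h) (pureWord K f' g' h')
      = sgn K (l * a + (∑ i, (b i - 1)) * a + l * ∑ i, (b' i - 1)) •
        ((f * f') ⊗ₜ[K] shuffleMid K 𝒜 p q
          (PiTensorProduct.tprod K fun i => Submodule.Quotient.mk (g i))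
          (PiTensorProduct.tprod K fun i => Submodule.Quotient.mk (g' i))) ⊗ₜ[K] (h * h') := by
  have hp : ∀ (s : ZMod 2) {k : ℤ} {x : ⨁ k, 𝒜 k}, x ∈ (cdga H).gr k →
      parity (K := K) 𝒜 s x = if (k : ZMod 2) = s then x else 0 := fun s k x hx =>
    (cdga H).par_of_mem s k x hx
  have key : ∀ s t u v : ZMod 2, (zsgn K (u * s + t * s + u * v) •
      TensorProduct.map₂
        (TensorProduct.map₂
          ((LinearMap.mul K (⨁ k, 𝒜 k)).compl₂ (parity 𝒜 s))
          ((shuffleMid K 𝒜 p q).compl₁₂ (wordParity K 𝒜 t) (wordParity K 𝒜 v)))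
        (LinearMap.mul K (⨁ k, 𝒜 k) ∘ₗ parity 𝒜 u)) (pureWord K f g h) (pureWord K f' g' h')
      = zsgn K (u * s + t * s + u * v) •
        ((f * if (a : ZMod 2) = s then f' else 0) ⊗ₜ[K] shuffleMid K 𝒜 p q
          (if ((∑ i, (b i - 1) : ℤ) : ZMod 2) = t then
            (PiTensorProduct.tprod K fun i => (Submodule.Quotient.mk (g i) : Red K 𝒜)) else 0)
          (if ((∑ i, (b' i - 1) : ℤ) : ZMod 2) = v then
            (PiTensorProduct.tprod K fun i => (Submodule.Quotient.mk (g' i) : Red K 𝒜)) else 0))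
          ⊗ₜ[K] ((if (l : ZMod 2) = u then h else 0) * h') := fun s t u v => by
    rw [← hp s hf', ← hp u hh, ← wordParity_tprod hg, ← wordParity_tprod hg', smul_tmul']
    rfl
  simp only [mulPart, LinearMap.sum_apply, key]
  rw [Fintype.sum_eq_single (a : ZMod 2) fun s hs => ?_,
    Fintype.sum_eq_single ((∑ i, (b i - 1) : ℤ) : ZMod 2) fun t ht => ?_,
    Fintype.sum_eq_single (l : ZMod 2) fun u hu => ?_,
    Fintype.sum_eq_single ((∑ i, (b' i - 1) : ℤ) : ZMod 2) fun v hv => ?_,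
    if_pos rfl, if_pos rfl, if_pos rfl, if_pos rfl, ← zsgn_intCast]
  · congr 2
    push_cast
    rfl
  · rw [if_neg hv.symm, map_zero, tmul_zero, zero_tmul, smul_zero]
  · simp only [if_neg hu.symm, zero_mul, tmul_zero, smul_zero, Finset.sum_const_zero]
  · simp only [if_neg ht.symm, map_zero, LinearMap.zero_apply, zero_tmul, tmul_zero, smul_zero,
      Finset.sum_const_zero]
  · simp only [if_neg hs.symm, mul_zero, zero_tmul, smul_zero, Finset.sum_const_zero]

lemma mul_word {p q : ℕ} (f f' h h' : ⨁ k, 𝒜 k) (g : Fin p → ⨁ k, 𝒜 k) (g' : Fin q → ⨁ k, 𝒜 k) :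
    mul K 𝒜 (word K f g h) (word K f' g' h') = DirectSum.lof K ℕ (Part K 𝒜) (p + q)
      (mulPart K 𝒜 p q (pureWord K f g h) (pureWord K f' g' h')) := by
  rw [mul, word, word, DirectSum.toModule_lof, LinearMap.flip_apply, DirectSum.toModule_lof]
  rfl

/-- The product of the bar construction is the shuffle product of words. -/
lemma mul_ofWords {l : ℤ} {h : ⨁ k, 𝒜 k} (hh : h ∈ (cdga H).gr l) (x y : Words K (⨁ k, 𝒜 k))
    (h' : ⨁ k, 𝒜 k) :
    mul K 𝒜 (ofWords x h) (ofWords y h') = ofWords ((cdga H).mul x ((cdga H).tw l y)) (h * h') := by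
  classical
  induction x using (cdga H).hom_induction with
  | hom k x hx =>
    induction y using (cdga H).hom_induction with
    | hom k' y hy =>
      obtain ⟨p, a, b, f, g, hf, hg, rfl, rfl⟩ := hx.exists_cword
      obtain ⟨q, a', b', f', g', hf', hg', rfl, rfl⟩ := hy.exists_cword
      have hw : ∀ i : Fin (p + q), Fin.append g g' i ∈ (cdga H).gr (Fin.append b b' i) :=
        fun i => by
        refine Fin.addCases (fun i => ?_) (fun i => ?_) i
        · rw [Fin.append_left, Fin.append_left]; exact hg i
        · rw [Fin.append_right, Fin.append_right]; exact hg' i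
      have h1 := shuffleMid_tprod hw
      simp only [Fin.append_left, Fin.append_right] at h1
      have h2 : cword K f' g' = (cdga H).mul (inc K f') (cword K 1 g') := by
        rw [Cdga.inc_mul, lmul_cword, _root_.mul_one]
      rw [ofWords_cword, ofWords_cword, mul_word, mulPart_pureWord hf' hg hg' hh, h1, hy.tw,
        map_smul,
        map_smul, h2, ← Cdga.mul_assoc, Cdga.cword_mul_inc hg hf', map_smul, LinearMap.smul_apply,
        map_smul, LinearMap.smul_apply, map_smul, LinearMap.smul_apply, smul_smul, ← sgn_add,
        Cdga.cword_mul_cword rfl _ _ _ hw g g'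
          (fun i j h => by
            rw [show j = Fin.castAdd q i from Fin.ext h, Fin.append_left])
          (fun i j h => by
            rw [show j = Fin.natAdd p i from Fin.ext h, Fin.append_right]),
        map_sum, LinearMap.sum_apply, tmul_sum, sum_tmul,
        map_sum]
      congr 1
      · congr 1
        ring
      · refine Finset.sum_congr rfl fun σ _ => ?_
        rw [tmul_smul, ← smul_tmul', map_smul, map_smul, LinearMap.smul_apply, ofWords_cword]
        rfl
    | add y z hy hz => simp only [map_add, LinearMap.add_apply, hy, hz]
  | add x y hx hy => simp only [map_add, LinearMap.add_apply, hx, hy]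

end parity

end Bar

namespace Bar

open Words

variable {K : Type} [CommRing K] {𝒜 : ℤ → Type u} [∀ k, AddCommGroup (𝒜 k)] [∀ k, Module K (𝒜 k)]
  [DirectSum.GRing 𝒜] [DirectSum.GAlgebra K 𝒜]
  {d : (⨁ k, 𝒜 k) →ₗ[K] ⨁ k, 𝒜 k} (hd : d 1 = 0) (H : IsCommCochainAlg (algData d))

/-! ### The grading of the bar construction -/

section grading

variable {H} in
lemma ofWords_mem_of_isHom {k l n : ℤ} {x : Words K (⨁ k, 𝒜 k)} {h : ⨁ k, 𝒜 k}
    (hx : (cdga H).IsHom k x) (hh : h ∈ (cdga H).gr l) (hn : k + l = n) :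
        ofWords x h ∈ gr K 𝒜 n := by
  obtain ⟨r, a, b, f, g, hf, hg, rfl, rfl⟩ := hx.exists_cword
  obtain ⟨f, rfl⟩ := hf
  obtain ⟨h, rfl⟩ := hh
  choose g' hg' using hg
  obtain rfl : g = fun i => DirectSum.lof K ℤ 𝒜 (b i) (g' i) := funext fun i => (hg' i).symm
  rw [ofWords_cword]
  exact Submodule.subset_span ⟨r, a, b, l, f, g', h, hn, rfl⟩

variable {H} in
lemma ofWords_mem {k l n : ℤ} {x : Words K (⨁ k, 𝒜 k)} {h : ⨁ k, 𝒜 k}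
    (hx : x ∈ (cdga H).homSpan k) (hh : h ∈ (cdga H).gr l) (hn : k + l = n) :
    ofWords x h ∈ gr K 𝒜 n :=
  Cdga.map_mem_of_isHom (ofWords.flip h) (fun _ hx => ofWords_mem_of_isHom hx hh hn) hx

lemma gr_le {n : ℤ} {S : Submodule K (Total K 𝒜)}
    (hS : ∀ k l x h, (cdga H).IsHom k x → h ∈ (cdga H).gr l → k + l = n → ofWords x h ∈ S) :
    gr K 𝒜 n ≤ S := by
  refine Submodule.span_le.2 ?_
  rintro _ ⟨r, a, b, c, f, g, h, hn, rfl⟩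
  rw [← ofWords_cword]
  exact hS _ _ _ _ (Cdga.isHom_cword (lof_mem _ f) fun i => lof_mem _ (g i)) (lof_mem _ h) hn

/-- The homogeneous components of words. -/
def wordComponent : Words K (⨁ k, 𝒜 k) →ₗ[K] ℤ → Words K (⨁ k, 𝒜 k) :=
  recLast (LinearMap.pi fun n => inc K ∘ₗ DirectSum.lof K ℤ 𝒜 n ∘ₗ DirectSum.component K ℤ 𝒜 n)
    (DirectSum.toModule K ℤ _ fun l => LinearMap.mk₂ K
      (fun a F n => app K (DirectSum.lof K ℤ 𝒜 l a) (F (n - (l - 1))))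
      (fun a b F => funext fun n => by rw [map_add, map_add]; rfl)
      (fun c a F => funext fun n => by rw [map_smul, map_smul]; rfl)
      (fun a F G => funext fun n => by rw [Pi.add_apply, map_add]; rfl)
      (fun c a F => funext fun n => by rw [Pi.smul_apply, map_smul]; rfl))

lemma wordComponent_app {l : ℤ} (a : 𝒜 l) (x : Words K (⨁ k, 𝒜 k)) (n : ℤ) :
    wordComponent (app K (DirectSum.lof K ℤ 𝒜 l a) x) n
      = app K (DirectSum.lof K ℤ 𝒜 l a) (wordComponent x (n - (l - 1))) := by
  rw [wordComponent, recLast_app, DirectSum.toModule_lof]; rfl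

variable {H} in
lemma wordComponent_of_isHom {k : ℤ} {x : Words K (⨁ k, 𝒜 k)} (hx : (cdga H).IsHom k x) (n : ℤ) :
    wordComponent x n = if n = k then x else 0 := by
  induction hx generalizing n with
  | inc k f hf =>
    obtain ⟨f, rfl⟩ := hf
    rw [wordComponent, recLast_inc]
    change inc K (DirectSum.lof K ℤ 𝒜 n (DirectSum.component K ℤ 𝒜 n (DirectSum.lof K ℤ 𝒜 k f))) = _
    split_ifs with h
    · subst h
      rw [DirectSum.component.lof_self]
    · rw [DirectSum.component.of, dif_neg (Ne.symm h), map_zero, map_zero]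
  | app k l a x ha hx ih =>
    obtain ⟨a, rfl⟩ := ha
    rw [wordComponent_app, ih]
    split_ifs with h1 h2 h2
    · rfl
    · omega
    · omega
    · rw [map_zero]

lemma wordComponent_mem_degenerate {x : Words K (⨁ k, 𝒜 k)} (hx : x ∈ degenerate K 𝒜) (n : ℤ) :
    wordComponent x n ∈ degenerate K 𝒜 := by
  have : degenerate K 𝒜 ≤ ⨅ n, (degenerate K 𝒜).comap (LinearMap.proj n ∘ₗ wordComponent) := by
    refine degenerate_le (fun x => ?_) fun a x hx => ?_
    · rw [Submodule.mem_iInf]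
      intro n
      change wordComponent (app K (DirectSum.lof K ℤ 𝒜 0 GradedMonoid.GOne.one) x) n
        ∈ degenerate K 𝒜
      rw [wordComponent_app]
      exact app_one_mem_degenerate _
    · rw [Submodule.mem_iInf] at hx ⊢
      intro n
      induction a using DirectSum.induction_on with
      | zero => rw [map_zero, LinearMap.zero_apply]; exact zero_mem _
      | of l a =>
        change wordComponent (app K (DirectSum.lof K ℤ 𝒜 l a) x) n ∈ degenerate K 𝒜
        rw [wordComponent_app]
        exact app_mem_degenerate _ (hx _)
      | add a b ha hb => rw [map_add, LinearMap.add_apply]; exact add_mem ha hb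
  exact (Submodule.mem_iInf _).1 (this hx) n

/-- The projection of the bar construction to its part of degree `n`. -/
def component (n : ℤ) : Total K 𝒜 →ₗ[K] Total K 𝒜 :=
  desc (LinearMap.flip (DirectSum.toModule K ℤ _ fun l =>
      (ofWords.flip ∘ₗ DirectSum.lof K ℤ 𝒜 l).compl₂ (LinearMap.proj (n - l) ∘ₗ wordComponent)))
    fun x hx => by
      refine LinearMap.ext fun h => ?_
      rw [LinearMap.flip_apply, LinearMap.zero_apply]
      induction h using DirectSum.induction_on with
      | zero => rw [map_zero, LinearMap.zero_apply]
      | of l h =>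
        rw [← DirectSum.lof_eq_of K, DirectSum.toModule_lof]
        change ofWords (wordComponent x (n - l)) _ = 0
        rw [ofWords_of_mem_degenerate (wordComponent_mem_degenerate hx _), LinearMap.zero_apply]
      | add a b ha hb => rw [map_add, LinearMap.add_apply, ha, hb, add_zero]

variable {H} in
lemma component_ofWords {k l : ℤ} {x : Words K (⨁ k, 𝒜 k)} {h : ⨁ k, 𝒜 k}
    (hx : (cdga H).IsHom k x) (hh : h ∈ (cdga H).gr l) (n : ℤ) :
    component n (ofWords x h) = if n = k + l then ofWords x h else 0 := by
  obtain ⟨h, rfl⟩ := hh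
  rw [component, desc_ofWords, LinearMap.flip_apply, DirectSum.toModule_lof]
  change ofWords (wordComponent x (n - l)) _ = _
  rw [wordComponent_of_isHom hx]
  split_ifs with h1 h2 h2
  · rfl
  · omega
  · omega
  · rw [map_zero, LinearMap.zero_apply]

include H in
/-- The homogeneous components of a degenerate word are degenerate, so that the projections to them
are defined on the bar construction. -/
lemma isInternal_gr : DirectSum.IsInternal (gr K 𝒜) := by
  rw [DirectSum.isInternal_submodule_iff_iSupIndep_and_iSup_eq_top]
  constructor
  · intro n
    rw [Submodule.disjoint_def]
    intro w hw hw'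
    have h1 : gr K 𝒜 n ≤ LinearMap.eqLocus (component n) LinearMap.id :=
      gr_le H fun k l x h hx hh hn => by
        rw [LinearMap.mem_eqLocus, component_ofWords hx hh, if_pos hn.symm]; rfl
    have h2 : ⨆ m, ⨆ (_ : m ≠ n), gr K 𝒜 m ≤ LinearMap.ker (component n) :=
      iSup_le fun m => iSup_le fun hm => gr_le H fun k l x h hx hh hn => by
        rw [LinearMap.mem_ker, component_ofWords hx hh, if_neg (by omega)]
    exact (h1 hw).symm.trans (h2 hw')
  · rw [eq_top_iff]
    rintro w -
    induction w using total_induction H with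
    | word k x hx l h hh =>
      exact Submodule.mem_iSup_of_mem (k + l) (ofWords_mem_of_isHom hx hh rfl)
    | add x y hx hy => exact add_mem hx hy

end grading

/-! ### The bar construction is a commutative cochain algebra -/

section axioms

variable {H} in
lemma lastFace_mem {k l n : ℤ} {x : Words K (⨁ k, 𝒜 k)} {h : ⨁ k, 𝒜 k}
    (hx : (cdga H).IsHom k x) (hh : h ∈ (cdga H).gr l) (hn : k + l + 1 = n) :
    lastFace H x h ∈ gr K 𝒜 n := by
  cases hx with
  | inc k f hf => rw [lastFace_inc]; exact zero_mem _
  | app k m a x ha hx =>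
    rw [lastFace_app]
    exact neg_mem (ofWords_mem (Cdga.sg_mem hx.mem) ((cdga H).mul_mem _ _ _ ha _ hh) (by omega))

include H in
lemma diff_mem (n : ℤ) (w : Total K 𝒜) (hw : w ∈ gr K 𝒜 n) : diff 𝒜 d hd w ∈ gr K 𝒜 (n + 1) := by
  refine gr_le H (S := (gr K 𝒜 (n + 1)).comap (diff 𝒜 d hd)) (fun k l x h hx hh hn => ?_) hw
  rw [Submodule.mem_comap, diff_ofWords hd H]
  exact add_mem (add_mem (ofWords_mem (Cdga.D_mem hx.mem) hh (by omega))
    (ofWords_mem (Cdga.sg_mem hx.mem) ((cdga H).d_mem _ _ hh) (by omega)))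
    (lastFace_mem hx hh (by omega))

include H in
lemma mul_mem (n m : ℤ) (v : Total K 𝒜) (hv : v ∈ gr K 𝒜 n) (w : Total K 𝒜) (hw : w ∈ gr K 𝒜 m) :
    mul K 𝒜 v w ∈ gr K 𝒜 (n + m) := by
  refine gr_le H (S := (gr K 𝒜 (n + m)).comap ((mul K 𝒜).flip w)) (fun k l x h hx hh hn => ?_) hv
  refine gr_le H (S := (gr K 𝒜 (n + m)).comap (mul K 𝒜 (ofWords x h)))
    (fun k' l' x' h' hx' hh' hn' => ?_) hw
  rw [Submodule.mem_comap, mul_ofWords hh]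
  exact ofWords_mem (Cdga.mul_mem_homSpan hx.mem (Cdga.tw_mem l hx'.mem))
    ((cdga H).mul_mem _ _ _ hh _ hh') (by omega)

include H in
lemma mul_comm' (n m : ℤ) (v : Total K 𝒜) (hv : v ∈ gr K 𝒜 n) (w : Total K 𝒜)
    (hw : w ∈ gr K 𝒜 m) : mul K 𝒜 v w = sgn K (n * m) • mul K 𝒜 w v := by
  refine gr_le H (S := LinearMap.eqLocus ((mul K 𝒜).flip w) (sgn K (n * m) • mul K 𝒜 w))
    (fun k l x h hx hh hn => ?_) hv
  refine gr_le H (S := LinearMap.eqLocus (mul K 𝒜 (ofWords x h))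
    (sgn K (n * m) • (mul K 𝒜).flip (ofWords x h))) (fun k' l' x' h' hx' hh' hn' => ?_) hw
  change mul K 𝒜 (ofWords x h) (ofWords x' h')
    = sgn K (n * m) • mul K 𝒜 (ofWords x' h') (ofWords x h)
  have h1 : h * h' = sgn K (l * l') • (h' * h) := (cdga H).comm l l' h hh h' hh'
  rw [mul_ofWords hh, mul_ofWords hh', hx'.tw, hx.tw, map_smul, map_smul, map_smul, map_smul,
    hx.mul_comm hx', map_smul, LinearMap.smul_apply, LinearMap.smul_apply, LinearMap.smul_apply, h1,
    map_smul, smul_smul, smul_smul, smul_smul, ← sgn_add, ← sgn_add, ← sgn_add]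
  congr 1
  refine sgn_congr K ⟨- l' * k, ?_⟩
  rw [← hn, ← hn']
  ring

set_option maxHeartbeats 1000000 in
/-- The last face is a derivation up to sign: the last letter of a shuffle is the last letter of one
of the factors. -/
lemma lastFace_mul {k k' l : ℤ} {x y : Words K (⨁ k, 𝒜 k)} {h h' : ⨁ k, 𝒜 k}
    (hx : (cdga H).IsHom k x) (hh : h ∈ (cdga H).gr l) (hy : (cdga H).IsHom k' y) :
    lastFace H ((cdga H).mul x ((cdga H).tw l y)) (h * h')
      = mul K 𝒜 (lastFace H x h) (ofWords y h')
        + sgn K (k + l) • mul K 𝒜 (ofWords x h) (lastFace H y h') := by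
  -- the last letter of the product is the last letter of `y`
  have h1 : ∀ (m : ℤ) (b : ⨁ k, 𝒜 k) (z : Words K (⨁ k, 𝒜 k)), b ∈ (cdga H).gr m →
      sgn K (l * (m - 1)) • lastFace H (app K b ((cdga H).mul x ((cdga H).tw l z))) (h * h')
        = sgn K (k + l) • mul K 𝒜 (ofWords x h) (lastFace H (app K b z) h') := fun m b z hb => by
    have h2 : b * h = sgn K (m * l) • (h * b) := (cdga H).comm m l b hb h hh
    rw [lastFace_app, lastFace_app, map_neg, mul_ofWords hh, Cdga.sg_mul, hx.sg, ← Cdga.tw_sg,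
      map_smul, LinearMap.smul_apply, map_smul, LinearMap.smul_apply, ← _root_.mul_assoc b,
      h2, smul_mul_assoc, map_smul, ← _root_.mul_assoc h, smul_neg, smul_neg, smul_smul, smul_smul,
      ← sgn_add, ← sgn_add]
    congr 2
    exact sgn_congr K ⟨m * l - l, by ring⟩
  -- the last letter of the product is the last letter of `x`
  have h2 : ∀ (m : ℤ) (a : ⨁ k, 𝒜 k) (z : Words K (⨁ k, 𝒜 k)), a ∈ (cdga H).gr m →
      lastFace H (app K a ((cdga H).mul z ((cdga H).tw (m - 1) ((cdga H).tw l y)))) (h * h')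
        = mul K 𝒜 (lastFace H (app K a z) h) (ofWords y h') := fun m a z ha => by
    rw [lastFace_app, lastFace_app, map_neg, LinearMap.neg_apply,
      mul_ofWords ((cdga H).mul_mem _ _ _ ha _ hh), Cdga.sg_mul, Cdga.sg_eq_tw _ (Cdga.tw _ _ _),
      Cdga.tw_tw, Cdga.tw_tw, _root_.mul_assoc]
    ring_nf
  cases hx with
  | inc k f hf =>
    rw [lastFace_inc, map_zero, LinearMap.zero_apply, zero_add]
    cases hy with
    | inc k' g hg => rw [lastFace_inc, map_zero, smul_zero, Cdga.tw_inc _ hg, map_smul, map_smul,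
        Cdga.inc_mul, lmul_inc, LinearMap.smul_apply, lastFace_inc, smul_zero]
    | app k' m b z hb hz => rw [← h1 m b z hb, Cdga.tw_app _ hb, map_smul, map_smul, Cdga.inc_mul,
        Cdga.inc_mul, lmul_app, LinearMap.smul_apply]
  | app k m a z ha hz =>
    rw [← h2 m a z ha]
    cases hy with
    | inc k' g hg =>
      rw [lastFace_inc, map_zero, smul_zero, add_zero, Cdga.tw_inc _ hg]
      simp only [map_smul, LinearMap.smul_apply, Cdga.app_mul_inc ha]
    | app k' m' b w hb hw =>
      rw [← h1 m' b w hb, Cdga.tw_app _ hb]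
      simp only [map_smul, LinearMap.smul_apply, Cdga.app_mul_app ha, map_add, LinearMap.add_apply,
        smul_add]

set_option maxHeartbeats 1000000 in
include H in
lemma diff_mul (n : ℤ) (v : Total K 𝒜) (hv : v ∈ gr K 𝒜 n) (w : Total K 𝒜) :
    diff 𝒜 d hd (mul K 𝒜 v w)
      = mul K 𝒜 (diff 𝒜 d hd v) w + sgn K n • mul K 𝒜 v (diff 𝒜 d hd w) := by
  refine gr_le H (S := LinearMap.eqLocus (diff 𝒜 d hd ∘ₗ (mul K 𝒜).flip w)
    ((mul K 𝒜).flip w ∘ₗ diff 𝒜 d hd + sgn K n • (mul K 𝒜).flip (diff 𝒜 d hd w)))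
    (fun k l x h hx hh hn => ?_) hv
  change diff 𝒜 d hd (mul K 𝒜 (ofWords x h) w) = mul K 𝒜 (diff 𝒜 d hd (ofWords x h)) w
    + sgn K n • mul K 𝒜 (ofWords x h) (diff 𝒜 d hd w)
  induction w using total_induction H with
  | word k' y hy l' h' hh' =>
    have h1 : d (h * h') = d h * h' + sgn K l • (h * d h') := (cdga H).leibniz l h hh h'
    have h2 : (cdga H).mul ((cdga H).sg x) ((cdga H).sg ((cdga H).tw l y))
        = (cdga H).mul ((cdga H).sg x) ((cdga H).tw (l + 1) y) := by
      rw [Cdga.sg_eq_tw _ (Cdga.tw _ _ _), Cdga.tw_tw, add_comm]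
    rw [mul_ofWords hh, diff_ofWords hd H, diff_ofWords hd H, diff_ofWords hd H,
      lastFace_mul H hx hh hy, Cdga.D_mul, Cdga.sg_mul, Cdga.D_tw, h1, ← hn]
    have e1 := mul_ofWords hh x ((cdga H).D y) h'
    have e2 := mul_ofWords hh x ((cdga H).sg y) (d h')
    have e3 := mul_ofWords hh ((cdga H).D x) y h'
    have hdh : d h ∈ (cdga H).gr (l + 1) := (cdga H).d_mem _ _ hh
    have e4 := mul_ofWords hdh ((cdga H).sg x) y h'
    have e5 : ∀ z e, ofWords ((cdga H).mul ((cdga H).sg x) z) (sgn K l • e)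
        = sgn K (k + l) • ofWords ((cdga H).mul x z) e := fun z e => by
      rw [hx.sg, map_smul, map_smul, LinearMap.smul_apply, map_smul, LinearMap.smul_apply,
        smul_smul, ← sgn_add, add_comm]
    have e6 : ∀ z e, ofWords ((cdga H).mul ((cdga H).sg x) (sgn K l • z)) e
        = sgn K (k + l) • ofWords ((cdga H).mul x z) e := fun z e => by
      rw [← e5, map_smul, map_smul, map_smul, LinearMap.smul_apply]
    simp only [map_add, LinearMap.add_apply, smul_add, e1, e2, e3, e4]
    rw [Cdga.tw_sg, ← h2, e5, e6]
    abel
  | add y z hy hz => simp only [map_add, hy, hz, smul_add]; abel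

include H in
lemma one_mul' (w : Total K 𝒜) : mul K 𝒜 (word K 1 Fin.elim0 1) w = w := by
  induction w using total_induction H with
  | word k x hx l h hh =>
    rw [← ofWords_cword, mul_ofWords (H := H) (cdga H).one_mem, cword_zero, Cdga.one_mul,
      Cdga.tw_even _ Even.zero, one_mul]
  | add x y hx hy => rw [map_add, hx, hy]

include H in
lemma mul_one' (w : Total K 𝒜) : mul K 𝒜 w (word K 1 Fin.elim0 1) = w := by
  induction w using total_induction H with
  | word k x hx l h hh =>
    rw [← ofWords_cword, mul_ofWords hh, cword_zero, Cdga.tw_inc _ (cdga H).one_mem, mul_zero,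
      sgn_zero, one_smul, Cdga.mul_one, mul_one]
  | add x y hx hy => rw [map_add, LinearMap.add_apply, hx, hy]

include H in
lemma mul_assoc' (v w z : Total K 𝒜) : mul K 𝒜 (mul K 𝒜 v w) z = mul K 𝒜 v (mul K 𝒜 w z) := by
  induction v using total_induction H with
  | word k x hx l h hh =>
    induction w using total_induction H with
    | word k' y hy l' h' hh' =>
      induction z using total_induction H with
      | word k'' c hc l'' h'' hh'' =>
        rw [mul_ofWords hh, mul_ofWords ((cdga H).mul_mem _ _ _ hh _ hh'), mul_ofWords hh',
          mul_ofWords hh, Cdga.mul_assoc, Cdga.tw_mul, Cdga.tw_tw, mul_assoc]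
      | add x y hx hy => rw [map_add, map_add, map_add, hx, hy]
    | add x y hx hy => simp only [map_add, LinearMap.add_apply, hx, hy]
  | add x y hx hy => simp only [map_add, LinearMap.add_apply, hx, hy]

include H in
/-- The bar construction of a commutative cochain algebra is a commutative cochain algebra. -/
theorem isCommCochainAlg_barData : IsCommCochainAlg (barData 𝒜 d hd) where
  internal := isInternal_gr H
  one_mem := by
    change word K 1 Fin.elim0 1 ∈ gr K 𝒜 0
    rw [← ofWords_cword, cword_zero]
    exact ofWords_mem_of_isHom (H := H) (.inc 0 1 (cdga H).one_mem) (cdga H).one_mem rfl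
  mul_mem := mul_mem H
  one_mul := one_mul' H
  mul_one := mul_one' H
  mul_assoc := mul_assoc' H
  mul_comm := mul_comm' H
  d_mem := diff_mem hd H
  d_d := diff_diff hd H
  leibniz := diff_mul hd H

end axioms

end Bar

/-! ### Iterated integrals on words -/

/-- An abstract operator of integration along paths. Here `Φ` is modelled on the forms on the
cylinder `X^{Δ¹} × Δ¹`, `T` integrates from the vertex `1` along the interval, `b` and `ev` are the
pullbacks of forms on `X` along the evaluations at the vertex `1` and at the point of the interval,
and `E` is the restriction to the vertex `1`. -/
structure PathIntegration {K : Type} {A : Type u} [CommRing K] [Ring A] [Algebra K A] (R : Cdga K A)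
    (Φ : Type u) [Ring Φ] [Algebra K Φ] where
  /-- the elements of degree `k` -/
  deg : ℤ → Submodule K Φ
  /-- the sign operator -/
  ε : Φ →ₐ[K] Φ
  /-- the differential -/
  D : Φ →ₗ[K] Φ
  /-- the integration -/
  T : Φ →ₗ[K] Φ
  /-- the restriction to the lower bound of the integrals -/
  E : Φ →ₐ[K] Φ
  /-- the constant integrands -/
  b : A →ₐ[K] Φ
  /-- the integrands -/
  ev : A →ₐ[K] Φ
  b_mem {k : ℤ} {f : A} : f ∈ R.gr k → b f ∈ deg k
  ev_mem {k : ℤ} {a : A} : a ∈ R.gr k → ev a ∈ deg k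
  mul_mem {k l : ℤ} {x y : Φ} : x ∈ deg k → y ∈ deg l → x * y ∈ deg (k + l)
  T_mem {k : ℤ} {x : Φ} : x ∈ deg k → T x ∈ deg (k - 1)
  comm {k l : ℤ} {x y : Φ} : x ∈ deg k → y ∈ deg l → x * y = sgn K (k * l) • (y * x)
  ε_of_mem {k : ℤ} {x : Φ} : x ∈ deg k → ε x = sgn K k • x
  ε_ε (x : Φ) : ε (ε x) = x
  T_ε (x : Φ) : T (ε x) = - ε (T x)
  D_b (f : A) : D (b f) = b (R.d f)
  D_ev (a : A) : D (ev a) = ev (R.d a)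
  D_mul (x y : Φ) : D (x * y) = D x * y + ε x * D y
  D_ε (x : Φ) : D (ε x) = - ε (D x)
  D_T (x : Φ) : D (T x) = E x - x - T (D x)
  E_T (x : Φ) : E (T x) = 0
  E_b (f : A) : E (b f) = b f
  E_ev (a : A) : E (ev a) = b a
  T_b_mul (f : A) (x : Φ) : T (b f * x) = ε (b f) * T x
  T_mul_b (x : Φ) (f : A) : T (x * b f) = T x * b f
  T_mul (x y : Φ) : T x * T y = T (x * T y) + T (ε (T x) * y)
  T_b (f : A) : T (b f) = 0
  T_T (x : Φ) : T (T x) = 0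

namespace PathIntegration

open Words

variable {K : Type} {A Φ : Type u} [CommRing K] [Ring A] [Algebra K A] [Ring Φ] [Algebra K Φ]
  {R : Cdga K A} (P : PathIntegration R Φ)

lemma ε_b (f : A) : P.ε (P.b f) = P.b (R.eps f) := by
  induction f using R.gr_induction with
  | mem k f hf => rw [P.ε_of_mem (P.b_mem hf), Cdga.eps_of_mem hf, map_smul]
  | add f g hf hg => simp only [map_add, hf, hg]

lemma ε_ev (a : A) : P.ε (P.ev a) = P.ev (R.eps a) := by
  induction a using R.gr_induction with
  | mem k f hf => rw [P.ε_of_mem (P.ev_mem hf), Cdga.eps_of_mem hf, map_smul]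
  | add f g hf hg => simp only [map_add, hf, hg]

/-- The iterated integral of a word, without signs: `f[g₁|⋯|g_r] ↦ T(⋯ T(f g₁) ⋯ g_r)`. -/
def iter : Words K A →ₗ[K] Φ :=
  recLast P.b.toLinearMap (LinearMap.mk₂ K (fun a U => P.T (U * P.ev a))
    (fun a b U => by rw [map_add, mul_add, map_add])
    (fun c a U => by rw [map_smul, mul_smul_comm, map_smul])
    (fun a U V => by rw [add_mul, map_add])
    (fun c a U => by rw [smul_mul_assoc, map_smul]))

lemma iter_inc (f : A) : P.iter (inc K f) = P.b f := by rw [iter, recLast_inc]; rfl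

lemma iter_app (a : A) (x : Words K A) : P.iter (app K a x) = P.T (P.iter x * P.ev a) := by
  rw [iter, recLast_app]; rfl

/-- The iterated integral of a word, with the sign `(-1)^{∑ᵢ (r - i) (|gᵢ| - 1)}`. -/
def int : Words K A →ₗ[K] Φ :=
  recLast P.b.toLinearMap (LinearMap.mk₂ K (fun a U => P.T (P.ε U * P.ev a))
    (fun a b U => by rw [map_add, mul_add, map_add])
    (fun c a U => by rw [map_smul, mul_smul_comm, map_smul])
    (fun a U V => by rw [map_add, add_mul, map_add])
    (fun c a U => by rw [map_smul, smul_mul_assoc, map_smul]))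

lemma int_inc (f : A) : P.int (inc K f) = P.b f := by rw [int, recLast_inc]; rfl

lemma int_app (a : A) (x : Words K A) : P.int (app K a x) = P.T (P.ε (P.int x) * P.ev a) := by
  rw [int, recLast_app]; rfl

/-- The integrand of the last integration in the iterated integral of a word. -/
def integrand : Words K A →ₗ[K] Φ :=
  paraLast 0 0 (LinearMap.mk₂ K (fun a x => P.ε (P.int x) * P.ev a)
    (fun a b x => by rw [map_add, mul_add])
    (fun c a x => by rw [map_smul, mul_smul_comm])
    (fun a x y => by rw [map_add, map_add, add_mul])
    (fun c a x => by rw [map_smul, map_smul, smul_mul_assoc]))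

lemma integrand_inc (f : A) : P.integrand (inc K f) = 0 := by
  rw [integrand, paraLast_inc, LinearMap.zero_apply]

lemma integrand_app (a : A) (x : Words K A) :
    P.integrand (app K a x) = P.ε (P.int x) * P.ev a := by
  rw [integrand, paraLast_app, LinearMap.zero_apply, LinearMap.zero_apply, add_zero]; rfl

lemma iter_mem {k : ℤ} {x : Words K A} (hx : R.IsHom k x) : P.iter x ∈ P.deg k := by
  induction hx with
  | inc k f hf => rw [iter_inc]; exact P.b_mem hf
  | app k l a x ha hx ih =>
    rw [iter_app, ← add_sub_assoc]
    exact P.T_mem (P.mul_mem ih (P.ev_mem ha))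

lemma int_sg (x : Words K A) : P.int (R.sg x) = P.ε (P.int x) := by
  induction x using Words.induction with
  | inc f => rw [Cdga.sg_inc, int_inc, int_inc, ε_b]
  | app a x ih =>
    rw [Cdga.sg_app, map_neg, int_app, int_app, ih, ← ε_ev, ← map_mul, P.T_ε, neg_neg]
  | add x y hx hy => simp only [map_add, hx, hy]

lemma int_mem {k : ℤ} {x : Words K A} (hx : R.IsHom k x) : P.int x ∈ P.deg k := by
  induction hx with
  | inc k f hf => rw [int_inc]; exact P.b_mem hf
  | app k l a x ha hx ih =>
    rw [int_app, ← add_sub_assoc, P.ε_of_mem ih]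
    exact P.T_mem (P.mul_mem (Submodule.smul_mem _ _ ih) (P.ev_mem ha))

lemma ev_mul_int {k : ℤ} {a : A} (ha : a ∈ R.gr k) (x : Words K A) :
    P.ev a * P.int x = P.int (R.tw k x) * P.ev a := by
  induction x using R.hom_induction with
  | hom l x hx => rw [hx.tw, P.comm (P.ev_mem ha) (P.int_mem hx), map_smul, smul_mul_assoc]
  | add x y hx hy => simp only [map_add, mul_add, add_mul, hx, hy]

lemma int_lmul (f : A) (x : Words K A) : P.int (lmul f x) = P.b f * P.int x := by
  induction x using Words.induction with
  | inc g => rw [lmul_inc, int_inc, int_inc, map_mul]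
  | app a x ih =>
    rw [lmul_app, int_app, int_app, ih, map_mul P.ε, mul_assoc, ε_b, P.T_b_mul, ← ε_b, P.ε_ε]
  | add x y hx hy => simp only [map_add, mul_add, hx, hy]

/-- Iterated integrals multiply by the shuffle product, as `T` is a Rota-Baxter operator. -/
lemma int_mul (x y : Words K A) : P.int (R.mul x y) = P.int x * P.int y := by
  induction x using R.app_induction generalizing y with
  | inc k f hf => rw [Cdga.inc_mul, int_lmul, int_inc]
  | app k a ha x hx =>
    have h : ∀ z, P.ε (P.int (R.mul x (R.tw (k - 1) z))) * P.ev a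
        = P.ε (P.int x) * P.ev a * P.int z := fun z => by
      rw [hx, map_mul, mul_assoc, mul_assoc, P.ev_mul_int ha, ← int_sg P (R.tw (k - 1) z),
        Cdga.sg_eq_tw, Cdga.tw_tw, add_sub_cancel]
    induction y using Words.induction with
    | inc g => rw [Cdga.app_mul_inc ha, int_app, h, int_inc, P.T_mul_b, int_app]
    | app c y hy =>
      rw [Cdga.app_mul_app ha, map_add, int_app, h, int_app P c (R.mul _ _), hy, int_app P a x,
        int_app P c y, P.T_mul, map_mul P.ε, mul_assoc (P.ε (P.T _))]
    | add y z hy hz => simp only [map_add, mul_add, hy, hz]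
  | add x z hx hz => simp only [map_add, LinearMap.add_apply, add_mul, hx, hz]

/-- The terms of the differential of an iterated integral in which `a` is multiplied by its left
neighbour. If `x` has no letters, this is the value of the integrand at the vertex `1`; otherwise
that value vanishes, and the last integrand of `x` is multiplied by `a`. -/
lemma E_int_mul_b (x : Words K A) (a : A) :
    P.E (P.ε (P.int x) * P.ev a) - P.T (P.ε (P.integrand x) * P.ev a) = P.int (R.merge x a) := by
  induction x using Words.induction with
  | inc f => rw [integrand_inc, map_zero, zero_mul, map_zero, sub_zero, map_mul, int_inc,
      ε_b, P.E_b, P.E_ev, Cdga.merge_inc, int_inc, map_mul]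
  | app c x _ =>
    rw [integrand_app, int_app, ← neg_neg (P.ε (P.T _)), ← P.T_ε, map_mul, map_neg, P.E_T, neg_zero,
      zero_mul, zero_sub, map_mul P.ε, P.ε_ε, ε_ev, Cdga.merge_app, map_neg, int_app, int_sg, P.ε_ε,
      map_mul P.ev, mul_assoc]
  | add x y hx hy =>
    simp only [map_add, LinearMap.add_apply, ← hx, ← hy, add_mul]
    abel

/-- The differential of an iterated integral. -/
lemma D_int (x : Words K A) : P.D (P.int x) = P.int (R.D x) - P.integrand x := by
  induction x using Words.induction with
  | inc f => rw [int_inc, P.D_b, Cdga.D_inc, int_inc, integrand_inc, sub_zero]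
  | app a x ih =>
    rw [int_app, P.D_T, P.D_mul, P.D_ε, ih, P.D_ev, P.ε_ε, integrand_app, Cdga.D_app,
      map_add P.int, map_sub P.int, int_app, int_app, int_sg, P.ε_ε, ← E_int_mul_b]
    simp only [map_add, map_sub, map_neg, sub_mul, neg_mul]
    abel
  | add x y hx hy => simp only [map_add, hx, hy]; abel

/-- Iterated integrals of degenerate words vanish. -/
lemma int_app_one (x : Words K A) : P.int (app K 1 x) = 0 := by
  rw [int_app, map_one, mul_one, P.T_ε, neg_eq_zero]
  induction x using Words.induction with
  | inc f => rw [int_inc, P.T_b, map_zero]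
  | app a x _ => rw [int_app, P.T_T, map_zero]
  | add x y hx hy => rw [map_add, map_add, map_add, hx, hy, add_zero]

/-- The sign that relates the two versions of the iterated integral. -/
lemma int_cword {r : ℕ} {a : Fin r → ℤ} {f : A} {g : Fin r → A}
    (hg : ∀ i, g i ∈ R.gr (a i)) :
    P.int (cword K f g)
      = sgn K (∑ i : Fin r, ((r : ℤ) - (i + 1)) * (a i - 1)) • (P.b f * P.iter (cword K 1 g)) := by
  have h1 : P.int (cword K 1 g)
      = sgn K (∑ i : Fin r, ((r : ℤ) - (i + 1)) * (a i - 1)) • P.iter (cword K 1 g) := by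
    induction r with
    | zero => rw [cword_zero, int_inc, iter_inc, Fin.sum_univ_zero, sgn_zero, one_smul]
    | succ r ih =>
      have h := P.iter_mem (Cdga.isHom_cword R.one_mem fun i : Fin r => hg i.castSucc)
      rw [cword_succ, int_app, iter_app, ih fun i => hg i.castSucc, map_smul, P.ε_of_mem h,
        smul_smul, smul_mul_assoc, map_smul, ← sgn_add, Fin.sum_univ_castSucc, zero_add,
        ← Finset.sum_add_distrib]
      congr 2
      simp only [Fin.val_castSucc, Fin.val_last]
      push_cast
      rw [sub_self, zero_mul, add_zero]
      exact Finset.sum_congr rfl fun i _ => by ring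
  rw [← mul_one f, ← lmul_cword, int_lmul, h1, mul_smul_comm, mul_one]

end PathIntegration

/-! ### Iterated integrals on the path space -/

section morphisms

lemma cylEnd_cylFst (Y : SSet.{u}) (ε : Fin 2) : cylEnd Y ε ≫ cylFst Y = 𝟙 Y :=
  CartesianMonoidalCategory.lift_fst _ _

lemma cylEnd_cylEv (X : SSet.{u}) (ε : Fin 2) : cylEnd (PathSp X) ε ≫ cylEv X = evalAt X ε := by
  rw [cylEv, evalAt, ← Category.assoc, CartesianMonoidalCategory.comp_lift, cylEnd]
  congr 2

lemma whiskerLeft_constPath_pathEv (X : SSet.{u}) : (Δ[1] : SSet.{u}) ◁ constPath X ≫ pathEv X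
    = SemiCartesianMonoidalCategory.snd (Δ[1] : SSet.{u}) X :=
  MonoidalClosed.whiskerLeft_curry_ihom_ev_app _ _ _

lemma lift_constPath_pathEv {X Z : SSet.{u}} (t : Z ⟶ Δ[1]) (g : Z ⟶ X) :
    CartesianMonoidalCategory.lift t (g ≫ constPath X) ≫ pathEv X = g := by
  rw [← CartesianMonoidalCategory.lift_whiskerLeft, Category.assoc, whiskerLeft_constPath_pathEv]
  exact CartesianMonoidalCategory.lift_snd _ _

lemma constPath_evalAt (X : SSet.{u}) (ε : Fin 2) : constPath X ≫ evalAt X ε = 𝟙 X := by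
  rw [evalAt, ← Category.assoc, CartesianMonoidalCategory.comp_lift, Category.comp_id,
    ← Category.id_comp (constPath X), lift_constPath_pathEv]

lemma whiskerRight_cylFst {Y Z : SSet.{u}} (g : Z ⟶ Y) :
    g ▷ (Δ[1] : SSet.{u}) ≫ cylFst Y = cylFst Z ≫ g := rfl

lemma comp_cylEnd {Y Z : SSet.{u}} (g : Z ⟶ Y) (ε : Fin 2) :
    g ≫ cylEnd Y ε = cylEnd Z ε ≫ g ▷ (Δ[1] : SSet.{u}) := rfl

/-- The evaluation of constant paths does not depend on the parameter. -/
lemma constPath_cylEv (X : SSet.{u}) : constPath X ▷ (Δ[1] : SSet.{u}) ≫ cylEv X = cylFst X := by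
  rw [cylEv, ← Category.assoc, CartesianMonoidalCategory.comp_lift,
    show constPath X ▷ (Δ[1] : SSet.{u}) ≫ SemiCartesianMonoidalCategory.fst (PathSp X) _
      = cylFst X ≫ constPath X from whiskerRight_cylFst _, lift_constPath_pathEv]

end morphisms

lemma isCommCochainAlg_algData (X : SSet.{u}) : IsCommCochainAlg (Bar.algData (deRhamD X)) :=
  isCommCochainAlg_deRhamAlg X

/-- The commutative differential graded algebra `A(X)`. -/
abbrev deRhamCdga (X : SSet.{u}) : Cdga Theta (DeRham X) := Bar.cdga (isCommCochainAlg_algData X)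

/-- The integration along the paths in `X`. -/
def pathIntegration (X : SSet.{u}) :
    PathIntegration (deRhamCdga X) (Forms (PathSp X ⊗ (Δ[1] : SSet.{u}))) where
  deg := FormsDeg _
  ε := formsEps _
  D := formsD _
  T := segHomotopy _
  E := endOne _
  b := ((formsPull (cylFst _)).comp (formsPull (evalAt X 1))).comp (toForms X)
  ev := (formsPull (cylEv X)).comp (toForms X)
  b_mem hf := formsDeg_pull _ (formsDeg_pull _ (toForms_mem hf))
  ev_mem ha := formsDeg_pull _ (toForms_mem ha)
  mul_mem hx hy := SetLike.GradedMul.mul_mem hx hy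
  T_mem := formsDeg_segHomotopy
  comm := forms_mul_comm
  ε_of_mem := formsEps_of_mem
  ε_ε := formsEps_eps
  T_ε := segHomotopy_eps
  D_b f := by
    change formsD _ (formsPull _ (formsPull _ (toForms X f)))
      = formsPull _ (formsPull _ (toForms X (deRhamD X f)))
    rw [formsD_pull, formsD_pull, toForms_d]
  D_ev a := by
    change formsD _ (formsPull _ (toForms X a)) = formsPull _ (toForms X (deRhamD X a))
    rw [formsD_pull, toForms_d]
  D_mul := formsD_mul
  D_ε := formsD_eps
  D_T := formsD_segHomotopy
  E_T := endOne_segHomotopy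
  E_b f := by
    change formsPull _ (formsPull _ (formsPull _ (formsPull _ (toForms X f))))
      = formsPull _ (formsPull _ (toForms X f))
    rw [← formsPull_comp (cylEnd _ 1), cylEnd_cylFst, formsPull_id]
  E_ev a := by
    change formsPull _ (formsPull _ (formsPull _ (toForms X a)))
      = formsPull _ (formsPull _ (toForms X a))
    rw [← formsPull_comp (cylEnd _ 1), cylEnd_cylEv]
  T_b_mul f := segHomotopy_pull_mul _
  T_mul_b x f := segHomotopy_mul_pull _ x
  T_mul := segHomotopy_mul
  T_b f := (vertical_pull _).segHomotopy_eq_zero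
  T_T x := (vertical_segHomotopy x).segHomotopy_eq_zero

variable (X : SSet.{u})

lemma pathIntegration_b (f : DeRham X) : (pathIntegration X).b f
    = formsPull (cylFst _) (formsPull (evalAt X 1) (toForms X f)) := rfl

lemma pathIntegration_ev (f : DeRham X) : (pathIntegration X).ev f = evForm f := rfl

/-- The restriction of forms on `X^{Δ¹} × Δ¹` to the upper bound of the integrals. -/
def endZero : Forms (PathSp X ⊗ (Δ[1] : SSet.{u})) →ₐ[Theta] Forms (PathSp X) :=
  formsPull (cylEnd (PathSp X) 0)

/-- The pullback of forms along the evaluation at the vertex `0`. -/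
def rightEnd : DeRham X →ₐ[Theta] Forms (PathSp X) :=
  (formsPull (evalAt X 0)).comp (toForms X)

lemma endZero_b (f : DeRham X) :
    endZero X ((pathIntegration X).b f) = formsPull (evalAt X 1) (toForms X f) := by
  rw [pathIntegration_b, endZero, ← formsPull_comp (cylEnd _ 0), cylEnd_cylFst, formsPull_id]

lemma endZero_ev (f : DeRham X) : endZero X ((pathIntegration X).ev f) = rightEnd X f := by
  rw [pathIntegration_ev, endZero, evForm, ← formsPull_comp, cylEnd_cylEv]; rfl

lemma rightEnd_mem {X : SSet.{u}} {k : ℤ} {h : DeRham X} (hh : h ∈ (deRhamCdga X).gr k) :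
    rightEnd X h ∈ FormsDeg (PathSp X) k := formsDeg_pull _ (toForms_mem hh)

lemma iterForm_eq {r : ℕ} (ω : Fin r → DeRham X) :
    iterForm 1 (List.ofFn fun i => evForm (ω i))
      = (pathIntegration X).iter (Words.cword Theta 1 ω) := by
  induction r with
  | zero => rw [List.ofFn_zero, Words.cword_zero, PathIntegration.iter_inc, map_one]; rfl
  | succ r ih =>
    rw [List.ofFn_succ', List.concat_eq_append, iterForm, List.foldl_append]
    change segHomotopy _ (iterForm 1 (List.ofFn fun i : Fin r => evForm (ω i.castSucc)) * _) = _
    rw [ih, Words.cword_succ, PathIntegration.iter_app]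
    rfl

variable (X : SSet.{u})

section formsInt

open Words

lemma formsDeg_le_range (k : ℤ) : FormsDeg X k ≤ LinearMap.range (toForms X).toLinearMap :=
  fun ω hω => ⟨DirectSum.lof Theta ℤ (DegForms X) k ⟨ω, hω⟩, toForms_lof _ _⟩

variable {X} in
lemma degenerate_le_ker_int : Bar.degenerate Theta (DegForms X)
    ≤ LinearMap.ker (pathIntegration X).int := by
  refine Bar.degenerate_le (fun x => (pathIntegration X).int_app_one x) fun a x hx => ?_
  rw [LinearMap.mem_ker] at hx ⊢
  rw [PathIntegration.int_app, hx, map_zero, zero_mul, map_zero]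

/-- The map `f[g₁|⋯|g_r]h ↦ ± E₁^* f ∧ (∫ g₁ ⋯ g_r) ∧ E₀^* h`, with values in the algebra of all
simplicial maps from `X^{Δ¹}` to the forms on simplices. -/
def formsInt : Bar.Total Theta (DegForms X) →ₗ[Theta] Forms (PathSp X) :=
  Bar.desc ((LinearMap.mul Theta (Forms (PathSp X))).compl₁₂
      ((endZero X).toLinearMap ∘ₗ (pathIntegration X).int) (rightEnd X).toLinearMap)
    fun x hx => by
      have h : (pathIntegration X).int x = 0 := degenerate_le_ker_int hx
      refine LinearMap.ext fun y => ?_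
      change endZero X ((pathIntegration X).int x) * rightEnd X y = 0
      rw [h, map_zero, zero_mul]

lemma formsInt_ofWords (x : Words Theta (DeRham X)) (h : DeRham X) :
    formsInt X (Bar.ofWords x h) = endZero X ((pathIntegration X).int x) * rightEnd X h :=
  Bar.desc_ofWords _ _ _ _

variable {X} in
lemma formsInt_ofWords_mem {k l : ℤ} {x : Words Theta (DeRham X)} {h : DeRham X}
    (hx : (deRhamCdga X).IsHom k x) (hh : h ∈ (deRhamCdga X).gr l) :
    formsInt X (Bar.ofWords x h) ∈ FormsDeg (PathSp X) (k + l) := by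
  rw [formsInt_ofWords]
  exact SetLike.GradedMul.mul_mem (formsDeg_pull _ ((pathIntegration X).int_mem hx))
    (rightEnd_mem hh)

lemma formsInt_mem (k : ℤ) (w : Bar.Total Theta (DegForms X))
    (hw : w ∈ Bar.gr Theta (DegForms X) k) : formsInt X w ∈ FormsDeg (PathSp X) k :=
  Bar.gr_le (isCommCochainAlg_algData X) (S := (FormsDeg (PathSp X) k).comap (formsInt X))
    (fun k' l x h hx hh hn => by
      rw [Submodule.mem_comap, ← hn]
      exact formsInt_ofWords_mem hx hh) hw

lemma formsInt_mem_range (w : Bar.Total Theta (DegForms X)) :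
    formsInt X w ∈ LinearMap.range (toForms (PathSp X)).toLinearMap := by
  induction w using Bar.total_induction (isCommCochainAlg_algData X) with
  | word k x hx l h hh => exact formsDeg_le_range _ _ (formsInt_ofWords_mem hx hh)
  | add x y hx hy => rw [map_add]; exact add_mem hx hy

/-- The last face of the bar differential corresponds to the boundary term of Stokes' theorem at the
end of the path. -/
lemma formsInt_lastFace (x : Words Theta (DeRham X)) (h : DeRham X) :
    formsInt X (Bar.lastFace (isCommCochainAlg_algData X) x h)
      = - (endZero X ((pathIntegration X).integrand x) * rightEnd X h) := by
  induction x using Words.induction with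
  | inc f => rw [Bar.lastFace_inc, PathIntegration.integrand_inc, map_zero, map_zero, zero_mul,
      neg_zero]
  | app a x _ =>
    rw [Bar.lastFace_app, map_neg, formsInt_ofWords, PathIntegration.integrand_app,
      PathIntegration.int_sg, map_mul (endZero X), endZero_ev, map_mul (rightEnd X), mul_assoc]
  | add x y hx hy => simp only [map_add, LinearMap.add_apply, hx, hy, add_mul]; abel

lemma formsD_endZero_int (x : Words Theta (DeRham X)) :
    formsD (PathSp X) (endZero X ((pathIntegration X).int x))
      = endZero X ((pathIntegration X).int ((deRhamCdga X).D x))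
        - endZero X ((pathIntegration X).integrand x) := by
  have h : formsD _ ((pathIntegration X).int x) = _ := (pathIntegration X).D_int x
  rw [endZero, formsD_pull, h, map_sub]

lemma formsEps_endZero_int (x : Words Theta (DeRham X)) :
    formsEps (PathSp X) (endZero X ((pathIntegration X).int x))
      = endZero X ((pathIntegration X).int ((deRhamCdga X).sg x)) := by
  rw [PathIntegration.int_sg, endZero, formsEps_pull]
  rfl

lemma formsD_rightEnd (h : DeRham X) :
    formsD (PathSp X) (rightEnd X h) = rightEnd X (deRhamD X h) := by
  change formsD _ (formsPull _ (toForms X h)) = formsPull _ (toForms X (deRhamD X h))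
  rw [formsD_pull, toForms_d]

lemma formsInt_d (w : Bar.Total Theta (DegForms X)) :
    formsInt X (Bar.diff (DegForms X) (deRhamD X) (deRhamD_one X) w)
      = formsD (PathSp X) (formsInt X w) := by
  induction w using Bar.total_induction (isCommCochainAlg_algData X) with
  | word k x hx l h hh =>
    have h1 := formsInt_ofWords X ((deRhamCdga X).D x) h
    have h2 := formsInt_ofWords X ((deRhamCdga X).sg x) (deRhamD X h)
    have h3 := formsInt_lastFace X x h
    rw [Bar.diff_ofWords _ (isCommCochainAlg_algData X), map_add, map_add, h1, h2, h3,
      formsInt_ofWords X x h, formsD_mul, formsD_endZero_int, formsEps_endZero_int, formsD_rightEnd,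
      sub_mul, sub_add_eq_add_sub, sub_eq_add_neg]
  | add x y hx hy => rw [map_add, map_add, map_add, map_add, hx, hy]

variable {X} in
lemma rightEnd_mul_int {l : ℤ} {h : DeRham X} (hh : h ∈ (deRhamCdga X).gr l)
    (y : Words Theta (DeRham X)) :
    rightEnd X h * endZero X ((pathIntegration X).int y)
      = endZero X ((pathIntegration X).int ((deRhamCdga X).tw l y)) * rightEnd X h := by
  rw [← endZero_ev, ← map_mul, PathIntegration.ev_mul_int _ hh, map_mul]

lemma mul_mul_mul_swap {M : Type*} [Semigroup M] {a b c d e : M} (h : c * e = b * c) :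
    a * b * (c * d) = a * c * (e * d) := by
  rw [mul_assoc, ← mul_assoc b, ← h, mul_assoc c, ← mul_assoc]

lemma formsInt_mul (v w : Bar.Total Theta (DegForms X)) :
    formsInt X (Bar.mul Theta (DegForms X) v w) = formsInt X v * formsInt X w := by
  induction v using Bar.total_induction (isCommCochainAlg_algData X) with
  | word k x hx l h hh =>
    induction w using Bar.total_induction (isCommCochainAlg_algData X) with
    | word k' y hy l' h' hh' =>
      rw [Bar.mul_ofWords hh, formsInt_ofWords, formsInt_ofWords, formsInt_ofWords,
        map_mul (rightEnd X), PathIntegration.int_mul, map_mul (endZero X)]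
      exact mul_mul_mul_swap (rightEnd_mul_int hh y)
    | add x y hx hy => simp only [map_add, mul_add, hx, hy]
  | add x y hx hy => simp only [map_add, LinearMap.add_apply, add_mul, hx, hy]

lemma formsInt_word_zero (f : DeRham X) (g : Fin 0 → DeRham X) (h : DeRham X) :
    formsInt X (Bar.word Theta f g h)
      = formsPull (evalAt X 1) (toForms X f) * formsPull (evalAt X 0) (toForms X h) := by
  rw [← Bar.ofWords_cword, cword_zero, formsInt_ofWords, PathIntegration.int_inc, endZero_b]
  rfl

/-- Iterated integrals of words with a letter vanish on constant paths. -/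
lemma pull_constPath_int_app (a : DeRham X) (x : Words Theta (DeRham X)) :
    formsPull (constPath X) (endZero X ((pathIntegration X).int (app Theta a x))) = 0 := by
  have h1 : Vertical (formsPull (constPath X ▷ (Δ[1] : SSet.{u}))
      (formsEps _ ((pathIntegration X).int x))) := by
    induction x using Words.induction with
    | inc f =>
      rw [PathIntegration.int_inc, pathIntegration_b, formsEps_pull, ← formsPull_comp,
        whiskerRight_cylFst, formsPull_comp]
      exact vertical_pull _
    | app a x _ =>
      rw [PathIntegration.int_app]
      change Vertical (formsPull _ (formsEps _ (segHomotopy _ _)))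
      rw [← formsEps_pull, ← segHomotopy_natural, formsEps_segHomotopy]
      exact (vertical_segHomotopy _).neg
    | add x y hx hy => rw [map_add, map_add, map_add]; exact hx.add hy
  have h2 : Vertical (formsPull (constPath X ▷ (Δ[1] : SSet.{u})) (evForm a)) := by
    rw [evForm, ← formsPull_comp, constPath_cylEv]
    exact vertical_pull _
  rw [PathIntegration.int_app, endZero, ← formsPull_comp, comp_cylEnd, formsPull_comp]
  change formsPull _ (formsPull _ (segHomotopy _ (formsEps _ _ * evForm a))) = 0
  rw [← segHomotopy_natural, map_mul, (h1.mul h2).segHomotopy_eq_zero, map_zero]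

lemma aug_inc (f h : DeRham X) :
    Bar.aug Theta (DegForms X) (Bar.ofWords (inc Theta f) h) = f * h := by
  rw [← cword_zero f Fin.elim0, Bar.ofWords_cword, Bar.aug, Bar.word, DirectSum.toModule_lof]
  change (TensorProduct.rid Theta _) (f ⊗ₜ PiTensorProduct.isEmptyEquiv (Fin 0)
    (PiTensorProduct.tprod Theta _)) * h = _
  rw [PiTensorProduct.isEmptyEquiv_apply_tprod, TensorProduct.rid_tmul, one_smul]

lemma aug_app (a : DeRham X) (x : Words Theta (DeRham X)) (h : DeRham X) :
    Bar.aug Theta (DegForms X) (Bar.ofWords (app Theta a x) h) = 0 := by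
  induction x using cword_induction with
  | cword r f g =>
    rw [app_cword, Bar.ofWords_cword, Bar.aug, Bar.word, DirectSum.toModule_lof]
    rfl
  | add x y hx hy => rw [map_add, map_add, LinearMap.add_apply, map_add, hx, hy, add_zero]

lemma pull_constPath_formsInt (w : Bar.Total Theta (DegForms X)) :
    formsPull (constPath X) (formsInt X w) = toForms X (Bar.aug Theta (DegForms X) w) := by
  induction w using Bar.total_induction (isCommCochainAlg_algData X) with
  | word k x hx l h hh =>
    have h1 : formsPull (constPath X) (rightEnd X h) = toForms X h := by
      change formsPull _ (formsPull _ _) = _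
      rw [← formsPull_comp, constPath_evalAt, formsPull_id]
      rfl
    rw [formsInt_ofWords, map_mul, h1]
    clear hx
    induction x using Words.induction with
    | inc f =>
      rw [PathIntegration.int_inc, endZero_b, ← formsPull_comp, constPath_evalAt, formsPull_id,
        aug_inc, map_mul]
    | app a x _ => rw [pull_constPath_int_app, zero_mul, aug_app, map_zero]
    | add x y hx hy =>
      simp only [map_add, add_mul, LinearMap.add_apply, hx, hy]
  | add x y hx hy => rw [map_add, map_add, map_add, map_add, hx, hy]

end formsInt

/-! ### The iterated integral map -/

/-- The iterated integral map `BA(X) → A(X^{Δ¹})`. -/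
def barIntegral : Bar.Total Theta (DegForms X) →ₗ[Theta] DeRham (PathSp X) :=
  (LinearEquiv.ofInjective (toForms (PathSp X)).toLinearMap
    (toForms_injective (PathSp X))).symm.toLinearMap ∘ₗ
    (formsInt X).codRestrict _ (formsInt_mem_range X)

lemma toForms_barIntegral (w : Bar.Total Theta (DegForms X)) :
    toForms (PathSp X) (barIntegral X w) = formsInt X w :=
  congrArg Subtype.val (LinearEquiv.apply_symm_apply (LinearEquiv.ofInjective
    (toForms (PathSp X)).toLinearMap (toForms_injective (PathSp X))) ⟨_, formsInt_mem_range X w⟩)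

lemma isCochainAlgHom_barIntegral :
    IsCochainAlgHom (barAlg X) (deRhamAlg (PathSp X)) (barIntegral X) where
  map_mem k (w : Bar.Total Theta (DegForms X)) hw := mem_of_toForms_mem (by
    change toForms _ (barIntegral X w) ∈ _
    rw [toForms_barIntegral]
    exact formsInt_mem X k w hw)
  map_d (w : Bar.Total Theta (DegForms X)) := toForms_injective _ (by
    change toForms _ (barIntegral X (Bar.diff _ _ (deRhamD_one X) w))
      = toForms _ (deRhamD _ (barIntegral X w))
    rw [toForms_d, toForms_barIntegral, toForms_barIntegral, formsInt_d])
  map_one := toForms_injective _ (by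
    change toForms _ (barIntegral X (Bar.word Theta 1 Fin.elim0 1)) = toForms _ 1
    rw [toForms_barIntegral, formsInt_word_zero, map_one, map_one, map_one, map_one, mul_one])
  map_mul (v w : Bar.Total Theta (DegForms X)) := toForms_injective _ (by
    change toForms _ (barIntegral X (Bar.mul Theta (DegForms X) v w))
      = toForms _ (barIntegral X v * barIntegral X w)
    rw [map_mul, toForms_barIntegral, toForms_barIntegral, toForms_barIntegral, formsInt_mul])

lemma barIntegral_incl : barIntegral X ∘ₗ Bar.incl Theta (DegForms X) = endpointsMap X := by
  refine TensorProduct.ext' fun f h => toForms_injective _ ?_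
  have h1 : Bar.incl Theta (DegForms X) (f ⊗ₜ[Theta] h)
      = Bar.word Theta f (Fin.elim0 : Fin 0 → DeRham X) h := by
    rw [Bar.incl, LinearMap.comp_apply, TensorProduct.map_tmul, LinearMap.flip_apply,
      TensorProduct.mk_apply, LinearMap.id_apply, Bar.word, Bar.pureWord]
    congr 4
    exact Subsingleton.elim _ _
  rw [LinearMap.comp_apply, toForms_barIntegral, h1, formsInt_word_zero]
  change _ = toForms _ (deRhamPull _ (deRhamPull _ f * deRhamPull _ h))
  rw [toForms_pull, map_mul, toForms_pull, toForms_pull, map_mul, ← formsPull_comp,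
    ← formsPull_comp]
  rfl

lemma constPath_barIntegral :
    deRhamPull (constPath X) ∘ₗ barIntegral X = Bar.aug Theta (DegForms X) :=
  LinearMap.ext fun w => toForms_injective _ (by
    rw [LinearMap.comp_apply, toForms_pull, toForms_barIntegral, pull_constPath_formsInt])

lemma exists_iteratedIntegral {r : ℕ} (ω : Fin r → DeRham X) :
    ∃ J : DeRham (PathSp X),
      toForms _ J = endZero X (iterForm 1 (List.ofFn fun i => evForm (ω i))) := by
  have h : ∀ x, endZero X ((pathIntegration X).iter x)
      ∈ LinearMap.range (toForms (PathSp X)).toLinearMap := fun x => by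
    induction x using (deRhamCdga X).hom_induction with
    | hom k x hx =>
      exact formsDeg_le_range _ k (formsDeg_pull _ ((pathIntegration X).iter_mem hx))
    | add x y hx hy => rw [map_add, map_add]; exact add_mem hx hy
  rw [iterForm_eq]
  exact h _

/-- The iterated integral `∫ ω₁ ⋯ ω_r`, as an element of `A(X^{Δ¹})`. -/
def iteratedIntegralForm {r : ℕ} (ω : Fin r → DeRham X) : DeRham (PathSp X) :=
  (exists_iteratedIntegral X ω).choose

lemma toForms_iteratedIntegralForm {r : ℕ} (ω : Fin r → DeRham X) :
    toForms _ (iteratedIntegralForm X ω)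
      = endZero X ((pathIntegration X).iter (Words.cword Theta 1 ω)) := by
  rw [← iterForm_eq]
  exact (exists_iteratedIntegral X ω).choose_spec

lemma value_iteratedIntegralForm {r : ℕ} (ω : Fin r → DeRham X) {n : ℕ} (γ : (PathSp X) _⦋n⦌) :
    (iteratedIntegralForm X ω).value γ = iteratedIntegral ω γ := by
  rw [value_eq, iteratedIntegral_eq, toForms_iteratedIntegralForm, iterForm_eq, ← cylEnd_zero_app]
  rfl

lemma barIntegral_word {r : ℕ} {a : Fin r → ℤ} (ω₀ : DeRham X) {ω : Fin r → DeRham X}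
    (ω' : DeRham X) (hω : ∀ i, ω i ∈ (deRhamAlg X).gr (a i)) :
    barIntegral X (Bar.word Theta ω₀ ω ω')
      = sgn Theta (∑ i : Fin r, ((r : ℤ) - (i + 1)) * (a i - 1)) •
        (deRhamPull (evalAt X 1) ω₀ * iteratedIntegralForm X ω * deRhamPull (evalAt X 0) ω') := by
  refine toForms_injective _ ?_
  rw [toForms_barIntegral, ← Bar.ofWords_cword, formsInt_ofWords, PathIntegration.int_cword _ hω,
    map_smul, map_smul, map_mul (endZero X), endZero_b, map_mul, map_mul, toForms_pull,
    toForms_pull, toForms_iteratedIntegralForm, smul_mul_assoc]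
  rfl

/-- A linear map on the bar construction is determined by its values on homogeneous words. -/
lemma total_hom_ext {I I' : Bar.Total Theta (DegForms X) →ₗ[Theta] DeRham (PathSp X)}
    (h : ∀ (r : ℕ) (a : Fin r → ℤ) (ω₀ : DeRham X) (ω : Fin r → DeRham X) (ω' : DeRham X),
      (∀ i, ω i ∈ (deRhamAlg X).gr (a i)) →
        I (Bar.word Theta ω₀ ω ω') = I' (Bar.word Theta ω₀ ω ω')) : I = I' := by
  refine LinearMap.ext fun w => ?_
  induction w using Bar.total_induction (isCommCochainAlg_algData X) with
  | word k x hx l e he =>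
    obtain ⟨r, a, b, f, g, hf, hg, rfl, rfl⟩ := hx.exists_cword
    rw [Bar.ofWords_cword]
    exact h r b f g e hg
  | add x y hx hy => rw [map_add, map_add, hx, hy]

end SimplicialDeRham

end

theorem mainTheorem4 (X : SSet.{u}) :
    IsCommCochainAlg (deRhamAlg X) ∧ IsCommCochainAlg (deRhamAlg (PathSp X)) ∧
    IsCommCochainAlg (barAlg X) ∧
    ∃ J : ∀ r : ℕ, (Fin r → DeRham X) → DeRham (PathSp X),
      (∀ (r : ℕ) (ω : Fin r → DeRham X) (n : ℕ)
        (γ : (PathSp X).obj (Opposite.op (SimplexCategory.mk n))),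
        (J r ω).value γ = iteratedIntegral ω γ) ∧
      ∃! I : Bar.Total Theta (DegForms X) →ₗ[Theta] DeRham (PathSp X),
        (∀ (r : ℕ) (a : Fin r → ℤ) (ω₀ : DeRham X) (ω : Fin r → DeRham X) (ω' : DeRham X),
          (∀ i, ω i ∈ (deRhamAlg X).gr (a i)) →
          I (Bar.word Theta ω₀ ω ω') =
            sgn Theta (∑ i : Fin r, ((r : ℤ) - (i + 1)) * (a i - 1)) •
              (deRhamPull (evalAt X 1) ω₀ * J r ω * deRhamPull (evalAt X 0) ω')) ∧
        IsCochainAlgHom (barAlg X) (deRhamAlg (PathSp X)) I ∧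
        I ∘ₗ Bar.incl Theta (DegForms X) = endpointsMap X ∧
        deRhamPull (constPath X) ∘ₗ I = Bar.aug Theta (DegForms X) := by
  refine ⟨isCommCochainAlg_deRhamAlg X, isCommCochainAlg_deRhamAlg (PathSp X),
    Bar.isCommCochainAlg_barData (deRhamD_one X) (isCommCochainAlg_deRhamAlg X),
    fun _ ω => iteratedIntegralForm X ω, fun _ ω _ γ => value_iteratedIntegralForm X ω γ,
    barIntegral X, ⟨fun _ _ ω₀ _ ω' hω => barIntegral_word X ω₀ ω' hω,
      isCochainAlgHom_barIntegral X, barIntegral_incl X, constPath_barIntegral X⟩, ?_⟩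
  rintro I ⟨hI, -⟩
  exact total_hom_ext X fun r a ω₀ ω ω' hω =>
    (hI r a ω₀ ω ω' hω).trans (barIntegral_word X ω₀ ω' hω).symm
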